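/- Let $r\ge 1$ be an integer and $a>0$ a real number. Let $\zeta_H(s,a)$ be the Hurwitz zeta function, i.e. the meromorphic continuation to $\mathbb C$ of $\sum_{m\ge 0}(m+a)^{-s}$ $(\operatorname{Re}s>1)$, and let $\zeta_r(s,a,\mathbf 1)$ be the Hurwitz multiple zeta function, i.e. the meromorphic continuation to $\mathbb C$, holomorphic outside $\{1,\dots,r\}$, of $$\sum_{m_1,\dots,m_r\ge 0}(a+m_1+\cdots+m_r)^{-s}\qquad(\operatorname{Re}s>r).$$ For $0\le j\le r-1$ put $$p_{r,j}(a)=\frac1{(r-1)!}\sum_{l=j}^{r-1}(-1)^{r+1-j}\binom lj S(r,l+1)\,a^{l-j},$$ where $S(n,k)$ is the signed Stirling number of the first kind (the coefficient of $x^k$ in $x(x-1)\cdots(x-n+1)$). Let $\zeta$ be the Riemann zeta function, $\gamma$ Euler's constant, and $\gamma(a)=\lim_{M\to\infty}\bigl\{\sum_{m=0}^M\frac1{m+a}-\log(M+a)\bigr\}$. Then, for all $s\notin\{1,\dots,r\}$, $$\zeta_r(s,a,\mathbf 1)=\sum_{j=0}^{r-1}p_{r,j}(a)\,\zeta_H(s-j,a),$$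 and the following hold as $T\to\infty$, with implied constants depending only on $r$, $a$, $\sigma$. (i) If $r-\frac12<\sigma<r$, then $$\int_1^T|\zeta_r(\sigma+it,a,\mathbf 1)|^2dt=\sum_{0\le k,l\le r-1}p_{r,k}(a)p_{r,l}(a)\,\zeta_H(2\sigma-k-l,a)\,T+\frac1{((r-1)!)^2}\,\frac{(2\pi)^{2\sigma-2r+1}}{2r-2\sigma}\,\zeta(2r-2\sigma)\,T^{2r-2\sigma}+O(T^{r-\sigma}\log T).$$ (ii) If $\sigma=r-\frac12$, then $$\int_1^T|\zeta_r(\sigma+it,a,\mathbf 1)|^2dt=\frac{T\log T}{((r-1)!)^2}+\Bigl\{\sum_{\substack{0\le k,l\le r-1\\(k,l)\ne(r-1,r-1)}}p_{r,k}(a)p_{r,l}(a)\,\zeta_H(2\sigma-k-l,a)+\frac{\gamma(a)+\gamma-1-\log(2\pi)}{((r-1)!)^2}\Bigr\}T+O(T^{1/2}\log T).$$ (iii) If $r-1<\sigma<r-\frac12$, then $$\int_1^T|\zeta_r(\sigma+it,a,\mathbf 1)|^2dt=\frac1{((r-1)!)^2}\,\frac{(2\pi)^{2\sigma-2r+1}}{2r-2\sigma}\,\zeta(2r-2\sigma)\,T^{2r-2\sigma}+\sum_{0\le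 k,l\le r-1}p_{r,k}(a)p_{r,l}(a)\,\zeta_H(2\sigma-k-l,a)\,T+O(T^{r-\sigma}\log T).$$ -/

import Mathlib

open Filter Asymptotics Topology

noncomputable section

/-- The set of possible poles `1, 2, …, r` of the Barnes `r`-fold zeta function. -/
def barnesPoles (r : ℕ) : Set ℂ := {s | ∃ j : ℕ, 1 ≤ j ∧ j ≤ r ∧ s = (j : ℂ)}

/-- The Barnes multiple Dirichlet series
`∑_{m₁,…,m_r ≥ 0} (a + m₁ w₁ + ⋯ + m_r w_r)^{-s}` (absolutely convergent for `Re s > r`). -/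
def barnesSeries (r : ℕ) (a : ℝ) (w : Fin r → ℝ) (s : ℂ) : ℂ :=
  ∑' m : Fin r → ℕ, 1 / ((a + ∑ i, (m i : ℝ) * w i : ℝ) : ℂ) ^ s

/-- `Z` is the continuation of the Barnes series: it is given by the series for `Re s > r`, and it is
holomorphic on the (connected) complement of `{1, …, r}`. This determines `Z` off `{1, …, r}`. -/
def IsBarnesZeta (r : ℕ) (a : ℝ) (w : Fin r → ℝ) (Z : ℂ → ℂ) : Prop :=
  DifferentiableOn ℂ Z (barnesPoles r)ᶜ ∧ ∀ s : ℂ, (r : ℝ) < s.re → Z s = barnesSeries r a w s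

open Classical in
/-- The Barnes multiple zeta function `ζ_r(s, a, w)`: the meromorphic continuation of the series. -/
def barnesZeta (r : ℕ) (s : ℂ) (a : ℝ) (w : Fin r → ℝ) : ℂ :=
  if h : ∃ Z : ℂ → ℂ, IsBarnesZeta r a w Z then h.choose s else 0

/-- The Hurwitz multiple zeta function `ζ_r(s, a, (1, …, 1))`. -/
def hurwitzMultipleZeta (r : ℕ) (s : ℂ) (a : ℝ) : ℂ :=
  barnesZeta r s a (fun _ => 1)

/-- The Hurwitz zeta function `ζ_H(s, a)` for every real `a > 0`. Mathlib's `hurwitzZeta` is periodic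
in `a` and is the usual function for `0 < a ≤ 1`; for larger `a`, written as `a = b + N` with
`0 < b ≤ 1` and `N = ⌈a⌉₊ - 1`, the terms `(b + i)^{-s}` with `i < N` are removed.
See `hasSum_zetaH` and `differentiableAt_zetaH`. -/
def zetaH (s : ℂ) (a : ℝ) : ℂ :=
  HurwitzZeta.hurwitzZeta (a : UnitAddCircle) s -
    ∑ i ∈ Finset.range (⌈a⌉₊ - 1), 1 / ((a - ((⌈a⌉₊ - 1 : ℕ) : ℝ) + i : ℝ) : ℂ) ^ s

/-- `zetaH` is the Hurwitz series in the half-plane of convergence. -/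
theorem hasSum_zetaH {a : ℝ} (ha : 0 < a) {s : ℂ} (hs : 1 < s.re) :
    HasSum (fun m : ℕ => 1 / ((m + a : ℝ) : ℂ) ^ s) (zetaH s a) := by
  obtain ⟨N, hN⟩ : ∃ N : ℕ, ⌈a⌉₊ - 1 = N := ⟨_, rfl⟩
  have h1 : 0 < ⌈a⌉₊ := Nat.ceil_pos.mpr ha
  have h2 : (⌈a⌉₊ : ℝ) = N + 1 := by
    have : ⌈a⌉₊ = N + 1 := by omega
    exact_mod_cast this
  have h3 : a ≤ ⌈a⌉₊ := Nat.le_ceil a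
  have h4 : (⌈a⌉₊ : ℝ) < a + 1 := Nat.ceil_lt_add_one ha.le
  have hb : a - N ∈ Set.Icc (0 : ℝ) 1 := ⟨by linarith, by linarith⟩
  have key := HurwitzZeta.hasSum_hurwitzZeta_of_one_lt_re hb hs
  have hc : ((a - N : ℝ) : UnitAddCircle) = (a : UnitAddCircle) := by
    rw [AddCircle.coe_sub, sub_eq_self, AddCircle.coe_eq_zero_iff]
    exact ⟨(N : ℤ), by simp⟩
  rw [hc, ← hasSum_nat_add_iff' N] at key
  rw [zetaH, hN]
  have e1 : (fun m : ℕ => 1 / ((m + a : ℝ) : ℂ) ^ s) =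
      fun n : ℕ => 1 / (((n + N : ℕ) : ℂ) + ((a - N : ℝ) : ℂ)) ^ s := by
    funext m
    congr 2
    push_cast
    ring
  have e2 : ∀ i : ℕ, 1 / ((a - N + i : ℝ) : ℂ) ^ s = 1 / ((i : ℂ) + ((a - N : ℝ) : ℂ)) ^ s := by
    intro i
    congr 2
    push_cast
    ring
  simp only [e1, e2]
  exact key

/-- `zetaH` is holomorphic away from `s = 1`. -/
theorem differentiableAt_zetaH {a : ℝ} (ha : 0 < a) {s : ℂ} (hs : s ≠ 1) :
    DifferentiableAt ℂ (fun z => zetaH z a) s := by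
  have h1 : 0 < ⌈a⌉₊ := Nat.ceil_pos.mpr ha
  have h4 : (⌈a⌉₊ : ℝ) < a + 1 := Nat.ceil_lt_add_one ha.le
  have h5 : ((⌈a⌉₊ - 1 : ℕ) : ℝ) = (⌈a⌉₊ : ℝ) - 1 := by
    rw [Nat.cast_sub h1]
    simp
  refine (HurwitzZeta.differentiableAt_hurwitzZeta _ hs).sub (DifferentiableAt.fun_sum fun i _ => ?_)
  have hpos : (0 : ℝ) < a - ((⌈a⌉₊ - 1 : ℕ) : ℝ) + i := by
    have : (0 : ℝ) ≤ i := Nat.cast_nonneg i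
    linarith
  have hne : ((a - ((⌈a⌉₊ - 1 : ℕ) : ℝ) + i : ℝ) : ℂ) ≠ 0 := by
    exact_mod_cast hpos.ne'
  refine (differentiableAt_const _).div (differentiableAt_id.const_cpow (Or.inl hne)) ?_
  rw [Ne, Complex.cpow_eq_zero_iff]
  tauto

/-- The signed Stirling number of the first kind: the coefficient of `x^k` in
`x (x - 1) ⋯ (x - n + 1)`. -/
def signedStirlingFirst (n k : ℕ) : ℤ := (-1) ^ (n + k) * (Nat.stirlingFirst n k : ℤ)

/-- `p_{r,j}(a) = (1/(r-1)!) ∑_{l=j}^{r-1} (-1)^{r+1-j} (l choose j) S(r, l+1) a^{l-j}`. -/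
def hurwitzCoeff (r j : ℕ) (a : ℝ) : ℝ :=
  1 / ((r - 1).factorial : ℝ) *
    ∑ l ∈ Finset.Ico j r,
      (-1 : ℝ) ^ (r + 1 - j) * (l.choose j : ℝ) * (signedStirlingFirst r (l + 1) : ℝ) * a ^ (l - j)

/-- The generalized Euler constant
`γ(a) = lim_{M → ∞} (∑_{m=0}^{M} 1/(m+a) - log (M+a))`. -/
def eulerGamma (a : ℝ) : ℝ :=
  limUnder atTop fun M : ℕ => ∑ m ∈ Finset.range (M + 1), 1 / ((m : ℝ) + a) - Real.log (M + a)

/-- The mean square integral `∫_1^T |ζ_r(σ + it, a, (1, …, 1))|² dt`. -/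
def meanSquare (r : ℕ) (σ a T : ℝ) : ℝ :=
  ∫ t in (1 : ℝ)..T, ‖hurwitzMultipleZeta r ((σ : ℂ) + (t : ℂ) * Complex.I) a‖ ^ 2

end

namespace HurwitzMean

open MeasureTheory Set
open Complex (I)
open scoped Real ComplexConjugate

/-! ### Stirling's formula on vertical lines -/

/-- The main part of `log Γ`, without the constant. -/
noncomputable def logGammaMain (z : ℂ) : ℂ := (z - 1 / 2) * Complex.log z - z

/-- The increment of `log Γ - logGammaMain`. -/
noncomputable def gudermann (z : ℂ) : ℂ := (z + 1 / 2) * (Complex.log (z + 1) - Complex.log z) - 1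

lemma logGammaMain_add_one (z : ℂ) :
    logGammaMain (z + 1) = logGammaMain z + Complex.log z + gudermann z := by
  simp only [logGammaMain, gudermann]; ring

lemma log_add_one_sub_log {z : ℂ} (hre : 0 ≤ z.re) (hz : z ≠ 0) :
    Complex.log (z + 1) - Complex.log z = Complex.log (1 + z⁻¹) := by
  have h1 : z + 1 = z * (1 + z⁻¹) := by field_simp
  have hre' : 0 < (1 + z⁻¹).re := by
    simp only [Complex.add_re, Complex.one_re, Complex.inv_re]
    have : 0 ≤ z.re / Complex.normSq z := div_nonneg hre (Complex.normSq_nonneg _)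
    linarith
  have h2 : (1 + z⁻¹) ≠ 0 := by
    intro h; rw [h] at hre'; simp at hre'
  have a1 := Complex.abs_arg_le_pi_div_two_iff.mpr hre
  have a2 := Complex.abs_arg_lt_pi_div_two_iff.mpr (Or.inl hre')
  rw [abs_le] at a1
  rw [abs_lt] at a2
  rw [h1, Complex.log_mul hz h2 ⟨by linarith, by linarith⟩]
  ring

lemma norm_gudermann_le {z : ℂ} (hre : 0 ≤ z.re) (hz : 2 ≤ ‖z‖) :
    ‖gudermann z‖ ≤ 2 / ‖z‖ ^ 2 := by
  have hz0 : z ≠ 0 := by rintro rfl; norm_num at hz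
  have hn : 0 < ‖z‖ := by linarith
  set w := z⁻¹ with hw
  have hwn : ‖w‖ = ‖z‖⁻¹ := norm_inv z
  have hw2 : ‖w‖ ≤ 1 / 2 := by
    rw [hwn, inv_le_comm₀ hn (by norm_num)]; norm_num; exact hz
  have hT := Complex.norm_log_sub_logTaylor_le 2 (z := w) (by linarith)
  have hTay : Complex.logTaylor (2 + 1) w = w - w ^ 2 / 2 := by
    simp [Complex.logTaylor_succ, Complex.logTaylor_zero]; ring
  rw [hTay] at hT
  set d := Complex.log (1 + w) - (w - w ^ 2 / 2) with hd
  have hg : gudermann z = - w ^ 2 / 4 + (z + 1 / 2) * d := by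
    rw [gudermann, log_add_one_sub_log hre hz0, hd]
    have : z * w = 1 := mul_inv_cancel₀ hz0
    have e : Complex.log (1 + w) = d + (w - w ^ 2 / 2) := by rw [hd]; ring
    rw [← hw, e]
    linear_combination (1 - w / 2) * this
  have hd' : ‖d‖ ≤ ‖w‖ ^ 3 * (2 / 3) := by
    refine hT.trans ?_
    have : (1 - ‖w‖)⁻¹ ≤ 2 := by
      rw [inv_le_comm₀ (by linarith) (by norm_num)]; linarith
    have h3 : 0 ≤ ‖w‖ ^ 3 := by positivity
    norm_num
    nlinarith
  have hzz : ‖z + 1 / 2‖ ≤ ‖z‖ * (5 / 4) := by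
    refine (norm_add_le _ _).trans ?_
    norm_num; linarith
  have hzw : ‖z‖ * ‖w‖ = 1 := by rw [hwn]; field_simp
  rw [hg]
  calc ‖- w ^ 2 / 4 + (z + 1 / 2) * d‖ ≤ ‖w‖ ^ 2 / 4 + ‖z‖ * (5 / 4) * (‖w‖ ^ 3 * (2 / 3)) := by
        refine (norm_add_le _ _).trans (add_le_add ?_ ?_)
        · simp
        · rw [norm_mul]; gcongr
    _ = ‖w‖ ^ 2 / 4 + (‖z‖ * ‖w‖) * (‖w‖ ^ 2 * (5 / 6)) := by ring
    _ ≤ 2 * ‖w‖ ^ 2 := by rw [hzw]; nlinarith [sq_nonneg ‖w‖]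
    _ = 2 / ‖z‖ ^ 2 := by rw [hwn]; field_simp

lemma prod_add_nat_eq {s : ℂ} (hs : 0 < s.im) (n : ℕ) :
    ∏ j ∈ Finset.range n, (s + j) =
      Complex.exp (logGammaMain (s + n) - logGammaMain s -
        ∑ j ∈ Finset.range n, gudermann (s + j)) := by
  induction n with
  | zero => simp
  | succ n ih =>
    have hne : s + n ≠ 0 := by
      intro h
      have := congrArg Complex.im h
      simp at this; linarith
    rw [Finset.prod_range_succ, ih, Finset.sum_range_succ]
    nth_rw 2 [← Complex.exp_log hne]
    rw [← Complex.exp_add]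
    congr 1
    have := logGammaMain_add_one (s + n)
    push_cast
    rw [← add_assoc, this]
    ring

lemma sum_norm_gudermann_le {s : ℂ} (hre : 0 ≤ s.re) (him : 2 ≤ s.im) (n : ℕ) :
    ∑ j ∈ Finset.range n, ‖gudermann (s + j)‖ ≤ 8 / s.im := by
  have h1 : ∀ j : ℕ, ‖gudermann (s + j)‖ ≤ 4 / (s.im + j - 1) - 4 / (s.im + (j + 1 : ℕ) - 1) := by
    intro j
    have hj : (0 : ℝ) ≤ j := Nat.cast_nonneg j
    have hsq : (s.im + j) ^ 2 / 2 ≤ ‖s + j‖ ^ 2 := by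
      rw [← Complex.normSq_eq_norm_sq, Complex.normSq_apply]
      simp
      nlinarith [sq_nonneg (s.im - j), mul_nonneg hre hj]
    have h2 : 2 ≤ ‖s + j‖ := by
      have := Complex.abs_im_le_norm (s + j)
      simp at this
      exact him.trans ((le_abs_self _).trans this)
    refine (norm_gudermann_le (by simp; linarith) h2).trans ?_
    have h3 : 2 / ‖s + j‖ ^ 2 ≤ 4 / (s.im + j) ^ 2 := by
      rw [div_le_div_iff₀ (by positivity) (by positivity)]
      nlinarith
    refine h3.trans ?_
    push_cast
    have e : 4 / (s.im + j - 1) - 4 / (s.im + (j + 1) - 1) = 4 / ((s.im + j - 1) * (s.im + j)) := by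
      have : s.im + j - 1 ≠ 0 := by linarith
      have : s.im + j ≠ 0 := by linarith
      have : s.im + (j + 1) - 1 ≠ 0 := by linarith
      field_simp
      ring
    rw [e]
    apply div_le_div_of_nonneg_left (by norm_num)
    · apply mul_pos <;> linarith
    · nlinarith
  calc ∑ j ∈ Finset.range n, ‖gudermann (s + j)‖
      ≤ ∑ j ∈ Finset.range n, (4 / (s.im + j - 1) - 4 / (s.im + (j + 1 : ℕ) - 1)) :=
        Finset.sum_le_sum fun j _ => h1 j
    _ = 4 / (s.im + (0 : ℕ) - 1) - 4 / (s.im + n - 1) :=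
        Finset.sum_range_sub' (fun j : ℕ => 4 / (s.im + (j : ℝ) - 1)) n
    _ ≤ 8 / s.im := by
        have hn : (0 : ℝ) ≤ n := Nat.cast_nonneg n
        have : 0 ≤ 4 / (s.im + n - 1) := by apply div_nonneg <;> linarith
        have h2 : 4 / (s.im + (0 : ℕ) - 1) ≤ 8 / s.im := by
          rw [div_le_div_iff₀ (by simp; linarith) (by linarith)]
          simp; linarith
        linarith

lemma tendsto_stirling_aux (s : ℂ) :
    Tendsto (fun n : ℕ => (n : ℂ) ^ s * (n.factorial : ℂ) *
      Complex.exp (-logGammaMain (s + (n + 1 : ℕ)))) atTop (𝓝 (√(2 * π) : ℝ)) := by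
  have hg : Tendsto (fun n : ℕ => (n : ℂ) * ((s + 1) / n)) atTop (𝓝 (s + 1)) := by
    apply tendsto_const_nhds.congr'
    filter_upwards [eventually_gt_atTop 0] with n hn
    have : (n : ℂ) ≠ 0 := by exact_mod_cast hn.ne'
    field_simp
  have h1 := Complex.tendsto_nat_mul_log_one_add_of_tendsto hg
  have h0 : Tendsto (fun n : ℕ => (s + 1) / (n : ℂ)) atTop (𝓝 0) :=
    tendsto_const_div_atTop_nhds_zero_nat _
  have h2 : Tendsto (fun n : ℕ => Complex.log (1 + (s + 1) / n)) atTop (𝓝 0) := by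
    have hc : ContinuousAt Complex.log (1 + 0) := by
      apply continuousAt_clog; simp
    have := hc.tendsto.comp ((tendsto_const_nhds (x := (1 : ℂ))).add h0)
    simpa [Function.comp_def] using this
  have h3 : Tendsto (fun n : ℕ => (s + 1) - (n * Complex.log (1 + (s + 1) / n) +
      (s + 1 / 2) * Complex.log (1 + (s + 1) / n))) atTop (𝓝 0) := by
    have := (tendsto_const_nhds (x := s + 1)).sub (h1.add (h2.const_mul (s + 1 / 2)))
    simpa using this
  have h4 := (Complex.continuous_exp.tendsto _).comp h3
  have h5 : Tendsto (fun n : ℕ => ((Stirling.stirlingSeq n * √2 : ℝ) : ℂ)) atTop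
      (𝓝 ((√π * √2 : ℝ) : ℂ)) :=
    (Complex.continuous_ofReal.tendsto _).comp (Stirling.tendsto_stirlingSeq_sqrt_pi.mul_const _)
  have h6 := h5.mul h4
  rw [Complex.exp_zero, mul_one] at h6
  have e : (√(2 * π) : ℝ) = √π * √2 := by rw [Real.sqrt_mul (by norm_num), mul_comm]
  rw [e]
  apply h6.congr'
  have hlarge : ∀ᶠ n : ℕ in atTop, ‖s + 1‖ < n := by
    obtain ⟨N, hN⟩ := exists_nat_gt ‖s + 1‖
    filter_upwards [eventually_ge_atTop N] with n hn
    exact hN.trans_le (by exact_mod_cast hn)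
  filter_upwards [eventually_gt_atTop 0, hlarge] with n hn hl
  have hn' : (0 : ℝ) < n := by exact_mod_cast hn
  have hnc : (n : ℂ) ≠ 0 := by exact_mod_cast hn.ne'
  have hq : ‖(s + 1) / (n : ℂ)‖ < 1 := by
    rw [norm_div, div_lt_one (by simpa using hn')]; simpa using hl
  have hq0 : (1 + (s + 1) / (n : ℂ)) ≠ 0 := by
    intro h
    have : (s + 1) / (n : ℂ) = -1 := by linear_combination h
    rw [this] at hq; simp at hq
  have hlog : Complex.log (s + (n + 1 : ℕ)) = (Real.log n : ℝ) + Complex.log (1 + (s + 1) / n) := by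
    rw [← Complex.log_ofReal_mul hn' hq0]
    congr 1
    push_cast
    field_simp
    ring
  have hst : (Stirling.stirlingSeq n : ℝ) * √2 =
      Real.exp (Real.log n.factorial - 1 / 2 * Real.log n - n * Real.log n + n) := by
    have hsp : 0 < Stirling.stirlingSeq n := by
      obtain ⟨m, rfl⟩ : ∃ m, n = m + 1 := ⟨n - 1, by omega⟩
      exact Stirling.stirlingSeq'_pos m
    have h2' : √2 = Real.exp (1 / 2 * Real.log 2) := by
      rw [mul_comm, ← Real.rpow_def_of_pos (by norm_num), Real.sqrt_eq_rpow]
    rw [h2', ← Real.exp_log hsp, Stirling.log_stirlingSeq_formula, ← Real.exp_add,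
      Real.log_mul (by norm_num) hn'.ne', Real.log_div hn'.ne' (Real.exp_pos _).ne', Real.log_exp]
    congr 1; ring
  have hfac : (n.factorial : ℂ) = Complex.exp ((Real.log n.factorial : ℝ) : ℂ) := by
    rw [← Complex.ofReal_exp, Real.exp_log (by exact_mod_cast n.factorial_pos)]; simp
  simp only [Function.comp]
  rw [hst, Complex.cpow_def_of_ne_zero hnc, hfac, Complex.ofReal_exp, ← Complex.exp_add,
    ← Complex.exp_add, ← Complex.exp_add, logGammaMain, hlog, ← Complex.natCast_log]
  congr 1
  push_cast
  ring

lemma norm_Gamma_sub_main_le {s : ℂ} (hre : 0 ≤ s.re) (him : 2 ≤ s.im) :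
    ‖Complex.Gamma s * Complex.exp (-logGammaMain s) - (√(2 * π) : ℝ)‖ ≤
      √(2 * π) * (8 * Real.exp 4) / s.im := by
  have ht := tendsto_stirling_aux s
  have hG := (Complex.GammaSeq_tendsto_Gamma s).mul_const (Complex.exp (-logGammaMain s))
  have hlim := (hG.sub ht).norm
  refine le_of_tendsto_of_tendsto hlim ((ht.norm).mul_const ((8 * Real.exp 4) / s.im)) ?_ |>.trans
    (le_of_eq ?_)
  · refine Eventually.of_forall fun n => ?_
    have hsim : 0 < s.im := by linarith
    simp only [Complex.GammaSeq]
    rw [prod_add_nat_eq hsim]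
    set G := ∑ j ∈ Finset.range (n + 1), gudermann (s + j) with hGdef
    generalize (n : ℂ) ^ s * (n.factorial : ℂ) = A
    have e : A / Complex.exp (logGammaMain (s + (n + 1 : ℕ)) - logGammaMain s - G) *
        Complex.exp (-logGammaMain s) - A * Complex.exp (-logGammaMain (s + (n + 1 : ℕ))) =
        A * Complex.exp (-logGammaMain (s + (n + 1 : ℕ))) * (Complex.exp G - 1) := by
      rw [div_eq_mul_inv, ← Complex.exp_neg, mul_assoc, ← Complex.exp_add, mul_sub, mul_one,
        mul_assoc, ← Complex.exp_add]
      congr 3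
      ring
    rw [e, norm_mul]
    gcongr
    have hGn : ‖G‖ ≤ 8 / s.im := (norm_sum_le _ _).trans (sum_norm_gudermann_le hre him _)
    have hG4 : ‖G‖ ≤ 4 := hGn.trans (by rw [div_le_iff₀ hsim]; linarith)
    have := Complex.norm_exp_sub_sum_le_norm_mul_exp G 1
    simp at this
    refine this.trans ?_
    calc ‖G‖ * Real.exp ‖G‖ ≤ 8 / s.im * Real.exp 4 := by gcongr
      _ = _ := by ring
  · rw [Complex.norm_real, Real.norm_of_nonneg (Real.sqrt_nonneg _)]; ring

/-- The exponent of the leading term of `Γ(σ + it)`. -/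
noncomputable def stirlingPhase (σ t : ℝ) : ℂ :=
  ((σ - 1 / 2 : ℝ) + t * I) * (Real.log t + π / 2 * I) - t * I

lemma norm_logGammaMain_sub_stirlingPhase_le {σ t : ℝ} (hσ : 0 ≤ σ) (hσ2 : σ ≤ 2) (ht : 4 ≤ t) :
    ‖logGammaMain (σ + t * I) - stirlingPhase σ t‖ ≤ 14 / t := by
  have ht0 : 0 < t := by linarith
  have htc : (t : ℂ) ≠ 0 := by exact_mod_cast ht0.ne'
  set v : ℂ := -I * σ / t with hv
  have hvn : ‖v‖ = σ / t := by
    rw [hv]; simp [abs_of_nonneg hσ, abs_of_pos ht0]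
  have hv2 : ‖v‖ ≤ 1 / 2 := by
    rw [hvn, div_le_iff₀ ht0]; linarith
  have h1v : 0 < (1 + v).re := by
    have := Complex.abs_re_le_norm v
    have := (abs_le.mp (this.trans hv2)).1
    simp; linarith
  have h1v0 : (1 + v) ≠ 0 := by intro h; rw [h] at h1v; simp at h1v
  have hfac : (σ : ℂ) + t * I = t * (I * (1 + v)) := by
    rw [hv]; field_simp; ring_nf; simp
  have ha := Complex.abs_arg_lt_pi_div_two_iff.mpr (Or.inl h1v)
  rw [abs_lt] at ha
  have hlog : Complex.log (σ + t * I) = Real.log t + π / 2 * I + Complex.log (1 + v) := by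
    rw [hfac, Complex.log_ofReal_mul ht0 (mul_ne_zero Complex.I_ne_zero h1v0),
      Complex.log_mul Complex.I_ne_zero h1v0 (by rw [Complex.arg_I]; constructor <;> linarith),
      Complex.log_I]
    ring
  have hd := Complex.norm_log_one_add_sub_self_le (z := v) (by linarith)
  set d := Complex.log (1 + v) - v
  have hd' : ‖d‖ ≤ ‖v‖ ^ 2 := by
    refine hd.trans ?_
    have : (1 - ‖v‖)⁻¹ ≤ 2 := by
      rw [inv_le_comm₀ (by linarith) (by norm_num)]; linarith
    nlinarith [sq_nonneg ‖v‖]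
  have e : logGammaMain (σ + t * I) - stirlingPhase σ t =
      (σ - 1 / 2 : ℝ) * v + ((σ - 1 / 2 : ℝ) + t * I) * d := by
    have hl : Complex.log (1 + v) = d + v := by simp [d]
    have hvt : t * I * v = σ := by rw [hv]; field_simp; simp
    rw [logGammaMain, hlog, hl, stirlingPhase]
    push_cast
    linear_combination hvt
  have hσ' : |σ - 1 / 2| ≤ 2 := abs_le.mpr ⟨by linarith, by linarith⟩
  rw [e]
  calc _ ≤ 2 * ‖v‖ + (2 + t) * ‖v‖ ^ 2 := by
        refine (norm_add_le _ _).trans (add_le_add ?_ ?_)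
        · rw [norm_mul, Complex.norm_real, Real.norm_eq_abs]; gcongr
        · rw [norm_mul]
          gcongr
          refine (norm_add_le _ _).trans (add_le_add ?_ ?_)
          · rw [Complex.norm_real, Real.norm_eq_abs]; exact hσ'
          · simp [abs_of_pos ht0]
    _ ≤ 14 / t := by
        rw [hvn]
        have e2 : 2 * (σ / t) + (2 + t) * (σ / t) ^ 2 = (2 * σ + 2 * σ * (σ / t) + σ ^ 2) / t := by
          field_simp
          ring
        rw [e2]
        gcongr
        have : σ / t ≤ 1 / 2 := by rw [hvn] at hv2; exact hv2
        nlinarith [div_nonneg hσ ht0.le]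

/-- Stirling's formula on vertical lines, with a uniform relative error `O(1/t)`. -/
theorem exists_stirling : ∃ C : ℝ, 0 < C ∧ ∀ σ t : ℝ, 0 ≤ σ → σ ≤ 2 → 4 ≤ t →
    ‖Complex.Gamma (σ + t * I) * Complex.exp (-stirlingPhase σ t) - (√(2 * π) : ℝ)‖ ≤ C / t := by
  set K := √(2 * π) * (8 * Real.exp 4) with hK
  refine ⟨K * Real.exp 14 + √(2 * π) * (14 * Real.exp 14), by positivity, ?_⟩
  intro σ t hσ hσ2 ht
  have ht0 : 0 < t := by linarith
  have h1 := norm_Gamma_sub_main_le (s := σ + t * I) (by simpa using hσ) (by simp; linarith)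
  have h2 := norm_logGammaMain_sub_stirlingPhase_le hσ hσ2 ht
  set w := logGammaMain (σ + t * I) - stirlingPhase σ t with hw
  have hw14 : ‖w‖ ≤ 14 := h2.trans (by rw [div_le_iff₀ ht0]; linarith)
  have h3 := Complex.norm_exp_sub_sum_le_norm_mul_exp w 1
  simp only [Finset.range_one, Finset.sum_singleton, pow_zero, Nat.factorial_zero, Nat.cast_one,
    div_one, pow_one] at h3
  have h4 : ‖Complex.exp w‖ ≤ Real.exp 14 :=
    (Complex.norm_exp_le_exp_norm w).trans (Real.exp_le_exp.mpr hw14)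
  have e : Complex.Gamma (σ + t * I) * Complex.exp (-stirlingPhase σ t) - (√(2 * π) : ℝ) =
      (Complex.Gamma (σ + t * I) * Complex.exp (-logGammaMain (σ + t * I)) - (√(2 * π) : ℝ)) *
        Complex.exp w + (√(2 * π) : ℝ) * (Complex.exp w - 1) := by
    have : Complex.exp (-stirlingPhase σ t) =
        Complex.exp (-logGammaMain (σ + t * I)) * Complex.exp w := by
      rw [← Complex.exp_add, hw]; congr 1; ring
    rw [this]; ring
  have him : ((σ : ℂ) + t * I).im = t := by simp
  rw [him] at h1
  rw [e]
  calc _ ≤ K / t * Real.exp 14 + √(2 * π) * (14 / t * Real.exp 14) := by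
        refine (norm_add_le _ _).trans (add_le_add ?_ ?_)
        · rw [norm_mul]; gcongr
        · rw [norm_mul, Complex.norm_real, Real.norm_of_nonneg (Real.sqrt_nonneg _)]
          gcongr
          refine h3.trans ?_
          gcongr
    _ = _ := by ring

lemma norm_exp_stirlingPhase {σ t : ℝ} (ht : 0 < t) :
    ‖Complex.exp (stirlingPhase σ t)‖ = t ^ (σ - 1 / 2) * Real.exp (-(π * t / 2)) := by
  rw [Complex.norm_exp, Real.rpow_def_of_pos ht, ← Real.exp_add]
  congr 1
  simp [stirlingPhase]
  ring

theorem exists_norm_Gamma_le : ∃ C : ℝ, 0 < C ∧ ∀ σ t : ℝ, 0 ≤ σ → σ ≤ 2 → 4 ≤ |t| →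
    ‖Complex.Gamma (σ + t * I)‖ ≤ C * |t| ^ (σ - 1 / 2) * Real.exp (-(π * |t| / 2)) := by
  obtain ⟨C, hC, h⟩ := exists_stirling
  have key : ∀ σ t : ℝ, 0 ≤ σ → σ ≤ 2 → 4 ≤ t → ‖Complex.Gamma (σ + t * I)‖ ≤
      (C + √(2 * π)) * t ^ (σ - 1 / 2) * Real.exp (-(π * t / 2)) := by
    intro σ t h0 h2 ht
    have ht0 : 0 < t := by linarith
    have h1 := h σ t h0 h2 ht
    have hn : ‖Complex.Gamma (σ + t * I) * Complex.exp (-stirlingPhase σ t)‖ ≤ C + √(2 * π) := by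
      have := norm_le_norm_add_norm_sub' (Complex.Gamma (σ + t * I) *
        Complex.exp (-stirlingPhase σ t)) ((√(2 * π) : ℝ) : ℂ)
      rw [Complex.norm_real, Real.norm_of_nonneg (Real.sqrt_nonneg _)] at this
      have h3 : C / t ≤ C := div_le_self hC.le (by linarith)
      linarith
    have e : Complex.Gamma (σ + t * I) = Complex.Gamma (σ + t * I) *
        Complex.exp (-stirlingPhase σ t) * Complex.exp (stirlingPhase σ t) := by
      rw [mul_assoc, ← Complex.exp_add]; simp
    rw [e, norm_mul, norm_exp_stirlingPhase ht0, ← mul_assoc]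
    gcongr
  refine ⟨C + √(2 * π), by positivity, fun σ t h0 h2 ht => ?_⟩
  rcases le_total 0 t with h3 | h3
  · rw [abs_of_nonneg h3] at ht ⊢
    exact key σ t h0 h2 ht
  · rw [abs_of_nonpos h3] at ht ⊢
    have := key σ (-t) h0 h2 ht
    have e : (σ : ℂ) + (-t : ℝ) * I = (starRingEnd ℂ) (σ + t * I) := by
      simp
    rwa [e, Complex.Gamma_conj, Complex.norm_conj] at this

/-- The factor `Γ(1-s) (2π)^{s-1} e^{iπ(1-s)/2}` of the functional equation, which is dominant in
the upper half plane; it is the improper integral `∫_0^∞ x^{-s} e^{2πix} dx`. -/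
noncomputable def dualFactor (s : ℂ) : ℂ :=
  Complex.Gamma (1 - s) * (2 * π : ℂ) ^ (s - 1) * Complex.exp (π * I * (1 - s) / 2)

/-- The leading term of `dualFactor (θ + it)`. -/
noncomputable def dualMain (θ t : ℝ) : ℂ :=
  ((t / (2 * π)) ^ (1 / 2 - θ) : ℝ) *
    Complex.exp ((π / 4 - (t * Real.log (t / (2 * π)) - t) : ℝ) * I)

lemma norm_dualMain {θ t : ℝ} (ht : 0 < t) : ‖dualMain θ t‖ = (t / (2 * π)) ^ (1 / 2 - θ) := by
  rw [dualMain, norm_mul, Complex.norm_exp_ofReal_mul_I, mul_one, Complex.norm_real,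
    Real.norm_of_nonneg (by positivity)]

theorem exists_norm_dualFactor_sub_le : ∃ C : ℝ, 0 < C ∧ ∀ θ t : ℝ, 0 ≤ θ → θ ≤ 1 → 4 ≤ t →
    ‖dualFactor (θ + t * I) - dualMain θ t‖ ≤ C / t * (t / (2 * π)) ^ (1 / 2 - θ) := by
  obtain ⟨C, hC, h⟩ := exists_stirling
  refine ⟨C / √(2 * π), by positivity, fun θ t h0 h1 ht => ?_⟩
  have ht0 : 0 < t := by linarith
  have h2 := h (1 - θ) t (by linarith) (by linarith) ht
  set ℓ := Real.log (2 * π) with hℓ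
  have hpi : (0 : ℝ) < 2 * π := by positivity
  have hpow : (2 * π : ℂ) ^ ((θ : ℂ) + t * I - 1) = Complex.exp (ℓ * (θ + t * I - 1)) := by
    rw [Complex.cpow_def_of_ne_zero (by exact_mod_cast hpi.ne'), hℓ]
    congr 2
    rw [Complex.ofReal_log hpi.le]; push_cast; rfl
  have hsq : ((√(2 * π) : ℝ) : ℂ) = Complex.exp ((ℓ / 2 : ℝ) : ℂ) := by
    rw [← Complex.ofReal_exp, hℓ, Real.sqrt_eq_rpow, Real.rpow_def_of_pos hpi]
    congr 2; ring
  have hlogt : Real.log (t / (2 * π)) = Real.log t - ℓ := by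
    rw [Real.log_div ht0.ne' hpi.ne']
  have hmain : dualMain θ t = ((√(2 * π) : ℝ) : ℂ) *
      (starRingEnd ℂ) (Complex.exp (stirlingPhase (1 - θ) t)) *
      Complex.exp (ℓ * (θ + t * I - 1)) * Complex.exp (π * I * (1 - (θ + t * I)) / 2) := by
    rw [dualMain, hsq, ← Complex.exp_conj, Real.rpow_def_of_pos (by positivity), hlogt,
      Complex.ofReal_exp, ← Complex.exp_add, ← Complex.exp_add, ← Complex.exp_add,
      ← Complex.exp_add]
    congr 1
    simp only [stirlingPhase, map_sub, map_mul, map_add, Complex.conj_ofReal, Complex.conj_I,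
      map_div₀, map_ofNat]
    push_cast
    ring
  have hG : Complex.Gamma (1 - (θ + t * I)) =
      (starRingEnd ℂ) (Complex.Gamma ((1 - θ : ℝ) + t * I)) := by
    rw [← Complex.Gamma_conj]
    congr 1
    simp; ring
  have e : dualFactor (θ + t * I) - dualMain θ t = (starRingEnd ℂ)
      (Complex.Gamma ((1 - θ : ℝ) + t * I) * Complex.exp (-stirlingPhase (1 - θ) t) -
        (√(2 * π) : ℝ)) * (dualMain θ t / (√(2 * π) : ℝ)) := by
    have hq : ((√(2 * π) : ℝ) : ℂ) ≠ 0 := by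
      have : 0 < √(2 * π) := by positivity
      exact_mod_cast this.ne'
    have hexp : (starRingEnd ℂ) (Complex.exp (-stirlingPhase (1 - θ) t)) *
        (starRingEnd ℂ) (Complex.exp (stirlingPhase (1 - θ) t)) = 1 := by
      rw [← map_mul, ← Complex.exp_add]; simp
    rw [dualFactor, hpow, hG, map_sub, map_mul, Complex.conj_ofReal, sub_mul,
      mul_div_cancel₀ _ hq]
    congr 1
    rw [hmain]
    field_simp
    rw [mul_assoc, hexp, mul_one]
  rw [e, norm_mul, Complex.norm_conj, norm_div, norm_dualMain ht0, Complex.norm_real,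
    Real.norm_of_nonneg (Real.sqrt_nonneg _)]
  calc _ ≤ C / t * ((t / (2 * π)) ^ (1 / 2 - θ) / √(2 * π)) := by gcongr
    _ = _ := by ring

/-! ### Euler–Maclaurin summation for the Hurwitz zeta function -/

/-- The second Bernoulli polynomial, extended periodically. -/
noncomputable def bernoulliTwo (x : ℝ) : ℝ := Int.fract x ^ 2 - Int.fract x + 1 / 6

lemma abs_bernoulliTwo_le (x : ℝ) : |bernoulliTwo x| ≤ 1 / 6 := by
  have h0 := Int.fract_nonneg x
  have h1 := (Int.fract_lt_one x).le
  rw [bernoulliTwo, abs_le]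
  constructor <;> nlinarith [sq_nonneg (Int.fract x - 1 / 2)]

lemma measurable_bernoulliTwo : Measurable bernoulliTwo := by
  unfold bernoulliTwo; fun_prop

/-- The remainder integral of the Euler–Maclaurin formula. -/
noncomputable def emTail (b : ℝ) (s : ℂ) : ℂ :=
  ∫ x in Ioi b, (bernoulliTwo (x - b) : ℂ) * (x : ℂ) ^ (-s - 2)

/-- The Euler–Maclaurin expansion of `∑ (m+b)^{-s}`. -/
noncomputable def emSum (b : ℝ) (s : ℂ) : ℂ :=
  (b : ℂ) ^ (1 - s) / (s - 1) + (b : ℂ) ^ (-s) / 2 + s * (b : ℂ) ^ (-s - 1) / 12 -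
    s * (s + 1) / 2 * emTail b s

lemma norm_emTail_integrand_le {b x : ℝ} (hb : 0 < b) (hx : b < x) (s : ℂ) :
    ‖(bernoulliTwo (x - b) : ℂ) * (x : ℂ) ^ (-s - 2)‖ ≤ 1 / 6 * x ^ (-s.re - 2) := by
  rw [norm_mul, Complex.norm_real, Complex.norm_cpow_eq_rpow_re_of_pos (hb.trans hx)]
  have : (-s - 2).re = -s.re - 2 := by simp
  rw [this]
  gcongr
  · exact Real.rpow_nonneg (hb.trans hx).le _
  · exact abs_bernoulliTwo_le _

lemma continuousOn_cpow_const_Ioi (c : ℂ) : ContinuousOn (fun x : ℝ => (x : ℂ) ^ c) (Ioi 0) := by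
  intro x hx
  exact (Complex.continuousAt_ofReal_cpow_const x c (Or.inr hx.ne')).continuousWithinAt

lemma hasDerivAt_real_cpow {x : ℝ} (hx : 0 < x) (r : ℂ) :
    HasDerivAt (fun y : ℝ => (y : ℂ) ^ r) (r * (x : ℂ) ^ (r - 1)) x := by
  have h := (hasDerivAt_id (x : ℂ)).cpow_const (c := r) (Or.inl (by simpa using hx))
  simpa using h.comp_ofReal

lemma integrableOn_emTail {b : ℝ} (hb : 0 < b) {s : ℂ} (hs : -1 < s.re) :
    IntegrableOn (fun x : ℝ => (bernoulliTwo (x - b) : ℂ) * (x : ℂ) ^ (-s - 2)) (Ioi b) := by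
  have h1 : IntegrableOn (fun x : ℝ => 1 / 6 * x ^ (-s.re - 2)) (Ioi b) :=
    (integrableOn_Ioi_rpow_of_lt (by linarith) hb).const_mul _
  refine Integrable.mono' h1 ?_ ?_
  · refine AEStronglyMeasurable.mul ?_ ?_
    · exact (Complex.measurable_ofReal.comp
        (measurable_bernoulliTwo.comp (measurable_id.sub_const b))).aestronglyMeasurable
    · exact ((continuousOn_cpow_const_Ioi _).mono (Ioi_subset_Ioi hb.le)).aestronglyMeasurable
        measurableSet_Ioi
  · filter_upwards [ae_restrict_mem measurableSet_Ioi] with x hx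
    exact norm_emTail_integrand_le hb hx s

lemma norm_emTail_le {b : ℝ} (hb : 0 < b) {s : ℂ} (hs : -1 < s.re) :
    ‖emTail b s‖ ≤ b ^ (-s.re - 1) / (6 * (s.re + 1)) := by
  have h1 : IntegrableOn (fun x : ℝ => 1 / 6 * x ^ (-s.re - 2)) (Ioi b) :=
    (integrableOn_Ioi_rpow_of_lt (by linarith) hb).const_mul _
  have h2 := norm_integral_le_of_norm_le h1 (f := fun x : ℝ => (bernoulliTwo (x - b) : ℂ) *
    (x : ℂ) ^ (-s - 2)) (by
      filter_upwards [ae_restrict_mem measurableSet_Ioi] with x hx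
      exact norm_emTail_integrand_le hb hx s)
  refine h2.trans (le_of_eq ?_)
  rw [integral_const_mul, integral_Ioi_rpow_of_lt (by linarith) hb]
  have : -s.re - 2 + 1 = -(s.re + 1) := by ring
  have e : -s.re - 1 = -(s.re + 1) := by ring
  rw [this, e]
  have : s.re + 1 ≠ 0 := by linarith
  field_simp

lemma norm_emSum_sub_le {b : ℝ} (hb : 0 < b) {s : ℂ} (hs : -1 < s.re) :
    ‖emSum b s - (b : ℂ) ^ (1 - s) / (s - 1)‖ ≤ b ^ (-s.re) / 2 +
      b ^ (-s.re - 1) * (‖s‖ / 12 + ‖s‖ * ‖s + 1‖ / (12 * (s.re + 1))) := by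
  have e : emSum b s - (b : ℂ) ^ (1 - s) / (s - 1) = (b : ℂ) ^ (-s) / 2 +
      (s * (b : ℂ) ^ (-s - 1) / 12 - s * (s + 1) / 2 * emTail b s) := by rw [emSum]; ring
  have h1 : ‖(b : ℂ) ^ (-s)‖ = b ^ (-s.re) := by
    rw [Complex.norm_cpow_eq_rpow_re_of_pos hb]; simp
  have h2 : ‖(b : ℂ) ^ (-s - 1)‖ = b ^ (-s.re - 1) := by
    rw [Complex.norm_cpow_eq_rpow_re_of_pos hb]; simp
  have h3 := norm_emTail_le hb hs
  rw [e]
  refine (norm_add_le _ _).trans (add_le_add ?_ ?_)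
  · rw [norm_div, h1]; simp
  · calc _ ≤ ‖s‖ * b ^ (-s.re - 1) / 12 + ‖s‖ * ‖s + 1‖ / 2 *
          (b ^ (-s.re - 1) / (6 * (s.re + 1))) := by
          refine (norm_sub_le _ _).trans (add_le_add ?_ ?_)
          · rw [norm_div, norm_mul, h2]; simp
          · rw [norm_mul, norm_div, norm_mul]
            simp only [Complex.norm_ofNat]
            gcongr
      _ = _ := by
          have : s.re + 1 ≠ 0 := by linarith
          field_simp
          ring

lemma emSum_sub_emSum_add_one {b : ℝ} (hb : 0 < b) {s : ℂ} (hs : -1 < s.re) (hs1 : s ≠ 1) :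
    emSum b s - emSum (b + 1) s = (b : ℂ) ^ (-s) := by
  have hsplit : emTail b s = (∫ x in b..(b + 1), (bernoulliTwo (x - b) : ℂ) *
      (x : ℂ) ^ (-s - 2)) + emTail (b + 1) s := by
    have hI := integrableOn_emTail hb hs
    have h1 : emTail (b + 1) s = ∫ x in Ioi (b + 1), (bernoulliTwo (x - b) : ℂ) *
        (x : ℂ) ^ (-s - 2) := by
      rw [emTail]
      congr 1
      ext x
      have : bernoulliTwo (x - (b + 1)) = bernoulliTwo (x - b) := by
        simp only [bernoulliTwo, ← sub_sub, Int.fract_sub_one]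
      rw [this]
    rw [h1, emTail]
    exact (intervalIntegral.integral_interval_add_Ioi hI
      (hI.mono_set (Ioi_subset_Ioi (by linarith)))).symm
  set c := (s * (s + 1) / 2 : ℂ) with hc
  have hone : (1 - s) ≠ 0 := sub_ne_zero.mpr (Ne.symm hs1)
  have hinteg : c * ∫ x in b..(b + 1), (bernoulliTwo (x - b) : ℂ) * (x : ℂ) ^ (-s - 2) =
      -(s / 12) * (((b + 1 : ℝ) : ℂ) ^ (-s - 1) - (b : ℂ) ^ (-s - 1)) -
        (((b + 1 : ℝ) : ℂ) ^ (-s) + (b : ℂ) ^ (-s)) / 2 +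
        (((b + 1 : ℝ) : ℂ) ^ (1 - s) - (b : ℂ) ^ (1 - s)) / (1 - s) := by
    set H : ℝ → ℂ := fun x => -(s / 2) * (((x - b) ^ 2 - (x - b) + 1 / 6 : ℝ) : ℂ) *
      (x : ℂ) ^ (-s - 1) - ((x - b - 1 / 2 : ℝ) : ℂ) * (x : ℂ) ^ (-s) + (x : ℂ) ^ (1 - s) / (1 - s)
      with hH
    have hcong : ∫ x in b..(b + 1), c * ((bernoulliTwo (x - b) : ℂ) * (x : ℂ) ^ (-s - 2)) =
        ∫ x in b..(b + 1), c * ((((x - b) ^ 2 - (x - b) + 1 / 6 : ℝ) : ℂ) *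
          (x : ℂ) ^ (-s - 2)) := by
      apply intervalIntegral.integral_congr_ae
      have : ∀ᵐ x : ℝ, x ≠ b + 1 := by simp [ae_iff]
      filter_upwards [this] with x hx hmem
      rw [uIoc_of_le (by linarith)] at hmem
      have hf : Int.fract (x - b) = x - b := by
        rw [Int.fract_eq_self]
        exact ⟨by linarith [hmem.1], by
          have := lt_of_le_of_ne hmem.2 hx
          linarith⟩
      rw [bernoulliTwo, hf]
    rw [← intervalIntegral.integral_const_mul, hcong]
    have hderiv : ∀ x ∈ uIcc b (b + 1), HasDerivAt H (c * ((((x - b) ^ 2 - (x - b) + 1 / 6 : ℝ) : ℂ) *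
          (x : ℂ) ^ (-s - 2))) x := by
      intro x hx
      rw [uIcc_of_le (by linarith)] at hx
      have hx0 : 0 < x := hb.trans_le hx.1
      have hxne : (x : ℂ) ≠ 0 := by exact_mod_cast hx0.ne'
      have hp := hasDerivAt_real_cpow hx0
      have hu : HasDerivAt (fun y : ℝ => (((y - b) ^ 2 - (y - b) + 1 / 6 : ℝ) : ℂ))
          ((2 * (x - b) - 1 : ℝ) : ℂ) x := by
        apply HasDerivAt.ofReal_comp
        have h := ((((hasDerivAt_id x).sub_const b).pow 2).sub
          ((hasDerivAt_id x).sub_const b)).add_const (1 / 6)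
        refine h.congr_deriv ?_
        simp
      have hv : HasDerivAt (fun y : ℝ => ((y - b - 1 / 2 : ℝ) : ℂ)) ((1 : ℝ) : ℂ) x := by
        apply HasDerivAt.ofReal_comp
        exact ((hasDerivAt_id x).sub_const b).sub_const (1 / 2)
      have h := (((hu.const_mul (-(s / 2))).mul (hp (-s - 1))).sub (hv.mul (hp (-s)))).add
        ((hp (1 - s)).div_const (1 - s))
      refine h.congr_deriv ?_
      have e1 : (x : ℂ) ^ (-s - 1 - 1) = (x : ℂ) ^ (-s - 2) := by congr 1; ring
      have e2 : (x : ℂ) ^ (1 - s - 1) = (x : ℂ) ^ (-s) := by congr 1; ring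
      rw [e1, e2, mul_div_cancel_left₀ _ hone, hc]
      push_cast
      ring
    rw [intervalIntegral.integral_eq_sub_of_hasDerivAt hderiv]
    · simp only [hH]
      push_cast
      field_simp
      ring
    · apply ContinuousOn.intervalIntegrable
      rw [uIcc_of_le (by linarith)]
      refine continuousOn_const.mul (ContinuousOn.mul (by fun_prop) ?_)
      exact (continuousOn_cpow_const_Ioi _).mono fun x hx => hb.trans_le hx.1
  have hone' : (s - 1) ≠ 0 := sub_ne_zero.mpr hs1
  have hdiv : ∀ z : ℂ, z / (1 - s) = -(z / (s - 1)) := by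
    intro z; rw [← neg_sub s 1, div_neg]
  rw [emSum, emSum, hsplit]
  rw [hdiv, sub_div] at hinteg
  linear_combination -hinteg

lemma isPreconnected_strip : IsPreconnected {s : ℂ | -1 < s.re ∧ s ≠ 1} := by
  have hA : IsPreconnected ({s : ℂ | -1 < s.re} ∩ {s | 0 < s.im}) :=
    ((convex_halfSpace_re_gt _).inter (convex_halfSpace_im_gt _)).isPreconnected
  have hB : IsPreconnected ({s : ℂ | -1 < s.re} ∩ {s | s.im < 0}) :=
    ((convex_halfSpace_re_gt _).inter (convex_halfSpace_im_lt _)).isPreconnected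
  have hC : IsPreconnected {s : ℂ | 1 < s.re} := (convex_halfSpace_re_gt _).isPreconnected
  have hD : IsPreconnected ({s : ℂ | -1 < s.re} ∩ {s | s.re < 1}) :=
    ((convex_halfSpace_re_gt _).inter (convex_halfSpace_re_lt _)).isPreconnected
  have h1 := IsPreconnected.union (2 + I) (by simp; norm_num) (by simp) hA hC
  have h2 := IsPreconnected.union (2 - I) (by right; simp) (by simp; norm_num) h1 hB
  have h3 := IsPreconnected.union I (by left; left; simp) (by simp) h2 hD
  convert! h3 using 1
  ext s
  simp only [mem_ofPred_eq, mem_union, mem_inter_iff]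
  constructor
  · rintro ⟨h, hne⟩
    rcases lt_trichotomy s.im 0 with hi | hi | hi
    · tauto
    · rcases lt_trichotomy s.re 1 with hr | hr | hr
      · tauto
      · exact absurd (Complex.ext hr hi) hne
      · tauto
    · tauto
  · rintro (((h | h) | h) | h)
    · exact ⟨h.1, by rintro rfl; simp at h⟩
    · exact ⟨by linarith, by rintro rfl; simp at h⟩
    · exact ⟨h.1, by rintro rfl; simp at h⟩
    · exact ⟨h.1, by rintro rfl; simp at h⟩

lemma differentiableAt_emTail {b : ℝ} (hb : 0 < b) {s : ℂ} (hs : -1 < s.re) :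
    DifferentiableAt ℂ (emTail b) s := by
  set f : ℝ → ℂ := (Ioi b).indicator fun x => (bernoulliTwo (x - b) : ℂ) with hf
  have hm : ∀ z : ℂ, emTail b z = mellin f (-z - 1) := by
    intro z
    rw [emTail, mellin, ← integral_indicator measurableSet_Ioi,
      ← integral_indicator measurableSet_Ioi]
    congr 1
    ext x
    by_cases hx : x ∈ Ioi b
    · have hx0 : x ∈ Ioi (0 : ℝ) := lt_trans hb hx
      rw [indicator_of_mem hx, indicator_of_mem hx0, hf, indicator_of_mem hx, smul_eq_mul, mul_comm]
      congr 2; ring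
    · rw [indicator_of_notMem hx]
      by_cases hx0 : x ∈ Ioi (0 : ℝ)
      · rw [indicator_of_mem hx0, hf, indicator_of_notMem hx, smul_zero]
      · rw [indicator_of_notMem hx0]
  have hbd : ∀ x, ‖f x‖ ≤ 1 := by
    intro x
    rw [hf]
    by_cases hx : x ∈ Ioi b
    · rw [indicator_of_mem hx, Complex.norm_real]
      exact (abs_bernoulliTwo_le _).trans (by norm_num)
    · rw [indicator_of_notMem hx]; simp
  have hmeas : Measurable f :=
    (Complex.measurable_ofReal.comp
        (measurable_bernoulliTwo.comp (measurable_id.sub_const b))).indicator measurableSet_Ioi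
  have hd : DifferentiableAt ℂ (mellin f) (-s - 1) := by
    refine mellin_differentiableAt_of_isBigO_rpow (a := 0) (b := (-s - 1).re - 1) ?_ ?_ ?_ ?_ ?_
    · apply LocallyIntegrable.locallyIntegrableOn
      have hc : LocallyIntegrable (fun _ : ℝ => (1 : ℝ)) := continuous_const.locallyIntegrable
      exact hc.mono hmeas.aestronglyMeasurable (ae_of_all _ fun x => by simpa using hbd x)
    · refine IsBigO.of_bound 1 (Eventually.of_forall fun x => ?_)
      simpa using hbd x
    · simp; linarith
    · refine IsBigO.of_bound 1 ?_
      filter_upwards [mem_nhdsWithin_of_mem_nhds (Iio_mem_nhds hb)] with x hx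
      rw [hf, indicator_of_notMem (by simpa using (le_of_lt hx))]
      simp
    · linarith
  have : emTail b = (mellin f) ∘ fun z => -z - 1 := funext hm
  rw [this]
  exact hd.comp s (by fun_prop)

lemma differentiableAt_emSum {b : ℝ} (hb : 0 < b) {s : ℂ} (hs : -1 < s.re) (hs1 : s ≠ 1) :
    DifferentiableAt ℂ (emSum b) s := by
  have hbc : (b : ℂ) ≠ 0 := by exact_mod_cast hb.ne'
  have hp : ∀ c : ℂ → ℂ, DifferentiableAt ℂ c s → DifferentiableAt ℂ (fun z => (b : ℂ) ^ c z) s :=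
    fun c hc => hc.const_cpow (Or.inl hbc)
  have h1 := hp (fun z => 1 - z) (by fun_prop)
  have h2 := hp (fun z => -z) (by fun_prop)
  have h3 := hp (fun z => -z - 1) (by fun_prop)
  have h4 := differentiableAt_emTail hb hs
  unfold emSum
  refine DifferentiableAt.sub (DifferentiableAt.add (DifferentiableAt.add ?_ ?_) ?_) ?_
  · exact h1.div (by fun_prop) (sub_ne_zero.mpr hs1)
  · exact h2.div_const 2
  · exact (differentiableAt_id.mul h3).div_const 12
  · exact DifferentiableAt.mul (by fun_prop) h4

lemma tendsto_emSum_add_nat {b : ℝ} (hb : 0 < b) {s : ℂ} (hs : 1 < s.re) :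
    Tendsto (fun n : ℕ => emSum (b + n) s) atTop (𝓝 0) := by
  have hbn : Tendsto (fun n : ℕ => b + (n : ℝ)) atTop atTop :=
    tendsto_atTop_add_const_left _ _ tendsto_natCast_atTop_atTop
  have hr : ∀ p : ℝ, 0 < p → Tendsto (fun n : ℕ => (b + (n : ℝ)) ^ (-p)) atTop (𝓝 0) :=
    fun p hp => (tendsto_rpow_neg_atTop hp).comp hbn
  have hlim : Tendsto (fun n : ℕ => (b + (n : ℝ)) ^ (-(s.re - 1)) / ‖s - 1‖ +
      ((b + (n : ℝ)) ^ (-s.re) / 2 + (b + (n : ℝ)) ^ (-(s.re + 1)) *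
        (‖s‖ / 12 + ‖s‖ * ‖s + 1‖ / (12 * (s.re + 1))))) atTop (𝓝 0) := by
    have := ((hr (s.re - 1) (by linarith)).div_const ‖s - 1‖).add
      (((hr s.re (by linarith)).div_const 2).add ((hr (s.re + 1) (by linarith)).mul_const
        (‖s‖ / 12 + ‖s‖ * ‖s + 1‖ / (12 * (s.re + 1)))))
    simpa using this
  refine squeeze_zero_norm (fun n => ?_) hlim
  have hbn' : 0 < b + (n : ℝ) := by positivity
  have h1 := norm_emSum_sub_le hbn' (s := s) (by linarith)
  have h2 : ‖(((b + n : ℝ) : ℂ)) ^ (1 - s) / (s - 1)‖ = (b + (n : ℝ)) ^ (-(s.re - 1)) / ‖s - 1‖ := by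
    rw [norm_div, Complex.norm_cpow_eq_rpow_re_of_pos hbn']
    simp
  have h3 := norm_le_norm_add_norm_sub' (emSum (b + n) s) ((((b + n : ℝ) : ℂ)) ^ (1 - s) / (s - 1))
  have e : -(s.re + 1) = -s.re - 1 := by ring
  rw [h2] at h3
  rw [e]
  linarith

/-- The Euler–Maclaurin formula for the Hurwitz zeta function. -/
theorem zetaH_eq_emSum {b : ℝ} (hb : 0 < b) {s : ℂ} (hs : -1 < s.re) (hs1 : s ≠ 1) :
    zetaH s b = emSum b s := by
  have hU : IsOpen {s : ℂ | -1 < s.re ∧ s ≠ 1} :=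
    (isOpen_lt continuous_const Complex.continuous_re).inter isOpen_ne
  have key : ∀ z : ℂ, 1 < z.re → zetaH z b = emSum b z := by
    intro z hz
    have h1 := (hasSum_zetaH hb hz).tendsto_sum_nat
    have h2 : ∀ n : ℕ, ∑ m ∈ Finset.range n, 1 / ((m + b : ℝ) : ℂ) ^ z =
        emSum b z - emSum (b + n) z := by
      intro n
      induction n with
      | zero => simp
      | succ n ih =>
        have hz1 : z ≠ 1 := by rintro rfl; simp at hz
        rw [Finset.sum_range_succ, ih]
        have := emSum_sub_emSum_add_one (b := b + n) (by positivity) (s := z) (by linarith) hz1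
        push_cast
        rw [← add_assoc, one_div, ← Complex.cpow_neg, add_comm (n : ℂ)]
        push_cast at this
        linear_combination -this
    have h3 : Tendsto (fun n : ℕ => emSum b z - emSum (b + n) z) atTop (𝓝 (emSum b z - 0)) :=
      tendsto_const_nhds.sub (tendsto_emSum_add_nat hb hz)
    rw [sub_zero] at h3
    exact tendsto_nhds_unique (h1.congr h2) h3
  have hf : AnalyticOnNhd ℂ (fun z => zetaH z b) {s : ℂ | -1 < s.re ∧ s ≠ 1} :=
    DifferentiableOn.analyticOnNhd
      (fun z hz => (differentiableAt_zetaH hb hz.2).differentiableWithinAt) hU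
  have hg : AnalyticOnNhd ℂ (emSum b) {s : ℂ | -1 < s.re ∧ s ≠ 1} :=
    DifferentiableOn.analyticOnNhd
      (fun z hz => (differentiableAt_emSum hb hz.1 hz.2).differentiableWithinAt) hU
  have h2 : (2 : ℂ) ∈ {s : ℂ | -1 < s.re ∧ s ≠ 1} := by simp; norm_num
  refine hf.eqOn_of_preconnected_of_eventuallyEq hg isPreconnected_strip h2 ?_ ⟨hs, hs1⟩
  filter_upwards [(isOpen_lt continuous_const Complex.continuous_re).mem_nhds
    (show (2 : ℂ) ∈ {z : ℂ | 1 < z.re} by simp)] with z hz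
  exact key z hz

/-! ### Poisson summation for the tail of the Hurwitz zeta function -/

/-- The additive character `x ↦ e^{2πiνx}`. -/
noncomputable def wave (ν x : ℝ) : ℂ := Complex.exp ((2 * π * ν * x : ℝ) * I)

@[simp] lemma norm_wave (ν x : ℝ) : ‖wave ν x‖ = 1 := Complex.norm_exp_ofReal_mul_I _

lemma wave_ne_zero (ν x : ℝ) : wave ν x ≠ 0 := Complex.exp_ne_zero _

lemma wave_add (ν x y : ℝ) : wave ν (x + y) = wave ν x * wave ν y := by
  rw [wave, wave, wave, ← Complex.exp_add]; congr 1; push_cast; ring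

lemma wave_mul_wave_neg (ν x : ℝ) : wave ν x * wave ν (-x) = 1 := by
  rw [← wave_add]; simp [wave]

lemma hasDerivAt_wave (ν x : ℝ) : HasDerivAt (wave ν) (2 * π * ν * I * wave ν x) x := by
  have h1 : HasDerivAt (fun y : ℝ => ((2 * π * ν * y : ℝ) : ℂ) * I) (((2 * π * ν : ℝ) : ℂ) * I) x := by
    apply HasDerivAt.mul_const
    apply HasDerivAt.ofReal_comp
    simpa using (hasDerivAt_id x).const_mul (2 * π * ν)
  have h2 := h1.cexp
  unfold wave
  refine h2.congr_deriv ?_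
  push_cast; ring

lemma continuous_wave (ν : ℝ) : Continuous (wave ν) := by
  unfold wave; fun_prop

/-- The value of the improper integral `∫_b^∞ x^{-s} e^{2πiνx} dx`. -/
noncomputable def oscInt (b : ℝ) (s : ℂ) (ν : ℝ) : ℂ :=
  (-((b : ℂ) ^ (-s) * wave ν b) + s * ∫ x in Ioi b, (x : ℂ) ^ (-s - 1) * wave ν x) /
    (2 * π * ν * I)

lemma integrableOn_cpow_mul_wave {b : ℝ} (hb : 0 < b) {c : ℂ} (hc : c.re < -1) (ν : ℝ) :
    IntegrableOn (fun x : ℝ => (x : ℂ) ^ c * wave ν x) (Ioi b) := by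
  refine Integrable.mono' (integrableOn_Ioi_rpow_of_lt hc hb) ?_ ?_
  · refine ContinuousOn.aestronglyMeasurable ?_ measurableSet_Ioi
    exact ((continuousOn_cpow_const_Ioi _).mono (Ioi_subset_Ioi hb.le)).mul
      (continuous_wave ν).continuousOn
  · filter_upwards [ae_restrict_mem measurableSet_Ioi] with x hx
    rw [norm_mul, norm_wave, mul_one, Complex.norm_cpow_eq_rpow_re_of_pos (hb.trans hx)]

lemma hasDerivAt_cpow_mul_wave {x : ℝ} (hx : 0 < x) (c : ℂ) (ν : ℝ) :
    HasDerivAt (fun y : ℝ => (y : ℂ) ^ c * wave ν y)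
      (c * ((x : ℂ) ^ (c - 1) * wave ν x) + 2 * π * ν * I * ((x : ℂ) ^ c * wave ν x)) x := by
  refine ((hasDerivAt_real_cpow hx c).mul (hasDerivAt_wave ν x)).congr_deriv ?_
  ring

lemma tendsto_cpow_mul_wave {c : ℂ} (hc : c.re < 0) (ν : ℝ) :
    Tendsto (fun x : ℝ => (x : ℂ) ^ c * wave ν x) atTop (𝓝 0) := by
  have h := tendsto_rpow_neg_atTop (y := -c.re) (by linarith)
  refine squeeze_zero_norm' ?_ h
  filter_upwards [eventually_gt_atTop 0] with x hx
  rw [norm_mul, norm_wave, mul_one, Complex.norm_cpow_eq_rpow_re_of_pos hx, neg_neg]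

lemma integral_Ioi_cpow_mul_wave {b : ℝ} (hb : 0 < b) {c : ℂ} (hc : c.re < -1) {ν : ℝ}
    (hν : ν ≠ 0) :
    ∫ x in Ioi b, (x : ℂ) ^ c * wave ν x = (-((b : ℂ) ^ c * wave ν b) -
      c * ∫ x in Ioi b, (x : ℂ) ^ (c - 1) * wave ν x) / (2 * π * ν * I) := by
  have hc1 : (c - 1).re < -1 := by simp; linarith
  have i1 := integrableOn_cpow_mul_wave hb hc ν
  have i2 := integrableOn_cpow_mul_wave hb hc1 ν
  have h := integral_Ioi_of_hasDerivAt_of_tendsto' (a := b) (m := 0)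
    (fun x hx => hasDerivAt_cpow_mul_wave (hb.trans_le hx) c ν)
    ((i2.const_mul c).add (i1.const_mul (2 * π * ν * I)))
    (tendsto_cpow_mul_wave (by linarith) ν)
  rw [integral_add (i2.const_mul c) (i1.const_mul (2 * π * ν * I)), integral_const_mul,
    integral_const_mul] at h
  have hne : (2 * π * ν * I : ℂ) ≠ 0 := by
    have : (π : ℂ) ≠ 0 := by exact_mod_cast Real.pi_ne_zero
    have : (ν : ℂ) ≠ 0 := by exact_mod_cast hν
    simp [*]
  rw [eq_div_iff hne]
  linear_combination h

/-- The finite integral defining `oscInt`. -/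
lemma integral_cpow_mul_wave {b X : ℝ} (hb : 0 < b) (hX : b ≤ X) (s : ℂ) {ν : ℝ} (hν : ν ≠ 0) :
    ∫ x in b..X, (x : ℂ) ^ (-s) * wave ν x =
      ((X : ℂ) ^ (-s) * wave ν X - (b : ℂ) ^ (-s) * wave ν b +
        s * ∫ x in b..X, (x : ℂ) ^ (-s - 1) * wave ν x) / (2 * π * ν * I) := by
  have hii : ∀ c : ℂ, IntervalIntegrable (fun x : ℝ => (x : ℂ) ^ c * wave ν x) volume b X := by
    intro c
    apply ContinuousOn.intervalIntegrable
    rw [uIcc_of_le hX]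
    exact ((continuousOn_cpow_const_Ioi _).mono fun x hx => hb.trans_le hx.1).mul
      (continuous_wave ν).continuousOn
  have h := intervalIntegral.integral_eq_sub_of_hasDerivAt
    (fun x hx => hasDerivAt_cpow_mul_wave (x := x) (by
      rw [uIcc_of_le hX] at hx; exact hb.trans_le hx.1) (-s) ν)
    (((hii (-s - 1)).const_mul (-s)).add ((hii (-s)).const_mul (2 * π * ν * I)))
  rw [intervalIntegral.integral_add ((hii (-s - 1)).const_mul (-s))
    ((hii (-s)).const_mul (2 * π * ν * I)), intervalIntegral.integral_const_mul,
    intervalIntegral.integral_const_mul] at h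
  have hne : (2 * π * ν * I : ℂ) ≠ 0 := by
    have : (π : ℂ) ≠ 0 := by exact_mod_cast Real.pi_ne_zero
    have : (ν : ℂ) ≠ 0 := by exact_mod_cast hν
    simp [*]
  rw [eq_div_iff hne]
  linear_combination h

lemma tendsto_integral_oscInt {b : ℝ} (hb : 0 < b) {s : ℂ} (hs : 0 < s.re) {ν : ℝ} (hν : ν ≠ 0) :
    Tendsto (fun X : ℝ => ∫ x in b..X, (x : ℂ) ^ (-s) * wave ν x) atTop (𝓝 (oscInt b s ν)) := by
  have i1 := integrableOn_cpow_mul_wave hb (c := -s - 1) (by simp; linarith) ν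
  have h1 := intervalIntegral_tendsto_integral_Ioi b i1 tendsto_id
  have h2 := tendsto_cpow_mul_wave (c := -s) (by simp; linarith) ν
  have h3 : Tendsto (fun X : ℝ => ((X : ℂ) ^ (-s) * wave ν X - (b : ℂ) ^ (-s) * wave ν b +
        s * ∫ x in b..X, (x : ℂ) ^ (-s - 1) * wave ν x) / (2 * π * ν * I)) atTop
        (𝓝 (oscInt b s ν)) := by
    have := ((h2.sub_const ((b : ℂ) ^ (-s) * wave ν b)).add (h1.const_mul s)).div_const
      (2 * π * ν * I)
    rw [zero_sub] at this
    exact this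
  refine h3.congr' ?_
  filter_upwards [eventually_ge_atTop b] with X hX
  exact (integral_cpow_mul_wave hb hX s hν).symm

lemma hasSum_bernoulliTwo (x : ℝ) :
    HasSum (fun n : ℕ => 1 / ((π : ℂ) ^ 2 * n ^ 2) * ((wave n x + wave (-n) x) / 2))
      (bernoulliTwo x : ℂ) := by
  have h := hasSum_one_div_nat_pow_mul_cos (k := 1) (by norm_num) (x := Int.fract x)
    ⟨Int.fract_nonneg x, (Int.fract_lt_one x).le⟩
  have hb : (Polynomial.map (algebraMap ℚ ℝ) (Polynomial.bernoulli (2 * 1))).eval (Int.fract x) =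
      bernoulliTwo x := by
    have := bernoulliFun_two (Int.fract x)
    rw [bernoulliFun] at this
    rw [mul_one]
    rw [this, bernoulliTwo]; norm_num
  rw [hb] at h
  have h2 := (Complex.hasSum_ofReal.mpr h).mul_left (1 / (π : ℂ) ^ 2)
  have hpi : (π : ℂ) ≠ 0 := by exact_mod_cast Real.pi_ne_zero
  convert! h2 using 1
  · ext n
    have hc : Real.cos (2 * π * n * Int.fract x) = Real.cos (2 * π * n * x) := by
      rw [Int.fract, mul_sub]
      have : 2 * π * n * (⌊x⌋ : ℝ) = ((n * ⌊x⌋ : ℤ) : ℝ) * (2 * π) := by push_cast; ring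
      rw [this, Real.cos_sub_int_mul_two_pi]
    have hw : (wave n x + wave (-n) x) / 2 = (Real.cos (2 * π * n * x) : ℝ) := by
      rw [Complex.ofReal_cos, Complex.cos, wave, wave]
      congr 3
      push_cast; ring_nf
    rw [hw, hc]
    push_cast
    by_cases hn : (n : ℂ) = 0
    · simp [hn]
    · field_simp
  · push_cast [Nat.factorial]
    field_simp

lemma oscInt_add_neg {b : ℝ} (hb : 0 < b) {s : ℂ} (hs : 0 < s.re) (n : ℕ) :
    wave n (-b) * oscInt b s n + wave (-n) (-b) * oscInt b s (-n) =
      s * (b : ℂ) ^ (-s - 1) / (2 * π ^ 2) * (1 / (n : ℂ) ^ 2) - s * (s + 1) / 2 *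
        ∫ x in Ioi b, (1 / ((π : ℂ) ^ 2 * n ^ 2) * ((wave n (x - b) + wave (-n) (x - b)) / 2)) *
          (x : ℂ) ^ (-s - 2) := by
  rcases Nat.eq_zero_or_pos n with rfl | hn
  · simp [oscInt]
  have hpi : (π : ℂ) ≠ 0 := by exact_mod_cast Real.pi_ne_zero
  have hn0 : (n : ℝ) ≠ 0 := by exact_mod_cast hn.ne'
  have hnc : (n : ℂ) ≠ 0 := by exact_mod_cast hn.ne'
  have key : ∀ ν : ℝ, ν ≠ 0 → wave ν (-b) * oscInt b s ν =
      -((b : ℂ) ^ (-s)) / (2 * π * ν * I) + s * (b : ℂ) ^ (-s - 1) / (4 * π ^ 2 * ν ^ 2) -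
        s * (s + 1) / (4 * π ^ 2 * ν ^ 2) *
          ∫ x in Ioi b, wave ν (x - b) * (x : ℂ) ^ (-s - 2) := by
    intro ν hν
    have hνc : (ν : ℂ) ≠ 0 := by exact_mod_cast hν
    have e1 : ∫ x in Ioi b, wave ν (x - b) * (x : ℂ) ^ (-s - 2) =
        wave ν (-b) * ∫ x in Ioi b, (x : ℂ) ^ (-s - 1 - 1) * wave ν x := by
      rw [← integral_const_mul]
      congr 1
      ext x
      rw [sub_eq_add_neg, wave_add, show -s - 1 - 1 = -s - 2 by ring]; ring
    have hw := wave_mul_wave_neg ν b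
    rw [oscInt, integral_Ioi_cpow_mul_wave hb (by simp; linarith) hν, e1]
    generalize ∫ x in Ioi b, (x : ℂ) ^ (-s - 1 - 1) * wave ν x = A
    have e3 : wave ν (-b) = (wave ν b)⁻¹ := by
      exact eq_inv_of_mul_eq_one_right hw
    rw [e3]
    have hw0 := wave_ne_zero ν b
    field_simp
    ring_nf
    simp only [Complex.I_sq]
    ring
  have i1 : ∀ ν : ℝ, Integrable (fun x : ℝ => wave ν (x - b) * (x : ℂ) ^ (-s - 2))
      (volume.restrict (Ioi b)) := by
    intro ν
    have := (integrableOn_cpow_mul_wave hb (c := -s - 2) (by simp; linarith) ν).const_mul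
      (wave ν (-b))
    refine this.congr (ae_of_all _ fun x => ?_)
    simp only [sub_eq_add_neg, wave_add]; ring
  have e2 : ∫ x in Ioi b, (1 / ((π : ℂ) ^ 2 * n ^ 2) * ((wave n (x - b) + wave (-n) (x - b)) / 2)) *
          (x : ℂ) ^ (-s - 2) = 1 / (2 * (π : ℂ) ^ 2 * n ^ 2) *
          ((∫ x in Ioi b, wave n (x - b) * (x : ℂ) ^ (-s - 2)) +
            ∫ x in Ioi b, wave (-n) (x - b) * (x : ℂ) ^ (-s - 2)) := by
    rw [← integral_add (i1 n) (i1 (-n)), ← integral_const_mul]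
    congr 1
    ext x
    field_simp
  rw [key n hn0, key (-n) (neg_ne_zero.mpr hn0), e2]
  push_cast
  field_simp
  ring

/-- Poisson summation for `ζ(s, b) = ∑ (m+b)^{-s}`. -/
theorem hasSum_oscInt {b : ℝ} (hb : 0 < b) {s : ℂ} (hs : 0 < s.re) (hs1 : s ≠ 1) :
    HasSum (fun n : ℕ => wave n (-b) * oscInt b s n + wave (-n) (-b) * oscInt b s (-n))
      (zetaH s b - (b : ℂ) ^ (1 - s) / (s - 1) - (b : ℂ) ^ (-s) / 2) := by
  have hpi : (π : ℂ) ≠ 0 := by exact_mod_cast Real.pi_ne_zero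
  simp_rw [oscInt_add_neg hb hs]
  have h1 : HasSum (fun n : ℕ => s * (b : ℂ) ^ (-s - 1) / (2 * π ^ 2) * (1 / (n : ℂ) ^ 2))
      (s * (b : ℂ) ^ (-s - 1) / 12) := by
    have := (Complex.hasSum_ofReal.mpr hasSum_zeta_two).mul_left
      (s * (b : ℂ) ^ (-s - 1) / (2 * π ^ 2))
    push_cast at this
    convert! this using 1
    field_simp
    ring
  set F : ℕ → ℝ → ℂ := fun n x => (1 / ((π : ℂ) ^ 2 * n ^ 2) *
    ((wave n (x - b) + wave (-n) (x - b)) / 2)) * (x : ℂ) ^ (-s - 2) with hF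
  have hFn : ∀ n x, 0 < x → ‖F n x‖ ≤ 1 / (n : ℝ) ^ 2 * x ^ (-s.re - 2) := by
    intro n x hx
    rw [hF]
    simp only
    rw [norm_mul, norm_mul, Complex.norm_cpow_eq_rpow_re_of_pos hx]
    have e : (-s - 2).re = -s.re - 2 := by simp
    rw [e]
    refine mul_le_mul_of_nonneg_right ?_ (Real.rpow_nonneg hx.le _)
    have hw : ‖(wave n (x - b) + wave (-n) (x - b)) / 2‖ ≤ 1 := by
      rw [norm_div]
      have := norm_add_le (wave n (x - b)) (wave (-n) (x - b))
      simp only [norm_wave] at this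
      simp; linarith
    have h2 : ‖1 / ((π : ℂ) ^ 2 * n ^ 2)‖ ≤ 1 / (n : ℝ) ^ 2 := by
      rw [norm_div, norm_mul, norm_pow, norm_pow, Complex.norm_real, Complex.norm_natCast,
        norm_one, Real.norm_of_nonneg Real.pi_pos.le]
      rcases Nat.eq_zero_or_pos n with rfl | hn
      · simp
      · have : (0 : ℝ) < n := by exact_mod_cast hn
        apply one_div_le_one_div_of_le (by positivity)
        have : 1 ≤ π ^ 2 := by nlinarith [Real.pi_gt_three]
        nlinarith [sq_nonneg (n : ℝ)]
    calc _ ≤ 1 / (n : ℝ) ^ 2 * 1 := by gcongr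
      _ = _ := mul_one _
  have hI0 : IntegrableOn (fun x : ℝ => x ^ (-s.re - 2)) (Ioi b) :=
    integrableOn_Ioi_rpow_of_lt (by linarith) hb
  have hFint : ∀ n, Integrable (F n) (volume.restrict (Ioi b)) := by
    intro n
    refine Integrable.mono' (hI0.const_mul (1 / (n : ℝ) ^ 2)) ?_ ?_
    · refine ContinuousOn.aestronglyMeasurable ?_ measurableSet_Ioi
      refine ContinuousOn.mul ?_ ((continuousOn_cpow_const_Ioi _).mono (Ioi_subset_Ioi hb.le))
      have h1 := continuous_wave n
      have h2 := continuous_wave (-n)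
      fun_prop
    · filter_upwards [ae_restrict_mem measurableSet_Ioi] with x hx
      exact hFn n x (hb.trans hx)
  have h2 : HasSum (fun n : ℕ => ∫ x in Ioi b, F n x) (emTail b s) := by
    have := hasSum_integral_of_summable_integral_norm hFint (by
      refine Summable.of_nonneg_of_le (fun n => integral_nonneg fun x => norm_nonneg _)
        (fun n => ?_) ((hasSum_zeta_two.summable).mul_right (∫ x in Ioi b, x ^ (-s.re - 2)))
      rw [← integral_const_mul]
      refine integral_mono_ae (hFint n).norm (hI0.const_mul _) ?_
      filter_upwards [ae_restrict_mem measurableSet_Ioi] with x hx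
      exact hFn n x (hb.trans hx))
    convert! this using 1
    rw [emTail]
    congr 1
    ext x
    rw [← ((hasSum_bernoulliTwo (x - b)).mul_right ((x : ℂ) ^ (-s - 2))).tsum_eq]
  have h3 := h1.sub (h2.mul_left (s * (s + 1) / 2))
  convert! h3 using 1
  rw [zetaH_eq_emSum hb (by linarith) hs1, emSum]
  ring

lemma integrableOn_cpow_mul_cexp_Ioi {c r : ℂ} (hc : -1 < c.re) (hr : 0 < r.re) :
    IntegrableOn (fun x : ℝ => (x : ℂ) ^ c * Complex.exp (-r * x)) (Ioi 0) := by
  have h1 := integrableOn_rpow_mul_exp_neg_mul_rpow hc one_pos hr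
  refine Integrable.mono' h1 ?_ ?_
  · refine ContinuousOn.aestronglyMeasurable ?_ measurableSet_Ioi
    exact (continuousOn_cpow_const_Ioi _).mul (by fun_prop)
  · filter_upwards [ae_restrict_mem measurableSet_Ioi] with x hx
    rw [norm_mul, Complex.norm_cpow_eq_rpow_re_of_pos hx, Complex.norm_exp, Real.rpow_one]
    simp

/-- The Gamma integral with a complex frequency in the right half plane. -/
lemma integral_cpow_mul_cexp_Ioi {s r : ℂ} (hs : s.re < 1) (hr : 0 < r.re) :
    ∫ x in Ioi (0 : ℝ), (x : ℂ) ^ (-s) * Complex.exp (-r * x) =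
      (1 / r) ^ (1 - s) * Complex.Gamma (1 - s) := by
  set f : ℂ → ℂ := fun r => ∫ x in Ioi (0 : ℝ), (x : ℂ) ^ (-s) * Complex.exp (-r * x) with hf
  have hU : IsOpen {z : ℂ | 0 < z.re} := isOpen_lt continuous_const Complex.continuous_re
  have hfd : DifferentiableOn ℂ f {z : ℂ | 0 < z.re} := by
    intro r₀ hr₀
    have hr₀' : 0 < r₀.re := hr₀
    have hball : ∀ z ∈ Metric.ball r₀ (r₀.re / 2), r₀.re / 2 ≤ z.re := by
      intro z hz
      rw [mem_ball_iff_norm] at hz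
      have h1 := (Complex.abs_re_le_norm (z - r₀)).trans hz.le
      rw [Complex.sub_re, abs_le] at h1
      linarith
    have key := hasDerivAt_integral_of_dominated_loc_of_deriv_le (μ := volume.restrict (Ioi (0 : ℝ)))
      (F := fun r (x : ℝ) => (x : ℂ) ^ (-s) * Complex.exp (-r * x))
      (F' := fun r (x : ℝ) => (x : ℂ) ^ (-s) * (Complex.exp (-r * x) * (-x)))
      (x₀ := r₀) (bound := fun x => x ^ (1 - s.re) * Real.exp (-(r₀.re / 2) * x ^ (1 : ℝ)))
      (Metric.ball_mem_nhds r₀ (half_pos hr₀')) ?_ ?_ ?_ ?_ ?_ ?_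
    · exact key.2.differentiableAt.differentiableWithinAt
    · refine Eventually.of_forall fun z => ContinuousOn.aestronglyMeasurable ?_ measurableSet_Ioi
      exact (continuousOn_cpow_const_Ioi _).mul (by fun_prop)
    · exact integrableOn_cpow_mul_cexp_Ioi (by simp; linarith) hr₀'
    · refine ContinuousOn.aestronglyMeasurable ?_ measurableSet_Ioi
      exact (continuousOn_cpow_const_Ioi _).mul (by fun_prop)
    · filter_upwards [ae_restrict_mem measurableSet_Ioi] with x hx z hz
      have hx0 : (0 : ℝ) < x := hx
      rw [norm_mul, norm_mul, norm_neg, Complex.norm_real, Real.norm_of_nonneg hx0.le,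
        Complex.norm_cpow_eq_rpow_re_of_pos hx0, Complex.norm_exp, Real.rpow_one]
      have e : x ^ (1 - s.re) = x ^ (-s).re * x := by
        rw [← Real.rpow_add_one hx0.ne']; congr 1; simp; ring
      rw [e, mul_comm (Real.exp _), ← mul_assoc]
      gcongr
      simp only [neg_mul, Complex.neg_re, Complex.re_mul_ofReal]
      have := mul_le_mul_of_nonneg_right (hball z hz) hx0.le
      linarith
    · exact integrableOn_rpow_mul_exp_neg_mul_rpow (by linarith) one_pos (half_pos hr₀')
    · refine ae_of_all _ fun x z _ => ?_
      have h1 : HasDerivAt (fun r : ℂ => -r * (x : ℂ)) (-(x : ℂ)) z := by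
        simpa using (hasDerivAt_id z).neg.mul_const (x : ℂ)
      exact (h1.cexp).const_mul _
  have hgd : DifferentiableOn ℂ (fun r : ℂ => (1 / r) ^ (1 - s) * Complex.Gamma (1 - s))
      {z : ℂ | 0 < z.re} := by
    intro z hz
    have hz' : 0 < z.re := hz
    have hz0 : z ≠ 0 := by rintro rfl; simp at hz'
    refine DifferentiableAt.differentiableWithinAt (DifferentiableAt.mul_const ?_ _)
    refine DifferentiableAt.cpow_const ?_ ?_
    · exact (differentiableAt_const _).div differentiableAt_id hz0
    · left
      rw [one_div, Complex.inv_re]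
      exact div_pos hz' (Complex.normSq_pos.mpr hz0)
  refine (hfd.analyticOnNhd hU).eqOn_of_preconnected_of_frequently_eq (hgd.analyticOnNhd hU)
    (convex_halfSpace_re_gt 0).isPreconnected (show (1 : ℂ) ∈ {z : ℂ | 0 < z.re} by simp) ?_ hr
  have hreal : ∀ y : ℝ, 0 < y → f y = (1 / (y : ℂ)) ^ (1 - s) * Complex.Gamma (1 - s) := by
    intro y hy
    rw [← Complex.integral_cpow_mul_exp_neg_mul_Ioi (a := 1 - s) (by simpa using hs) hy]
    refine integral_congr_ae (ae_of_all _ fun x => ?_)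
    simp only
    rw [show 1 - s - 1 = -s by ring, neg_mul]
  have ht : Tendsto (fun n : ℕ => ((1 + 1 / ((n : ℝ) + 1) : ℝ) : ℂ)) atTop (𝓝[≠] 1) := by
    rw [tendsto_nhdsWithin_iff]
    constructor
    · have := (Complex.continuous_ofReal.tendsto _).comp
        ((tendsto_const_nhds (x := (1 : ℝ))).add tendsto_one_div_add_atTop_nhds_zero_nat)
      simpa [Function.comp_def] using this
    · refine Eventually.of_forall fun n => ?_
      have : (0 : ℝ) < 1 / ((n : ℝ) + 1) := by positivity
      rw [mem_compl_iff, mem_singleton_iff]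
      intro h
      have h' : (1 + 1 / ((n : ℝ) + 1) : ℝ) = 1 := by exact_mod_cast h
      linarith
  exact ht.frequently (Frequently.of_forall fun n => hreal _ (by positivity))

/-- The complete oscillatory integral `∫_0^∞ x^{-s} e^{2πiνx} dx`. -/
theorem integral_add_oscInt {b : ℝ} (hb : 0 < b) {s : ℂ} (hs : 0 < s.re) (hs1 : s.re < 1) {ν : ℝ}
    (hν : 0 < ν) :
    (∫ x in (0 : ℝ)..b, (x : ℂ) ^ (-s) * wave ν x) + oscInt b s ν =
      (ν : ℂ) ^ (s - 1) * dualFactor s := by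
  have hpi : (π : ℂ) ≠ 0 := by exact_mod_cast Real.pi_ne_zero
  have hνc : (ν : ℂ) ≠ 0 := by exact_mod_cast hν.ne'
  set ε : ℕ → ℝ := fun k => 1 / ((k : ℝ) + 1) with hε
  have hεpos : ∀ k, 0 < ε k := fun k => by rw [hε]; positivity
  have hεlim : Tendsto ε atTop (𝓝 0) := tendsto_one_div_add_atTop_nhds_zero_nat
  have hεc : Tendsto (fun k => ((ε k : ℝ) : ℂ)) atTop (𝓝 0) := by
    have := (Complex.continuous_ofReal.tendsto 0).comp hεlim
    simpa [Function.comp_def] using this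
  set r : ℕ → ℂ := fun k => ε k - 2 * π * ν * I with hr
  have hrlim : Tendsto r atTop (𝓝 (-(2 * π * ν * I))) := by
    have := hεc.sub_const (2 * π * ν * I)
    simpa [hr] using this
  have hr0 : ∀ k, r k ≠ 0 := by
    intro k h
    have := congrArg Complex.re h
    simp [hr] at this
    exact (hεpos k).ne' this
  have hexp : ∀ k (x : ℝ), Complex.exp (-r k * x) = wave ν x * Complex.exp (-(ε k * x : ℝ)) := by
    intro k x
    rw [wave, ← Complex.exp_add, hr]; congr 1; push_cast; ring
  have hdamp : ∀ k (x : ℝ), 0 ≤ x → ‖Complex.exp (-(ε k * x : ℝ))‖ ≤ 1 := by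
    intro k x hx
    rw [Complex.norm_exp]
    have : (-((ε k * x : ℝ) : ℂ)).re = -(ε k * x) := by simp
    rw [this, Real.exp_le_one_iff]
    have := mul_nonneg (hεpos k).le hx
    linarith
  have hdamplim : ∀ x : ℝ, Tendsto (fun k => Complex.exp (-(ε k * x : ℝ))) atTop (𝓝 1) := by
    intro x
    have h1 : Tendsto (fun k => -((ε k * x : ℝ) : ℂ)) atTop (𝓝 0) := by
      have := ((Complex.continuous_ofReal.tendsto _).comp (hεlim.mul_const x)).neg
      simpa [Function.comp_def] using this
    simpa [Function.comp_def] using (Complex.continuous_exp.tendsto _).comp h1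
  have hfull : ∀ k, ∫ x in Ioi (0 : ℝ), (x : ℂ) ^ (-s) * Complex.exp (-r k * x) =
      (1 / r k) ^ (1 - s) * Complex.Gamma (1 - s) := by
    intro k
    exact integral_cpow_mul_cexp_Ioi hs1 (by simp [hr, hεpos])
  have hfullint : ∀ k, IntegrableOn (fun x : ℝ => (x : ℂ) ^ (-s) * Complex.exp (-r k * x))
      (Ioi 0) := by
    intro k
    exact integrableOn_cpow_mul_cexp_Ioi (c := -s) (by simp; linarith) (by simp [hr, hεpos])
  have hlow : Tendsto (fun k => ∫ x in (0 : ℝ)..b, (x : ℂ) ^ (-s) * Complex.exp (-r k * x)) atTop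
      (𝓝 (∫ x in (0 : ℝ)..b, (x : ℂ) ^ (-s) * wave ν x)) := by
    refine intervalIntegral.tendsto_integral_filter_of_dominated_convergence
      (fun x => x ^ (-s.re)) ?_ ?_ ?_ ?_
    · refine Eventually.of_forall fun k => ?_
      rw [uIoc_of_le hb.le]
      refine ContinuousOn.aestronglyMeasurable ?_ measurableSet_Ioc
      exact ((continuousOn_cpow_const_Ioi _).mono fun x hx => hx.1).mul (by fun_prop)
    · refine Eventually.of_forall fun k => ae_of_all _ fun x hx => ?_
      rw [uIoc_of_le hb.le] at hx
      rw [hexp, norm_mul, norm_mul, norm_wave, one_mul,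
        Complex.norm_cpow_eq_rpow_re_of_pos hx.1, Complex.neg_re]
      exact mul_le_of_le_one_right (Real.rpow_nonneg hx.1.le _) (hdamp k x hx.1.le)
    · exact intervalIntegral.intervalIntegrable_rpow' (by linarith)
    · refine ae_of_all _ fun x _ => ?_
      simp_rw [hexp]
      simpa using ((hdamplim x).const_mul (wave ν x)).const_mul ((x : ℂ) ^ (-s))
  have hhigh : ∀ k, ∫ x in Ioi b, (x : ℂ) ^ (-s) * Complex.exp (-r k * x) =
      ((b : ℂ) ^ (-s) * Complex.exp (-r k * b) - s * ∫ x in Ioi b, (x : ℂ) ^ (-s - 1) *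
        Complex.exp (-r k * x)) / r k := by
    intro k
    have hd : ∀ x ∈ Ici b, HasDerivAt (fun y : ℝ => (y : ℂ) ^ (-s) * Complex.exp (-r k * y))
        (-s * ((x : ℂ) ^ (-s - 1) * Complex.exp (-r k * x)) + (-r k) *
          ((x : ℂ) ^ (-s) * Complex.exp (-r k * x))) x := by
      intro x hx
      have h1 := hasDerivAt_real_cpow (hb.trans_le hx) (-s)
      have h2 : HasDerivAt (fun y : ℝ => Complex.exp (-r k * y))
          (Complex.exp (-r k * x) * (-r k)) x := by
        have := ((hasDerivAt_id (x : ℂ)).const_mul (-r k)).cexp.comp_ofReal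
        simpa using this
      refine (h1.mul h2).congr_deriv ?_
      ring
    have j1 : IntegrableOn (fun x : ℝ => (x : ℂ) ^ (-s) * Complex.exp (-r k * x)) (Ioi b) :=
      (hfullint k).mono_set (Ioi_subset_Ioi hb.le)
    have j2 : IntegrableOn (fun x : ℝ => (x : ℂ) ^ (-s - 1) * Complex.exp (-r k * x)) (Ioi b) := by
      refine Integrable.mono' (integrableOn_Ioi_rpow_of_lt (a := -s.re - 1) (by linarith) hb) ?_ ?_
      · refine ContinuousOn.aestronglyMeasurable ?_ measurableSet_Ioi
        exact ((continuousOn_cpow_const_Ioi _).mono (Ioi_subset_Ioi hb.le)).mul (by fun_prop)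
      · filter_upwards [ae_restrict_mem measurableSet_Ioi] with x hx
        have hx0 := hb.trans hx
        rw [hexp, norm_mul, norm_mul, norm_wave, one_mul,
          Complex.norm_cpow_eq_rpow_re_of_pos hx0]
        have e : (-s - 1).re = -s.re - 1 := by simp
        rw [e]
        exact mul_le_of_le_one_right (Real.rpow_nonneg hx0.le _) (hdamp k x hx0.le)
    have hlim : Tendsto (fun y : ℝ => (y : ℂ) ^ (-s) * Complex.exp (-r k * y)) atTop (𝓝 0) := by
      have h := tendsto_rpow_neg_atTop (y := s.re) hs
      refine squeeze_zero_norm' ?_ h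
      filter_upwards [eventually_gt_atTop 0] with x hx
      rw [hexp, norm_mul, norm_mul, norm_wave, one_mul,
          Complex.norm_cpow_eq_rpow_re_of_pos hx, Complex.neg_re]
      exact mul_le_of_le_one_right (Real.rpow_nonneg hx.le _) (hdamp k x hx.le)
    have h := integral_Ioi_of_hasDerivAt_of_tendsto' hd
      ((j2.const_mul (-s)).add (j1.const_mul (-r k))) hlim
    rw [integral_add (j2.const_mul (-s)) (j1.const_mul (-r k)), integral_const_mul,
      integral_const_mul] at h
    rw [eq_div_iff (hr0 k)]
    linear_combination -h
  have hne : (-(2 * π * ν * I) : ℂ) ≠ 0 := by simp [hpi, hνc]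
  have hhighlim : Tendsto (fun k => ∫ x in Ioi b, (x : ℂ) ^ (-s) * Complex.exp (-r k * x)) atTop
      (𝓝 (oscInt b s ν)) := by
    simp_rw [hhigh]
    have h1 : Tendsto (fun k => ∫ x in Ioi b, (x : ℂ) ^ (-s - 1) * Complex.exp (-r k * x)) atTop
        (𝓝 (∫ x in Ioi b, (x : ℂ) ^ (-s - 1) * wave ν x)) := by
      refine tendsto_integral_of_dominated_convergence (fun x => x ^ (-s.re - 1)) ?_
        (integrableOn_Ioi_rpow_of_lt (a := -s.re - 1) (by linarith) hb) ?_ ?_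
      · intro k
        refine ContinuousOn.aestronglyMeasurable ?_ measurableSet_Ioi
        exact ((continuousOn_cpow_const_Ioi _).mono (Ioi_subset_Ioi hb.le)).mul (by fun_prop)
      · intro k
        filter_upwards [ae_restrict_mem measurableSet_Ioi] with x hx
        have hx0 := hb.trans hx
        rw [hexp, norm_mul, norm_mul, norm_wave, one_mul,
          Complex.norm_cpow_eq_rpow_re_of_pos hx0]
        have e : (-s - 1).re = -s.re - 1 := by simp
        rw [e]
        exact mul_le_of_le_one_right (Real.rpow_nonneg hx0.le _) (hdamp k x hx0.le)
      · refine ae_of_all _ fun x => ?_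
        simp_rw [hexp]
        simpa using ((hdamplim x).const_mul (wave ν x)).const_mul ((x : ℂ) ^ (-s - 1))
    have h2 : Tendsto (fun k => Complex.exp (-r k * b)) atTop (𝓝 (wave ν b)) := by
      simp_rw [hexp]
      simpa using (hdamplim b).const_mul (wave ν b)
    have h3 := ((h2.const_mul ((b : ℂ) ^ (-s))).sub (h1.const_mul s)).div hrlim hne
    convert! h3 using 2
    rw [oscInt, div_neg, ← neg_div]
    congr 1; ring
  have hleft := hlow.add hhighlim
  have hsplit : ∀ k, (∫ x in (0 : ℝ)..b, (x : ℂ) ^ (-s) * Complex.exp (-r k * x)) +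
      ∫ x in Ioi b, (x : ℂ) ^ (-s) * Complex.exp (-r k * x) =
      (1 / r k) ^ (1 - s) * Complex.Gamma (1 - s) := by
    intro k
    rw [← hfull k]
    exact intervalIntegral.integral_interval_add_Ioi (hfullint k)
      ((hfullint k).mono_set (Ioi_subset_Ioi hb.le))
  simp_rw [hsplit] at hleft
  have hinv : (1 / (-(2 * π * ν * I)) : ℂ) = ((1 / (2 * π * ν) : ℝ) : ℂ) * I := by
    push_cast
    field_simp
    simp
  have hq : (0 : ℝ) < 1 / (2 * π * ν) := by positivity
  have hright : Tendsto (fun k => (1 / r k) ^ (1 - s) * Complex.Gamma (1 - s)) atTop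
      (𝓝 ((((1 / (2 * π * ν) : ℝ) : ℂ) * I) ^ (1 - s) * Complex.Gamma (1 - s))) := by
    refine Tendsto.mul_const _ ?_
    have h1 : Tendsto (fun k => 1 / r k) atTop (𝓝 (((1 / (2 * π * ν) : ℝ) : ℂ) * I)) := by
      rw [← hinv]
      exact tendsto_const_nhds.div hrlim hne
    refine (continuousAt_cpow_const ?_).tendsto.comp h1
    rw [Complex.mem_slitPlane_iff]
    right
    simp
    exact hν.ne'
  rw [tendsto_nhds_unique hleft hright, dualFactor]
  have hlog : (((1 / (2 * π * ν) : ℝ) : ℂ) * I) ^ (1 - s) =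
      (ν : ℂ) ^ (s - 1) * (2 * π : ℂ) ^ (s - 1) * Complex.exp (π * I * (1 - s) / 2) := by
    have h2p : (0 : ℝ) < 2 * π := by positivity
    rw [Complex.cpow_def_of_ne_zero (mul_ne_zero (by exact_mod_cast hq.ne') Complex.I_ne_zero),
      Complex.log_ofReal_mul hq Complex.I_ne_zero, Complex.log_I,
      Complex.cpow_def_of_ne_zero hνc, Complex.cpow_def_of_ne_zero (by exact_mod_cast h2p.ne'),
      ← Complex.exp_add, ← Complex.exp_add]
    congr 1
    have e1 : Complex.log (2 * π) = ((Real.log (2 * π) : ℝ) : ℂ) := by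
      rw [Complex.ofReal_log h2p.le]; push_cast; rfl
    rw [e1, ← Complex.ofReal_log hν.le, one_div, Real.log_inv, Real.log_mul h2p.ne' hν.ne']
    push_cast
    ring
  rw [hlog]
  ring

/-! ### Oscillatory integrals with phase `2πνx - t log x` -/

/-- `x` times the derivative of the phase `2πνx - t log x`. -/
noncomputable def rate (t ν x : ℝ) : ℝ := 2 * π * ν * x - t

/-- The oscillating factor `x^{-it} e^{2πiνx}`. -/
noncomputable def osc (t ν x : ℝ) : ℂ := (x : ℂ) ^ (-(t * I)) * wave ν x

/-- The amplitude after one integration by parts. -/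
noncomputable def ampOne (θ t ν x : ℝ) : ℝ := x ^ (1 - θ) / rate t ν x

/-- The amplitude after two integrations by parts. -/
noncomputable def ampTwo (θ t ν x : ℝ) : ℝ :=
  (1 - θ) * x ^ (1 - θ) / rate t ν x ^ 2 - 2 * π * ν * x ^ (2 - θ) / rate t ν x ^ 3

/-- The derivative of `ampTwo`. -/
noncomputable def ampTwoDeriv (θ t ν x : ℝ) : ℝ :=
  (1 - θ) ^ 2 * x ^ (-θ) / rate t ν x ^ 2 -
    (4 - 3 * θ) * (2 * π * ν) * x ^ (1 - θ) / rate t ν x ^ 3 +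
    3 * (2 * π * ν) ^ 2 * x ^ (2 - θ) / rate t ν x ^ 4

lemma norm_osc {x : ℝ} (hx : 0 < x) (t ν : ℝ) : ‖osc t ν x‖ = 1 := by
  rw [osc, norm_mul, norm_wave, mul_one, Complex.norm_cpow_eq_rpow_re_of_pos hx]
  simp

lemma hasDerivAt_rate (t ν x : ℝ) : HasDerivAt (rate t ν) (2 * π * ν) x := by
  unfold rate
  simpa using ((hasDerivAt_id x).const_mul (2 * π * ν)).sub_const t

lemma continuous_rate (t ν : ℝ) : Continuous (rate t ν) := by unfold rate; fun_prop

lemma hasDerivAt_osc {x : ℝ} (hx : 0 < x) (t ν : ℝ) :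
    HasDerivAt (osc t ν) (I * ((rate t ν x / x : ℝ) : ℂ) * osc t ν x) x := by
  have hxc : (x : ℂ) ≠ 0 := by exact_mod_cast hx.ne'
  refine (hasDerivAt_cpow_mul_wave hx (-(t * I)) ν).congr_deriv ?_
  rw [Complex.cpow_sub _ _ hxc, Complex.cpow_one, rate, osc]
  push_cast
  field_simp
  ring

lemma continuousOn_osc (t ν : ℝ) : ContinuousOn (osc t ν) (Ioi 0) := fun _ hx =>
  (hasDerivAt_osc hx t ν).continuousAt.continuousWithinAt

lemma cpow_mul_wave_eq {x : ℝ} (hx : 0 < x) (θ t ν : ℝ) :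
    (x : ℂ) ^ (-((θ : ℂ) + t * I)) * wave ν x = ((x ^ (-θ) : ℝ) : ℂ) * osc t ν x := by
  have hxc : (x : ℂ) ≠ 0 := by exact_mod_cast hx.ne'
  rw [osc, neg_add, Complex.cpow_add _ _ hxc, Complex.ofReal_cpow hx.le]
  push_cast
  ring

lemma hasDerivAt_ampOne {x : ℝ} (hx : 0 < x) {θ t ν : ℝ} (hq : rate t ν x ≠ 0) :
    HasDerivAt (ampOne θ t ν) (ampTwo θ t ν x * (rate t ν x / x)) x := by
  have h1 : HasDerivAt (fun y : ℝ => y ^ (1 - θ)) ((1 - θ) * x ^ (1 - θ - 1)) x :=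
    Real.hasDerivAt_rpow_const (Or.inl hx.ne')
  refine (h1.div (hasDerivAt_rate t ν x) hq).congr_deriv ?_
  have e1 : x ^ (1 - θ - 1) = x ^ (1 - θ) / x := Real.rpow_sub_one hx.ne' _
  have e2 : x ^ (2 - θ) = x ^ (1 - θ) * x := by
    rw [← Real.rpow_add_one hx.ne']; congr 1; ring
  rw [ampTwo, e1, e2]
  field_simp

lemma hasDerivAt_ampTwo {x : ℝ} (hx : 0 < x) {θ t ν : ℝ} (hq : rate t ν x ≠ 0) :
    HasDerivAt (ampTwo θ t ν) (ampTwoDeriv θ t ν x) x := by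
  have h1 : HasDerivAt (fun y : ℝ => y ^ (1 - θ)) ((1 - θ) * x ^ (1 - θ - 1)) x :=
    Real.hasDerivAt_rpow_const (Or.inl hx.ne')
  have h2 : HasDerivAt (fun y : ℝ => y ^ (2 - θ)) ((2 - θ) * x ^ (2 - θ - 1)) x :=
    Real.hasDerivAt_rpow_const (Or.inl hx.ne')
  have hr := hasDerivAt_rate t ν x
  have h := ((h1.const_mul (1 - θ)).div (hr.pow 2) (pow_ne_zero 2 hq)).sub
    ((h2.const_mul (2 * π * ν)).div (hr.pow 3) (pow_ne_zero 3 hq))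
  refine h.congr_deriv ?_
  have e0 : x ^ (1 - θ) = x ^ (-θ) * x := by
    rw [← Real.rpow_add_one hx.ne']; congr 1; ring
  have e1 : x ^ (1 - θ - 1) = x ^ (-θ) := by congr 1; ring
  have e2 : x ^ (2 - θ) = x ^ (-θ) * x ^ 2 := by
    rw [← Real.rpow_add_natCast hx.ne']; congr 1; push_cast; ring
  have e3 : x ^ (2 - θ - 1) = x ^ (-θ) * x := by
    rw [← Real.rpow_add_one hx.ne']; congr 1; ring
  simp only [ampTwoDeriv, e0, e1, e2, e3, Pi.pow_apply]
  field_simp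
  ring

/-- Integration by parts against the oscillating factor. -/
lemma integral_mul_rate_mul_osc {α β : ℝ} (hα : 0 < α) (hαβ : α ≤ β) (t ν : ℝ) {G G' : ℝ → ℝ}
    (hG : ∀ x ∈ Icc α β, HasDerivAt G (G' x) x) (hG' : ContinuousOn G' (Icc α β)) :
    ∫ x in α..β, ((G x * (rate t ν x / x) : ℝ) : ℂ) * osc t ν x =
      -I * (G β * osc t ν β - G α * osc t ν α) + I * ∫ x in α..β, (G' x : ℂ) * osc t ν x := by
  have hpos : ∀ x ∈ Icc α β, 0 < x := fun x hx => hα.trans_le hx.1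
  have hosc : ContinuousOn (osc t ν) (Icc α β) := (continuousOn_osc t ν).mono hpos
  have hGc : ContinuousOn G (Icc α β) := fun x hx => (hG x hx).continuousAt.continuousWithinAt
  have hd : ∀ x ∈ uIcc α β, HasDerivAt (fun y => (G y : ℂ) * osc t ν y)
      ((G' x : ℂ) * osc t ν x + I * (((G x * (rate t ν x / x) : ℝ) : ℂ) * osc t ν x)) x := by
    intro x hx
    rw [uIcc_of_le hαβ] at hx
    refine ((hG x hx).ofReal_comp.mul (hasDerivAt_osc (hpos x hx) t ν)).congr_deriv ?_
    push_cast; ring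
  have i1 : IntervalIntegrable (fun x => (G' x : ℂ) * osc t ν x) volume α β := by
    apply ContinuousOn.intervalIntegrable
    rw [uIcc_of_le hαβ]
    exact (Complex.continuous_ofReal.comp_continuousOn hG').mul hosc
  have i2 : IntervalIntegrable (fun x => ((G x * (rate t ν x / x) : ℝ) : ℂ) * osc t ν x)
      volume α β := by
    apply ContinuousOn.intervalIntegrable
    rw [uIcc_of_le hαβ]
    refine (Complex.continuous_ofReal.comp_continuousOn ?_).mul hosc
    exact hGc.mul ((continuous_rate t ν).continuousOn.div continuousOn_id
      fun x hx => (hpos x hx).ne')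
  have h := intervalIntegral.integral_eq_sub_of_hasDerivAt hd (i1.add (i2.const_mul I))
  rw [intervalIntegral.integral_add i1 (i2.const_mul I), intervalIntegral.integral_const_mul] at h
  linear_combination (-I) * h + (∫ x in α..β, ((G x * (rate t ν x / x) : ℝ) : ℂ) * osc t ν x) *
    Complex.I_sq

lemma continuousOn_ampTwo {α β θ t ν : ℝ} (hα : 0 < α) (hq : ∀ x ∈ Icc α β, rate t ν x ≠ 0) :
    ContinuousOn (ampTwo θ t ν) (Icc α β) := fun x hx =>
  (hasDerivAt_ampTwo (hα.trans_le hx.1) (hq x hx)).continuousAt.continuousWithinAt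

lemma continuousOn_ampTwo_mul {α β θ t ν : ℝ} (hα : 0 < α) (hq : ∀ x ∈ Icc α β, rate t ν x ≠ 0) :
    ContinuousOn (fun x => ampTwo θ t ν x * (rate t ν x / x)) (Icc α β) :=
  (continuousOn_ampTwo hα hq).mul ((continuous_rate t ν).continuousOn.div continuousOn_id
      fun _ hx => (hα.trans_le hx.1).ne')

lemma continuousOn_ampTwoDeriv {α β θ t ν : ℝ} (hα : 0 < α)
    (hq : ∀ x ∈ Icc α β, rate t ν x ≠ 0) :
    ContinuousOn (ampTwoDeriv θ t ν) (Icc α β) := by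
  have hp : ∀ p : ℝ, ContinuousOn (fun x : ℝ => x ^ p) (Icc α β) := fun p =>
    ContinuousOn.rpow_const continuousOn_id fun x hx => Or.inl (hα.trans_le hx.1).ne'
  have hr : ∀ k : ℕ, ContinuousOn (fun x : ℝ => rate t ν x ^ k) (Icc α β) := fun k =>
    ((continuous_rate t ν).pow k).continuousOn
  unfold ampTwoDeriv
  refine ContinuousOn.add (ContinuousOn.sub ?_ ?_) ?_
  · exact (continuousOn_const.mul (hp _)).div (hr 2) fun x hx => pow_ne_zero _ (hq x hx)
  · exact (continuousOn_const.mul (hp _)).div (hr 3) fun x hx => pow_ne_zero _ (hq x hx)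
  · exact (continuousOn_const.mul (hp _)).div (hr 4) fun x hx => pow_ne_zero _ (hq x hx)

lemma integral_osc_parts {α β θ t ν : ℝ} (hα : 0 < α) (hαβ : α ≤ β)
    (hq : ∀ x ∈ Icc α β, rate t ν x ≠ 0) :
    ∫ x in α..β, (x : ℂ) ^ (-((θ : ℂ) + t * I)) * wave ν x =
      -I * (ampOne θ t ν β * osc t ν β - ampOne θ t ν α * osc t ν α) +
        I * ∫ x in α..β, ((ampTwo θ t ν x * (rate t ν x / x) : ℝ) : ℂ) * osc t ν x := by
  rw [← integral_mul_rate_mul_osc hα hαβ t ν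
    (fun x hx => hasDerivAt_ampOne (hα.trans_le hx.1) (hq x hx)) (continuousOn_ampTwo_mul hα hq)]
  apply intervalIntegral.integral_congr
  intro x hx
  rw [uIcc_of_le hαβ] at hx
  have hx0 := hα.trans_le hx.1
  simp only
  rw [cpow_mul_wave_eq hx0]
  congr 2
  rw [ampOne]
  have := hq x hx
  have e0 : x ^ (1 - θ) = x ^ (-θ) * x := by
    rw [← Real.rpow_add_one hx0.ne']; congr 1; ring
  rw [e0]
  field_simp

/-- The first derivative test. -/
lemma norm_integral_osc_le {α β θ t ν : ℝ} (hα : 0 < α) (hαβ : α ≤ β) (hθ : 0 < θ) (hθ1 : θ < 1)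
    (ht : 0 < t) (hν : 0 < ν) (hq : ∀ x ∈ Icc α β, rate t ν x ≠ 0) :
    ‖∫ x in α..β, (x : ℂ) ^ (-((θ : ℂ) + t * I)) * wave ν x‖ ≤
      2 * (|ampOne θ t ν α| + |ampOne θ t ν β|) := by
  have hpos : ∀ x ∈ Icc α β, 0 < x := fun x hx => hα.trans_le hx.1
  have hsign : ∀ x ∈ Icc α β, ampTwo θ t ν x * (rate t ν x / x) ≤ 0 := by
    intro x hx
    have hx0 := hpos x hx
    have hqx := hq x hx
    have e2 : x ^ (2 - θ) = x ^ (1 - θ) * x := by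
      rw [← Real.rpow_add_one hx0.ne']; congr 1; ring
    have e : ampTwo θ t ν x * (rate t ν x / x) =
        -(x ^ (1 - θ) * (θ * (2 * π * ν * x) + (1 - θ) * t) / (rate t ν x ^ 2 * x)) := by
      rw [ampTwo, e2]
      field_simp
      rw [rate]; ring
    rw [e, neg_nonpos]
    have := Real.pi_pos
    have h1 : 0 ≤ θ * (2 * π * ν * x) + (1 - θ) * t := by
      have : 0 ≤ (1 - θ) * t := mul_nonneg (by linarith) ht.le
      positivity
    positivity
  rw [integral_osc_parts hα hαβ hq]
  have hc := continuousOn_ampTwo_mul (θ := θ) hα hq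
  have hinteg : ‖∫ x in α..β, ((ampTwo θ t ν x * (rate t ν x / x) : ℝ) : ℂ) * osc t ν x‖ ≤
      ampOne θ t ν α - ampOne θ t ν β := by
    have hii : IntervalIntegrable (fun x => ampTwo θ t ν x * (rate t ν x / x)) volume α β := by
      apply ContinuousOn.intervalIntegrable; rwa [uIcc_of_le hαβ]
    have h1 := intervalIntegral.norm_integral_le_of_norm_le (f := fun x =>
        ((ampTwo θ t ν x * (rate t ν x / x) : ℝ) : ℂ) * osc t ν x)
      (g := fun x => -(ampTwo θ t ν x * (rate t ν x / x))) hαβ (ae_of_all _ fun x hx => ?_) hii.neg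
    · refine h1.trans (le_of_eq ?_)
      rw [intervalIntegral.integral_neg, intervalIntegral.integral_eq_sub_of_hasDerivAt
        (fun x hx => ?_) hii]
      · ring
      · rw [uIcc_of_le hαβ] at hx
        exact hasDerivAt_ampOne (hpos x hx) (hq x hx)
    · have hx' : x ∈ Icc α β := ⟨hx.1.le, hx.2⟩
      rw [norm_mul, norm_osc (hpos x hx'), mul_one, Complex.norm_real, Real.norm_eq_abs,
        abs_of_nonpos (hsign x hx')]
  have hA := norm_osc hα t ν
  have hB := norm_osc (hα.trans_le hαβ) t ν
  calc _ ≤ (|ampOne θ t ν β| + |ampOne θ t ν α|) + (ampOne θ t ν α - ampOne θ t ν β) := by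
        refine (norm_add_le _ _).trans (add_le_add ?_ ?_)
        · rw [norm_mul, norm_neg, Complex.norm_I, one_mul]
          refine (norm_sub_le _ _).trans (le_of_eq ?_)
          rw [norm_mul, norm_mul, hA, hB, mul_one, mul_one, Complex.norm_real, Complex.norm_real,
            Real.norm_eq_abs, Real.norm_eq_abs]
        · rw [norm_mul, Complex.norm_I, one_mul]; exact hinteg
    _ ≤ _ := by
        have := le_abs_self (ampOne θ t ν α)
        have := neg_abs_le (ampOne θ t ν β)
        linarith

/-- Two integrations by parts. -/
lemma norm_integral_osc_sub_le {α β θ t ν : ℝ} (hα : 0 < α) (hαβ : α ≤ β)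
    (hq : ∀ x ∈ Icc α β, rate t ν x ≠ 0) :
    ‖(∫ x in α..β, (x : ℂ) ^ (-((θ : ℂ) + t * I)) * wave ν x) +
      I * (ampOne θ t ν β * osc t ν β - ampOne θ t ν α * osc t ν α)‖ ≤
      |ampTwo θ t ν α| + |ampTwo θ t ν β| + ∫ x in α..β, |ampTwoDeriv θ t ν x| := by
  have hpos : ∀ x ∈ Icc α β, 0 < x := fun x hx => hα.trans_le hx.1
  rw [integral_osc_parts hα hαβ hq, integral_mul_rate_mul_osc hα hαβ t ν
    (fun x hx => hasDerivAt_ampTwo (hpos x hx) (hq x hx)) (continuousOn_ampTwoDeriv hα hq)]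
  have hii : IntervalIntegrable (fun x => |ampTwoDeriv θ t ν x|) volume α β := by
    apply ContinuousOn.intervalIntegrable
    rw [uIcc_of_le hαβ]
    exact (continuousOn_ampTwoDeriv hα hq).abs
  have h1 := intervalIntegral.norm_integral_le_of_norm_le (f := fun x =>
        (ampTwoDeriv θ t ν x : ℂ) * osc t ν x)
      (g := fun x => |ampTwoDeriv θ t ν x|) hαβ (ae_of_all _ fun x hx => by
        rw [norm_mul, norm_osc (hpos x ⟨hx.1.le, hx.2⟩), mul_one, Complex.norm_real,
          Real.norm_eq_abs]) hii
  have hA := norm_osc hα t ν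
  have hB := norm_osc (hα.trans_le hαβ) t ν
  set J := ∫ x in α..β, (ampTwoDeriv θ t ν x : ℂ) * osc t ν x
  have e : -I * (ampOne θ t ν β * osc t ν β - ampOne θ t ν α * osc t ν α) +
      I * (-I * (ampTwo θ t ν β * osc t ν β - ampTwo θ t ν α * osc t ν α) + I * J) +
      I * (ampOne θ t ν β * osc t ν β - ampOne θ t ν α * osc t ν α) =
      (ampTwo θ t ν β * osc t ν β - ampTwo θ t ν α * osc t ν α) - J := by
    linear_combination (J - (ampTwo θ t ν β * osc t ν β - ampTwo θ t ν α * osc t ν α)) * Complex.I_sq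
  rw [e]
  calc _ ≤ (|ampTwo θ t ν β| + |ampTwo θ t ν α|) + ‖J‖ := by
        refine (norm_sub_le _ _).trans (add_le_add ?_ le_rfl)
        refine (norm_sub_le _ _).trans (le_of_eq ?_)
        rw [norm_mul, norm_mul, hA, hB, mul_one, mul_one, Complex.norm_real, Complex.norm_real,
            Real.norm_eq_abs, Real.norm_eq_abs]
    _ ≤ _ := by linarith

lemma abs_ampTwo_le {x θ t ν : ℝ} (hx : 0 < x) (hθ : 0 < θ) (hθ1 : θ < 1)
    (ht : 0 < t) (hq : rate t ν x ≠ 0) :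
    |ampTwo θ t ν x| ≤ x ^ (1 - θ) * (2 / rate t ν x ^ 2 + t / |rate t ν x| ^ 3) := by
  set q := rate t ν x with hqd
  have e2 : x ^ (2 - θ) = x ^ (1 - θ) * x := by
    rw [← Real.rpow_add_one hx.ne']; congr 1; ring
  have hX : 2 * π * ν * x = q + t := by rw [hqd, rate]; ring
  have e : ampTwo θ t ν x = x ^ (1 - θ) * ((1 - θ) / q ^ 2 - (q + t) / q ^ 3) := by
    rw [ampTwo, e2, ← hX, ← hqd]; ring
  have hp : 0 ≤ x ^ (1 - θ) := by positivity
  rw [e, abs_mul, abs_of_nonneg hp]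
  refine mul_le_mul_of_nonneg_left ?_ hp
  have e3 : (1 - θ) / q ^ 2 - (q + t) / q ^ 3 = -(θ / q ^ 2 + t / q ^ 3) := by
    field_simp; ring
  rw [e3, abs_neg]
  refine (abs_add_le _ _).trans (add_le_add ?_ ?_)
  · rw [abs_of_nonneg (by positivity)]; gcongr; linarith
  · rw [abs_div, abs_pow, abs_of_pos ht]

lemma abs_ampTwoDeriv_le {x θ t ν : ℝ} (hx : 0 < x) (hθ : 0 < θ) (hθ1 : θ < 1)
    (hq : rate t ν x ≠ 0) :
    |ampTwoDeriv θ t ν x| ≤ x ^ (-θ) * (24 / rate t ν x ^ 2 + 6 * t ^ 2 / rate t ν x ^ 4) := by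
  set q := rate t ν x with hqd
  have e0 : x ^ (1 - θ) = x ^ (-θ) * x := by
    rw [← Real.rpow_add_one hx.ne']; congr 1; ring
  have e2 : x ^ (2 - θ) = x ^ (-θ) * x ^ 2 := by
    rw [← Real.rpow_add_natCast hx.ne']; congr 1; push_cast; ring
  have hX : 2 * π * ν * x = q + t := by rw [hqd, rate]; ring
  have e : ampTwoDeriv θ t ν x = x ^ (-θ) * (((1 - θ) ^ 2 * q ^ 2 - (4 - 3 * θ) * (q + t) * q +
      3 * (q + t) ^ 2) / q ^ 4) := by
    rw [ampTwoDeriv, e0, e2, ← hqd, ← hX]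
    field_simp
  have hp : 0 ≤ x ^ (-θ) := by positivity
  rw [e, abs_mul, abs_of_nonneg hp]
  refine mul_le_mul_of_nonneg_left ?_ hp
  have e3 : 24 / q ^ 2 + 6 * t ^ 2 / q ^ 4 = (24 * q ^ 2 + 6 * t ^ 2) / q ^ 4 := by
    field_simp
  rw [e3, abs_div, abs_of_pos (show 0 < q ^ 4 by positivity)]
  gcongr
  rw [abs_le]
  constructor <;> nlinarith [sq_nonneg (q + t), sq_nonneg (q - t), sq_nonneg q, sq_nonneg t,
    mul_nonneg hθ.le (sq_nonneg (q + t)), mul_nonneg hθ.le (sq_nonneg (q - t)),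
    mul_nonneg hθ.le (sq_nonneg q), mul_nonneg (mul_nonneg hθ.le (sub_nonneg.mpr hθ1.le)) (sq_nonneg q)]

lemma integral_inv_rate_sq {α β t ν : ℝ} (hαβ : α ≤ β) (hν : ν ≠ 0)
    (hq : ∀ x ∈ Icc α β, rate t ν x ≠ 0) :
    ∫ x in α..β, 1 / rate t ν x ^ 2 =
      1 / (2 * π * ν * rate t ν α) - 1 / (2 * π * ν * rate t ν β) := by
  have hpi := Real.pi_ne_zero
  have hd : ∀ x ∈ uIcc α β, HasDerivAt (fun y => -(1 / (2 * π * ν) * (rate t ν y)⁻¹))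
      (1 / rate t ν x ^ 2) x := by
    intro x hx
    rw [uIcc_of_le hαβ] at hx
    have := hq x hx
    refine ((((hasDerivAt_rate t ν x).inv (hq x hx)).const_mul (1 / (2 * π * ν))).neg).congr_deriv ?_
    field_simp
  rw [intervalIntegral.integral_eq_sub_of_hasDerivAt hd]
  · have h1 := hq α ⟨le_rfl, hαβ⟩
    have h2 := hq β ⟨hαβ, le_rfl⟩
    field_simp
    ring
  · apply ContinuousOn.intervalIntegrable
    rw [uIcc_of_le hαβ]
    exact continuousOn_const.div ((continuous_rate t ν).pow 2).continuousOn
      fun x hx => pow_ne_zero _ (hq x hx)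

/-- Bound for `∫ |ampTwoDeriv|` when `|rate| ≥ m` and `x^{-θ} ≤ p` on the interval. -/
lemma integral_abs_ampTwoDeriv_le {α β θ t ν m p : ℝ} (hα : 0 < α) (hαβ : α ≤ β) (hθ : 0 < θ)
    (hθ1 : θ < 1) (hν : ν ≠ 0) (hm : 0 < m) (hq : ∀ x ∈ Icc α β, m ≤ |rate t ν x|)
    (hp : ∀ x ∈ Icc α β, x ^ (-θ) ≤ p) :
    ∫ x in α..β, |ampTwoDeriv θ t ν x| ≤ p * (24 + 6 * (t / m) ^ 2) *
      (1 / (2 * π * ν * rate t ν α) - 1 / (2 * π * ν * rate t ν β)) := by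
  have hq0 : ∀ x ∈ Icc α β, rate t ν x ≠ 0 := fun x hx =>
    abs_pos.mp (hm.trans_le (hq x hx))
  rw [← integral_inv_rate_sq hαβ hν hq0, ← intervalIntegral.integral_const_mul]
  apply intervalIntegral.integral_mono_on hαβ
  · apply ContinuousOn.intervalIntegrable
    rw [uIcc_of_le hαβ]
    exact (continuousOn_ampTwoDeriv hα hq0).abs
  · apply ContinuousOn.intervalIntegrable
    rw [uIcc_of_le hαβ]
    exact continuousOn_const.mul (continuousOn_const.div ((continuous_rate t ν).pow 2).continuousOn
      fun x hx => pow_ne_zero _ (hq0 x hx))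
  · intro x hx
    refine (abs_ampTwoDeriv_le (hα.trans_le hx.1) hθ hθ1 (hq0 x hx)).trans ?_
    have hqx := hq0 x hx
    set q := rate t ν x
    have h2 : m ^ 2 ≤ q ^ 2 := by
      rw [← sq_abs q]; exact pow_le_pow_left₀ hm.le (hq x hx) 2
    have h3 : 24 / q ^ 2 + 6 * t ^ 2 / q ^ 4 ≤ (24 + 6 * (t / m) ^ 2) * (1 / q ^ 2) := by
      have e : 24 / q ^ 2 + 6 * t ^ 2 / q ^ 4 = (24 + 6 * (t ^ 2 / q ^ 2)) * (1 / q ^ 2) := by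
        field_simp
      rw [e, div_pow]
      gcongr
    calc _ ≤ p * ((24 + 6 * (t / m) ^ 2) * (1 / q ^ 2)) := by
          refine mul_le_mul (hp x hx) h3 (by positivity) ?_
          exact (Real.rpow_nonneg (hα.trans_le hx.1).le _).trans (hp x hx)
      _ = _ := by ring

lemma rate_eq {b : ℝ} (hb : 0 < b) (t ν : ℝ) :
    rate t ν b = 2 * π * b * (ν - t / (2 * π * b)) := by
  have := Real.pi_pos
  rw [rate]; field_simp

lemma abs_ampOne {b : ℝ} (hb : 0 < b) (θ t ν : ℝ) :
    |ampOne θ t ν b| = b ^ (1 - θ) / |rate t ν b| := by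
  rw [ampOne, abs_div, abs_of_nonneg (by positivity)]

lemma tendsto_ampOne_atTop {θ t ν : ℝ} (hθ : 0 < θ) (hν : ν ≠ 0) :
    Tendsto (ampOne θ t ν) atTop (𝓝 0) := by
  have h1 : Tendsto (fun x : ℝ => x ^ (-θ) * (1 / (π * |ν|))) atTop (𝓝 0) := by
    simpa using (tendsto_rpow_neg_atTop hθ).mul_const (1 / (π * |ν|))
  have hc : 0 < π * |ν| := mul_pos Real.pi_pos (abs_pos.mpr hν)
  refine squeeze_zero_norm' ?_ h1
  filter_upwards [eventually_gt_atTop 0, eventually_ge_atTop (|t| / (π * |ν|))] with x hx hx2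
  rw [div_le_iff₀ hc] at hx2
  have hq : π * |ν| * x ≤ |rate t ν x| := by
    have h2 : |2 * π * ν * x| = 2 * (π * |ν| * x) := by
      rw [abs_mul, abs_mul, abs_mul, abs_of_pos hx, abs_of_pos Real.pi_pos]; norm_num; ring
    have h3 := abs_sub_abs_le_abs_sub (2 * π * ν * x) t
    rw [rate]; nlinarith
  rw [Real.norm_eq_abs, abs_ampOne hx]
  have e0 : x ^ (1 - θ) = x ^ (-θ) * x := by
    rw [← Real.rpow_add_one hx.ne']; congr 1; ring
  calc x ^ (1 - θ) / |rate t ν x| ≤ x ^ (1 - θ) / (π * |ν| * x) := by gcongr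
    _ = _ := by rw [e0]; field_simp

lemma tendsto_ampTwo_atTop {θ t ν : ℝ} (hθ : 0 < θ) (hθ1 : θ < 1) (ht : 0 < t) (hν : ν ≠ 0) :
    Tendsto (ampTwo θ t ν) atTop (𝓝 0) := by
  set c := π * |ν| with hcdef
  have hc : 0 < c := mul_pos Real.pi_pos (abs_pos.mpr hν)
  have h1 : Tendsto (fun x : ℝ => x ^ (-θ) * (2 / c ^ 2 + t / c ^ 3)) atTop (𝓝 0) := by
    simpa using (tendsto_rpow_neg_atTop hθ).mul_const (2 / c ^ 2 + t / c ^ 3)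
  refine squeeze_zero_norm' ?_ h1
  filter_upwards [eventually_ge_atTop 1, eventually_ge_atTop (t / c)] with x hx1 hx2
  have hx : 0 < x := by linarith
  rw [div_le_iff₀ hc] at hx2
  have hq : c * x ≤ |rate t ν x| := by
    have h2 : |2 * π * ν * x| = 2 * (c * x) := by
      rw [abs_mul, abs_mul, abs_mul, abs_of_pos hx, abs_of_pos Real.pi_pos, hcdef]; norm_num; ring
    have h3 := abs_sub_abs_le_abs_sub (2 * π * ν * x) t
    rw [abs_of_pos ht] at h3
    rw [rate]; nlinarith
  have hcx : 0 < c * x := by positivity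
  have hq0 : rate t ν x ≠ 0 := abs_pos.mp (hcx.trans_le hq)
  have e0 : x ^ (1 - θ) = x ^ (-θ) * x := by
    rw [← Real.rpow_add_one hx.ne']; congr 1; ring
  refine (abs_ampTwo_le hx hθ hθ1 ht hq0).trans ?_
  rw [← sq_abs (rate t ν x), e0, mul_assoc]
  refine mul_le_mul_of_nonneg_left ?_ (by positivity)
  calc x * (2 / |rate t ν x| ^ 2 + t / |rate t ν x| ^ 3) ≤
        x * (2 / (c * x) ^ 2 + t / (c * x) ^ 3) := by gcongr
    _ = 2 / c ^ 2 / x + t / c ^ 3 / x ^ 2 := by field_simp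
    _ ≤ 2 / c ^ 2 + t / c ^ 3 := by
        refine add_le_add (div_le_self (by positivity) hx1)
          (div_le_self (by positivity) (one_le_pow₀ hx1))

lemma abs_rate_mono {b x t ν : ℝ} (hb : 0 < b) (hx : b ≤ x) (ht : 0 < t)
    (hν : ν < 0 ∨ t < 2 * π * ν * b) :
    |rate t ν b| ≤ |rate t ν x| ∧ 0 < ν * rate t ν x := by
  have hpi := Real.pi_pos
  rcases hν with h | h
  · have h1 : 2 * π * ν * x ≤ 2 * π * ν * b := by
      have : 2 * π * ν < 0 := by nlinarith
      nlinarith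
    have h2 : 2 * π * ν * b < 0 := by
      have : 2 * π * ν < 0 := by nlinarith
      nlinarith
    constructor
    · rw [rate, rate, abs_of_neg (by linarith), abs_of_neg (by linarith)]; linarith
    · exact mul_pos_of_neg_of_neg h (by rw [rate]; linarith)
  · have hν : 0 < ν := by
      by_contra hcon
      push Not at hcon
      have : 2 * π * ν * b ≤ 0 := by
        have : 2 * π * ν ≤ 0 := by nlinarith
        nlinarith
      linarith
    have h1 : 2 * π * ν * b ≤ 2 * π * ν * x := by gcongr
    constructor
    · rw [rate, rate, abs_of_pos (by linarith), abs_of_pos (by linarith)]; linarith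
    · exact mul_pos hν (by rw [rate]; linarith)

/-- The tail integral without stationary point, to second order. -/
lemma norm_oscInt_sub_le {b θ t ν : ℝ} (hb : 0 < b) (hθ : 0 < θ) (hθ1 : θ < 1) (ht : 0 < t)
    (hν : ν < 0 ∨ t < 2 * π * ν * b) :
    ‖oscInt b (θ + t * I) ν - I * (ampOne θ t ν b * osc t ν b)‖ ≤ |ampTwo θ t ν b| +
      b ^ (-θ) * (24 + 6 * (t / |rate t ν b|) ^ 2) / (2 * π * ν * rate t ν b) := by
  have hpi := Real.pi_pos
  have hν0 : ν ≠ 0 := by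
    rintro rfl
    rcases hν with h | h
    · exact lt_irrefl _ h
    · simp at h; linarith
  have hm : 0 < |rate t ν b| := by
    have := (abs_rate_mono hb le_rfl ht hν).2
    apply abs_pos.mpr
    intro h; rw [h] at this; simp at this
  have hL := (tendsto_integral_oscInt hb (s := (θ : ℂ) + t * I) (by simpa using hθ) hν0)
  have h1 : Tendsto (fun X => (ampOne θ t ν X : ℂ) * osc t ν X) atTop (𝓝 0) := by
    refine squeeze_zero_norm' (a := fun X => |ampOne θ t ν X|) ?_ ?_
    · filter_upwards [eventually_gt_atTop 0] with X hX
      rw [norm_mul, norm_osc hX, mul_one, Complex.norm_real, Real.norm_eq_abs]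
    · simpa using (tendsto_ampOne_atTop hθ hν0 (t := t)).abs
  have h2 := (hL.add ((h1.sub_const ((ampOne θ t ν b : ℂ) * osc t ν b)).const_mul I)).norm
  have h3 : Tendsto (fun X => |ampTwo θ t ν b| + |ampTwo θ t ν X| +
      b ^ (-θ) * (24 + 6 * (t / |rate t ν b|) ^ 2) / (2 * π * ν * rate t ν b)) atTop
      (𝓝 (|ampTwo θ t ν b| + 0 +
      b ^ (-θ) * (24 + 6 * (t / |rate t ν b|) ^ 2) / (2 * π * ν * rate t ν b))) := by
    have := (tendsto_ampTwo_atTop hθ hθ1 ht hν0).abs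
    rw [abs_zero] at this
    exact (tendsto_const_nhds.add this).add_const _
  have h4 := le_of_tendsto_of_tendsto h2 h3 ?_
  · rw [add_zero, zero_sub, mul_neg, ← sub_eq_add_neg] at h4
    exact h4
  · filter_upwards [eventually_ge_atTop b] with X hX
    have hq : ∀ x ∈ Icc b X, |rate t ν b| ≤ |rate t ν x| :=
      fun x hx => (abs_rate_mono hb hx.1 ht hν).1
    refine (norm_integral_osc_sub_le hb hX fun x hx =>
      abs_pos.mp (hm.trans_le (hq x hx))).trans ?_
    have hp : ∀ x ∈ Icc b X, x ^ (-θ) ≤ b ^ (-θ) := fun x hx =>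
      Real.rpow_le_rpow_of_nonpos hb hx.1 (by linarith)
    have h5 := integral_abs_ampTwoDeriv_le (t := t) hb hX hθ hθ1 hν0 hm hq hp
    have h6 : 0 ≤ 1 / (2 * π * ν * rate t ν X) := by
      have := (abs_rate_mono hb hX ht hν).2
      have : 0 < 2 * π * ν * rate t ν X := by nlinarith
      positivity
    have h7 : 0 ≤ b ^ (-θ) * (24 + 6 * (t / |rate t ν b|) ^ 2) := by positivity
    rw [mul_sub] at h5
    have h8 := mul_nonneg h7 h6
    rw [mul_one_div] at h5
    linarith

lemma norm_oscInt_le {b θ t ν : ℝ} (hb : 0 < b) (hθ : 0 < θ) (hθ1 : θ < 1) (ht : 0 < t)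
    (hν : t < 2 * π * ν * b) :
    ‖oscInt b (θ + t * I) ν‖ ≤ 2 * |ampOne θ t ν b| := by
  have hpi := Real.pi_pos
  have hν0 : 0 < ν := by
    by_contra hcon
    push Not at hcon
    have : 2 * π * ν * b ≤ 0 := by
      have : 2 * π * ν ≤ 0 := by nlinarith
      nlinarith
    linarith
  have hL := (tendsto_integral_oscInt hb (s := (θ : ℂ) + t * I) (by simpa using hθ) hν0.ne').norm
  have h3 : Tendsto (fun X => 2 * (|ampOne θ t ν b| + |ampOne θ t ν X|)) atTop
      (𝓝 (2 * (|ampOne θ t ν b| + 0))) := by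
    have := (tendsto_ampOne_atTop hθ hν0.ne' (t := t)).abs
    rw [abs_zero] at this
    exact (tendsto_const_nhds.add this).const_mul _
  rw [add_zero] at h3
  refine le_of_tendsto_of_tendsto hL h3 ?_
  filter_upwards [eventually_ge_atTop b] with X hX
  refine norm_integral_osc_le hb hX hθ hθ1 ht hν0 fun x hx h => ?_
  have := (abs_rate_mono hb hx.1 ht (Or.inr hν)).2
  rw [h] at this; simp at this

lemma tendsto_ampOne_zero {θ t ν : ℝ} (hθ1 : θ < 1) (ht : 0 < t) :
    Tendsto (ampOne θ t ν) (𝓝[>] 0) (𝓝 0) := by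
  have h1 : ContinuousAt (ampOne θ t ν) 0 := by
    unfold ampOne
    refine ContinuousAt.div ?_ (continuous_rate t ν).continuousAt (by simp [rate, ht.ne'])
    exact Real.continuousAt_rpow_const _ _ (Or.inr (by linarith))
  have h2 : ampOne θ t ν 0 = 0 := by
    rw [ampOne, Real.zero_rpow (by linarith), zero_div]
  have := h1.tendsto
  rw [h2] at this
  exact this.mono_left nhdsWithin_le_nhds

lemma tendsto_ampTwo_zero {θ t ν : ℝ} (hθ1 : θ < 1) (ht : 0 < t) :
    Tendsto (ampTwo θ t ν) (𝓝[>] 0) (𝓝 0) := by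
  have hr : ∀ k : ℕ, rate t ν 0 ^ k ≠ 0 := fun k => pow_ne_zero _ (by simp [rate, ht.ne'])
  have hrc : ∀ k : ℕ, ContinuousAt (fun x => rate t ν x ^ k) 0 := fun k =>
    ((continuous_rate t ν).pow k).continuousAt
  have h1 : ContinuousAt (ampTwo θ t ν) 0 := by
    unfold ampTwo
    refine ContinuousAt.sub (ContinuousAt.div ?_ (hrc 2) (hr 2))
      (ContinuousAt.div ?_ (hrc 3) (hr 3))
    · exact continuousAt_const.mul (Real.continuousAt_rpow_const _ _ (Or.inr (by linarith)))
    · exact continuousAt_const.mul (Real.continuousAt_rpow_const _ _ (Or.inr (by linarith)))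
  have h2 : ampTwo θ t ν 0 = 0 := by
    rw [ampTwo, Real.zero_rpow (by linarith), Real.zero_rpow (by linarith)]; simp
  have := h1.tendsto
  rw [h2] at this
  exact this.mono_left nhdsWithin_le_nhds

lemma intervalIntegrable_cpow_mul_wave {θ : ℝ} (hθ1 : θ < 1) (t ν α β : ℝ) :
    IntervalIntegrable (fun x : ℝ => (x : ℂ) ^ (-((θ : ℂ) + t * I)) * wave ν x) volume α β := by
  refine IntervalIntegrable.mul_continuousOn ?_ (continuous_wave ν).continuousOn
  exact intervalIntegral.intervalIntegrable_cpow' (by simp; linarith)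

lemma tendsto_integral_from_zero {b θ : ℝ} (hθ1 : θ < 1) (t ν : ℝ) :
    Tendsto (fun α : ℝ => ∫ x in α..b, (x : ℂ) ^ (-((θ : ℂ) + t * I)) * wave ν x) (𝓝[>] 0)
      (𝓝 (∫ x in (0 : ℝ)..b, (x : ℂ) ^ (-((θ : ℂ) + t * I)) * wave ν x)) := by
  have h := (intervalIntegral.continuous_primitive
    (fun α β => intervalIntegrable_cpow_mul_wave hθ1 t ν α β) b).neg.tendsto 0
  rw [Pi.neg_apply, ← intervalIntegral.integral_symm] at h
  refine (h.mono_left nhdsWithin_le_nhds).congr fun α => ?_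
  rw [Pi.neg_apply, ← intervalIntegral.integral_symm]

lemma rate_neg_of_le {x b t ν : ℝ} (hν : 0 < ν) (hx : x ≤ b) (h : 2 * π * ν * b < t) :
    rate t ν x ≤ rate t ν b ∧ rate t ν b < 0 := by
  have : 2 * π * ν * x ≤ 2 * π * ν * b := by
    have := Real.pi_pos
    gcongr
  constructor
  · rw [rate, rate]; linarith
  · rw [rate]; linarith

lemma norm_integral_from_zero_le {b θ t ν : ℝ} (hb : 0 < b) (hθ : 0 < θ) (hθ1 : θ < 1)
    (ht : 0 < t) (hν : 0 < ν) (h : 2 * π * ν * b < t) :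
    ‖∫ x in (0 : ℝ)..b, (x : ℂ) ^ (-((θ : ℂ) + t * I)) * wave ν x‖ ≤ 2 * |ampOne θ t ν b| := by
  have hL := (tendsto_integral_from_zero (b := b) hθ1 t ν).norm
  have h3 : Tendsto (fun α => 2 * (|ampOne θ t ν α| + |ampOne θ t ν b|)) (𝓝[>] 0)
      (𝓝 (2 * (0 + |ampOne θ t ν b|))) := by
    have := (tendsto_ampOne_zero hθ1 ht (ν := ν)).abs
    rw [abs_zero] at this
    exact (this.add_const _).const_mul _
  rw [zero_add] at h3
  refine le_of_tendsto_of_tendsto hL h3 ?_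
  filter_upwards [Ioo_mem_nhdsGT hb] with α hα
  refine norm_integral_osc_le hα.1 hα.2.le hθ hθ1 ht hν fun x hx h0 => ?_
  have := rate_neg_of_le hν hx.2 h
  linarith

/-- The head integral without stationary point, to second order. -/
lemma norm_integral_from_zero_sub_le {b θ t ν : ℝ} (hb : 0 < b) (hθ : 0 < θ) (hθ1 : θ < 1)
    (ht : 0 < t) (hν : 0 < ν) (h : 2 * π * ν * b < t) :
    ‖(∫ x in (0 : ℝ)..b, (x : ℂ) ^ (-((θ : ℂ) + t * I)) * wave ν x) +
      I * (ampOne θ t ν b * osc t ν b)‖ ≤ |ampTwo θ t ν b| + 192 / t ^ 2 * (b ^ (1 - θ) / (1 - θ)) +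
      2 * b ^ (-θ) * (24 + 6 * (t / |rate t ν b|) ^ 2) / (2 * π * ν * |rate t ν b|) := by
  have hpi := Real.pi_pos
  have hqb := (rate_neg_of_le hν le_rfl h).2
  have hm : 0 < |rate t ν b| := abs_pos.mpr hqb.ne
  have hL := tendsto_integral_from_zero (b := b) hθ1 t ν
  have h1 : Tendsto (fun X => (ampOne θ t ν X : ℂ) * osc t ν X) (𝓝[>] 0) (𝓝 0) := by
    refine squeeze_zero_norm' (a := fun X => |ampOne θ t ν X|) ?_ ?_
    · filter_upwards [self_mem_nhdsWithin] with X hX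
      rw [norm_mul, norm_osc hX, mul_one, Complex.norm_real, Real.norm_eq_abs]
    · simpa using (tendsto_ampOne_zero hθ1 ht (ν := ν)).abs
  have h2 := (hL.add ((h1.const_sub ((ampOne θ t ν b : ℂ) * osc t ν b)).const_mul I)).norm
  set B := 192 / t ^ 2 * (b ^ (1 - θ) / (1 - θ)) +
      2 * b ^ (-θ) * (24 + 6 * (t / |rate t ν b|) ^ 2) / (2 * π * ν * |rate t ν b|) with hB
  have h3 : Tendsto (fun X => |ampTwo θ t ν X| + |ampTwo θ t ν b| + B) (𝓝[>] 0)
      (𝓝 (0 + |ampTwo θ t ν b| + B)) := by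
    have := (tendsto_ampTwo_zero hθ1 ht (ν := ν)).abs
    rw [abs_zero] at this
    exact (this.add_const _).add_const _
  have h4 := le_of_tendsto_of_tendsto h2 h3 ?_
  · rw [sub_zero, zero_add] at h4
    rw [add_assoc (|ampTwo θ t ν b|), ← hB]
    exact h4
  · filter_upwards [Ioo_mem_nhdsGT (half_pos hb)] with α hα
    have hαb : α ≤ b := by linarith [hα.2]
    have hq : ∀ x ∈ Icc α b, rate t ν x ≠ 0 := fun x hx h0 => by
      have := rate_neg_of_le hν hx.2 h
      linarith
    refine (norm_integral_osc_sub_le hα.1 hαb hq).trans ?_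
    have hc := (continuousOn_ampTwoDeriv (θ := θ) hα.1 hq).abs
    have ii1 : IntervalIntegrable (fun x => |ampTwoDeriv θ t ν x|) volume α (b / 2) := by
      apply ContinuousOn.intervalIntegrable
      rw [uIcc_of_le hα.2.le]
      exact hc.mono (Icc_subset_Icc_right (by linarith))
    have ii2 : IntervalIntegrable (fun x => |ampTwoDeriv θ t ν x|) volume (b / 2) b := by
      apply ContinuousOn.intervalIntegrable
      rw [uIcc_of_le (by linarith)]
      exact hc.mono (Icc_subset_Icc_left hα.2.le)
    have hsplit := intervalIntegral.integral_add_adjacent_intervals ii1 ii2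
    have hA : ∫ x in α..(b / 2), |ampTwoDeriv θ t ν x| ≤
        192 / t ^ 2 * (b ^ (1 - θ) / (1 - θ)) := by
      have hrp : IntervalIntegrable (fun x : ℝ => x ^ (-θ)) volume α (b / 2) :=
        intervalIntegral.intervalIntegrable_rpow' (by linarith)
      have h5 : ∫ x in α..(b / 2), |ampTwoDeriv θ t ν x| ≤
          ∫ x in α..(b / 2), 192 / t ^ 2 * x ^ (-θ) := by
        refine intervalIntegral.integral_mono_on hα.2.le ii1 (hrp.const_mul _) fun x hx => ?_
        have hx0 : 0 < x := hα.1.trans_le hx.1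
        have hqx : t / 2 ≤ |rate t ν x| := by
          have h6 : 2 * π * ν * x ≤ 2 * π * ν * (b / 2) := by
            have := hx.2
            gcongr
          rw [rate, abs_of_neg (by nlinarith)]
          nlinarith
        have hqx0 : rate t ν x ≠ 0 := abs_pos.mp ((half_pos ht).trans_le hqx)
        refine (abs_ampTwoDeriv_le hx0 hθ hθ1 hqx0).trans ?_
        rw [mul_comm]
        refine mul_le_mul_of_nonneg_right ?_ (by positivity)
        have hs2 : (t / 2) ^ 2 ≤ rate t ν x ^ 2 := by
          rw [← sq_abs (rate t ν x)]; exact pow_le_pow_left₀ (by positivity) hqx 2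
        have hs4 : (t / 2) ^ 4 ≤ rate t ν x ^ 4 := by
          have := pow_le_pow_left₀ (by positivity) hs2 2
          nlinarith
        calc 24 / rate t ν x ^ 2 + 6 * t ^ 2 / rate t ν x ^ 4 ≤
            24 / (t / 2) ^ 2 + 6 * t ^ 2 / (t / 2) ^ 4 := by gcongr
          _ = 192 / t ^ 2 := by field_simp; norm_num
      refine h5.trans ?_
      rw [intervalIntegral.integral_const_mul, integral_rpow (Or.inl (by linarith))]
      have e : -θ + 1 = 1 - θ := by ring
      rw [e]
      gcongr
      have h7 : (b / 2) ^ (1 - θ) ≤ b ^ (1 - θ) :=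
        Real.rpow_le_rpow (by positivity) (by linarith) (by linarith)
      have h8 : 0 ≤ α ^ (1 - θ) := Real.rpow_nonneg hα.1.le _
      linarith
    have hBb : ∫ x in (b / 2)..b, |ampTwoDeriv θ t ν x| ≤
        2 * b ^ (-θ) * (24 + 6 * (t / |rate t ν b|) ^ 2) / (2 * π * ν * |rate t ν b|) := by
      have hq' : ∀ x ∈ Icc (b / 2) b, |rate t ν b| ≤ |rate t ν x| := fun x hx => by
        have := (rate_neg_of_le hν hx.2 h).1
        rw [abs_of_neg hqb, abs_of_neg (by linarith)]; linarith
      have hp : ∀ x ∈ Icc (b / 2) b, x ^ (-θ) ≤ 2 * b ^ (-θ) := fun x hx => by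
        calc x ^ (-θ) ≤ (b / 2) ^ (-θ) :=
              Real.rpow_le_rpow_of_nonpos (by positivity) hx.1 (by linarith)
          _ = 2 ^ θ * b ^ (-θ) := by
              rw [Real.div_rpow hb.le (by norm_num), Real.rpow_neg (by norm_num : (0:ℝ) ≤ 2)]
              field_simp
          _ ≤ 2 * b ^ (-θ) := by
              gcongr
              calc (2 : ℝ) ^ θ ≤ 2 ^ (1 : ℝ) :=
                    Real.rpow_le_rpow_of_exponent_le (by norm_num) hθ1.le
                _ = 2 := Real.rpow_one 2
      refine (integral_abs_ampTwoDeriv_le (t := t) (half_pos hb) (by linarith) hθ hθ1 hν.ne' hm hq'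
        hp).trans ?_
      have hn := (rate_neg_of_le hν (show b / 2 ≤ b by linarith) h).1
      have h6 : 1 / (2 * π * ν * rate t ν (b / 2)) ≤ 0 := by
        apply div_nonpos_of_nonneg_of_nonpos (by norm_num)
        have : 0 < 2 * π * ν := by positivity
        nlinarith
      have e : 1 / (2 * π * ν * rate t ν b) = -(1 / (2 * π * ν * |rate t ν b|)) := by
        rw [abs_of_neg hqb]; ring
      have h7 : 0 ≤ 2 * b ^ (-θ) * (24 + 6 * (t / |rate t ν b|) ^ 2) := by positivity
      have e2 := mul_one_div (2 * b ^ (-θ) * (24 + 6 * (t / |rate t ν b|) ^ 2))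
        (2 * π * ν * |rate t ν b|)
      rw [e, sub_neg_eq_add, mul_add, ← e2]
      have := mul_nonpos_of_nonneg_of_nonpos h7 h6
      linarith
    rw [← hsplit, hB]
    linarith

/-! ### The remainder after removing the stationary phase contribution -/

open Classical in
/-- The oscillatory integral over `(b, ∞)` with the complete integral over `(0, ∞)` removed
when the stationary point lies to the right of `b`. -/
noncomputable def dualRem (b θ t ν : ℝ) : ℂ :=
  if 2 * π * b * ν ≤ t then
    -∫ x in (0 : ℝ)..b, (x : ℂ) ^ (-((θ : ℂ) + t * I)) * wave ν x
  else oscInt b (θ + t * I) ν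

open Classical in
lemma dualRem_eq {b θ t ν : ℝ} (hb : 0 < b) (hθ : 0 < θ) (hθ1 : θ < 1) (hν : 0 < ν) :
    dualRem b θ t ν = oscInt b (θ + t * I) ν -
      if 2 * π * b * ν ≤ t then (ν : ℂ) ^ ((θ : ℂ) + t * I - 1) * dualFactor (θ + t * I) else 0 := by
  have := integral_add_oscInt (b := b) (s := θ + t * I) hb (by simp [hθ]) (by simp [hθ1]) hν
  unfold dualRem
  split_ifs
  · rw [← this]; ring
  · simp

lemma amp_bound_eq {b θ : ℝ} (hb : 0 < b) {t ν : ℝ} (hν : ν ≠ t / (2 * π * b)) :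
    b ^ (1 - θ) * (2 / rate t ν b ^ 2 + t / |rate t ν b| ^ 3) = b ^ (-θ - 1) / (4 * π ^ 2) *
      (2 / |ν - t / (2 * π * b)| ^ 2 + (t / (2 * π * b)) / |ν - t / (2 * π * b)| ^ 3) := by
  have hpi := Real.pi_pos
  set y := t / (2 * π * b) with hy
  have ht : t = 2 * π * b * y := by rw [hy]; field_simp
  have hd : 0 < |ν - y| := abs_pos.mpr (sub_ne_zero.mpr hν)
  have hq : |rate t ν b| = 2 * π * b * |ν - y| := by
    rw [rate_eq hb, abs_mul, abs_of_pos (by positivity)]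
  have e : b ^ (1 - θ) = b ^ (-θ - 1) * b ^ 2 := by
    rw [← Real.rpow_add_natCast hb.ne']; congr 1; push_cast; ring
  rw [← sq_abs (rate t ν b), hq, e, ht]
  field_simp
  ring

lemma quot_bound_eq {b θ : ℝ} (hb : 0 < b) {t ν : ℝ} (hν : ν ≠ t / (2 * π * b)) (hν0 : ν ≠ 0) :
    b ^ (-θ) * (24 + 6 * (t / |rate t ν b|) ^ 2) / (2 * π * |ν| * |rate t ν b|) =
      b ^ (-θ - 1) / (4 * π ^ 2) * (24 / (|ν| * |ν - t / (2 * π * b)|) +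
        6 * (t / (2 * π * b)) ^ 2 / (|ν| * |ν - t / (2 * π * b)| ^ 3)) := by
  have hpi := Real.pi_pos
  set y := t / (2 * π * b) with hy
  have ht : t = 2 * π * b * y := by rw [hy]; field_simp
  have hd : 0 < |ν - y| := abs_pos.mpr (sub_ne_zero.mpr hν)
  have hn : 0 < |ν| := abs_pos.mpr hν0
  have hq : |rate t ν b| = 2 * π * b * |ν - y| := by
    rw [rate_eq hb, abs_mul, abs_of_pos (by positivity)]
  have e : b ^ (-θ) = b ^ (-θ - 1) * b := by
    rw [← Real.rpow_add_one hb.ne']; congr 1; ring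
  rw [hq, e, ht]
  field_simp
  norm_num

lemma four_mul_pi_sq_ge : 39 ≤ 4 * π ^ 2 := by
  have := Real.pi_gt_d2
  nlinarith

lemma linear_bound_aux {A B D K u v w P : ℝ} (hA : 0 ≤ A) (hB : 0 ≤ B) (hD : 0 ≤ D) (hK : 0 ≤ K)
    (hP : 39 ≤ P) (hw : w ≤ 192 * (K * D)) (hu : u ≤ 2 * A + 2 * D) (hv : v ≤ 2 * B + 8 * D) :
    2 * A + B + w + 2 * (24 * u + 6 * v) ≤ (5 * K + 5) * (A + B + D) * P := by
  have hx : (5 * K + 5) * (A + B + D) * 39 ≤ (5 * K + 5) * (A + B + D) * P := by gcongr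
  have : 0 ≤ K * A := by positivity
  have : 0 ≤ K * B := by positivity
  have : 0 ≤ K * D := by positivity
  linarith

lemma norm_oscInt_neg_sub_le {b θ t ν : ℝ} (hb : 0 < b) (hθ : 0 < θ) (hθ1 : θ < 1) (ht : 0 < t)
    (hν : 0 < ν) :
    ‖oscInt b (θ + t * I) (-ν) - I * (ampOne θ t (-ν) b * osc t (-ν) b)‖ ≤
      b ^ (-θ - 1) / ν ^ 2 := by
  have hpi := Real.pi_gt_three
  have hy : 0 < t / (2 * π * b) := by positivity
  have hne : -ν ≠ t / (2 * π * b) := by linarith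
  have hr : rate t (-ν) b < 0 := by
    have : 0 < 2 * π * ν * b := by positivity
    rw [rate]; linarith
  have h := norm_oscInt_sub_le hb hθ hθ1 ht (ν := -ν) (Or.inl (by linarith))
  have e1 : 2 * π * -ν * rate t (-ν) b = 2 * π * |-ν| * |rate t (-ν) b| := by
    rw [abs_of_neg hr, abs_neg, abs_of_pos hν]; ring
  rw [e1, quot_bound_eq hb hne (by linarith)] at h
  have h2 := abs_ampTwo_le hb hθ hθ1 ht hr.ne
  rw [amp_bound_eq hb hne] at h2
  refine h.trans ((add_le_add_left h2 _).trans ?_)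
  set y := t / (2 * π * b)
  have hd : |-ν - y| = ν + y := by rw [abs_of_neg (by linarith)]; ring
  rw [hd, abs_neg, abs_of_pos hν, ← mul_add, div_eq_mul_one_div _ (ν ^ 2), div_mul_eq_mul_div,
    mul_div_assoc]
  refine mul_le_mul_of_nonneg_left ?_ (by positivity)
  have b1 : 2 / (ν + y) ^ 2 ≤ 2 / ν ^ 2 := by gcongr; linarith
  have b2 : y / (ν + y) ^ 3 ≤ 1 / ν ^ 2 := by
    rw [div_le_div_iff₀ (by positivity) (by positivity)]
    nlinarith [pow_pos hν 3, pow_pos hy 3, mul_pos hν hy, mul_pos (pow_pos hν 2) hy,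
      mul_pos hν (pow_pos hy 2)]
  have b3 : 24 / (ν * (ν + y)) ≤ 24 / ν ^ 2 := by
    gcongr; nlinarith
  have b4 : 6 * y ^ 2 / (ν * (ν + y) ^ 3) ≤ 6 / ν ^ 2 := by
    rw [div_le_div_iff₀ (by positivity) (by positivity)]
    nlinarith [pow_pos hν 4, mul_pos hν (pow_pos hy 3), mul_pos (pow_pos hν 3) hy,
      mul_pos (pow_pos hν 2) (pow_pos hy 2)]
  rw [div_le_iff₀ (by positivity)]
  have e : 2 / ν ^ 2 + 1 / ν ^ 2 + (24 / ν ^ 2 + 6 / ν ^ 2) = 33 * (1 / ν ^ 2) := by ring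
  have h0 : 0 < 1 / ν ^ 2 := by positivity
  have := mul_le_mul_of_nonneg_left four_mul_pi_sq_ge h0.le
  linarith

open Classical in
lemma norm_dualRem_sub_le {b θ t ν : ℝ} (hb : 0 < b) (hθ : 0 < θ) (hθ1 : θ < 1) (ht : 0 < t)
    (hν : 1 ≤ ν) (hne : ν ≠ t / (2 * π * b)) :
    ‖dualRem b θ t ν - I * (ampOne θ t ν b * osc t ν b)‖ ≤
      (5 / (1 - θ) + 5) * b ^ (-θ - 1) * (1 / |ν - t / (2 * π * b)| ^ 2 +
        (t / (2 * π * b)) / |ν - t / (2 * π * b)| ^ 3 +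
        if ν < t / (2 * π * b) then 1 / (t / (2 * π * b)) else 0) := by
  have hpi := Real.pi_gt_three
  have hy : 0 < t / (2 * π * b) := by positivity
  have hν0 : 0 < ν := by linarith
  have hd : 0 < |ν - t / (2 * π * b)| := abs_pos.mpr (sub_ne_zero.mpr hne)
  have hr0 : rate t ν b ≠ 0 := by
    rw [rate_eq hb]
    exact mul_ne_zero (by positivity) (sub_ne_zero.mpr hne)
  have h2 := abs_ampTwo_le hb hθ hθ1 ht hr0
  rw [amp_bound_eq hb hne] at h2
  have hC : 5 ≤ 5 / (1 - θ) + 5 := by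
    have : 0 < 5 / (1 - θ) := div_pos (by norm_num) (by linarith)
    linarith
  rcases lt_or_gt_of_ne hne with hlt | hgt
  · have h1 : 2 * π * ν * b < t := by
      rw [lt_div_iff₀ (by positivity)] at hlt; linarith
    rw [if_pos hlt, dualRem, if_pos (by linarith)]
    have h := norm_integral_from_zero_sub_le hb hθ hθ1 ht hν0 h1
    have e1 : 2 * b ^ (-θ) * (24 + 6 * (t / |rate t ν b|) ^ 2) / (2 * π * ν * |rate t ν b|) =
        2 * (b ^ (-θ) * (24 + 6 * (t / |rate t ν b|) ^ 2) / (2 * π * |ν| * |rate t ν b|)) := by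
      rw [abs_of_pos hν0]; ring
    rw [e1, quot_bound_eq hb hne hν0.ne'] at h
    have e2 : (192 / t ^ 2 * (b ^ (1 - θ) / (1 - θ))) = b ^ (-θ - 1) / (4 * π ^ 2) *
        (192 / (1 - θ) / (t / (2 * π * b)) ^ 2) := by
      have e : b ^ (1 - θ) = b ^ (-θ - 1) * b ^ 2 := by
        rw [← Real.rpow_add_natCast hb.ne']; congr 1; push_cast; ring
      have : 1 - θ ≠ 0 := by linarith
      rw [e]; field_simp; ring
    rw [e2] at h
    rw [← norm_neg, neg_sub, sub_neg_eq_add, add_comm]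
    refine h.trans ((add_le_add_left (add_le_add_left h2 _) _).trans ?_)
    set y := t / (2 * π * b)
    have hdy : |ν - y| = y - ν := by rw [abs_of_neg (by linarith)]; ring
    rw [hdy] at hd ⊢
    set d := y - ν with hdd
    have hyd : y = ν + d := by rw [hdd]; ring
    have hy1 : 1 < y := by linarith
    rw [abs_of_pos hν0, ← mul_add, mul_left_comm, ← mul_add, mul_comm _ (b ^ (-θ - 1)), mul_assoc,
      div_mul_eq_mul_div, mul_div_assoc]
    refine mul_le_mul_of_nonneg_left ?_ (by positivity)
    have b1 : 1 / (ν * d) ≤ 2 / d ^ 2 + 2 / y := by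
      have e : 1 / (ν * d) = (1 / ν + 1 / d) / y := by rw [hyd]; field_simp; ring
      have h3 : 1 / d / y ≤ 1 / d ^ 2 := by
        rw [div_div]; gcongr; nlinarith
      have h4 : 1 / ν / y ≤ 1 / y := by gcongr; rw [div_le_one hν0]; exact hν
      have : 0 < 1 / d ^ 2 := by positivity
      have : 0 < 1 / y := by positivity
      rw [e, add_div]
      have e5 : 2 / d ^ 2 = 2 * (1 / d ^ 2) := by ring
      have e6 : 2 / y = 2 * (1 / y) := by ring
      linarith
    have b2 : y ^ 2 / (ν * d ^ 3) ≤ 2 * (y / d ^ 3) + 8 / y := by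
      rcases le_total (y / 2) ν with h3 | h3
      · have : y ^ 2 / (ν * d ^ 3) ≤ 2 * (y / d ^ 3) := by
          rw [← mul_div_assoc, div_le_div_iff₀ (by positivity) (by positivity)]
          nlinarith [mul_pos hy (pow_pos hd 3)]
        have : 0 < 8 / y := by positivity
        linarith
      · have hd2 : y / 2 ≤ d := by linarith
        have : y ^ 2 / (ν * d ^ 3) ≤ 8 / y := by
          calc y ^ 2 / (ν * d ^ 3) ≤ y ^ 2 / (1 * (y / 2) ^ 3) := by gcongr
            _ = 8 / y := by field_simp; norm_num
        have : 0 < 2 * (y / d ^ 3) := by positivity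
        linarith
    have b3 : 192 / (1 - θ) / y ^ 2 ≤ 192 / (1 - θ) / y := by
      have : 0 < 1 - θ := by linarith
      gcongr
      nlinarith
    set A := 1 / d ^ 2 with hA
    set B := y / d ^ 3
    set D := 1 / y with hD
    set K := 1 / (1 - θ) with hK
    have hAp : 0 < A := by positivity
    have hBp : 0 < B := by positivity
    have hDp : 0 < D := by positivity
    have hKp : 0 < K := div_pos one_pos (by linarith)
    have f1 : 24 / (ν * d) = 24 * (1 / (ν * d)) := by ring
    have f2 : 6 * y ^ 2 / (ν * d ^ 3) = 6 * (y ^ 2 / (ν * d ^ 3)) := by ring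
    have f3 : 2 / d ^ 2 = 2 * A := by rw [hA]; ring
    have f4 : 192 / (1 - θ) / y = 192 * (K * D) := by rw [hK, hD]; ring
    have f5 : 2 / y = 2 * D := by rw [hD]; ring
    have f6 : 8 / y = 8 * D := by rw [hD]; ring
    have f7 : 5 / (1 - θ) = 5 * K := by rw [hK]; ring
    rw [f1, f2, f3, f7]
    rw [f4] at b3
    rw [f5, f3] at b1
    rw [f6] at b2
    rw [div_le_iff₀ (by positivity)]
    exact linear_bound_aux hAp.le hBp.le hDp.le hKp.le four_mul_pi_sq_ge b3 b1 b2
  · have h1 : t < 2 * π * ν * b := by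
      rw [div_lt_iff₀ (by positivity)] at hgt; linarith
    rw [if_neg (by linarith), dualRem, if_neg (by linarith)]
    have h := norm_oscInt_sub_le hb hθ hθ1 ht (Or.inr h1)
    have hrp : 0 < rate t ν b := by rw [rate]; linarith
    have e1 : 2 * π * ν * rate t ν b = 2 * π * |ν| * |rate t ν b| := by
      rw [abs_of_pos hrp, abs_of_pos hν0]
    rw [e1, quot_bound_eq hb hne hν0.ne'] at h
    refine h.trans ((add_le_add_left h2 _).trans ?_)
    set y := t / (2 * π * b)
    have hdy : |ν - y| = ν - y := abs_of_pos (by linarith)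
    rw [hdy] at hd ⊢
    set d := ν - y with hdd
    rw [abs_of_pos hν0, ← mul_add, mul_comm _ (b ^ (-θ - 1)), mul_assoc,
      div_mul_eq_mul_div, mul_div_assoc]
    refine mul_le_mul_of_nonneg_left ?_ (by positivity)
    have b1 : 24 / (ν * d) ≤ 24 / d ^ 2 := by gcongr; nlinarith
    have b2 : 6 * y ^ 2 / (ν * d ^ 3) ≤ 6 * (y / d ^ 3) := by
      rw [← mul_div_assoc, div_le_div_iff₀ (by positivity) (by positivity)]
      nlinarith [mul_pos hy (pow_pos hd 3)]
    set A := 1 / d ^ 2 with hA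
    set B := y / d ^ 3
    have hAp : 0 < A := by positivity
    have hBp : 0 < B := by positivity
    have f1 : 24 / d ^ 2 = 24 * A := by rw [hA]; ring
    have f2 : 2 / d ^ 2 = 2 * A := by rw [hA]; ring
    rw [f2]
    rw [f1] at b1
    rw [div_le_iff₀ (by positivity), add_zero]
    have hp4 := four_mul_pi_sq_ge
    have hx : 5 * (A + B) * 39 ≤ (5 / (1 - θ) + 5) * (A + B) * (4 * π ^ 2) := by
      gcongr
    linarith

lemma norm_dualRem_le {b θ t ν : ℝ} (hb : 0 < b) (hθ : 0 < θ) (hθ1 : θ < 1) (ht : 0 < t)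
    (hν : 0 < ν) (hne : ν ≠ t / (2 * π * b)) :
    ‖dualRem b θ t ν‖ ≤ b ^ (-θ) / |ν - t / (2 * π * b)| := by
  have hpi := Real.pi_gt_three
  have hd : 0 < |ν - t / (2 * π * b)| := abs_pos.mpr (sub_ne_zero.mpr hne)
  have key : 2 * |ampOne θ t ν b| ≤ b ^ (-θ) / |ν - t / (2 * π * b)| := by
    rw [abs_ampOne hb, rate_eq hb, abs_mul, abs_of_pos (by positivity : 0 < 2 * π * b)]
    have e : b ^ (1 - θ) = b ^ (-θ) * b := by
      rw [← Real.rpow_add_one hb.ne']; congr 1; ring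
    rw [e]
    have : 2 * (b ^ (-θ) * b / (2 * π * b * |ν - t / (2 * π * b)|)) =
        b ^ (-θ) / |ν - t / (2 * π * b)| / π := by field_simp
    rw [this]
    exact div_le_self (by positivity) (by linarith)
  refine le_trans ?_ key
  rcases lt_or_gt_of_ne hne with hlt | hgt
  · have h1 : 2 * π * ν * b < t := by
      rw [lt_div_iff₀ (by positivity)] at hlt; linarith
    rw [dualRem, if_pos (by linarith), norm_neg]
    exact norm_integral_from_zero_le hb hθ hθ1 ht hν h1
  · have h1 : t < 2 * π * ν * b := by
      rw [div_lt_iff₀ (by positivity)] at hgt; linarith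
    rw [dualRem, if_neg (by linarith)]
    exact norm_oscInt_le hb hθ hθ1 ht h1

lemma norm_integral_cpow_wave_le {α β θ t ν : ℝ} (hα : 0 < α) (hαβ : α ≤ β) (hθ : 0 < θ) :
    ‖∫ x in α..β, (x : ℂ) ^ (-((θ : ℂ) + t * I)) * wave ν x‖ ≤ α ^ (-θ) * (β - α) := by
  have := intervalIntegral.norm_integral_le_of_norm_le_const (a := α) (b := β) (C := α ^ (-θ))
    (f := fun x : ℝ => (x : ℂ) ^ (-((θ : ℂ) + t * I)) * wave ν x) (fun x hx => by
      rw [uIoc_of_le hαβ] at hx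
      have hx0 : 0 < x := hα.trans hx.1
      rw [norm_mul, norm_wave, mul_one, Complex.norm_cpow_eq_rpow_re_of_pos hx0]
      simp only [Complex.neg_re, Complex.add_re, Complex.ofReal_re, Complex.mul_re, Complex.I_re,
        mul_zero, Complex.ofReal_im, Complex.I_im, mul_one, sub_zero, add_zero]
      exact Real.rpow_le_rpow_of_nonpos hα hx.1.le (by linarith))
  rwa [abs_of_nonneg (by linarith)] at this

lemma integral_add_oscInt_shift {b c θ t ν : ℝ} (hb : 0 < b) (hc : 0 < c) (hθ : 0 < θ)
    (hθ1 : θ < 1) (hν : ν ≠ 0) :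
    (∫ x in b..c, (x : ℂ) ^ (-((θ : ℂ) + t * I)) * wave ν x) + oscInt c (θ + t * I) ν =
      oscInt b (θ + t * I) ν := by
  have h1 := tendsto_integral_oscInt hb (s := θ + t * I) (by simp [hθ]) hν
  have h2 := (tendsto_integral_oscInt hc (s := θ + t * I) (by simp [hθ]) hν).const_add
    (∫ x in b..c, (x : ℂ) ^ (-((θ : ℂ) + t * I)) * wave ν x)
  refine tendsto_nhds_unique h2 (h1.congr fun X => ?_)
  exact (intervalIntegral.integral_add_adjacent_intervals
    (intervalIntegrable_cpow_mul_wave hθ1 t ν _ _)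
    (intervalIntegrable_cpow_mul_wave hθ1 t ν _ _)).symm

/-- A bound for the remainder term near the stationary point, uniform in its position. -/
lemma norm_dualRem_le_sqrt {b θ t ν : ℝ} (hb : 0 < b) (hθ : 0 < θ) (hθ1 : θ < 1) (ht : 1 ≤ t)
    (hν : 0 < ν) (hne : ν ≠ t / (2 * π * b)) (hν2 : t / (2 * π * b) / 2 ≤ ν) :
    ‖dualRem b θ t ν‖ ≤ 9 * (b ^ (1 - θ) / √t) := by
  have hpi := Real.pi_gt_three
  have ht0 : 0 < t := by linarith
  have hs : 1 ≤ √t := Real.one_le_sqrt.mpr ht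
  have hs0 : 0 < √t := by linarith
  have hss : √t * √t = t := Real.mul_self_sqrt ht0.le
  have e : b ^ (1 - θ) = b ^ (-θ) * b := by
    rw [← Real.rpow_add_one hb.ne']; congr 1; ring
  rcases lt_or_gt_of_ne hne with hlt | hgt
  · have h1 : 2 * π * ν * b < t := by
      rw [lt_div_iff₀ (by positivity)] at hlt; linarith
    rw [dualRem, if_pos (by linarith), norm_neg]
    have hνb : t / 2 ≤ 2 * π * ν * b := by
      rw [div_div, div_le_iff₀ (by positivity)] at hν2; linarith
    set Δ := b / (2 * √t) with hΔ
    have hΔp : 0 < Δ := by positivity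
    have hΔb : Δ ≤ b / 2 := by rw [hΔ]; gcongr; linarith
    have h2 : 2 * π * ν * (b - Δ) < t := by
      have : 0 < 2 * π * ν * Δ := by positivity
      linarith
    rw [← intervalIntegral.integral_add_adjacent_intervals
      (intervalIntegrable_cpow_mul_wave hθ1 t ν 0 (b - Δ))
      (intervalIntegrable_cpow_mul_wave hθ1 t ν (b - Δ) b)]
    have hbΔ : 0 < b - Δ := by linarith
    have n1 := norm_integral_from_zero_le hbΔ hθ hθ1 ht0 hν h2
    have n2 := norm_integral_cpow_wave_le (t := t) (ν := ν) hbΔ (show b - Δ ≤ b by linarith) hθ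
    have hp : (b - Δ) ^ (-θ) ≤ 2 * b ^ (-θ) := by
      calc (b - Δ) ^ (-θ) ≤ (b / 2) ^ (-θ) :=
            Real.rpow_le_rpow_of_nonpos (by positivity) (by linarith) (by linarith)
        _ = 2 ^ θ * b ^ (-θ) := by
            rw [Real.div_rpow hb.le (by norm_num), Real.rpow_neg (by norm_num : (0:ℝ) ≤ 2)]
            field_simp
        _ ≤ 2 * b ^ (-θ) := by
            gcongr
            calc (2 : ℝ) ^ θ ≤ 2 ^ (1 : ℝ) :=
                  Real.rpow_le_rpow_of_exponent_le (by norm_num) hθ1.le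
              _ = 2 := Real.rpow_one 2
    have n3 : (b - Δ) ^ (-θ) * (b - (b - Δ)) ≤ b ^ (1 - θ) / √t := by
      have : (b - Δ) ^ (-θ) * (b - (b - Δ)) ≤ 2 * b ^ (-θ) * Δ := by
        rw [sub_sub_cancel]; gcongr
      refine this.trans_eq ?_
      rw [e, hΔ]; field_simp
    have n4 : 2 * |ampOne θ t ν (b - Δ)| ≤ 8 * (b ^ (1 - θ) / √t) := by
      have hq : √t / 4 ≤ |rate t ν (b - Δ)| := by
        rw [rate, abs_of_neg (by linarith)]
        have : t / 2 * (1 / (2 * √t)) ≤ 2 * π * ν * b * (1 / (2 * √t)) := by gcongr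
        have e1 : t / 2 * (1 / (2 * √t)) = √t / 4 := by
          nth_rewrite 1 [← hss]; field_simp; norm_num
        have e2 : 2 * π * ν * b * (1 / (2 * √t)) = 2 * π * ν * Δ := by rw [hΔ]; ring
        linarith
      rw [abs_ampOne hbΔ]
      calc 2 * ((b - Δ) ^ (1 - θ) / |rate t ν (b - Δ)|) ≤ 2 * (b ^ (1 - θ) / (√t / 4)) := by
            gcongr <;> linarith
        _ = 8 * (b ^ (1 - θ) / √t) := by field_simp; norm_num
    refine (norm_add_le _ _).trans ?_
    linarith
  · have h1 : t < 2 * π * ν * b := by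
      rw [div_lt_iff₀ (by positivity)] at hgt; linarith
    rw [dualRem, if_neg (by linarith)]
    set Δ := b / √t with hΔ
    have hΔp : 0 < Δ := by positivity
    have hΔb : Δ ≤ b := div_le_self hb.le hs
    have h2 : t < 2 * π * ν * (b + Δ) := by
      have : 0 < 2 * π * ν * Δ := by positivity
      linarith
    have hbΔ : 0 < b + Δ := by linarith
    rw [← integral_add_oscInt_shift hb hbΔ hθ hθ1 hν.ne']
    have n1 := norm_oscInt_le hbΔ hθ hθ1 ht0 h2
    have n2 := norm_integral_cpow_wave_le (t := t) (ν := ν) hb (show b ≤ b + Δ by linarith) hθ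
    have n3 : b ^ (-θ) * (b + Δ - b) = b ^ (1 - θ) / √t := by
      rw [e, hΔ]; field_simp; ring
    have n4 : 2 * |ampOne θ t ν (b + Δ)| ≤ 4 * (b ^ (1 - θ) / √t) := by
      have hq : √t ≤ |rate t ν (b + Δ)| := by
        rw [rate, abs_of_pos (by linarith)]
        have : t * (1 / √t) ≤ 2 * π * ν * b * (1 / √t) := by gcongr
        have e1 : t * (1 / √t) = √t := by
          nth_rewrite 1 [← hss]; field_simp
        have e2 : 2 * π * ν * b * (1 / √t) = 2 * π * ν * Δ := by rw [hΔ]; ring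
        linarith
      have hp : (b + Δ) ^ (1 - θ) ≤ 2 * b ^ (1 - θ) := by
        calc (b + Δ) ^ (1 - θ) ≤ (2 * b) ^ (1 - θ) :=
              Real.rpow_le_rpow hbΔ.le (by linarith) (by linarith)
          _ = 2 ^ (1 - θ) * b ^ (1 - θ) := Real.mul_rpow (by norm_num) hb.le
          _ ≤ 2 * b ^ (1 - θ) := by
              gcongr
              calc (2 : ℝ) ^ (1 - θ) ≤ 2 ^ (1 : ℝ) :=
                    Real.rpow_le_rpow_of_exponent_le (by norm_num) (by linarith)
                _ = 2 := Real.rpow_one 2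
      rw [abs_ampOne hbΔ]
      calc 2 * ((b + Δ) ^ (1 - θ) / |rate t ν (b + Δ)|) ≤ 2 * (2 * b ^ (1 - θ) / √t) := by
            gcongr
        _ = 4 * (b ^ (1 - θ) / √t) := by ring
    have : 0 < b ^ (1 - θ) / √t := by positivity
    refine (norm_add_le _ _).trans ?_
    linarith

/-! ### A pointwise bound for the remainder of the approximate functional equation -/

lemma cot_periodic_pi : Function.Periodic Complex.cot π := fun x => by
  rw [Complex.cot, Complex.cot, Complex.cos_add_pi, Complex.sin_add_pi, neg_div_neg_eq]

lemma ofReal_mem_integerComplement {y : ℝ} (hy : ∀ n : ℤ, y ≠ n) :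
    (y : ℂ) ∈ Complex.integerComplement := by
  rw [Complex.mem_integerComplement_iff]
  rintro ⟨n, hn⟩
  exact hy n (by exact_mod_cast hn.symm)

lemma norm_cot_sub_inv_le {δ : ℝ} (hδ0 : δ ≠ 0) (hδ : |δ| ≤ 1 / 2) :
    ‖π * Complex.cot (π * δ) - 1 / (δ : ℂ)‖ ≤ 4 := by
  have hinteg : ∀ n : ℤ, δ ≠ n := by
    intro n hn
    have h1 : |(n : ℝ)| < 1 := by rw [← hn]; linarith
    have h2 : |n| < 1 := by exact_mod_cast h1
    rw [Int.abs_lt_one_iff] at h2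
    rw [h2] at hn; exact hδ0 (by simpa using hn)
  have hmem := ofReal_mem_integerComplement hinteg
  rw [cot_series_rep' hmem]
  have hg := (hasSum_nat_add_iff' 1).mpr hasSum_zeta_two
  simp only [Finset.range_one, Finset.sum_singleton, Nat.cast_zero, ne_eq, OfNat.ofNat_ne_zero,
    not_false_eq_true, zero_pow, div_zero, sub_zero] at hg
  have hg2 := hg.mul_left (4 / 3)
  refine (tsum_of_norm_bounded hg2 fun k => ?_).trans ?_
  · rw [show (1 / ((δ : ℂ) - (k + 1)) + 1 / ((δ : ℂ) + (k + 1))) = cotTerm δ k from rfl,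
      cotTerm_identity hmem]
    have e : (2 * (δ : ℂ) * (1 / ((δ + (k + 1)) * (δ - (k + 1))))) =
      ((2 * δ / (δ ^ 2 - (k + 1) ^ 2) : ℝ) : ℂ) := by
      push_cast
      rw [show ((δ : ℂ) ^ 2 - (k + 1) ^ 2) = (δ + (k + 1)) * (δ - (k + 1)) by ring]
      ring
    rw [e, Complex.norm_real, Real.norm_eq_abs, abs_div, abs_mul]
    have hk : (1 : ℝ) ≤ ((k + 1 : ℕ) : ℝ) := by exact_mod_cast Nat.le_add_left 1 k
    have hδ2 : δ ^ 2 ≤ 1 / 4 := by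
      rw [← sq_abs]; nlinarith [abs_nonneg δ]
    have hcast : ((k + 1 : ℕ) : ℝ) = k + 1 := by push_cast; ring
    rw [← hcast]
    set n := ((k + 1 : ℕ) : ℝ)
    have hneg : δ ^ 2 - n ^ 2 < 0 := by nlinarith
    rw [abs_of_neg hneg, div_mul_div_comm, abs_two, div_le_div_iff₀ (by linarith) (by positivity)]
    nlinarith
  · have := Real.pi_lt_d2
    have := Real.pi_pos
    nlinarith

lemma wave_mul_main {b θ t ν : ℝ} (hb : 0 < b) (hν : ν ≠ t / (2 * π * b)) :
    wave ν (-b) * (I * (ampOne θ t ν b * osc t ν b)) =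
      -(I * (b : ℂ) ^ (-((θ : ℂ) + t * I)) / (2 * π)) * (1 / (((t / (2 * π * b) : ℝ) : ℂ) - ν)) := by
  have hpi := Real.pi_pos
  have hbc : (b : ℂ) ≠ 0 := by exact_mod_cast hb.ne'
  have h1 := wave_mul_wave_neg ν b
  have h2 := cpow_mul_wave_eq hb θ t ν
  have hne : (((t / (2 * π * b) : ℝ) : ℂ) - ν) ≠ 0 := by
    rw [sub_ne_zero]; exact_mod_cast hν.symm
  have h3 : (ampOne θ t ν b : ℂ) = -(((b ^ (-θ) : ℝ) : ℂ) / (2 * π) *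
      (1 / (((t / (2 * π * b) : ℝ) : ℂ) - ν))) := by
    have : ampOne θ t ν b = -((b ^ (-θ)) / (2 * π) * (1 / ((t / (2 * π * b)) - ν))) := by
      have e : b ^ (1 - θ) = b ^ (-θ) * b := by
        rw [← Real.rpow_add_one hb.ne']; congr 1; ring
      rw [ampOne, rate_eq hb, e]
      have h5 : t / (2 * π * b) - ν ≠ 0 := sub_ne_zero.mpr hν.symm
      have h6 : ν - t / (2 * π * b) ≠ 0 := sub_ne_zero.mpr hν
      have h7 : ν - t / (2 * π * b) = -(t / (2 * π * b) - ν) := by ring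
      rw [h7]
      generalize t / (2 * π * b) - ν = z at *
      field_simp
    rw [this]; push_cast; ring
  rw [h3]
  have h4 : (b : ℂ) ^ (-((θ : ℂ) + t * I)) = ((b ^ (-θ) : ℝ) : ℂ) * osc t ν b * wave ν (-b) := by
    rw [← h2, mul_assoc, h1, mul_one]
  rw [h4]; ring

open Classical in
/-- The dual Dirichlet polynomial, truncated at `t / (2πb)`. -/
noncomputable def dualSum (b : ℝ) (N : ℕ) (θ t : ℝ) : ℂ :=
  ∑ k ∈ Finset.range N, if 2 * π * b * ((k + 1 : ℕ) : ℝ) ≤ t then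
    wave ((k + 1 : ℕ) : ℝ) (-b) * (((k + 1 : ℕ) : ℝ) : ℂ) ^ ((θ : ℂ) + t * I - 1) else 0

open Classical in
lemma hasSum_dualRem {b θ t : ℝ} {N : ℕ} (hb : 0 < b) (hθ : 0 < θ) (hθ1 : θ < 1) (ht : 0 < t)
    (hN : t < 2 * π * b * (N + 1)) :
    HasSum (fun k : ℕ => wave ((k + 1 : ℕ) : ℝ) (-b) * dualRem b θ t ((k + 1 : ℕ) : ℝ) +
      wave (-((k + 1 : ℕ) : ℝ)) (-b) * oscInt b (θ + t * I) (-((k + 1 : ℕ) : ℝ)))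
      (zetaH (θ + t * I) b - dualSum b N θ t * dualFactor (θ + t * I) -
        (b : ℂ) ^ (1 - ((θ : ℂ) + t * I)) / ((θ : ℂ) + t * I - 1) -
        (b : ℂ) ^ (-((θ : ℂ) + t * I)) / 2) := by
  set s : ℂ := θ + t * I with hs
  have hs1 : s ≠ 1 := fun h => by
    have := congrArg Complex.im h
    simp [hs] at this; exact ht.ne' this
  have h := (hasSum_nat_add_iff' 1).mpr (hasSum_oscInt hb (s := s) (by simp [hs, hθ]) hs1)
  simp only [Finset.range_one, Finset.sum_singleton, Nat.cast_zero, neg_zero, oscInt, mul_zero,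
    zero_mul, Complex.ofReal_zero, div_zero, add_zero, sub_zero] at h
  have h2 : HasSum (fun k : ℕ => if 2 * π * b * ((k + 1 : ℕ) : ℝ) ≤ t then
      wave ((k + 1 : ℕ) : ℝ) (-b) * (((k + 1 : ℕ) : ℝ) : ℂ) ^ ((θ : ℂ) + t * I - 1) else 0)
      (dualSum b N θ t) := by
    refine hasSum_sum_of_ne_finset_zero fun k hk => if_neg ?_
    rw [Finset.mem_range, not_lt] at hk
    have : (N : ℝ) + 1 ≤ ((k + 1 : ℕ) : ℝ) := by exact_mod_cast Nat.succ_le_succ hk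
    have : 2 * π * b * (N + 1) ≤ 2 * π * b * ((k + 1 : ℕ) : ℝ) := by
      have := Real.pi_pos
      gcongr
    linarith
  have h3 := h.sub (h2.mul_right (dualFactor s))
  convert! h3 using 1
  · funext k
    rw [dualRem_eq hb hθ hθ1 (by positivity)]
    rw [← hs]
    unfold oscInt
    split_ifs <;> ring
  · ring

set_option maxHeartbeats 800000 in
lemma exists_norm_zetaH_sub_dualSum_le {θ : ℝ} (hθ : 0 < θ) (hθ1 : θ < 1) :
    ∃ C > 0, ∀ (b t : ℝ) (N n₀ : ℕ), 1 ≤ b → 1 ≤ t → t ≤ b ^ 2 → t < 2 * π * b * (N + 1) →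
      (∀ n : ℤ, t / (2 * π * b) ≠ n) → |t / (2 * π * b) - n₀| ≤ 1 / 2 →
      ‖zetaH (θ + t * I) b - dualSum b N θ t * dualFactor (θ + t * I)‖ ≤
        C * (b ^ (1 - θ) / t + b ^ (-θ)) + if n₀ = 0 then 0 else ‖dualRem b θ t n₀‖ := by
  set Z := ∑' j : ℤ, 1 / (j : ℝ) ^ 2 with hZ
  have hsumZ : Summable fun j : ℤ => 1 / (j : ℝ) ^ 2 :=
    Real.summable_one_div_int_pow.mpr (by norm_num)
  have hZ0 : 0 ≤ Z := tsum_nonneg fun j => by positivity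
  set K := 5 / (1 - θ) + 5 with hK
  have hK0 : 0 < K := by
    have : 0 < 5 / (1 - θ) := div_pos (by norm_num) (by linarith)
    linarith
  refine ⟨10 + K * (20 * Z + 1), by positivity, fun b t N n₀ hb1 ht1 htb hN hinteg hn₀ => ?_⟩
  have hpi := Real.pi_gt_three
  have hb : 0 < b := by linarith
  have ht : 0 < t := by linarith
  set y := t / (2 * π * b) with hy
  have hy0 : 0 < y := by positivity
  have hyb : y ≤ b := by
    rw [hy, div_le_iff₀ (by positivity)]; nlinarith
  have hmem := ofReal_mem_integerComplement hinteg
  set s : ℂ := θ + t * I with hs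
  have hB : ‖(b : ℂ) ^ (-s)‖ = b ^ (-θ) := by
    rw [Complex.norm_cpow_eq_rpow_re_of_pos hb]; simp [hs]
  have hB1 : ‖(b : ℂ) ^ (1 - s) / (s - 1)‖ ≤ b ^ (1 - θ) / t := by
    rw [norm_div, Complex.norm_cpow_eq_rpow_re_of_pos hb]
    have h1 : (1 - s).re = 1 - θ := by simp [hs]
    rw [h1]
    gcongr
    have := Complex.abs_im_le_norm (s - 1)
    simpa [hs, abs_of_pos ht] using this
  set c : ℂ := -(I * (b : ℂ) ^ (-s) / (2 * π)) with hc
  have hcn : ‖c‖ ≤ b ^ (-θ) := by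
    rw [hc, norm_neg, norm_div, norm_mul, hB]
    simp only [Complex.norm_I, one_mul, norm_mul, Complex.norm_ofNat, Complex.norm_real,
      Real.norm_eq_abs, abs_of_pos Real.pi_pos]
    exact div_le_self (by positivity) (by linarith)
  have hne : ∀ k : ℕ, ((k + 1 : ℕ) : ℝ) ≠ y := fun k h => hinteg (k + 1 : ℕ) (by rw [← h]; simp)
  have hne' : ∀ k : ℕ, -((k + 1 : ℕ) : ℝ) ≠ y := fun k h =>
    hinteg (-(k + 1 : ℕ)) (by rw [← h]; simp)
  have hmain : HasSum (fun k : ℕ => wave ((k + 1 : ℕ) : ℝ) (-b) *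
      (I * (ampOne θ t ((k + 1 : ℕ) : ℝ) b * osc t ((k + 1 : ℕ) : ℝ) b)) +
      wave (-((k + 1 : ℕ) : ℝ)) (-b) *
      (I * (ampOne θ t (-((k + 1 : ℕ) : ℝ)) b * osc t (-((k + 1 : ℕ) : ℝ)) b)))
      (c * (π * Complex.cot (π * y) - 1 / (y : ℂ))) := by
    rw [cot_series_rep' hmem]
    have := (summable_cotTerm hmem).hasSum.mul_left c
    refine this.congr_fun fun k => ?_
    rw [wave_mul_main hb (hne k), wave_mul_main hb (hne' k), ← hs, ← hy, ← hc, cotTerm]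
    push_cast
    ring
  have hpeak : HasSum (fun k : ℕ => if k + 1 = n₀ then c * (1 / ((y : ℂ) - n₀)) else 0)
      (if n₀ = 0 then 0 else c * (1 / ((y : ℂ) - n₀))) := by
    rcases Nat.eq_zero_or_pos n₀ with h0 | h0
    · simp [h0]
    · obtain ⟨k₀, rfl⟩ : ∃ k₀, n₀ = k₀ + 1 := ⟨n₀ - 1, by omega⟩
      simp only [Nat.add_right_cancel_iff, Nat.add_eq_zero_iff, one_ne_zero, and_false, if_false]
      exact hasSum_ite_eq k₀ _
  have hdiff := ((hasSum_dualRem hb hθ hθ1 ht hN).sub hmain).add hpeak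
  set P := if n₀ = 0 then 0 else ‖dualRem b θ t n₀‖ with hP
  have hgP : HasSum (fun k : ℕ => if k + 1 = n₀ then P else 0) P := by
    rcases Nat.eq_zero_or_pos n₀ with h0 | h0
    · simp [h0, hP]
    · obtain ⟨k₀, rfl⟩ : ∃ k₀, n₀ = k₀ + 1 := ⟨n₀ - 1, by omega⟩
      simp only [Nat.add_right_cancel_iff]
      exact hasSum_ite_eq k₀ _
  have hg2 := ((hasSum_nat_add_iff' 1).mpr hasSum_zeta_two).mul_left (b ^ (-θ - 1))
  have hinj : Function.Injective fun k : ℕ => ((k + 1 : ℕ) : ℤ) - n₀ := fun i j h => by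
    simpa using h
  have hg3 := (hsumZ.comp_injective hinj).hasSum
  have hg3le : ∑' k, ((fun j : ℤ => 1 / (j : ℝ) ^ 2) ∘ fun k : ℕ => ((k + 1 : ℕ) : ℤ) - n₀) k ≤ Z :=
    tsum_comp_le_tsum_of_inj hsumZ (fun j => by positivity) hinj
  have hg4 : HasSum (fun k : ℕ => if k ∈ Finset.range ⌊y⌋₊ then 1 / y else 0)
      (∑ k ∈ Finset.range ⌊y⌋₊, if k ∈ Finset.range ⌊y⌋₊ then 1 / y else 0) :=
    hasSum_sum_of_ne_finset_zero fun k hk => if_neg hk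
  have hg4le : (∑ k ∈ Finset.range ⌊y⌋₊, if k ∈ Finset.range ⌊y⌋₊ then 1 / y else 0) ≤ 1 := by
    rw [Finset.sum_ite_mem, Finset.inter_self, Finset.sum_const, Finset.card_range, nsmul_eq_mul,
      mul_one_div, div_le_one hy0]
    exact Nat.floor_le hy0.le
  have hg := (hgP.add hg2).add
    (((hg3.mul_left (4 + 8 * y)).add hg4).mul_left (K * b ^ (-θ - 1)))
  have hbound := hdiff.norm_le_of_bounded hg fun k => ?_
  · have e1 : (∑ i ∈ Finset.range 1, 1 / (i : ℝ) ^ 2) = 0 := by simp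
    rw [e1, sub_zero] at hbound
    have hbb : b ^ (-θ - 1) * b = b ^ (-θ) := by
      rw [← Real.rpow_add_one hb.ne']; congr 1; ring
    have hbp : 0 < b ^ (-θ - 1) := by positivity
    have hbp' : 0 < b ^ (-θ) := by positivity
    have hle : b ^ (-θ - 1) ≤ b ^ (-θ) := by
      rw [← hbb]; exact le_mul_of_one_le_right hbp.le hb1
    have hcot : ‖c * (π * Complex.cot (π * y) - 1 / (y : ℂ)) -
        (if n₀ = 0 then 0 else c * (1 / ((y : ℂ) - n₀)))‖ ≤ 6 * b ^ (-θ) := by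
      rcases Nat.eq_zero_or_pos n₀ with h0 | h0
      · rw [if_pos h0, sub_zero, norm_mul]
        rw [h0, Nat.cast_zero, sub_zero] at hn₀
        calc ‖c‖ * _ ≤ b ^ (-θ) * 4 :=
              mul_le_mul hcn (norm_cot_sub_inv_le hy0.ne' hn₀) (norm_nonneg _) (by positivity)
          _ ≤ 6 * b ^ (-θ) := by linarith
      · rw [if_neg h0.ne', ← mul_sub, norm_mul]
        have hδ0 : y - n₀ ≠ 0 := sub_ne_zero.mpr (by exact_mod_cast hinteg n₀)
        have hper : Complex.cot (π * y) = Complex.cot (π * ((y - n₀ : ℝ) : ℂ)) := by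
          have := cot_periodic_pi.nat_mul n₀ (π * ((y - n₀ : ℝ) : ℂ))
          rw [← this]; congr 1; push_cast; ring
        have hsplit : (π * Complex.cot (π * y) - 1 / (y : ℂ)) - 1 / ((y : ℂ) - n₀) =
            (π * Complex.cot (π * ((y - n₀ : ℝ) : ℂ)) - 1 / ((y - n₀ : ℝ) : ℂ)) - 1 / (y : ℂ) := by
          rw [hper]; push_cast; ring
        have hy2 : 1 / 2 ≤ y := by
          have h1 : (1 : ℝ) ≤ n₀ := by exact_mod_cast h0
          have := (abs_le.mp hn₀).1
          linarith
        have hy3 : ‖1 / (y : ℂ)‖ ≤ 2 := by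
          rw [norm_div, norm_one, Complex.norm_real, Real.norm_eq_abs, abs_of_pos hy0,
            div_le_iff₀ hy0]
          linarith
        rw [hsplit]
        calc ‖c‖ * _ ≤ b ^ (-θ) * 6 := by
              refine mul_le_mul hcn ?_ (norm_nonneg _) (by positivity)
              refine (norm_sub_le _ _).trans ?_
              have := norm_cot_sub_inv_le hδ0 hn₀
              linarith
          _ = 6 * b ^ (-θ) := by ring
    have htot : P + b ^ (-θ - 1) * (π ^ 2 / 6) + K * b ^ (-θ - 1) * ((4 + 8 * y) * ∑' k,
        ((fun j : ℤ => 1 / (j : ℝ) ^ 2) ∘ fun k : ℕ => ((k + 1 : ℕ) : ℤ) - n₀) k +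
          ∑ k ∈ Finset.range ⌊y⌋₊, if k ∈ Finset.range ⌊y⌋₊ then 1 / y else 0) ≤
        P + 2 * b ^ (-θ) + K * b ^ (-θ) * (20 * Z + 1) := by
      have hp2 : π ^ 2 / 6 ≤ 2 := by nlinarith [Real.pi_lt_d2]
      have hy4 : b ^ (-θ - 1) * (4 + 8 * y) ≤ 12 * b ^ (-θ) := by
        rw [← hbb]; nlinarith
      have i1 : b ^ (-θ - 1) * (π ^ 2 / 6) ≤ b ^ (-θ) * 2 := by gcongr
      have i2 : b ^ (-θ - 1) * (4 + 8 * y) * ∑' k,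
        ((fun j : ℤ => 1 / (j : ℝ) ^ 2) ∘ fun k : ℕ => ((k + 1 : ℕ) : ℤ) - n₀) k ≤
          12 * b ^ (-θ) * Z := by
        refine mul_le_mul hy4 hg3le ?_ (by positivity)
        exact tsum_nonneg fun k => by simp only [Function.comp]; positivity
      have i3 : b ^ (-θ - 1) * (∑ k ∈ Finset.range ⌊y⌋₊,
          if k ∈ Finset.range ⌊y⌋₊ then 1 / y else 0) ≤ b ^ (-θ) * 1 := by gcongr
      have i4 := mul_le_mul_of_nonneg_left (add_le_add i2 i3) hK0.le
      have i5 : 0 ≤ K * (b ^ (-θ) * Z) := by positivity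
      linarith
    have e2 : zetaH s b - dualSum b N θ t * dualFactor s =
        (zetaH s b - dualSum b N θ t * dualFactor s - (b : ℂ) ^ (1 - s) / (s - 1) -
          (b : ℂ) ^ (-s) / 2 - c * (π * Complex.cot (π * y) - 1 / (y : ℂ)) +
          (if n₀ = 0 then 0 else c * (1 / ((y : ℂ) - n₀)))) +
        ((c * (π * Complex.cot (π * y) - 1 / (y : ℂ)) -
        (if n₀ = 0 then 0 else c * (1 / ((y : ℂ) - n₀)))) + (b : ℂ) ^ (1 - s) / (s - 1) +
        (b : ℂ) ^ (-s) / 2) := by ring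
    rw [e2]
    have hB2 : ‖(b : ℂ) ^ (-s) / 2‖ ≤ b ^ (-θ) := by
      rw [norm_div, hB, Complex.norm_ofNat]; linarith
    refine (norm_add_le _ _).trans ?_
    have f1 := (hbound.trans htot)
    have f2 := (norm_add_le (c * (π * Complex.cot (π * y) - 1 / (y : ℂ)) -
        (if n₀ = 0 then 0 else c * (1 / ((y : ℂ) - n₀))) + (b : ℂ) ^ (1 - s) / (s - 1))
        ((b : ℂ) ^ (-s) / 2))
    have f3 := norm_add_le (c * (π * Complex.cot (π * y) - 1 / (y : ℂ)) -
        (if n₀ = 0 then 0 else c * (1 / ((y : ℂ) - n₀)))) ((b : ℂ) ^ (1 - s) / (s - 1))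
    have f4 : 0 ≤ b ^ (1 - θ) / t := by positivity
    have f5 : b ^ (1 - θ) / t ≤ (10 + K * (20 * Z + 1)) * (b ^ (1 - θ) / t) := by
      refine le_mul_of_one_le_left f4 ?_
      have : 0 ≤ K * (20 * Z + 1) := by positivity
      linarith
    linarith
  · have hν1 : (1 : ℝ) ≤ ((k + 1 : ℕ) : ℝ) := by exact_mod_cast Nat.le_add_left 1 k
    have hν0 : (0 : ℝ) < ((k + 1 : ℕ) : ℝ) := by linarith
    have n2 := norm_oscInt_neg_sub_le hb hθ hθ1 ht hν0
    rw [← hs] at n2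
    have e : ∀ w₁ w₂ A B A' B' X : ℂ, w₁ * A + w₂ * B - (w₁ * A' + w₂ * B') + X =
      (w₁ * (A - A') + X) + w₂ * (B - B') := fun _ _ _ _ _ _ _ => by ring
    rw [e]
    refine (norm_add_le _ _).trans ?_
    have n3 : ‖wave (-((k + 1 : ℕ) : ℝ)) (-b) * (oscInt b s (-((k + 1 : ℕ) : ℝ)) -
        I * (ampOne θ t (-((k + 1 : ℕ) : ℝ)) b * osc t (-((k + 1 : ℕ) : ℝ)) b))‖ ≤
        b ^ (-θ - 1) * (1 / ((k + 1 : ℕ) : ℝ) ^ 2) := by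
      rw [norm_mul, norm_wave, one_mul, mul_one_div]; exact n2
    have hind : (0 : ℝ) ≤ if k ∈ Finset.range ⌊y⌋₊ then 1 / y else 0 := by
      split_ifs <;> positivity
    rcases eq_or_ne (k + 1) n₀ with hk | hk
    · have n4 : ‖wave ((k + 1 : ℕ) : ℝ) (-b) * (dualRem b θ t ((k + 1 : ℕ) : ℝ) -
          I * (ampOne θ t ((k + 1 : ℕ) : ℝ) b * osc t ((k + 1 : ℕ) : ℝ) b)) +
          (if k + 1 = n₀ then c * (1 / ((y : ℂ) - n₀)) else 0)‖ ≤ P := by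
        rw [if_pos hk, mul_sub, wave_mul_main hb (hne k), ← hs, ← hy, ← hc, hk]
        have e3 : ((n₀ : ℝ) : ℂ) = n₀ := by simp
        rw [e3, sub_add_cancel, norm_mul, norm_wave, one_mul, hP, if_neg (by omega)]
      have n5 : 0 ≤ K * b ^ (-θ - 1) * ((4 + 8 * y) *
          ((fun j : ℤ => 1 / (j : ℝ) ^ 2) ∘ fun k : ℕ => ((k + 1 : ℕ) : ℤ) - n₀) k +
          if k ∈ Finset.range ⌊y⌋₊ then 1 / y else 0) := by
        simp only [Function.comp]; positivity
      rw [if_pos hk] at n4 ⊢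
      rw [if_pos hk]
      linarith
    · have n4 := norm_dualRem_sub_le hb hθ hθ1 ht hν1 (hne k)
      rw [← hy] at n4
      rw [if_neg hk, if_neg hk, add_zero, zero_add, norm_mul, norm_wave, one_mul,
        add_comm (b ^ (-θ - 1) * _)]
      refine add_le_add (n4.trans ?_) n3
      refine mul_le_mul_of_nonneg_left ?_ (by positivity)
      have hj1 : (1 : ℝ) ≤ |((k + 1 : ℕ) : ℝ) - n₀| := by
        have : ((k + 1 : ℕ) : ℤ) - n₀ ≠ 0 := by
          rw [sub_ne_zero]; exact_mod_cast hk
        have := Int.one_le_abs this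
        exact_mod_cast this
      have hd : |((k + 1 : ℕ) : ℝ) - n₀| / 2 ≤ |((k + 1 : ℕ) : ℝ) - y| := by
        have := abs_sub_abs_le_abs_sub (((k + 1 : ℕ) : ℝ) - n₀) (y - n₀)
        rw [sub_sub_sub_cancel_right] at this
        linarith
      simp only [Function.comp]
      push_cast
      push_cast at hd hj1
      set j : ℝ := |(k : ℝ) + 1 - n₀| with hj
      set d : ℝ := |(k : ℝ) + 1 - y| with hdd
      have hj0 : 0 < j := by linarith
      have hd0 : 0 < d := by linarith
      rw [← sq_abs ((k : ℝ) + 1 - n₀), ← hj]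
      have g1 : 1 / d ^ 2 ≤ 4 * (1 / j ^ 2) := by
        have : 1 / d ^ 2 ≤ 1 / (j / 2) ^ 2 := by gcongr
        refine this.trans_eq ?_
        field_simp; norm_num
      have g2 : y / d ^ 3 ≤ 8 * y * (1 / j ^ 2) := by
        have : y / d ^ 3 ≤ y / ((j / 2) ^ 2 * (1 / 2)) := by
          gcongr
          rw [pow_succ d 2]
          exact mul_le_mul (pow_le_pow_left₀ (by positivity) hd 2) (by linarith) (by norm_num)
            (by positivity)
        refine this.trans_eq ?_
        field_simp; norm_num
      have g3 : (if (k : ℝ) + 1 < y then 1 / y else 0) ≤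
          if k ∈ Finset.range ⌊y⌋₊ then 1 / y else 0 := by
        by_cases h : (k : ℝ) + 1 < y
        · rw [if_pos h, if_pos]
          rw [Finset.mem_range]
          refine Nat.lt_of_succ_le (Nat.le_floor ?_)
          push_cast; exact h.le
        · rw [if_neg h]; exact hind
      rw [add_mul]
      refine add_le_add (add_le_add g1 g2) ?_
      convert! g3

/-! ### Mean square of the remainder of the approximate functional equation -/

lemma sum_succ_rpow_le {p : ℝ} (hp : 0 < p) (hp1 : p ≤ 1) (n : ℕ) :
    ∑ k ∈ Finset.range n, ((k + 1 : ℕ) : ℝ) ^ (p - 1) ≤ (n : ℝ) ^ p / p := by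
  induction n with
  | zero => simp [Real.zero_rpow hp.ne']
  | succ n ih =>
    rw [Finset.sum_range_succ]
    have hx : (0 : ℝ) < ((n + 1 : ℕ) : ℝ) := by positivity
    have hx1 : (1 : ℝ) ≤ ((n + 1 : ℕ) : ℝ) := by exact_mod_cast Nat.le_add_left 1 n
    have hn : (n : ℝ) = ((n + 1 : ℕ) : ℝ) - 1 := by push_cast; ring
    set x : ℝ := ((n + 1 : ℕ) : ℝ)
    have h1 : (n : ℝ) ^ p ≤ x ^ p - p * x ^ (p - 1) := by
      have e : (n : ℝ) = x * (1 + -(1 / x)) := by rw [hn]; field_simp; ring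
      have h2 : -1 ≤ -(1 / x) := by
        rw [neg_le_neg_iff, div_le_one hx]; exact hx1
      rw [e, Real.mul_rpow hx.le (by linarith)]
      calc x ^ p * (1 + -(1 / x)) ^ p ≤ x ^ p * (1 + p * -(1 / x)) := by
            gcongr; exact rpow_one_add_le_one_add_mul_self h2 hp.le hp1
        _ = x ^ p - p * x ^ (p - 1) := by rw [Real.rpow_sub_one hx.ne']; ring
    have h3 : (n : ℝ) ^ p / p ≤ x ^ p / p - x ^ (p - 1) := by
      rw [div_le_iff₀ hp, sub_mul, div_mul_cancel₀ _ hp.ne']; linarith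
    linarith

lemma norm_dualSum_le {b θ t : ℝ} (hb : 0 < b) (hθ : 0 < θ) (hθ1 : θ < 1) (ht : 0 < t) (N : ℕ) :
    ‖dualSum b N θ t‖ ≤ (t / (2 * π * b)) ^ θ / θ := by
  classical
  have hpi := Real.pi_pos
  set y := t / (2 * π * b) with hy
  have hy0 : 0 < y := by positivity
  calc ‖dualSum b N θ t‖ ≤ ∑ k ∈ Finset.range N,
        if k ∈ Finset.range ⌊y⌋₊ then ((k + 1 : ℕ) : ℝ) ^ (θ - 1) else 0 := by
        refine (norm_sum_le _ _).trans (Finset.sum_le_sum fun k _ => ?_)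
        split_ifs with h1 h2 h2
        · rw [norm_mul, norm_wave, one_mul, Complex.norm_cpow_eq_rpow_re_of_pos (by positivity)]
          simp
        · exfalso
          rw [Finset.mem_range, not_lt] at h2
          have h3 : ((k + 1 : ℕ) : ℝ) ≤ y := by rw [hy, le_div_iff₀ (by positivity)]; linarith
          have := Nat.le_floor h3
          omega
        · rw [norm_zero]; positivity
        · simp
    _ ≤ ∑ k ∈ Finset.range ⌊y⌋₊, ((k + 1 : ℕ) : ℝ) ^ (θ - 1) := by
        rw [Finset.sum_ite_mem]
        exact Finset.sum_le_sum_of_subset_of_nonneg Finset.inter_subset_right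
          fun _ _ _ => by positivity
    _ ≤ (⌊y⌋₊ : ℝ) ^ θ / θ := sum_succ_rpow_le hθ hθ1.le _
    _ ≤ y ^ θ / θ := by
        gcongr
        exact Nat.floor_le hy0.le

lemma dualSum_eq_zero {b θ t : ℝ} (hb : 0 < b) (ht : t < 2 * π * b) (N : ℕ) :
    dualSum b N θ t = 0 := by
  refine Finset.sum_eq_zero fun k _ => if_neg ?_
  have h1 : (1 : ℝ) ≤ ((k + 1 : ℕ) : ℝ) := by exact_mod_cast Nat.le_add_left 1 k
  have : 2 * π * b * 1 ≤ 2 * π * b * ((k + 1 : ℕ) : ℝ) := by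
    have := Real.pi_pos
    gcongr
  linarith

lemma exists_norm_dualSum_mul_sub_le {θ : ℝ} (hθ : 0 < θ) (hθ1 : θ < 1) :
    ∃ C > 0, ∀ (b t : ℝ) (N : ℕ), 1 ≤ b → 0 < t →
      ‖dualSum b N θ t * dualFactor (θ + t * I) - dualSum b N θ t * dualMain θ t‖ ≤
        C * b ^ (-θ) := by
  obtain ⟨C, hC, h⟩ := exists_norm_dualFactor_sub_le
  refine ⟨C / θ, by positivity, fun b t N hb ht => ?_⟩
  have hpi := Real.pi_gt_three
  have hb0 : 0 < b := by linarith
  rcases lt_or_ge t (2 * π * b) with h1 | h1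
  · rw [dualSum_eq_zero hb0 h1]; simp; positivity
  · have ht6 : 6 ≤ t := by nlinarith
    rw [← mul_sub, norm_mul]
    calc _ ≤ (t / (2 * π * b)) ^ θ / θ * (C / t * (t / (2 * π)) ^ (1 / 2 - θ)) :=
          mul_le_mul (norm_dualSum_le hb0 hθ hθ1 ht N) (h θ t hθ.le hθ1.le (by linarith))
            (norm_nonneg _) (by positivity)
      _ = C / θ * b ^ (-θ) * ((t / (2 * π)) ^ (1 / 2 : ℝ) / t) := by
          have e1 : t / (2 * π * b) = t / (2 * π) * b⁻¹ := by field_simp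
          have e2 : (t / (2 * π)) ^ (1 / 2 : ℝ) =
              (t / (2 * π)) ^ θ * (t / (2 * π)) ^ (1 / 2 - θ) := by
            rw [← Real.rpow_add (by positivity)]; congr 1; ring
          rw [e1, Real.mul_rpow (by positivity) (by positivity), Real.inv_rpow hb0.le,
            Real.rpow_neg hb0.le, e2]
          field_simp
      _ ≤ C / θ * b ^ (-θ) * 1 := by
          gcongr
          rw [div_le_one ht]
          calc (t / (2 * π)) ^ (1 / 2 : ℝ) ≤ t ^ (1 / 2 : ℝ) := by
                gcongr; exact div_le_self ht.le (by linarith)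
            _ ≤ t ^ (1 : ℝ) := Real.rpow_le_rpow_of_exponent_le (by linarith) (by norm_num)
            _ = t := Real.rpow_one t
      _ = C / θ * b ^ (-θ) := mul_one _

lemma integral_lorentz_le {c k x α β : ℝ} (hc : 0 < c) (hk : 0 < k) :
    ∫ t in α..β, c / (1 + c * (t / k - x) ^ 2) ≤ π * k * √c := by
  have hd : ∀ t : ℝ, HasDerivAt (fun t => k * √c * Real.arctan (√c * (t / k - x)))
      (c / (1 + c * (t / k - x) ^ 2)) t := by
    intro t
    have h1 : HasDerivAt (fun t => √c * (t / k - x)) (√c * (1 / k)) t :=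
      (((hasDerivAt_id t).div_const k).sub_const x).const_mul _
    refine ((h1.arctan).const_mul (k * √c)).congr_deriv ?_
    rw [mul_pow, Real.sq_sqrt hc.le]
    have : 1 + c * (t / k - x) ^ 2 ≠ 0 := by positivity
    field_simp
    rw [Real.sq_sqrt hc.le]
  have hcont : Continuous fun t : ℝ => c / (1 + c * (t / k - x) ^ 2) :=
    continuous_const.div (by fun_prop) fun t => by positivity
  rw [intervalIntegral.integral_eq_sub_of_hasDerivAt (fun t _ => hd t)
    (hcont.intervalIntegrable _ _), ← mul_sub]
  have h1 := (Real.arctan_lt_pi_div_two (√c * (β / k - x))).le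
  have h2 := (Real.neg_pi_div_two_lt_arctan (√c * (α / k - x))).le
  calc _ ≤ k * √c * π := by gcongr; linarith
    _ = π * k * √c := by ring

lemma sq_dualRem_le {b θ t : ℝ} {n : ℕ} (hb : 1 ≤ b) (hθ : 0 < θ) (hθ1 : θ < 1) (ht : 1 ≤ t)
    (hn : 1 ≤ n) (hne : (n : ℝ) ≠ t / (2 * π * b)) (hn2 : |t / (2 * π * b) - n| ≤ 1 / 2) :
    ‖dualRem b θ t n‖ ^ 2 ≤
      b ^ (-(2 * θ)) * (2 * (27 * b / n / (1 + 27 * b / n * (t / (2 * π * b) - n) ^ 2))) := by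
  have hpi := Real.pi_gt_three
  have hb0 : 0 < b := by linarith
  have hn1 : (1 : ℝ) ≤ n := by exact_mod_cast hn
  have hab := abs_le.mp hn2
  have h1 := norm_dualRem_le hb0 hθ hθ1 (by linarith) (by linarith) hne
  have h2 := norm_dualRem_le_sqrt hb0 hθ hθ1 ht (by linarith) hne (by linarith)
  have hyn : (n : ℝ) / 2 ≤ t / (2 * π * b) := by linarith
  have htn : π * b * n ≤ t := by
    rw [le_div_iff₀ (by positivity)] at hyn; linarith
  rw [abs_sub_comm] at h1
  have hy0 : t / (2 * π * b) - n ≠ 0 := sub_ne_zero.mpr hne.symm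
  set δ := t / (2 * π * b) - n
  set c := 27 * b / n with hc
  have hc0 : 0 < c := by positivity
  have hδ : 0 < |δ| := abs_pos.mpr hy0
  have e : b ^ (-(2 * θ)) = (b ^ (-θ)) ^ 2 := by
    rw [← Real.rpow_mul_natCast hb0.le]; congr 1; push_cast; ring
  have e1 : b ^ (1 - θ) = b ^ (-θ) * b := by
    rw [← Real.rpow_add_one hb0.ne']; congr 1; ring
  have s1 : ‖dualRem b θ t n‖ ^ 2 ≤ (b ^ (-θ)) ^ 2 * (1 / δ ^ 2) := by
    calc _ ≤ (b ^ (-θ) / |δ|) ^ 2 := pow_le_pow_left₀ (norm_nonneg _) h1 2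
      _ = _ := by rw [div_pow, sq_abs]; ring
  have s2 : ‖dualRem b θ t n‖ ^ 2 ≤ (b ^ (-θ)) ^ 2 * c := by
    calc _ ≤ (9 * (b ^ (1 - θ) / √t)) ^ 2 := pow_le_pow_left₀ (norm_nonneg _) h2 2
      _ = (b ^ (-θ)) ^ 2 * (81 * b ^ 2 / t) := by
          rw [e1, mul_pow, div_pow, Real.sq_sqrt (by linarith)]; ring
      _ ≤ (b ^ (-θ)) ^ 2 * c := by
          gcongr
          rw [hc, div_le_div_iff₀ (by linarith) (by positivity)]
          have : 3 * b * n ≤ t := by nlinarith [mul_pos hb0 (show (0:ℝ) < n by linarith)]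
          nlinarith
  rw [e]
  rcases le_total (c * δ ^ 2) 1 with h | h
  · refine s2.trans ?_
    gcongr
    rw [← mul_div_assoc, le_div_iff₀ (by positivity)]
    nlinarith
  · refine s1.trans ?_
    gcongr
    rw [← mul_div_assoc, div_le_div_iff₀ (by positivity) (by positivity)]
    nlinarith

lemma ae_div_ne_int {k : ℝ} (hk : k ≠ 0) : ∀ᵐ t : ℝ, ∀ n : ℤ, t / k ≠ n := by
  rw [ae_all_iff]
  intro n
  have : ({t : ℝ | ¬ t / k ≠ n}) = {(n : ℝ) * k} := by
    ext t; simp [div_eq_iff hk]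
  rw [ae_iff, this]
  exact measure_singleton _

theorem exists_integral_sq_rem_le {θ : ℝ} (hθ : 0 < θ) (hθ1 : θ < 1) :
    ∃ C > 0, ∀ (b T : ℝ) (N : ℕ), 1 ≤ b → 1 ≤ T → T ≤ b ^ 2 → T < 2 * π * b * (N + 1) →
      (N : ℝ) ≤ b →
      ∫ t in (1 : ℝ)..T, ‖zetaH (θ + t * I) b - dualSum b N θ t * dualMain θ t‖ ^ 2 ≤
        C * b ^ (2 - 2 * θ) := by
  obtain ⟨C₁, hC₁, h1⟩ := exists_norm_zetaH_sub_dualSum_le hθ hθ1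
  obtain ⟨C₂, hC₂, h2⟩ := exists_norm_dualSum_mul_sub_le hθ hθ1
  refine ⟨3 * ((C₁ + C₂) ^ 2 + (C₁ + C₂) ^ 2 + 2 * (2 * π ^ 2 * (√27 * 4))), by positivity,
    fun b T N hb hT hTb hN hNb => ?_⟩
  have hpi := Real.pi_gt_three
  have hb0 : 0 < b := by linarith
  set k := 2 * π * b with hk
  have hk0 : 0 < k := by positivity
  set C := C₁ + C₂ with hC
  set L : ℕ → ℝ → ℝ := fun j t =>
    27 * b / ((j + 1 : ℕ) : ℝ) / (1 + 27 * b / ((j + 1 : ℕ) : ℝ) * (t / k - ((j + 1 : ℕ) : ℝ)) ^ 2)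
    with hL
  have hLpos : ∀ j t, 0 ≤ L j t := fun j t => by rw [hL]; positivity
  have hLcont : ∀ j, Continuous (L j) := fun j =>
    continuous_const.div (by fun_prop) fun t => by positivity
  have hpt : ∀ t ∈ Ioc 1 T, (∀ n : ℤ, t / k ≠ n) →
      ‖zetaH (θ + t * I) b - dualSum b N θ t * dualMain θ t‖ ^ 2 ≤
        3 * (C ^ 2 * b ^ (2 - 2 * θ) * t ^ (-2 : ℝ) + C ^ 2 * b ^ (-(2 * θ)) +
          b ^ (-(2 * θ)) * (2 * ∑ j ∈ Finset.range (N + 1), L j t)) := by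
    intro t ht hinteg
    have ht0 : 0 < t := by linarith [ht.1]
    set n₀ := (round (t / k)).toNat with hn₀
    have hy0 : 0 < t / k := by positivity
    have hr0 : 0 ≤ round (t / k) := by
      rw [round_eq]; exact Int.floor_nonneg.mpr (by positivity)
    have hcast : (n₀ : ℝ) = (round (t / k) : ℝ) := by
      have : (n₀ : ℤ) = round (t / k) := Int.toNat_of_nonneg hr0
      exact_mod_cast this
    have hn2 : |t / k - n₀| ≤ 1 / 2 := by rw [hcast]; exact abs_sub_round _
    have hb1 := h1 b t N n₀ hb ht.1.le (ht.2.trans hTb) (ht.2.trans_lt hN) hinteg hn2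
    have hb2 := h2 b t N hb ht0
    set P := if n₀ = 0 then 0 else ‖dualRem b θ t n₀‖ with hP
    have hP2 : P ^ 2 ≤ b ^ (-(2 * θ)) * (2 * ∑ j ∈ Finset.range (N + 1), L j t) := by
      rcases Nat.eq_zero_or_pos n₀ with h0 | h0
      · rw [hP, if_pos h0]
        have : 0 ≤ ∑ j ∈ Finset.range (N + 1), L j t := Finset.sum_nonneg fun j _ => hLpos j t
        rw [zero_pow two_ne_zero]; positivity
      · rw [hP, if_neg h0.ne']
        refine (sq_dualRem_le hb hθ hθ1 ht.1.le h0 (by exact_mod_cast (hinteg n₀).symm) hn2).trans ?_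
        gcongr
        obtain ⟨j₀, hj₀⟩ : ∃ j₀, n₀ = j₀ + 1 := ⟨n₀ - 1, by omega⟩
        have hj : j₀ ∈ Finset.range (N + 1) := by
          rw [Finset.mem_range]
          have h5 : t / k < N + 1 := by
            rw [div_lt_iff₀ hk0]; linarith [ht.2]
          have h6 : (n₀ : ℝ) < (N : ℝ) + 2 := by
            have := (abs_le.mp hn2).1; linarith
          have : n₀ < N + 2 := by exact_mod_cast h6
          omega
        have := Finset.single_le_sum (f := fun j => L j t) (fun j _ => hLpos j t) hj
        refine le_trans (le_of_eq ?_) this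
        rw [hL, hj₀]
    have htri : ‖zetaH (θ + t * I) b - dualSum b N θ t * dualMain θ t‖ ≤
        C * (b ^ (1 - θ) / t) + C * b ^ (-θ) + P := by
      have := norm_add_le (zetaH (θ + t * I) b - dualSum b N θ t * dualFactor (θ + t * I))
        (dualSum b N θ t * dualFactor (θ + t * I) - dualSum b N θ t * dualMain θ t)
      rw [sub_add_sub_cancel] at this
      have h7 : 0 ≤ C₂ * (b ^ (1 - θ) / t) := by positivity
      rw [hC]
      linarith
    have hsq : ∀ x y z : ℝ, (x + y + z) ^ 2 ≤ 3 * (x ^ 2 + y ^ 2 + z ^ 2) := fun x y z => by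
      nlinarith [sq_nonneg (x - y), sq_nonneg (y - z), sq_nonneg (x - z)]
    have e1 : (C * (b ^ (1 - θ) / t)) ^ 2 = C ^ 2 * b ^ (2 - 2 * θ) * t ^ (-2 : ℝ) := by
      rw [mul_pow, div_pow, ← Real.rpow_mul_natCast hb0.le, Real.rpow_neg ht0.le]
      rw [show (1 - θ) * ((2 : ℕ) : ℝ) = 2 - 2 * θ by push_cast; ring]
      rw [show t ^ (2 : ℝ) = t ^ 2 by norm_cast]
      ring
    have e2 : (C * b ^ (-θ)) ^ 2 = C ^ 2 * b ^ (-(2 * θ)) := by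
      rw [mul_pow, ← Real.rpow_mul_natCast hb0.le]
      rw [show -θ * ((2 : ℕ) : ℝ) = -(2 * θ) by push_cast; ring]
    calc _ ≤ (C * (b ^ (1 - θ) / t) + C * b ^ (-θ) + P) ^ 2 :=
          pow_le_pow_left₀ (norm_nonneg _) htri 2
      _ ≤ _ := hsq _ _ _
      _ ≤ _ := by rw [e1, e2]; gcongr
  have hi1 : IntervalIntegrable (fun t : ℝ => C ^ 2 * b ^ (2 - 2 * θ) * t ^ (-2 : ℝ)) volume 1 T := by
    refine ContinuousOn.intervalIntegrable (continuousOn_const.mul fun t ht => ?_)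
    rw [uIcc_of_le hT] at ht
    exact (Real.continuousAt_rpow_const _ _ (Or.inl (by linarith [ht.1]))).continuousWithinAt
  have hi2 : IntervalIntegrable (fun t : ℝ => C ^ 2 * b ^ (-(2 * θ))) volume 1 T :=
    intervalIntegrable_const
  have hLsum : Continuous fun t => ∑ j ∈ Finset.range (N + 1), L j t :=
    continuous_finsetSum _ fun j _ => hLcont j
  have hi3 : IntervalIntegrable (fun t : ℝ =>
      b ^ (-(2 * θ)) * (2 * ∑ j ∈ Finset.range (N + 1), L j t)) volume 1 T :=
    ((hLsum.const_mul 2).const_mul _).intervalIntegrable _ _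
  have hinteg := ((hi1.add hi2).add hi3).const_mul 3
  have hmono : ∫ t in (1 : ℝ)..T, ‖zetaH (θ + t * I) b - dualSum b N θ t * dualMain θ t‖ ^ 2 ≤
      ∫ t in (1 : ℝ)..T, 3 * (C ^ 2 * b ^ (2 - 2 * θ) * t ^ (-2 : ℝ) + C ^ 2 * b ^ (-(2 * θ)) +
          b ^ (-(2 * θ)) * (2 * ∑ j ∈ Finset.range (N + 1), L j t)) := by
    rw [intervalIntegral.integral_of_le hT, intervalIntegral.integral_of_le hT]
    refine integral_mono_of_nonneg (Eventually.of_forall fun t => by positivity)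
      ((intervalIntegrable_iff_integrableOn_Ioc_of_le hT).mp hinteg) ?_
    filter_upwards [ae_restrict_mem measurableSet_Ioc, ae_restrict_of_ae (ae_div_ne_int hk0.ne')]
      with t ht1 ht2
    exact hpt t ht1 ht2
  refine hmono.trans ?_
  rw [intervalIntegral.integral_const_mul, intervalIntegral.integral_add (hi1.add hi2) hi3,
    intervalIntegral.integral_add hi1 hi2, intervalIntegral.integral_const_mul,
    intervalIntegral.integral_const_mul, intervalIntegral.integral_const_mul,
    intervalIntegral.integral_const_mul, intervalIntegral.integral_const, smul_eq_mul]
  have hbe : b ^ (-(2 * θ)) * b ^ 2 = b ^ (2 - 2 * θ) := by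
    rw [← Real.rpow_add_natCast hb0.ne']; congr 1; push_cast; ring
  have j1 : ∫ t in (1 : ℝ)..T, t ^ (-2 : ℝ) ≤ 1 := by
    rw [integral_rpow (Or.inr ⟨by norm_num, by rw [uIcc_of_le hT]; simp⟩)]
    have : (0 : ℝ) ≤ T ^ (-2 + 1 : ℝ) := by positivity
    rw [Real.one_rpow]
    have e : (-2 + 1 : ℝ) = -1 := by norm_num
    rw [e] at this ⊢
    rw [div_le_iff_of_neg (by norm_num)]; linarith
  have j2 : (T - 1) * (C ^ 2 * b ^ (-(2 * θ))) ≤ C ^ 2 * b ^ (2 - 2 * θ) := by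
    calc (T - 1) * (C ^ 2 * b ^ (-(2 * θ))) ≤ b ^ 2 * (C ^ 2 * b ^ (-(2 * θ))) := by
          gcongr; linarith
      _ = _ := by rw [← hbe]; ring
  have j3 : ∫ t in (1 : ℝ)..T, ∑ j ∈ Finset.range (N + 1), L j t ≤
      2 * π ^ 2 * (√27 * 4) * b ^ 2 := by
    rw [intervalIntegral.integral_finsetSum fun j _ => (hLcont j).intervalIntegrable _ _]
    calc _ ≤ ∑ j ∈ Finset.range (N + 1), π * k * √(27 * b / ((j + 1 : ℕ) : ℝ)) :=
          Finset.sum_le_sum fun j _ => integral_lorentz_le (by positivity) hk0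
      _ = π * k * √27 * √b * ∑ j ∈ Finset.range (N + 1), ((j + 1 : ℕ) : ℝ) ^ ((1 / 2 : ℝ) - 1) := by
          rw [Finset.mul_sum]
          refine Finset.sum_congr rfl fun j _ => ?_
          have hj : (0 : ℝ) < ((j + 1 : ℕ) : ℝ) := by positivity
          rw [Real.sqrt_div (by positivity), Real.sqrt_mul (by norm_num),
            show ((1 / 2 : ℝ) - 1) = -(1 / 2) by norm_num, Real.rpow_neg hj.le,
            ← Real.sqrt_eq_rpow]
          ring
      _ ≤ π * k * √27 * √b * (((N + 1 : ℕ) : ℝ) ^ (1 / 2 : ℝ) / (1 / 2)) := by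
          gcongr; exact sum_succ_rpow_le (by norm_num) (by norm_num) _
      _ ≤ π * k * √27 * √b * (2 * √b / (1 / 2)) := by
          gcongr
          rw [← Real.sqrt_eq_rpow]
          have h4 : ((N + 1 : ℕ) : ℝ) ≤ 2 ^ 2 * b := by push_cast; linarith
          calc √((N + 1 : ℕ) : ℝ) ≤ √(2 ^ 2 * b) := Real.sqrt_le_sqrt h4
            _ = 2 * √b := by rw [Real.sqrt_mul (by norm_num), Real.sqrt_sq (by norm_num)]
      _ = 2 * π ^ 2 * (√27 * 4) * b ^ 2 := by
          have := Real.mul_self_sqrt hb0.le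
          rw [hk]
          linear_combination (8 * π ^ 2 * b * √27) * this
  have hA : 0 ≤ C ^ 2 * b ^ (2 - 2 * θ) := by positivity
  have k1 : C ^ 2 * b ^ (2 - 2 * θ) * ∫ t in (1 : ℝ)..T, t ^ (-2 : ℝ) ≤
      C ^ 2 * b ^ (2 - 2 * θ) * 1 := by gcongr
  have k3 : b ^ (-(2 * θ)) * (2 * ∫ t in (1 : ℝ)..T, ∑ j ∈ Finset.range (N + 1), L j t) ≤
      2 * (2 * π ^ 2 * (√27 * 4)) * b ^ (2 - 2 * θ) := by
    calc _ ≤ b ^ (-(2 * θ)) * (2 * (2 * π ^ 2 * (√27 * 4) * b ^ 2)) := by gcongr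
      _ = _ := by rw [← hbe]; ring
  linarith

/-! ### Convexity bounds -/

lemma cube_le_exp_sq {u : ℝ} (hu : 0 ≤ u) : (u + 3) ^ 3 ≤ 648 * Real.exp (u ^ 2) := by
  have h1 := Real.quadratic_le_exp_of_nonneg (sq_nonneg u)
  have h2 : (u + 3) ^ 2 ≤ 18 * (1 + u ^ 2) := by nlinarith [sq_nonneg (u - 3)]
  have h3 : (u + 3) ^ 4 ≤ (18 * (1 + u ^ 2)) ^ 2 := by
    calc (u + 3) ^ 4 = ((u + 3) ^ 2) ^ 2 := by ring
      _ ≤ _ := pow_le_pow_left₀ (by positivity) h2 2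
  have h4 : (u + 3) ^ 3 ≤ (u + 3) ^ 4 := pow_le_pow_right₀ (by linarith) (by norm_num)
  nlinarith

lemma differentiable_sq_mul {H : ℂ → ℂ} (hd : ∀ s ≠ 1, DifferentiableAt ℂ H s)
    (hlim : Tendsto (fun s => (s - 1) ^ 2 * H s) (𝓝[≠] 1) (𝓝 0)) :
    Differentiable ℂ fun s => (s - 1) ^ 2 * H s := by
  have hne : ∀ s ≠ 1, DifferentiableAt ℂ (fun s => (s - 1) ^ 2 * H s) s := fun s hs =>
    DifferentiableAt.mul (by fun_prop) (hd s hs)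
  intro s
  rcases eq_or_ne s 1 with rfl | hs
  · refine (Complex.analyticAt_of_differentiable_on_punctured_nhds_of_continuousAt ?_
      ?_).differentiableAt
    · filter_upwards [self_mem_nhdsWithin] with z hz using hne z hz
    · rw [continuousAt_iff_punctured_nhds]; simpa using hlim
  · exact hne s hs

/-- The convexity bound, from the bounds on the lines `Re s = 1 + δ` and `Re s = -δ`. -/
theorem exists_convexity_bound {H : ℂ → ℂ} (hd : ∀ s ≠ 1, DifferentiableAt ℂ H s)
    (hlim : Tendsto (fun s => (s - 1) ^ 2 * H s) (𝓝[≠] 1) (𝓝 0)) {K A : ℝ} (hK : 0 < K)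
    (hright : ∀ δ s, 0 < δ → δ ≤ 1 / 2 → s.re = 1 + δ → ‖H s‖ ≤ K / δ)
    (hleft : ∀ δ s, 0 < δ → δ ≤ 1 / 2 → s.re = -δ → ‖H s‖ ≤ K / δ * (|s.im| + 1) ^ (1 / 2 + δ))
    (hgrow : ∀ s : ℂ, -(1 / 2) ≤ s.re → s.re ≤ 3 / 2 → 4 ≤ |s.im| → ‖H s‖ ≤ A * |s.im| ^ 4) :
    ∃ C > 0, ∀ x t : ℝ, 10 ≤ |t| → 0 ≤ x → x ≤ 1 + 1 / Real.log |t| →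
      ‖H (x + t * I)‖ ≤ C * |t| ^ ((1 - x) / 2) * Real.log |t| := by
  refine ⟨2 * Real.exp 4 * K * 648, by positivity, fun x t ht hx0 hx1 => ?_⟩
  set T := |t| with hT
  have hT0 : 0 < T := by linarith
  have hlog : 2 ≤ Real.log T := by
    rw [Real.le_log_iff_exp_le hT0]
    have h1 := Real.exp_one_lt_d9
    have : Real.exp 2 = Real.exp 1 * Real.exp 1 := by rw [← Real.exp_add]; norm_num
    rw [this]; nlinarith [Real.exp_pos 1]
  set δ := 1 / Real.log T with hδ
  have hδ0 : 0 < δ := by positivity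
  have hδ1 : δ ≤ 1 / 2 := by rw [hδ]; gcongr
  have hKδ : K / δ = K * Real.log T := by rw [hδ]; field_simp
  have hTδ : T ^ (δ / 2) ≤ 2 := by
    have : T ^ (δ / 2) = Real.exp (1 / 2) := by
      rw [Real.rpow_def_of_pos hT0, hδ]
      congr 1; field_simp
    rw [this]
    have h1 := Real.exp_one_lt_d9
    have h2 : Real.exp (1 / 2) * Real.exp (1 / 2) = Real.exp 1 := by
      rw [← Real.exp_add]; norm_num
    nlinarith [Real.exp_pos (1 / 2)]
  set s₀ : ℂ := x + t * I with hs₀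
  have hs₀re : s₀.re = x := by simp [hs₀]
  have hs₀im : s₀.im = t := by simp [hs₀]
  set f : ℂ → ℂ := fun z => (z - 1) ^ 2 * H z * (T : ℂ) ^ ((z - 1) / 2) * Complex.exp ((z - s₀) ^ 2)
    with hf
  have hTc : (T : ℂ) ≠ 0 := by exact_mod_cast hT0.ne'
  have hfd : Differentiable ℂ f := by
    refine ((differentiable_sq_mul hd hlim).mul ?_).mul ?_
    · exact fun z => DifferentiableAt.const_cpow (by fun_prop) (Or.inl hTc)
    · fun_prop
  have hnormf : ∀ z : ℂ, ‖f z‖ = ‖z - 1‖ ^ 2 * ‖H z‖ * T ^ ((z.re - 1) / 2) *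
      Real.exp ((z.re - x) ^ 2 - (z.im - t) ^ 2) := by
    intro z
    rw [hf]
    simp only [norm_mul, norm_pow]
    rw [Complex.norm_cpow_eq_rpow_re_of_pos hT0, Complex.norm_exp]
    congr 2
    · congr 1; simp
    · rw [pow_two, Complex.mul_re, Complex.sub_re, Complex.sub_im, hs₀re, hs₀im]; ring
  have hz1 : ∀ z : ℂ, -(1 / 2) ≤ z.re → z.re ≤ 3 / 2 → ‖z - 1‖ ≤ |z.im| + 2 := by
    intro z h1 h2
    have := Complex.norm_le_abs_re_add_abs_im (z - 1)
    simp only [Complex.sub_re, Complex.one_re, Complex.sub_im, Complex.one_im, sub_zero] at this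
    have h3 : |z.re - 1| ≤ 2 := by rw [abs_le]; constructor <;> linarith
    linarith
  have hexp : ∀ z : ℂ, -δ ≤ z.re → z.re ≤ 1 + δ →
      Real.exp ((z.re - x) ^ 2 - (z.im - t) ^ 2) ≤ Real.exp 4 * Real.exp (-(z.im - t) ^ 2) := by
    intro z h1 h2
    rw [← Real.exp_add, Real.exp_le_exp]
    have h3 : |z.re - x| ≤ 2 := by rw [abs_le]; constructor <;> linarith
    have h4 : (z.re - x) ^ 2 ≤ 4 := by rw [← sq_abs]; nlinarith [abs_nonneg (z.re - x)]
    linarith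
  have hshift : ∀ z : ℂ, |z.im| + 2 ≤ T * (|z.im - t| + 3) := by
    intro z
    have h1 := abs_sub_abs_le_abs_sub z.im t
    have h2 : |z.im - t| ≤ T * |z.im - t| := le_mul_of_one_le_left (abs_nonneg _) (by linarith)
    nlinarith
  have hfin : ∀ z : ℂ, T ^ 2 * (|z.im - t| + 3) ^ 2 * (K / δ * (|z.im - t| + 3)) * 2 *
      (Real.exp 4 * Real.exp (-(z.im - t) ^ 2)) ≤ 2 * Real.exp 4 * K * 648 * Real.log T * T ^ 2 := by
    intro z
    set u := |z.im - t|
    have hu : 0 ≤ u := abs_nonneg _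
    have h1 := cube_le_exp_sq hu
    have h2 : (z.im - t) ^ 2 = u ^ 2 := (sq_abs _).symm
    rw [neg_eq_neg_one_mul, ← neg_eq_neg_one_mul, h2, hKδ]
    have h3 : (u + 3) ^ 3 * Real.exp (-u ^ 2) ≤ 648 := by
      rw [Real.exp_neg, ← div_eq_mul_inv, div_le_iff₀ (Real.exp_pos _)]; exact h1
    calc _ = 2 * Real.exp 4 * K * Real.log T * T ^ 2 * ((u + 3) ^ 3 * Real.exp (-u ^ 2)) := by ring
      _ ≤ 2 * Real.exp 4 * K * Real.log T * T ^ 2 * 648 := by gcongr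
      _ = _ := by ring
  have hB : ∃ c < π / (1 + δ - -δ), ∃ B, f =O[comap (_root_.abs ∘ Complex.im) atTop ⊓
      𝓟 (Complex.re ⁻¹' Ioo (-δ) (1 + δ))] fun z ↦ Real.exp (B * Real.exp (c * |z.im|)) := by
    refine ⟨1, ?_, 1, ?_⟩
    · rw [lt_div_iff₀ (by linarith)]
      have := Real.pi_gt_three; linarith
    · refine IsBigO.of_bound (4 * 720 * |A| * T * Real.exp 4) ?_
      have hev : ∀ᶠ z : ℂ in comap (_root_.abs ∘ Complex.im) atTop ⊓
          𝓟 (Complex.re ⁻¹' Ioo (-δ) (1 + δ)), 4 ≤ |z.im| ∧ z.re ∈ Ioo (-δ) (1 + δ) := by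
        rw [eventually_inf_principal]
        have : ∀ᶠ z : ℂ in comap (_root_.abs ∘ Complex.im) atTop, 4 ≤ |z.im| :=
          tendsto_comap.eventually (eventually_ge_atTop 4)
        filter_upwards [this] with z hz h using ⟨hz, h⟩
      filter_upwards [hev] with z hz
      obtain ⟨hz4, hzr⟩ := hz
      have hr1 : -(1 / 2) ≤ z.re := by linarith [hzr.1]
      have hr2 : z.re ≤ 3 / 2 := by linarith [hzr.2]
      set u := |z.im| with hu
      have hg := hgrow z hr1 hr2 hz4
      have hg' : ‖H z‖ ≤ |A| * u ^ 4 := hg.trans (by gcongr; exact le_abs_self A)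
      rw [hnormf, one_mul, one_mul, Real.norm_eq_abs, abs_of_pos (Real.exp_pos _)]
      have h6 : u ^ 6 ≤ 720 * Real.exp u := by
        have := Real.pow_div_factorial_le_exp u (by linarith) 6
        rw [div_le_iff₀ (by positivity)] at this
        norm_num [Nat.factorial] at this; linarith
      have h7 : Real.exp u ≤ Real.exp (Real.exp u) := by
        rw [Real.exp_le_exp]; linarith [Real.add_one_le_exp u]
      have hT1 : T ^ ((z.re - 1) / 2) ≤ T := by
        calc _ ≤ T ^ (1 : ℝ) := Real.rpow_le_rpow_of_exponent_le (by linarith) (by linarith)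
          _ = T := Real.rpow_one T
      have he := hexp z hzr.1.le hzr.2.le
      have he1 : Real.exp (-(z.im - t) ^ 2) ≤ 1 := Real.exp_le_one_iff.mpr (by nlinarith)
      have he2 : Real.exp ((z.re - x) ^ 2 - (z.im - t) ^ 2) ≤ Real.exp 4 :=
        he.trans (mul_le_of_le_one_right (Real.exp_pos _).le he1)
      have hz2 : ‖z - 1‖ ≤ 2 * u := (hz1 z hr1 hr2).trans (by linarith)
      calc _ ≤ (2 * u) ^ 2 * (|A| * u ^ 4) * T * Real.exp 4 := by gcongr
        _ = 4 * |A| * T * Real.exp 4 * u ^ 6 := by ring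
        _ ≤ 4 * |A| * T * Real.exp 4 * (720 * Real.exp (Real.exp u)) := by
            gcongr; linarith
        _ = _ := by ring
  have hmain := PhragmenLindelof.vertical_strip (f := f) (z := s₀)
    (C := 2 * Real.exp 4 * K * 648 * Real.log T * T ^ 2) hfd.diffContOnCl hB ?_ ?_
    (by rw [hs₀re]; linarith) (by rw [hs₀re]; exact hx1)
  · rw [hnormf, hs₀re, hs₀im] at hmain
    simp only [sub_self, ne_eq, OfNat.ofNat_ne_zero, not_false_eq_true, zero_pow, Real.exp_zero,
      mul_one] at hmain
    have h1 : T ≤ ‖s₀ - 1‖ := by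
      have := Complex.abs_im_le_norm (s₀ - 1)
      simpa [hs₀im] using this
    have h2 : T ^ 2 * ‖H s₀‖ * T ^ ((x - 1) / 2) ≤ 2 * Real.exp 4 * K * 648 * Real.log T * T ^ 2 :=
      le_trans (by gcongr) hmain
    have h3 : T ^ ((x - 1) / 2) * T ^ ((1 - x) / 2) = 1 := by
      rw [← Real.rpow_add hT0, show (x - 1) / 2 + (1 - x) / 2 = 0 by ring, Real.rpow_zero]
    have h4 := mul_le_mul_of_nonneg_right h2 (by positivity : 0 ≤ T ^ ((1 - x) / 2) / T ^ 2)
    have e1 : T ^ 2 * ‖H s₀‖ * T ^ ((x - 1) / 2) * (T ^ ((1 - x) / 2) / T ^ 2) = ‖H s₀‖ := by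
      calc _ = ‖H s₀‖ * (T ^ ((x - 1) / 2) * T ^ ((1 - x) / 2)) * (T ^ 2 / T ^ 2) := by ring
        _ = _ := by rw [h3, div_self (by positivity)]; ring
    rw [e1] at h4
    refine h4.trans_eq ?_
    field_simp
  · intro z hz
    rw [hnormf]
    have hb1 := hz1 z (by linarith) (by linarith)
    have hb2 := hshift z
    have hb3 := hleft δ z hδ0 hδ1 hz
    have hb4 := hexp z (by linarith) (by linarith)
    set u := |z.im - t| with hu
    have hu0 : 0 ≤ u := abs_nonneg _
    have hH : ‖H z‖ * T ^ ((z.re - 1) / 2) ≤ K / δ * (u + 3) * 2 := by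
      calc ‖H z‖ * T ^ ((z.re - 1) / 2) ≤
          K / δ * (T * (u + 3)) ^ (1 / 2 + δ) * T ^ ((z.re - 1) / 2) := by
            gcongr
            refine hb3.trans ?_
            gcongr
            linarith
        _ = K / δ * (u + 3) ^ (1 / 2 + δ) * T ^ (δ / 2) := by
            rw [Real.mul_rpow hT0.le (by positivity), hz]
            have : T ^ (δ / 2) = T ^ (1 / 2 + δ) * T ^ ((-δ - 1) / 2) := by
              rw [← Real.rpow_add hT0]; congr 1; ring
            rw [this]; ring
        _ ≤ K / δ * (u + 3) * 2 := by
            gcongr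
            calc (u + 3) ^ (1 / 2 + δ) ≤ (u + 3) ^ (1 : ℝ) :=
                  Real.rpow_le_rpow_of_exponent_le (by linarith) (by linarith)
              _ = u + 3 := Real.rpow_one _
    calc _ = ‖z - 1‖ ^ 2 * (‖H z‖ * T ^ ((z.re - 1) / 2)) *
          Real.exp ((z.re - x) ^ 2 - (z.im - t) ^ 2) := by ring
      _ ≤ (T * (u + 3)) ^ 2 * (K / δ * (u + 3) * 2) *
          (Real.exp 4 * Real.exp (-(z.im - t) ^ 2)) := by
          gcongr
          linarith
      _ = T ^ 2 * (u + 3) ^ 2 * (K / δ * (u + 3)) * 2 *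
          (Real.exp 4 * Real.exp (-(z.im - t) ^ 2)) := by ring
      _ ≤ _ := hfin z
  · intro z hz
    rw [hnormf]
    have hb1 := hz1 z (by linarith) (by linarith)
    have hb2 := hshift z
    have hb3 := hright δ z hδ0 hδ1 hz
    have hb4 := hexp z (by linarith) (by linarith)
    set u := |z.im - t| with hu
    have hu0 : 0 ≤ u := abs_nonneg _
    have hH : ‖H z‖ * T ^ ((z.re - 1) / 2) ≤ K / δ * (u + 3) * 2 := by
      rw [hz, show (1 + δ - 1) / 2 = δ / 2 by ring]
      calc ‖H z‖ * T ^ (δ / 2) ≤ K / δ * 2 := by gcongr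
        _ ≤ K / δ * (u + 3) * 2 := by
            gcongr
            exact le_mul_of_one_le_right (by positivity) (by linarith)
    calc _ = ‖z - 1‖ ^ 2 * (‖H z‖ * T ^ ((z.re - 1) / 2)) *
          Real.exp ((z.re - x) ^ 2 - (z.im - t) ^ 2) := by ring
      _ ≤ (T * (u + 3)) ^ 2 * (K / δ * (u + 3) * 2) *
          (Real.exp 4 * Real.exp (-(z.im - t) ^ 2)) := by
          gcongr
          linarith
      _ = T ^ 2 * (u + 3) ^ 2 * (K / δ * (u + 3)) * 2 *
          (Real.exp 4 * Real.exp (-(z.im - t) ^ 2)) := by ring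
      _ ≤ _ := hfin z

section

open HurwitzZeta

/-- A Dirichlet series `∑ c_k (k+α)^{-s}` with unimodular coefficients whose continuation satisfies
the convexity bound in the critical strip. -/
structure IsConvexZeta (H : ℂ → ℂ) (α : ℝ) (c : ℕ → ℂ) : Prop where
  pos : 0 < α
  norm_eq : ∀ k, ‖c k‖ = 1
  hasSum : ∀ s : ℂ, 1 < s.re → HasSum (fun k : ℕ => c k * (((k + α : ℝ) : ℂ)) ^ (-s)) (H s)
  differentiableAt : ∀ s ≠ 1, DifferentiableAt ℂ H s
  convex : ∃ C > 0, ∀ x t : ℝ, 10 ≤ |t| → 0 ≤ x → x ≤ 1 + 1 / Real.log |t| →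
      ‖H (x + t * I)‖ ≤ C * |t| ^ ((1 - x) / 2) * Real.log |t|

lemma sum_succ_rpow_neg_le {δ : ℝ} (hδ : 0 < δ) (n : ℕ) :
    ∑ k ∈ Finset.range (n + 1), ((k + 1 : ℕ) : ℝ) ^ (-(1 + δ)) ≤
      1 + 1 / δ - ((n + 1 : ℕ) : ℝ) ^ (-δ) / δ := by
  induction n with
  | zero => simp
  | succ n ih =>
    rw [Finset.sum_range_succ]
    have hx1 : (0 : ℝ) < ((n + 1 : ℕ) : ℝ) := by positivity
    have hx : ((n + 1 + 1 : ℕ) : ℝ) = ((n + 1 : ℕ) : ℝ) + 1 := by push_cast; ring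
    set y : ℝ := ((n + 1 : ℕ) : ℝ)
    set x : ℝ := ((n + 1 + 1 : ℕ) : ℝ)
    have hx0 : 0 < x := by linarith
    have h1 : x ^ (-δ) * (1 + δ / x) ≤ y ^ (-δ) := by
      have hl : Real.log (y / x) ≤ -(1 / x) := by
        have := Real.log_le_sub_one_of_pos (div_pos hx1 hx0)
        refine this.trans_eq ?_
        rw [hx]; field_simp; ring
      have h2 : y ^ (-δ) = x ^ (-δ) * (y / x) ^ (-δ) := by
        rw [← Real.mul_rpow hx0.le (by positivity)]; congr 1; field_simp
      rw [h2]
      gcongr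
      rw [Real.rpow_def_of_pos (by positivity)]
      refine le_trans ?_ (Real.add_one_le_exp _)
      have e : δ / x = δ * (1 / x) := by ring
      nlinarith
    have h3 : x ^ (-(1 + δ)) = x ^ (-δ) / x := by
      rw [← Real.rpow_sub_one hx0.ne']; congr 1; ring
    have h4 : x ^ (-(1 + δ)) ≤ (y ^ (-δ) - x ^ (-δ)) / δ := by
      rw [h3, le_div_iff₀ hδ]
      have : x ^ (-δ) / x * δ = x ^ (-δ) * (δ / x) := by ring
      rw [this]; linarith
    rw [sub_div] at h4
    linarith

lemma sum_rpow_neg_le {α δ : ℝ} (hα : 0 < α) (hδ : 0 < δ) (n : ℕ) :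
    ∑ k ∈ Finset.range n, (k + α : ℝ) ^ (-(1 + δ)) ≤ α ^ (-(1 + δ)) + (1 + 1 / δ) := by
  have hp : 0 < α ^ (-(1 + δ)) := by positivity
  have hd : 0 < 1 + 1 / δ := by positivity
  cases n with
  | zero => rw [Finset.sum_range_zero]; positivity
  | succ n =>
    rw [Finset.sum_range_succ', add_comm]
    simp only [Nat.cast_zero, zero_add]
    gcongr
    calc _ ≤ ∑ k ∈ Finset.range n, ((k + 1 : ℕ) : ℝ) ^ (-(1 + δ)) := by
          refine Finset.sum_le_sum fun k _ => ?_
          exact Real.rpow_le_rpow_of_nonpos (by positivity) (by linarith) (by linarith)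
      _ ≤ 1 + 1 / δ := by
          cases n with
          | zero => rw [Finset.sum_range_zero]; positivity
          | succ n =>
            refine (sum_succ_rpow_neg_le hδ n).trans ?_
            have : 0 ≤ ((n + 1 : ℕ) : ℝ) ^ (-δ) / δ := by positivity
            linarith

lemma summable_rpow_neg {α δ : ℝ} (hα : 0 < α) (hδ : 0 < δ) :
    Summable fun k : ℕ => (k + α : ℝ) ^ (-(1 + δ)) :=
  summable_of_sum_range_le (fun k => by positivity) (sum_rpow_neg_le hα hδ)

lemma tsum_rpow_neg_le {α δ : ℝ} (hα : 0 < α) (hδ : 0 < δ) :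
    ∑' k : ℕ, (k + α : ℝ) ^ (-(1 + δ)) ≤ α ^ (-(1 + δ)) + (1 + 1 / δ) :=
  Real.tsum_le_of_sum_range_le (fun k => by positivity) (sum_rpow_neg_le hα hδ)

lemma norm_le_of_hasSum_dirichlet {α δ : ℝ} (hα : 0 < α) (hδ : 0 < δ) (hδ1 : δ ≤ 1) {c : ℕ → ℂ}
    (hc : ∀ k, ‖c k‖ = 1) {s w : ℂ} (hs : s.re = 1 + δ)
    (h : HasSum (fun k : ℕ => c k * (((k + α : ℝ) : ℂ)) ^ (-s)) w) :
    ‖w‖ ≤ (α ^ (-1 : ℝ) + α ^ (-2 : ℝ) + 2) / δ := by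
  have h1 := h.norm_le_of_bounded (summable_rpow_neg hα hδ).hasSum fun k => by
    rw [norm_mul, hc, one_mul, Complex.norm_cpow_eq_rpow_re_of_pos (by positivity), Complex.neg_re,
      hs]
  refine h1.trans ((tsum_rpow_neg_le hα hδ).trans ?_)
  have h2 : α ^ (-(1 + δ)) ≤ α ^ (-1 : ℝ) + α ^ (-2 : ℝ) := by
    rcases le_total α 1 with h | h
    · have := Real.rpow_le_rpow_of_exponent_ge hα h (show (-2 : ℝ) ≤ -(1 + δ) by linarith)
      have : 0 < α ^ (-1 : ℝ) := by positivity
      linarith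
    · have := Real.rpow_le_rpow_of_exponent_le h (show -(1 + δ) ≤ (-1 : ℝ) by linarith)
      have : 0 < α ^ (-2 : ℝ) := by positivity
      linarith
  have h3 : 1 ≤ 1 / δ := by rw [le_div_iff₀ hδ]; linarith
  have h4 : 0 < α ^ (-1 : ℝ) + α ^ (-2 : ℝ) := by positivity
  rw [div_eq_mul_one_div (α ^ (-1 : ℝ) + α ^ (-2 : ℝ) + 2)]
  nlinarith

lemma exists_rep (x : ℝ) : ∃ x' : ℝ, 0 < x' ∧ x' ≤ 1 ∧ (x' : UnitAddCircle) = (x : UnitAddCircle) := by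
  refine ⟨x - (⌈x⌉ - 1 : ℤ), ?_, ?_, ?_⟩
  · have := Int.ceil_lt_add_one x; push_cast; linarith
  · have := Int.le_ceil x; push_cast; linarith
  · rw [AddCircle.coe_sub, sub_eq_self, AddCircle.coe_eq_zero_iff]
    exact ⟨⌈x⌉ - 1, by simp⟩

lemma exists_rep_circle (x : UnitAddCircle) : ∃ x' : ℝ, 0 < x' ∧ x' ≤ 1 ∧ (x' : UnitAddCircle) = x := by
  obtain ⟨y, rfl⟩ := QuotientAddGroup.mk_surjective x
  exact exists_rep y

lemma zetaH_eq_hurwitzZeta {x : ℝ} (hx : 0 < x) (hx1 : x ≤ 1) (s : ℂ) :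
    zetaH s x = hurwitzZeta (x : UnitAddCircle) s := by
  have : ⌈x⌉₊ = 1 := by rw [Nat.ceil_eq_iff one_ne_zero]; simp [hx, hx1]
  rw [zetaH, this]; simp

lemma exists_norm_hurwitzZeta_le_sq (x : UnitAddCircle) :
    ∃ A > 0, ∀ s : ℂ, -(1 / 2) ≤ s.re → s.re ≤ 3 / 2 → 4 ≤ |s.im| →
      ‖hurwitzZeta x s‖ ≤ A * |s.im| ^ 2 := by
  obtain ⟨b, hb, hb1, rfl⟩ := exists_rep_circle x
  refine ⟨10 * b ^ (-3 : ℝ), by positivity, fun s h1 h2 h4 => ?_⟩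
  have hs1 : s ≠ 1 := by rintro rfl; simp at h4; linarith
  rw [← zetaH_eq_hurwitzZeta hb hb1, zetaH_eq_emSum hb (by linarith) hs1]
  have hem := norm_emSum_sub_le hb (s := s) (by linarith)
  set u := |s.im| with hu
  have hn := Complex.norm_le_abs_re_add_abs_im s
  have hr : |s.re| ≤ 2 := by rw [abs_le]; constructor <;> linarith
  have hs2 : ‖s‖ ≤ 2 * u := by linarith
  have hs3 : ‖s + 1‖ ≤ 3 * u := (norm_add_le _ _).trans (by rw [norm_one]; linarith)
  have hs4 : 1 ≤ ‖s - 1‖ := by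
    have := Complex.abs_im_le_norm (s - 1)
    simp only [Complex.sub_im, Complex.one_im, sub_zero] at this
    linarith
  have hB : ∀ p : ℝ, -3 ≤ p → b ^ p ≤ b ^ (-3 : ℝ) := fun p hp =>
    Real.rpow_le_rpow_of_exponent_ge hb hb1 hp
  have hlead : ‖(b : ℂ) ^ (1 - s) / (s - 1)‖ ≤ b ^ (-3 : ℝ) := by
    rw [norm_div, Complex.norm_cpow_eq_rpow_re_of_pos hb]
    refine (div_le_self (by positivity) hs4).trans (hB _ ?_)
    simp; linarith
  have hB0 : 0 < b ^ (-3 : ℝ) := by positivity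
  have htail : b ^ (-s.re) / 2 + b ^ (-s.re - 1) *
      (‖s‖ / 12 + ‖s‖ * ‖s + 1‖ / (12 * (s.re + 1))) ≤
      b ^ (-3 : ℝ) / 2 + b ^ (-3 : ℝ) * (2 * u / 12 + 2 * u * (3 * u) / (12 * (1 / 2))) := by
    have t1 := hB (-s.re) (by linarith)
    have t2 := hB (-s.re - 1) (by linarith)
    have t3 : ‖s‖ * ‖s + 1‖ / (12 * (s.re + 1)) ≤ 2 * u * (3 * u) / (12 * (1 / 2)) := by
      gcongr
      linarith
    have t4 : 0 ≤ ‖s‖ * ‖s + 1‖ / (12 * (s.re + 1)) := div_nonneg (by positivity) (by linarith)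
    refine add_le_add (by linarith) (mul_le_mul t2 (by linarith) (by positivity) hB0.le)
  calc ‖emSum b s‖ = ‖(emSum b s - (b : ℂ) ^ (1 - s) / (s - 1)) + (b : ℂ) ^ (1 - s) / (s - 1)‖ := by
        rw [sub_add_cancel]
    _ ≤ _ := norm_add_le _ _
    _ ≤ (b ^ (-3 : ℝ) / 2 + b ^ (-3 : ℝ) * (2 * u / 12 + 2 * u * (3 * u) / (12 * (1 / 2)))) +
        b ^ (-3 : ℝ) := add_le_add (hem.trans htail) hlead
    _ = b ^ (-3 : ℝ) * (3 / 2 + u / 6 + u ^ 2) := by ring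
    _ ≤ b ^ (-3 : ℝ) * (10 * u ^ 2) := by gcongr; nlinarith
    _ = _ := by ring

/-- The size of the factor in the functional equation. -/
lemma exists_norm_factor_le : ∃ C > 0, ∀ s w : ℂ, -1 ≤ s.re → s.re ≤ 2 → 4 ≤ |s.im| →
    ‖w‖ ≤ Real.exp (π * |s.im| / 2) →
    ‖(2 * π : ℂ) ^ (-s) * Complex.Gamma s * w‖ ≤ C * |s.im| ^ (s.re - 1 / 2) := by
  obtain ⟨C, hC, h⟩ := exists_norm_Gamma_le
  refine ⟨2 * π * C, by positivity, fun s w h1 h2 h4 hw => ?_⟩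
  have hu : 0 < |s.im| := by linarith
  have hG : ‖Complex.Gamma s‖ ≤ C * |s.im| ^ (s.re - 1 / 2) * Real.exp (-(π * |s.im| / 2)) := by
    rcases le_or_gt 0 s.re with h0 | h0
    · have := h s.re s.im h0 h2 h4
      rwa [Complex.re_add_im] at this
    · have h5 := h (s.re + 1) s.im (by linarith) (by linarith) h4
      have e : (((s.re + 1 : ℝ) : ℂ) + s.im * I) = s + 1 := by
        nth_rewrite 3 [← Complex.re_add_im s]; push_cast; ring
      have hs0 : s ≠ 0 := by rintro rfl; simp at hu
      rw [e, Complex.Gamma_add_one s hs0, norm_mul] at h5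
      have h6 := Complex.abs_im_le_norm s
      have h7 : |s.im| ^ (s.re + 1 - 1 / 2) = |s.im| ^ (s.re - 1 / 2) * |s.im| := by
        rw [← Real.rpow_add_one hu.ne']; congr 1; ring
      rw [h7] at h5
      have h8 : |s.im| * ‖Complex.Gamma s‖ ≤
          |s.im| * (C * |s.im| ^ (s.re - 1 / 2) * Real.exp (-(π * |s.im| / 2))) := by
        calc _ ≤ ‖s‖ * ‖Complex.Gamma s‖ := by gcongr
          _ ≤ _ := h5
          _ = _ := by ring
      exact le_of_mul_le_mul_left h8 hu
  have h2pi : (1 : ℝ) ≤ 2 * π := by linarith [Real.pi_gt_three]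
  have hP : ‖(2 * π : ℂ) ^ (-s)‖ ≤ 2 * π := by
    have : (2 * π : ℂ) = ((2 * π : ℝ) : ℂ) := by push_cast; ring
    rw [this, Complex.norm_cpow_eq_rpow_re_of_pos (by positivity)]
    calc (2 * π) ^ (-s).re ≤ (2 * π) ^ (1 : ℝ) :=
          Real.rpow_le_rpow_of_exponent_le h2pi (by simp; linarith)
      _ = 2 * π := Real.rpow_one _
  rw [norm_mul, norm_mul]
  calc _ ≤ 2 * π * (C * |s.im| ^ (s.re - 1 / 2) * Real.exp (-(π * |s.im| / 2))) *
        Real.exp (π * |s.im| / 2) := by gcongr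
    _ = 2 * π * C * |s.im| ^ (s.re - 1 / 2) *
        (Real.exp (-(π * |s.im| / 2)) * Real.exp (π * |s.im| / 2)) := by ring
    _ = _ := by rw [← Real.exp_add]; simp

lemma norm_exp_pi_mul_le (s : ℂ) : ‖Complex.exp (π * I * s / 2)‖ ≤ Real.exp (π * |s.im| / 2) ∧
    ‖Complex.exp (-π * I * s / 2)‖ ≤ Real.exp (π * |s.im| / 2) := by
  have hpi := Real.pi_pos
  constructor
  · rw [Complex.norm_exp, Real.exp_le_exp]
    have : (π * I * s / 2).re = -(π * s.im / 2) := by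
      rw [show (π * I * s / 2 : ℂ) = ((π / 2 : ℝ) : ℂ) * (I * s) by push_cast; ring,
        Complex.re_ofReal_mul]
      simp; ring
    rw [this]
    have := neg_abs_le s.im
    nlinarith
  · rw [Complex.norm_exp, Real.exp_le_exp]
    have : (-π * I * s / 2).re = π * s.im / 2 := by
      rw [show (-π * I * s / 2 : ℂ) = ((-(π / 2) : ℝ) : ℂ) * (I * s) by push_cast; ring,
        Complex.re_ofReal_mul]
      simp; ring
    rw [this]
    have := le_abs_self s.im
    gcongr

lemma exists_norm_one_sub_le : ∃ C > 0, ∀ (x : UnitAddCircle) (s : ℂ), -1 ≤ s.re → s.re ≤ 2 →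
    4 ≤ |s.im| →
    ‖hurwitzZeta x (1 - s)‖ ≤ C * |s.im| ^ (s.re - 1 / 2) * (‖expZeta x s‖ + ‖expZeta (-x) s‖) ∧
    ‖expZeta x (1 - s)‖ ≤
      C * |s.im| ^ (s.re - 1 / 2) * (‖hurwitzZeta x s‖ + ‖hurwitzZeta (-x) s‖) := by
  obtain ⟨C, hC, h⟩ := exists_norm_factor_le
  refine ⟨C, hC, fun x s h1 h2 h4 => ?_⟩
  have him : s.im ≠ 0 := by intro h0; rw [h0] at h4; simp at h4; linarith
  have g1 := h s _ h1 h2 h4 (norm_exp_pi_mul_le s).1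
  have g2 := h s _ h1 h2 h4 (norm_exp_pi_mul_le s).2
  have key : ∀ P Q u v : ℂ, ‖(2 * π : ℂ) ^ (-s) * Complex.Gamma s * P‖ ≤
      C * |s.im| ^ (s.re - 1 / 2) → ‖(2 * π : ℂ) ^ (-s) * Complex.Gamma s * Q‖ ≤
      C * |s.im| ^ (s.re - 1 / 2) → ‖(2 * π : ℂ) ^ (-s) * Complex.Gamma s * (P * u + Q * v)‖ ≤
      C * |s.im| ^ (s.re - 1 / 2) * (‖u‖ + ‖v‖) := by
    intro P Q u v hP hQ
    rw [mul_add, ← mul_assoc, ← mul_assoc, mul_add]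
    refine (norm_add_le _ _).trans ?_
    rw [norm_mul _ u, norm_mul _ v]
    gcongr
  constructor
  · rw [hurwitzZeta_one_sub x (fun n hn => him (by rw [hn]; simp)) (Or.inr fun hn => him (by simp [hn]))]
    exact key _ _ _ _ g2 g1
  · rw [expZeta_one_sub x (fun n hn => him (by rw [hn]; simp))]
    exact key _ _ _ _ g1 g2

lemma exists_norm_le_of_compact {H : ℂ → ℂ} (hd : ∀ s ≠ 1, DifferentiableAt ℂ H s) :
    ∃ B > 0, ∀ s : ℂ, -(1 / 2) ≤ s.re → s.re ≤ 0 → |s.im| ≤ 4 → ‖H s‖ ≤ B := by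
  have hcomp : IsCompact (Icc (-(1 / 2) : ℝ) 0 ×ℂ Icc (-4 : ℝ) 4) :=
    isCompact_Icc.reProdIm isCompact_Icc
  have hcont : ContinuousOn H (Icc (-(1 / 2) : ℝ) 0 ×ℂ Icc (-4 : ℝ) 4) := fun s hs => by
    refine (hd s ?_).continuousAt.continuousWithinAt
    rintro rfl
    have := hs.1.2
    norm_num at this
  obtain ⟨B, hB⟩ := hcomp.exists_bound_of_continuousOn hcont
  refine ⟨max B 1, by positivity, fun s h1 h2 h3 => (hB s ?_).trans (le_max_left _ _)⟩
  rw [Complex.mem_reProdIm]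
  exact ⟨⟨h1, h2⟩, abs_le.mp h3⟩

lemma wave_exp_norm (x : ℝ) (n : ℕ) : ‖Complex.exp (2 * π * I * x * n)‖ = 1 := by
  rw [show (2 * π * I * x * n : ℂ) = ((2 * π * x * n : ℝ) : ℂ) * I by push_cast; ring]
  exact Complex.norm_exp_ofReal_mul_I _

lemma hasSum_expZeta_succ (x : ℝ) {s : ℂ} (hs : 1 < s.re) :
    HasSum (fun k : ℕ => Complex.exp (2 * π * I * x * (k + 1 : ℕ)) * (((k + 1 : ℝ) : ℂ)) ^ (-s))
      (expZeta (x : UnitAddCircle) s) := by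
  have h := (hasSum_nat_add_iff' 1).mpr (hasSum_expZeta_of_one_lt_re x hs)
  have hs0 : s ≠ 0 := by rintro rfl; simp at hs; linarith
  simp only [Finset.range_one, Finset.sum_singleton, Nat.cast_zero, Complex.zero_cpow hs0, div_zero,
    sub_zero] at h
  refine h.congr_fun fun k => ?_
  rw [Complex.cpow_neg, div_eq_mul_inv]
  push_cast
  rfl

lemma exists_norm_expZeta_right (x : UnitAddCircle) : ∀ (δ : ℝ) (s : ℂ), 0 < δ → δ ≤ 1 / 2 →
    s.re = 1 + δ → ‖expZeta x s‖ ≤ 4 / δ := by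
  intro δ s h1 h2 h3
  obtain ⟨y, -, -, rfl⟩ := exists_rep_circle x
  have := norm_le_of_hasSum_dirichlet one_pos h1 (by linarith) (fun k => wave_exp_norm y (k + 1)) h3
    (hasSum_expZeta_succ y (by linarith))
  refine this.trans_eq ?_
  norm_num

lemma exists_norm_hurwitzZeta_right (x : UnitAddCircle) : ∃ K > 0, ∀ (δ : ℝ) (s : ℂ), 0 < δ →
    δ ≤ 1 / 2 → s.re = 1 + δ → ‖hurwitzZeta x s‖ ≤ K / δ := by
  obtain ⟨y, hy, hy1, rfl⟩ := exists_rep_circle x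
  refine ⟨_, ?_, fun δ s h1 h2 h3 => norm_le_of_hasSum_dirichlet (c := fun _ => 1) hy h1
    (by linarith) (fun k => norm_one) h3 ?_⟩
  · positivity
  · rw [← zetaH_eq_hurwitzZeta hy hy1]
    refine (hasSum_zetaH hy (by linarith)).congr_fun fun k => ?_
    rw [Complex.cpow_neg]; simp

lemma left_bound_of_one_sub {H : ℂ → ℂ} (hd : ∀ s ≠ 1, DifferentiableAt ℂ H s) {C K : ℝ}
    (hC : 0 < C) (hK : 0 < K)
    (h : ∀ (δ : ℝ) (s : ℂ), 0 < δ → δ ≤ 1 / 2 → s.re = 1 + δ → 4 ≤ |s.im| →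
      ‖H (1 - s)‖ ≤ C * |s.im| ^ (s.re - 1 / 2) * (K / δ)) :
    ∃ B > 0, ∀ (δ : ℝ) (s : ℂ), 0 < δ → δ ≤ 1 / 2 → s.re = -δ →
      ‖H s‖ ≤ B / δ * (|s.im| + 1) ^ (1 / 2 + δ) := by
  obtain ⟨B, hB, hb⟩ := exists_norm_le_of_compact hd
  refine ⟨B + C * K, by positivity, fun δ s h1 h2 h3 => ?_⟩
  have hp : 1 ≤ (|s.im| + 1) ^ (1 / 2 + δ) :=
    Real.one_le_rpow (by linarith [abs_nonneg s.im]) (by linarith)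
  rcases le_or_gt 4 |s.im| with h4 | h4
  · have := h δ (1 - s) h1 h2 (by simp [h3]) (by simpa using h4)
    rw [sub_sub_cancel] at this
    refine this.trans ?_
    have e : (1 - s).re - 1 / 2 = 1 / 2 + δ := by simp [h3]; ring
    have e2 : |(1 - s).im| = |s.im| := by simp
    rw [e, e2]
    calc C * |s.im| ^ (1 / 2 + δ) * (K / δ) = C * K / δ * |s.im| ^ (1 / 2 + δ) := by ring
      _ ≤ (B + C * K) / δ * (|s.im| + 1) ^ (1 / 2 + δ) := by
          gcongr <;> linarith
  · refine (hb s (by linarith) (by linarith) h4.le).trans ?_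
    have h5 : B ≤ (B + C * K) / δ := by
      rw [le_div_iff₀ h1]
      have : 0 < C * K := by positivity
      nlinarith
    exact h5.trans (le_mul_of_one_le_right (by positivity) hp)

theorem exists_convexity_hurwitzZeta (x : UnitAddCircle) :
    ∃ C > 0, ∀ σ t : ℝ, 10 ≤ |t| → 0 ≤ σ → σ ≤ 1 + 1 / Real.log |t| →
      ‖hurwitzZeta x (σ + t * I)‖ ≤ C * |t| ^ ((1 - σ) / 2) * Real.log |t| := by
  have hd : ∀ s ≠ 1, DifferentiableAt ℂ (hurwitzZeta x) s := fun s hs =>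
    differentiableAt_hurwitzZeta x hs
  obtain ⟨K, hK, hright⟩ := exists_norm_hurwitzZeta_right x
  obtain ⟨A, hA, hgrow⟩ := exists_norm_hurwitzZeta_le_sq x
  obtain ⟨C, hC, hone⟩ := exists_norm_one_sub_le
  obtain ⟨B, hB, hleft⟩ := left_bound_of_one_sub hd hC (K := 8) (by norm_num)
    (fun δ s h1 h2 h3 h4 => by
      refine ((hone x s (by linarith) (by linarith) h4).1).trans ?_
      gcongr
      have := exists_norm_expZeta_right x δ s h1 h2 h3
      have := exists_norm_expZeta_right (-x) δ s h1 h2 h3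
      have e : (8 : ℝ) / δ = 4 / δ + 4 / δ := by ring
      linarith)
  refine exists_convexity_bound hd ?_ (K := K + B) (A := A) (by positivity) ?_ ?_ ?_
  · have h1 := hurwitzZeta_residue_one x
    have h2 : Tendsto (fun s : ℂ => s - 1) (𝓝[≠] 1) (𝓝 0) := by
      have : ContinuousAt (fun s : ℂ => s - 1) 1 := by fun_prop
      simpa using this.tendsto.mono_left nhdsWithin_le_nhds
    have h3 := h2.mul h1
    rw [zero_mul] at h3
    refine h3.congr fun s => by ring
  · intro δ s h1 h2 h3
    refine (hright δ s h1 h2 h3).trans ?_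
    gcongr; linarith
  · intro δ s h1 h2 h3
    refine (hleft δ s h1 h2 h3).trans ?_
    gcongr; linarith
  · intro s h1 h2 h4
    refine (hgrow s h1 h2 h4).trans ?_
    gcongr ?_ * ?_
    exact pow_le_pow_right₀ (by linarith) (by norm_num)

theorem exists_convexity_expZeta (x : UnitAddCircle) :
    ∃ C > 0, ∀ σ t : ℝ, 10 ≤ |t| → 0 ≤ σ → σ ≤ 1 + 1 / Real.log |t| →
      ‖expZeta x (σ + t * I)‖ ≤ C * |t| ^ ((1 - σ) / 2) * Real.log |t| := by
  have hd : ∀ s ≠ 1, DifferentiableAt ℂ (expZeta x) s := fun s hs =>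
    differentiableAt_expZeta x s (Or.inl hs)
  obtain ⟨K₁, hK₁, hr₁⟩ := exists_norm_hurwitzZeta_right x
  obtain ⟨K₂, hK₂, hr₂⟩ := exists_norm_hurwitzZeta_right (-x)
  obtain ⟨A₁, hA₁, hg₁⟩ := exists_norm_hurwitzZeta_le_sq x
  obtain ⟨A₂, hA₂, hg₂⟩ := exists_norm_hurwitzZeta_le_sq (-x)
  obtain ⟨C, hC, hone⟩ := exists_norm_one_sub_le
  obtain ⟨B, hB, hleft⟩ := left_bound_of_one_sub hd hC (K := K₁ + K₂) (by positivity)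
    (fun δ s h1 h2 h3 h4 => by
      refine ((hone x s (by linarith) (by linarith) h4).2).trans ?_
      gcongr
      rw [add_div]
      exact add_le_add (hr₁ δ s h1 h2 h3) (hr₂ δ s h1 h2 h3))
  refine exists_convexity_bound hd ?_ (K := 4 + B) (A := C * (A₁ + A₂)) (by positivity) ?_ ?_ ?_
  · rcases eq_or_ne x 0 with rfl | hx
    · rw [expZeta_zero]
      have h1 := riemannZeta_residue_one
      have h2 : Tendsto (fun s : ℂ => s - 1) (𝓝[≠] 1) (𝓝 0) := by
        have : ContinuousAt (fun s : ℂ => s - 1) 1 := by fun_prop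
        simpa using this.tendsto.mono_left nhdsWithin_le_nhds
      have h3 := h2.mul h1
      rw [zero_mul] at h3
      refine h3.congr fun s => by ring
    · have h1 : ContinuousAt (fun s : ℂ => (s - 1) ^ 2 * expZeta x s) 1 := by
        refine ContinuousAt.mul (by fun_prop) ?_
        exact (differentiableAt_expZeta x 1 (Or.inr hx)).continuousAt
      simpa using h1.tendsto.mono_left nhdsWithin_le_nhds
  · intro δ s h1 h2 h3
    refine (exists_norm_expZeta_right x δ s h1 h2 h3).trans ?_
    gcongr; linarith
  · intro δ s h1 h2 h3
    refine (hleft δ s h1 h2 h3).trans ?_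
    gcongr; linarith
  · intro s h1 h2 h4
    have e1 : (1 - s).re = 1 - s.re := by simp
    have e2 : |(1 - s).im| = |s.im| := by simp
    have h5 := (hone x (1 - s) (by rw [e1]; linarith) (by rw [e1]; linarith) (by rw [e2]; exact h4)).2
    rw [sub_sub_cancel, e1, e2] at h5
    have h6 := hg₁ (1 - s) (by rw [e1]; linarith) (by rw [e1]; linarith) (by rw [e2]; exact h4)
    have h7 := hg₂ (1 - s) (by rw [e1]; linarith) (by rw [e1]; linarith) (by rw [e2]; exact h4)
    rw [e2] at h6 h7
    set u := |s.im|
    have h8 : u ^ (1 - s.re - 1 / 2) ≤ u ^ 2 := by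
      calc u ^ (1 - s.re - 1 / 2) ≤ u ^ (2 : ℝ) :=
            Real.rpow_le_rpow_of_exponent_le (by linarith) (by linarith)
        _ = u ^ 2 := by norm_cast
    calc _ ≤ _ := h5
      _ ≤ C * u ^ 2 * (A₁ * u ^ 2 + A₂ * u ^ 2) := by gcongr
      _ = _ := by ring

lemma one_le_convex_factor {x t : ℝ} (ht : 10 ≤ |t|) (hx1 : x ≤ 1 + 1 / Real.log |t|) :
    1 ≤ |t| ^ ((1 - x) / 2) * Real.log |t| := by
  have hT0 : 0 < |t| := by linarith
  have hlog : 2 ≤ Real.log |t| := by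
    rw [Real.le_log_iff_exp_le hT0]
    have h1 := Real.exp_one_lt_d9
    have : Real.exp 2 = Real.exp 1 * Real.exp 1 := by rw [← Real.exp_add]; norm_num
    rw [this]; nlinarith [Real.exp_pos 1]
  have h1 : (1 / 2 : ℝ) ≤ |t| ^ ((1 - x) / 2) := by
    rw [Real.rpow_def_of_pos hT0]
    have h2 : -(1 / 2) ≤ Real.log |t| * ((1 - x) / 2) := by
      have h3 : 1 - x ≥ -(1 / Real.log |t|) := by linarith
      have h4 : Real.log |t| * (1 / Real.log |t|) = 1 := by field_simp
      nlinarith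
    have := Real.add_one_le_exp (Real.log |t| * ((1 - x) / 2))
    linarith
  nlinarith

theorem isConvexZeta_expZeta (x : ℝ) : IsConvexZeta (expZeta (x : UnitAddCircle)) 1
    (fun k => Complex.exp (2 * π * I * x * (k + 1 : ℕ))) where
  pos := one_pos
  norm_eq k := wave_exp_norm x (k + 1)
  hasSum _ hs := hasSum_expZeta_succ x hs
  differentiableAt s hs := differentiableAt_expZeta _ s (Or.inl hs)
  convex := exists_convexity_expZeta _

theorem isConvexZeta_zetaH {a : ℝ} (ha : 0 < a) : IsConvexZeta (fun s => zetaH s a) a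
    (fun _ => 1) where
  pos := ha
  norm_eq k := norm_one
  hasSum s hs := by
    refine (hasSum_zetaH ha hs).congr_fun fun k => ?_
    rw [Complex.cpow_neg]; simp
  differentiableAt _ hs := differentiableAt_zetaH ha hs
  convex := by
    obtain ⟨C, hC, h⟩ := exists_convexity_hurwitzZeta (a : UnitAddCircle)
    set N := ⌈a⌉₊ - 1 with hN
    have hpos : ∀ i : ℕ, 0 < a - (N : ℝ) + i := by
      intro i
      have h1 : 0 < ⌈a⌉₊ := Nat.ceil_pos.mpr ha
      have h4 : (⌈a⌉₊ : ℝ) < a + 1 := Nat.ceil_lt_add_one ha.le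
      have h5 : (N : ℝ) = (⌈a⌉₊ : ℝ) - 1 := by rw [hN, Nat.cast_sub h1]; simp
      have : (0 : ℝ) ≤ i := Nat.cast_nonneg i
      linarith
    set D := ∑ i ∈ Finset.range N, (1 + (a - (N : ℝ) + i) ^ (-2 : ℝ)) with hD
    have hD0 : 0 ≤ D := Finset.sum_nonneg fun i _ => by have := hpos i; positivity
    refine ⟨C + D, by positivity, fun x t ht hx0 hx1 => ?_⟩
    have h1 := h x t ht hx0 hx1
    have h2 := one_le_convex_factor ht hx1
    have hx2 : x ≤ 2 := by
      have hlog : 1 ≤ Real.log |t| := by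
        rw [Real.le_log_iff_exp_le (by linarith)]
        linarith [Real.exp_one_lt_d9]
      have : 1 / Real.log |t| ≤ 1 := by rw [div_le_one (by linarith)]; exact hlog
      linarith
    have h3 : ‖∑ i ∈ Finset.range N, 1 / ((a - (N : ℝ) + i : ℝ) : ℂ) ^ ((x : ℂ) + t * I)‖ ≤ D := by
      refine (norm_sum_le _ _).trans (Finset.sum_le_sum fun i _ => ?_)
      rw [norm_div, norm_one, Complex.norm_cpow_eq_rpow_re_of_pos (hpos i)]
      have e : ((x : ℂ) + t * I).re = x := by simp
      rw [e, one_div, ← Real.rpow_neg (hpos i).le]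
      have hp2 : 0 < (a - (N : ℝ) + i) ^ (-2 : ℝ) := Real.rpow_pos_of_pos (hpos i) _
      rcases le_total (a - (N : ℝ) + i) 1 with hl | hl
      · have := Real.rpow_le_rpow_of_exponent_ge (hpos i) hl (show (-2 : ℝ) ≤ -x by linarith)
        linarith
      · have := Real.rpow_le_one_of_one_le_of_nonpos hl (show -x ≤ 0 by linarith)
        linarith
    calc ‖zetaH (x + t * I) a‖ ≤ C * |t| ^ ((1 - x) / 2) * Real.log |t| + D :=
          (norm_sub_le _ _).trans (add_le_add h1 h3)
      _ ≤ C * (|t| ^ ((1 - x) / 2) * Real.log |t|) + D * (|t| ^ ((1 - x) / 2) * Real.log |t|) := by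
          rw [mul_assoc]
          gcongr
          exact le_mul_of_one_le_right hD0 h2
      _ = _ := by ring

end

/-! ### Integrals of Dirichlet series against their terms -/

lemma two_le_log {T : ℝ} (hT : 10 ≤ T) : 2 ≤ Real.log T := by
  rw [Real.le_log_iff_exp_le (by linarith)]
  have h1 := Real.exp_one_lt_d9
  have : Real.exp 2 = Real.exp 1 * Real.exp 1 := by rw [← Real.exp_add]; norm_num
  rw [this]; nlinarith [Real.exp_pos 1]

lemma norm_integral_exp_le {ω : ℝ} (hω : ω ≠ 0) (α β : ℝ) :
    ‖∫ u in α..β, Complex.exp ((ω * u : ℝ) * I)‖ ≤ 2 / |ω| := by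
  have hc : (ω * I : ℂ) ≠ 0 := mul_ne_zero (by exact_mod_cast hω) Complex.I_ne_zero
  have e : ∀ u : ℝ, Complex.exp ((ω * u : ℝ) * I) = Complex.exp (ω * I * u) := fun u => by
    congr 1; push_cast; ring
  simp_rw [e]
  rw [integral_exp_mul_complex hc, norm_div]
  have n1 : ∀ u : ℝ, ‖Complex.exp (ω * I * u)‖ = 1 := fun u => by
    rw [← e]; exact Complex.norm_exp_ofReal_mul_I _
  have h2 : ‖(ω * I : ℂ)‖ = |ω| := by simp
  rw [h2]
  gcongr
  refine (norm_sub_le _ _).trans ?_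
  rw [n1, n1]; norm_num

lemma cpow_mul_I {x : ℝ} (hx : 0 < x) (y : ℝ) :
    (x : ℂ) ^ ((y : ℂ) * I) = Complex.exp ((Real.log x * y : ℝ) * I) := by
  rw [Complex.cpow_def_of_ne_zero (by exact_mod_cast hx.ne'), ← Complex.ofReal_log hx.le]
  congr 1; push_cast; ring

lemma abs_log_sub_ge {x y : ℝ} (hx : 0 < x) (hxy : x < y) :
    (y - x) / y ≤ Real.log y - Real.log x := by
  have hy : 0 < y := hx.trans hxy
  have := Real.log_le_sub_one_of_pos (div_pos hx hy)
  rw [Real.log_div hx.ne' hy.ne'] at this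
  have e : (y - x) / y = 1 - x / y := by field_simp
  linarith

lemma sum_inv_succ_le (m : ℕ) : ∑ k ∈ Finset.range m, 1 / ((k : ℝ) + 1) ≤ 1 + Real.log (m + 1) := by
  have h := harmonic_le_one_add_log m
  have e : ((harmonic m : ℚ) : ℝ) = ∑ k ∈ Finset.range m, 1 / ((k : ℝ) + 1) := by
    rw [harmonic]; push_cast; simp
  rw [← e]
  refine h.trans ?_
  rcases Nat.eq_zero_or_pos m with rfl | hm
  · simp
  · gcongr; linarith

lemma sum_inv_add_le {α : ℝ} (hα : 0 < α) (m : ℕ) :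
    ∑ k ∈ Finset.range m, 1 / (k + α) ≤ 1 / α + (1 + Real.log (m + 1)) := by
  have h0 : (0 : ℝ) ≤ Real.log (m + 1) := Real.log_nonneg (by linarith [Nat.cast_nonneg (α := ℝ) m])
  cases m with
  | zero => rw [Finset.sum_range_zero]; positivity
  | succ n =>
    rw [Finset.sum_range_succ', add_comm]
    simp only [Nat.cast_zero, zero_add]
    gcongr
    refine le_trans ?_ ((sum_inv_succ_le n).trans ?_)
    · refine Finset.sum_le_sum fun k _ => ?_
      push_cast
      exact one_div_le_one_div_of_le (by positivity) (by linarith)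
    · gcongr; linarith

lemma sum_inv_sub_le (m : ℕ) :
    ∑ k ∈ Finset.range m, 1 / ((m : ℝ) - k) ≤ 1 + Real.log (m + 1) := by
  rw [← Finset.sum_range_reflect]
  refine le_trans (le_of_eq ?_) (sum_inv_succ_le m)
  refine Finset.sum_congr rfl fun k hk => ?_
  have : k + 1 ≤ m := Finset.mem_range.mp hk
  rw [show m - 1 - k = m - (k + 1) by omega, Nat.cast_sub this]
  push_cast; congr 1; ring

lemma sum_inv_le {α : ℝ} (hα : 0 < α) (m : ℕ) :
    ∑ k ∈ Finset.range m, (1 / (k + α) + 1 / ((m : ℝ) - k)) ≤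
      1 / α + 2 * (1 + Real.log (m + 1)) := by
  rw [Finset.sum_add_distrib]
  linarith [sum_inv_add_le hα m, sum_inv_sub_le m]

lemma div_mul_sub_eq {α : ℝ} (hα : 0 < α) {k m : ℕ} (hk : k < m) :
    (m + α) / ((k + α) * ((m : ℝ) - k)) = 1 / (k + α) + 1 / ((m : ℝ) - k) := by
  have h1 : (k : ℝ) + α ≠ 0 := by positivity
  have h2 : (m : ℝ) - k ≠ 0 := by
    have : (k : ℝ) < m := by exact_mod_cast hk
    linarith
  rw [div_add_div _ _ h1 h2]; congr 1; ring

lemma norm_integral_term_le {x y : ℝ} (hx : 0 < x) (hxy : x < y) {ε : ℝ} (hε : |ε| = 1) (A T : ℝ) :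
    ‖∫ u in A..T, (x : ℂ) ^ (-(((ε * u : ℝ) : ℂ) * I)) * (y : ℂ) ^ (((ε * u : ℝ) : ℂ) * I)‖ ≤
      2 * (y / (y - x)) ∧
    ‖∫ u in A..T, (y : ℂ) ^ (-(((ε * u : ℝ) : ℂ) * I)) * (x : ℂ) ^ (((ε * u : ℝ) : ℂ) * I)‖ ≤
      2 * (y / (y - x)) := by
  have hy : 0 < y := hx.trans hxy
  have hl := abs_log_sub_ge hx hxy
  have hq : 0 < (y - x) / y := div_pos (by linarith) hy
  have key : ∀ ω : ℝ, |ω| = Real.log y - Real.log x →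
      2 / |ω| ≤ 2 * (y / (y - x)) := by
    intro ω hω
    rw [hω]
    calc 2 / (Real.log y - Real.log x) ≤ 2 / ((y - x) / y) := by gcongr
      _ = _ := by field_simp
  have e : ∀ {p q : ℝ}, 0 < p → 0 < q → ∀ u : ℝ,
      (p : ℂ) ^ (-(((ε * u : ℝ) : ℂ) * I)) * (q : ℂ) ^ (((ε * u : ℝ) : ℂ) * I) =
      Complex.exp (((ε * (Real.log q - Real.log p)) * u : ℝ) * I) := by
    intro p q hp hq u
    rw [Complex.cpow_neg, cpow_mul_I hp, cpow_mul_I hq, ← Complex.exp_neg, ← Complex.exp_add]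
    congr 1; push_cast; ring
  constructor
  · simp_rw [e hx hy]
    have ha : |ε * (Real.log y - Real.log x)| = Real.log y - Real.log x := by
      rw [abs_mul, hε, one_mul, abs_of_pos (by linarith)]
    refine (norm_integral_exp_le (fun h => ?_) _ _).trans (key _ ha)
    rw [h, abs_zero] at ha; linarith
  · simp_rw [e hy hx]
    have ha : |ε * (Real.log x - Real.log y)| = Real.log y - Real.log x := by
      rw [abs_mul, hε, one_mul, abs_sub_comm, abs_of_pos (by linarith)]
    refine (norm_integral_exp_le (fun h => ?_) _ _).trans (key _ ha)
    rw [h, abs_zero] at ha; linarith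

/-- Integration of the series termwise on the line `Re s = σ > 1`. -/
lemma IsConvexZeta.hasSum_integral {L : ℂ → ℂ} {α : ℝ} {c : ℕ → ℂ} (hL : IsConvexZeta L α c)
    {σ : ℝ} (hσ : 1 < σ) {y : ℝ} (hy : 0 < y) (ε T : ℝ) :
    HasSum (fun k : ℕ => c k * (((k + α : ℝ) ^ (-σ) : ℝ) : ℂ) *
      ∫ u in (1 : ℝ)..T, ((k + α : ℝ) : ℂ) ^ (-(((ε * u : ℝ) : ℂ) * I)) *
        (y : ℂ) ^ (((ε * u : ℝ) : ℂ) * I))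
      (∫ u in (1 : ℝ)..T, L (σ + (ε * u : ℝ) * I) * (y : ℂ) ^ (((ε * u : ℝ) : ℂ) * I)) := by
  have hα := hL.pos
  have hpos : ∀ k : ℕ, (0 : ℝ) < k + α := fun k => by positivity
  have hcont : ∀ {x : ℝ}, 0 < x → Continuous fun u : ℝ => (x : ℂ) ^ (((ε * u : ℝ) : ℂ) * I) := by
    intro x hx
    simp_rw [cpow_mul_I hx]
    fun_prop
  have hcont' : ∀ {x : ℝ}, 0 < x → Continuous fun u : ℝ => (x : ℂ) ^ (-(((ε * u : ℝ) : ℂ) * I)) := by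
    intro x hx
    simp_rw [Complex.cpow_neg, cpow_mul_I hx, ← Complex.exp_neg]
    fun_prop
  have hn : ∀ {x : ℝ}, 0 < x → ∀ u : ℝ, ‖(x : ℂ) ^ (((ε * u : ℝ) : ℂ) * I)‖ = 1 := by
    intro x hx u
    rw [cpow_mul_I hx]; exact Complex.norm_exp_ofReal_mul_I _
  have hn' : ∀ {x : ℝ}, 0 < x → ∀ u : ℝ, ‖(x : ℂ) ^ (-(((ε * u : ℝ) : ℂ) * I))‖ = 1 := by
    intro x hx u
    rw [Complex.cpow_neg, norm_inv, hn hx, inv_one]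
  have hsum : Summable fun k : ℕ => (k + α : ℝ) ^ (-σ) := by
    have := summable_rpow_neg hα (show 0 < σ - 1 by linarith)
    simpa using this
  have h := intervalIntegral.hasSum_integral_of_dominated_convergence (μ := volume) (a := 1) (b := T)
    (F := fun (k : ℕ) (u : ℝ) => c k * (((k + α : ℝ) ^ (-σ) : ℝ) : ℂ) *
      (((k + α : ℝ) : ℂ) ^ (-(((ε * u : ℝ) : ℂ) * I)) * (y : ℂ) ^ (((ε * u : ℝ) : ℂ) * I)))
    (f := fun u => L (σ + (ε * u : ℝ) * I) * (y : ℂ) ^ (((ε * u : ℝ) : ℂ) * I))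
    (bound := fun k _ => (k + α : ℝ) ^ (-σ)) ?_ ?_ ?_ ?_ ?_
  · simp_rw [intervalIntegral.integral_const_mul] at h
    exact h
  · intro k
    exact (continuous_const.mul ((hcont' (hpos k)).mul (hcont hy))).aestronglyMeasurable
  · intro k
    refine Eventually.of_forall fun u _ => ?_
    rw [norm_mul, norm_mul, norm_mul, hL.norm_eq, hn' (hpos k), hn hy, Complex.norm_real,
      Real.norm_of_nonneg (by positivity)]
    simp
  · exact Eventually.of_forall fun u _ => hsum
  · exact intervalIntegrable_const
  · refine Eventually.of_forall fun u _ => ?_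
    have h1 := (hL.hasSum (σ + (ε * u : ℝ) * I) (by simp [hσ])).mul_right
      ((y : ℂ) ^ (((ε * u : ℝ) : ℂ) * I))
    refine h1.congr_fun fun k => ?_
    have hk : (((k + α : ℝ) : ℝ) : ℂ) ≠ 0 := by exact_mod_cast (hpos k).ne'
    rw [neg_add, Complex.cpow_add _ _ hk, Complex.ofReal_cpow (hpos k).le]
    push_cast
    ring

lemma rpow_neg_le_one_add {α δ : ℝ} (hα : 0 < α) (hδ : 0 ≤ δ) (hδ1 : δ ≤ 1) :
    α ^ (-δ) ≤ 1 + 1 / α := by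
  rcases le_total α 1 with h | h
  · have := Real.rpow_le_rpow_of_exponent_ge hα h (show (-1 : ℝ) ≤ -δ by linarith)
    rw [Real.rpow_neg_one] at this
    rw [one_div]; linarith
  · have := Real.rpow_le_one_of_one_le_of_nonpos h (show -δ ≤ 0 by linarith)
    have : 0 < 1 / α := by positivity
    linarith

/-- The off-diagonal contribution on the line `Re s = 1 + δ`. -/
lemma IsConvexZeta.norm_integral_right_sub_le {L : ℂ → ℂ} {α : ℝ} {c : ℕ → ℂ}
    (hL : IsConvexZeta L α c) {δ : ℝ} (hδ : 0 < δ) {D : ℝ} (hD : α ^ (-δ) ≤ D) {ε : ℝ} (hε : |ε| = 1) (m : ℕ)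
    (T : ℝ) :
    ‖(∫ u in (1 : ℝ)..T, L ((1 + δ : ℝ) + (ε * u : ℝ) * I) *
        ((m + α : ℝ) : ℂ) ^ (((ε * u : ℝ) : ℂ) * I)) -
      c m * (((m + α : ℝ) ^ (-(1 + δ)) : ℝ) : ℂ) * ((T - 1 : ℝ) : ℂ)‖ ≤
      2 * (2 + 1 / δ) + 2 * D * (1 / α + 2 * (1 + Real.log (m + 1))) := by
  have hα := hL.pos
  have hD0 : 0 ≤ D := le_trans (by positivity) hD
  have hpos : ∀ k : ℕ, (0 : ℝ) < k + α := fun k => by positivity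
  have h := hL.hasSum_integral (σ := 1 + δ) (by linarith) (hpos m) ε T
  set f : ℕ → ℂ := fun k : ℕ => c k * (((k + α : ℝ) ^ (-(1 + δ)) : ℝ) : ℂ) *
      ∫ u in (1 : ℝ)..T, ((k + α : ℝ) : ℂ) ^ (-(((ε * u : ℝ) : ℂ) * I)) *
        ((m + α : ℝ) : ℂ) ^ (((ε * u : ℝ) : ℂ) * I) with hf
  set V := ∫ u in (1 : ℝ)..T, L ((1 + δ : ℝ) + (ε * u : ℝ) * I) *
        ((m + α : ℝ) : ℂ) ^ (((ε * u : ℝ) : ℂ) * I) with hV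
  have hnf : ∀ k, ‖f k‖ = (k + α : ℝ) ^ (-(1 + δ)) *
      ‖∫ u in (1 : ℝ)..T, ((k + α : ℝ) : ℂ) ^ (-(((ε * u : ℝ) : ℂ) * I)) *
        ((m + α : ℝ) : ℂ) ^ (((ε * u : ℝ) : ℂ) * I)‖ := by
    intro k
    rw [hf]
    simp only [norm_mul]
    rw [hL.norm_eq, one_mul, Complex.norm_real, Real.norm_of_nonneg (by positivity)]
  have hfm : f m = c m * (((m + α : ℝ) ^ (-(1 + δ)) : ℝ) : ℂ) * ((T - 1 : ℝ) : ℂ) := by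
    rw [hf]
    simp only
    congr 1
    have hne : (((m + α : ℝ) : ℝ) : ℂ) ≠ 0 := by exact_mod_cast (hpos m).ne'
    have : ∀ u : ℝ, ((m + α : ℝ) : ℂ) ^ (-(((ε * u : ℝ) : ℂ) * I)) *
        ((m + α : ℝ) : ℂ) ^ (((ε * u : ℝ) : ℂ) * I) = 1 := fun u => by
      rw [← Complex.cpow_add _ _ hne, neg_add_cancel, Complex.cpow_zero]
    simp_rw [this]
    simp
  have htail := (hasSum_nat_add_iff' (m + 1)).mpr h
  have hb := ((summable_rpow_neg one_pos hδ).hasSum.mul_left 2)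
  have htail2 := htail.norm_le_of_bounded hb fun j => by
    rw [hnf]
    have hlt : (m : ℝ) + α < ((j + (m + 1) : ℕ) : ℝ) + α := by push_cast; linarith [Nat.cast_nonneg (α := ℝ) j]
    have h1 := (norm_integral_term_le (hpos m) hlt hε 1 T).2
    have e : ((j + (m + 1) : ℕ) : ℝ) + α - (m + α) = j + 1 := by push_cast; ring
    rw [e] at h1
    set y : ℝ := ((j + (m + 1) : ℕ) : ℝ) + α with hy
    have hy0 : 0 < y := hpos _
    have hj0 : (0 : ℝ) < j + 1 := by positivity
    have hjy : (j : ℝ) + 1 ≤ y := by linarith [hpos m]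
    calc y ^ (-(1 + δ)) * _ ≤ y ^ (-(1 + δ)) * (2 * (y / (j + 1))) := by gcongr
      _ = 2 * (y ^ (-δ) / (j + 1)) := by
          have : y ^ (-δ) = y ^ (-(1 + δ)) * y := by
            rw [← Real.rpow_add_one hy0.ne']; congr 1; ring
          rw [this]; ring
      _ ≤ 2 * ((j + 1 : ℝ) ^ (-δ) / (j + 1)) := by
          gcongr 2 * (?_ / _)
          exact Real.rpow_le_rpow_of_nonpos hj0 hjy (by linarith)
      _ = 2 * (j + 1 : ℝ) ^ (-(1 + δ)) := by
          rw [← Real.rpow_sub_one hj0.ne']; congr 2; ring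
  have hts : 2 * ∑' k : ℕ, ((k : ℝ) + 1) ^ (-(1 + δ)) ≤ 2 * (2 + 1 / δ) := by
    have := tsum_rpow_neg_le one_pos hδ
    rw [Real.one_rpow] at this
    linarith
  have hhead : ‖∑ k ∈ Finset.range m, f k‖ ≤
      2 * D * (1 / α + 2 * (1 + Real.log (m + 1))) := by
    calc _ ≤ ∑ k ∈ Finset.range m, 2 * D * (1 / (k + α) + 1 / ((m : ℝ) - k)) := by
          refine (norm_sum_le _ _).trans (Finset.sum_le_sum fun k hk => ?_)
          rw [Finset.mem_range] at hk
          have hkm : (k : ℝ) < m := by exact_mod_cast hk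
          have h1 := (norm_integral_term_le (hpos k) (show (k : ℝ) + α < m + α by linarith) hε 1 T).1
          rw [hnf, ← div_mul_sub_eq hα hk]
          rw [show (m : ℝ) + α - (k + α) = m - k by ring] at h1
          have hd : 0 < (m : ℝ) - k := by linarith
          have hp : (k + α : ℝ) ^ (-δ) ≤ D := (Real.rpow_le_rpow_of_nonpos hα
            (by linarith [Nat.cast_nonneg (α := ℝ) k]) (by linarith)).trans hD
          have hmα := hpos m
          have hkα := hpos k
          calc _ ≤ (k + α : ℝ) ^ (-(1 + δ)) * (2 * ((m + α) / (m - k))) := by gcongr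
            _ = 2 * (k + α : ℝ) ^ (-δ) * ((m + α) / ((k + α) * (m - k))) := by
                have : (k + α : ℝ) ^ (-(1 + δ)) = (k + α : ℝ) ^ (-δ) / (k + α) := by
                  rw [← Real.rpow_sub_one (hpos k).ne']; congr 1; ring
                rw [this]; field_simp
            _ ≤ _ := by gcongr
      _ ≤ _ := by
          rw [← Finset.mul_sum]
          gcongr
          exact sum_inv_le hα m
  have e : V - c m * (((m + α : ℝ) ^ (-(1 + δ)) : ℝ) : ℂ) * ((T - 1 : ℝ) : ℂ) =
      (V - ∑ k ∈ Finset.range (m + 1), f k) + ∑ k ∈ Finset.range m, f k := by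
    rw [Finset.sum_range_succ, hfm]; ring
  rw [e]
  refine (norm_add_le _ _).trans (add_le_add (htail2.trans hts) hhead)

set_option maxHeartbeats 1000000 in
/-- The mean value of a Dirichlet series against one of its terms. -/
theorem IsConvexZeta.exists_norm_integral_sub_le {L : ℂ → ℂ} {α : ℝ} {c : ℕ → ℂ}
    (hL : IsConvexZeta L α c) {θ : ℝ} (hθ : 0 < θ) (hθ1 : θ < 1) {B : ℝ} (hB : 0 < B) :
    ∃ C > 0, ∀ (ε : ℝ) (m : ℕ) (T : ℝ), |ε| = 1 → 10 ≤ T → m + α ≤ B * T →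
      ‖(∫ u in (1 : ℝ)..T, L (θ + (ε * u : ℝ) * I) *
          ((m + α : ℝ) : ℂ) ^ (((ε * u : ℝ) : ℂ) * I)) -
        c m * (((m + α : ℝ) ^ (-θ) : ℝ) : ℂ) * (T : ℂ)‖ ≤
        C * Real.log T * (T ^ ((1 - θ) / 2) + (m + α) ^ (1 - θ)) := by
  have hα := hL.pos
  obtain ⟨C₁, hC₁, hconv⟩ := hL.convex
  have hlow : ∃ B₁ > 0, ∀ ε x : ℝ, |ε| = 1 → 0 ≤ x → x ≤ 2 → ‖L (x + ε * I)‖ ≤ B₁ := by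
    have hc : ∀ ε : ℝ, |ε| = 1 → ContinuousOn (fun x : ℝ => L (x + ε * I)) (Icc 0 2) := by
      intro ε hε x _
      refine ContinuousAt.continuousWithinAt ?_
      have h1 : (x : ℂ) + ε * I ≠ 1 := fun h => by
        have := congrArg Complex.im h
        simp at this; rw [this] at hε; simp at hε
      exact (hL.differentiableAt _ h1).continuousAt.comp
        (f := fun x : ℝ => (x : ℂ) + ε * I) (by fun_prop)
    obtain ⟨b₁, h₁⟩ := isCompact_Icc.exists_bound_of_continuousOn (hc 1 (by simp))
    obtain ⟨b₂, h₂⟩ := isCompact_Icc.exists_bound_of_continuousOn (hc (-1) (by simp))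
    refine ⟨max 1 (max b₁ b₂), by positivity, fun ε x hε h0 h2 => ?_⟩
    rcases eq_or_eq_neg_of_abs_eq hε with rfl | rfl
    · exact (h₁ x ⟨h0, h2⟩).trans ((le_max_left _ _).trans (le_max_right _ _))
    · exact (h₂ x ⟨h0, h2⟩).trans ((le_max_right _ _).trans (le_max_right _ _))
  obtain ⟨B₁, hB₁, hlow⟩ := hlow
  set K := 3 * max B 1 with hK
  have hK3 : 3 ≤ K := by have := le_max_right B 1; linarith
  set A := 2 * (1 + 1 / α) * (1 / α + 2 * (2 + B)) with hA
  have hA0 : 0 < A := by positivity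
  refine ⟨2 * B₁ * (1 + K) + 2 * C₁ * K + K * (4 + A) + α ^ (-θ), by positivity,
    fun ε m T hε hT hm => ?_⟩
  have hlog := two_le_log hT
  have hT0 : 0 < T := by linarith
  set δ := 1 / Real.log T with hδ
  have hδ0 : 0 < δ := by positivity
  have hδ1 : δ ≤ 1 / 2 := by rw [hδ]; gcongr
  set y : ℝ := m + α with hy
  have hy0 : 0 < y := by positivity
  have hyc : (y : ℂ) ≠ 0 := by exact_mod_cast hy0.ne'
  set P := y ^ (1 + δ - θ) with hP
  set Q := y ^ (1 - θ) with hQ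
  set R := T ^ ((1 - θ) / 2) with hR
  have hR1 : 1 ≤ R := Real.one_le_rpow (by linarith) (by linarith)
  have hQ0 : 0 < Q := by positivity
  have hPQ : P ≤ K * Q := by
    have h1 : P = y ^ δ * Q := by rw [hP, hQ, ← Real.rpow_add hy0]; congr 1; ring
    rw [h1]
    gcongr
    have h2 : y ≤ max B 1 * T := hm.trans (by gcongr; exact le_max_left _ _)
    calc y ^ δ ≤ (max B 1 * T) ^ δ := Real.rpow_le_rpow hy0.le h2 hδ0.le
      _ = max B 1 ^ δ * T ^ δ := Real.mul_rpow (by positivity) hT0.le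
      _ ≤ max B 1 * 3 := by
          gcongr
          · calc max B 1 ^ δ ≤ max B 1 ^ (1 : ℝ) :=
                Real.rpow_le_rpow_of_exponent_le (le_max_right _ _) (by linarith)
              _ = max B 1 := Real.rpow_one _
          · rw [Real.rpow_def_of_pos hT0, hδ, mul_one_div_cancel (by linarith)]
            linarith [Real.exp_one_lt_d9]
      _ = K := by rw [hK]; ring
  set f : ℂ → ℂ := fun s => L s * (y : ℂ) ^ (s - θ) with hf
  have hnorm : ∀ x t : ℝ, ‖(y : ℂ) ^ (((x : ℂ) + t * I) - θ)‖ = y ^ (x - θ) := fun x t => by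
    rw [Complex.norm_cpow_eq_rpow_re_of_pos hy0]; simp
  have hyx : ∀ x : ℝ, θ ≤ x → x ≤ 1 + δ → y ^ (x - θ) ≤ 1 + P := by
    intro x h1 h2
    rcases le_total y 1 with h | h
    · have := Real.rpow_le_one hy0.le h (show 0 ≤ x - θ by linarith)
      have : 0 < P := by positivity
      linarith
    · have := Real.rpow_le_rpow_of_exponent_le h (show x - θ ≤ 1 + δ - θ by linarith)
      linarith
  have hε0 : ε ≠ 0 := by rintro rfl; simp at hε
  have hdiff : DifferentiableOn ℂ f (uIcc ((θ : ℂ) + ε * I).re (((1 + δ : ℝ) : ℂ) + (ε * T : ℝ) * I).re ×ℂ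
      uIcc ((θ : ℂ) + ε * I).im (((1 + δ : ℝ) : ℂ) + (ε * T : ℝ) * I).im) := by
    intro s hs
    refine DifferentiableAt.differentiableWithinAt ?_
    have him : s.im ≠ 0 := by
      have h2 := hs.2
      have e1 : ((θ : ℂ) + ε * I).im = ε := by simp
      have e2 : (((1 + δ : ℝ) : ℂ) + (ε * T : ℝ) * I).im = ε * T := by simp
      rw [mem_preimage, e1, e2] at h2
      intro h0
      rw [h0] at h2
      rcases eq_or_eq_neg_of_abs_eq hε with rfl | rfl
      · rw [uIcc_of_le (by linarith)] at h2; linarith [h2.1]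
      · rw [uIcc_of_ge (by linarith)] at h2; linarith [h2.2]
    have hs1 : s ≠ 1 := by rintro rfl; simp at him
    exact (hL.differentiableAt s hs1).mul
      (DifferentiableAt.const_cpow (by fun_prop) (Or.inl hyc))
  have hrect := Complex.integral_boundary_rect_eq_zero_of_differentiableOn f _ _ hdiff
  have e1 : ((θ : ℂ) + ε * I).im = ε := by simp
  have e2 : (((1 + δ : ℝ) : ℂ) + (ε * T : ℝ) * I).im = ε * T := by simp
  have e3 : ((θ : ℂ) + ε * I).re = θ := by simp
  have e4 : (((1 + δ : ℝ) : ℂ) + (ε * T : ℝ) * I).re = 1 + δ := by simp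
  rw [e1, e2, e3, e4] at hrect
  have hsub : ∀ g : ℝ → ℂ, ∫ v in ε..(ε * T), g v = (ε : ℂ) * ∫ u in (1 : ℝ)..T, g (ε * u) := by
    intro g
    have := intervalIntegral.smul_integral_comp_mul_left (a := 1) (b := T) g ε
    rw [mul_one] at this
    rw [← this, Complex.real_smul]
  rw [hsub, hsub] at hrect
  have hfl : ∀ u : ℝ, f ((θ : ℂ) + (ε * u : ℝ) * I) =
      L (θ + (ε * u : ℝ) * I) * (y : ℂ) ^ (((ε * u : ℝ) : ℂ) * I) := fun u => by
    rw [hf]; simp only; rw [add_sub_cancel_left]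
  have hfr : ∀ u : ℝ, f (((1 + δ : ℝ) : ℂ) + (ε * u : ℝ) * I) = ((P : ℝ) : ℂ) *
      (L ((1 + δ : ℝ) + (ε * u : ℝ) * I) * (y : ℂ) ^ (((ε * u : ℝ) : ℂ) * I)) := fun u => by
    rw [hf]; simp only
    rw [show ((1 + δ : ℝ) : ℂ) + (ε * u : ℝ) * I - θ = ((1 + δ - θ : ℝ) : ℂ) + (ε * u : ℝ) * I by
      push_cast; ring, Complex.cpow_add _ _ hyc, ← Complex.ofReal_cpow hy0.le]
    ring
  simp_rw [hfl, hfr] at hrect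
  rw [intervalIntegral.integral_const_mul] at hrect
  set X := ∫ u in (1 : ℝ)..T, L (θ + (ε * u : ℝ) * I) * (y : ℂ) ^ (((ε * u : ℝ) : ℂ) * I) with hX
  set V := ∫ u in (1 : ℝ)..T, L ((1 + δ : ℝ) + (ε * u : ℝ) * I) *
    (y : ℂ) ^ (((ε * u : ℝ) : ℂ) * I) with hV
  set H₁ := ∫ x in θ..(1 + δ), f (x + ε * I) with hH₁
  set H₂ := ∫ x in θ..(1 + δ), f (x + (ε * T : ℝ) * I) with hH₂
  have hlen : |1 + δ - θ| ≤ 2 := by rw [abs_le]; constructor <;> linarith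
  have hn1 : ‖H₁‖ ≤ B₁ * (1 + P) * 2 := by
    have := intervalIntegral.norm_integral_le_of_norm_le_const (a := θ) (b := 1 + δ)
      (C := B₁ * (1 + P)) (f := fun x : ℝ => f (x + ε * I)) (fun x hx => by
        rw [uIoc_of_le (by linarith)] at hx
        rw [hf]; simp only
        rw [norm_mul, hnorm]
        have g1 := hlow ε x hε (by linarith [hx.1]) (by linarith [hx.2])
        have g2 := hyx x hx.1.le hx.2
        gcongr)
    exact this.trans (by gcongr)
  have hεT : |ε * T| = T := by rw [abs_mul, hε, one_mul, abs_of_pos hT0]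
  have hn2 : ‖H₂‖ ≤ C₁ * Real.log T * (R + P) * 2 := by
    have := intervalIntegral.norm_integral_le_of_norm_le_const (a := θ) (b := 1 + δ)
      (C := C₁ * Real.log T * (R + P)) (f := fun x : ℝ => f (x + (ε * T : ℝ) * I)) (fun x hx => by
        rw [uIoc_of_le (by linarith)] at hx
        rw [hf]; simp only
        rw [norm_mul, hnorm]
        have g1 := hconv x (ε * T) (by rw [hεT]; exact hT) (by linarith [hx.1])
          (by rw [hεT]; exact hx.2)
        rw [hεT] at g1
        have g2 : T ^ ((1 - x) / 2) * y ^ (x - θ) ≤ R + P := by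
          set z := y / T ^ (1 / 2 : ℝ) with hz
          have hz0 : 0 < z := by positivity
          have g3 : T ^ ((1 - x) / 2) * y ^ (x - θ) = R * z ^ (x - θ) := by
            rw [hz, Real.div_rpow hy0.le (by positivity), ← Real.rpow_mul hT0.le, hR]
            have : T ^ ((1 - θ) / 2) = T ^ ((1 - x) / 2) * T ^ (1 / 2 * (x - θ)) := by
              rw [← Real.rpow_add hT0]; congr 1; ring
            rw [this]
            field_simp
          rw [g3]
          rcases le_total z 1 with h | h
          · have := Real.rpow_le_one hz0.le h (show 0 ≤ x - θ by linarith [hx.1])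
            have : 0 < P := by positivity
            nlinarith
          · have g4 := Real.rpow_le_rpow_of_exponent_le h (show x - θ ≤ 1 + δ - θ by linarith [hx.2])
            have g5 : R * z ^ (1 + δ - θ) ≤ P := by
              rw [hz, Real.div_rpow hy0.le (by positivity), ← Real.rpow_mul hT0.le, ← hP,
                ← mul_div_assoc, div_le_iff₀ (by positivity), mul_comm]
              gcongr
              rw [hR]
              exact Real.rpow_le_rpow_of_exponent_le (by linarith) (by linarith)
            have : R * z ^ (x - θ) ≤ R * z ^ (1 + δ - θ) := by gcongr
            linarith
        calc _ ≤ C₁ * T ^ ((1 - x) / 2) * Real.log T * y ^ (x - θ) := by gcongr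
          _ = C₁ * Real.log T * (T ^ ((1 - x) / 2) * y ^ (x - θ)) := by ring
          _ ≤ _ := by gcongr)
    exact this.trans (by gcongr)
  have hlogm : Real.log (m + 1) ≤ (1 + B) * Real.log T := by
    have h1 : (m : ℝ) + 1 ≤ (B + 1) * T := by
      have : (m : ℝ) ≤ y := by rw [hy]; linarith
      linarith
    calc Real.log (m + 1) ≤ Real.log ((B + 1) * T) := Real.log_le_log (by positivity) h1
      _ = Real.log (B + 1) + Real.log T := Real.log_mul (by positivity) hT0.ne'
      _ ≤ B + Real.log T := by
          have := Real.log_le_sub_one_of_pos (show 0 < B + 1 by linarith); linarith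
      _ ≤ _ := by nlinarith
  have hn3 : ‖V - c m * ((y ^ (-(1 + δ)) : ℝ) : ℂ) * ((T - 1 : ℝ) : ℂ)‖ ≤ (4 + A) * Real.log T := by
    refine (hL.norm_integral_right_sub_le hδ0 (rpow_neg_le_one_add hα hδ0.le (by linarith)) hε m T).trans ?_
    have g1 : 1 / δ = Real.log T := by rw [hδ, one_div_one_div]
    have g2 : 1 / α + 2 * (1 + Real.log (m + 1)) ≤ (1 / α + 2 * (2 + B)) * Real.log T := by
      have : 1 / α ≤ 1 / α * Real.log T := le_mul_of_one_le_right (by positivity) (by linarith)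
      nlinarith
    have g3 : 2 * (1 + 1 / α) * (1 / α + 2 * (1 + Real.log (m + 1))) ≤ A * Real.log T := by
      rw [hA, mul_assoc (2 * (1 + 1 / α))]
      gcongr
    rw [g1]; linarith
  have hsplit : X - c m * ((y ^ (-θ) : ℝ) : ℂ) * (T : ℂ) =
      (P : ℂ) * (V - c m * ((y ^ (-(1 + δ)) : ℝ) : ℂ) * ((T - 1 : ℝ) : ℂ)) -
      c m * ((y ^ (-θ) : ℝ) : ℂ) + (ε : ℂ) * (-I) * (H₁ - H₂) := by
    have hPy : (P : ℂ) * ((y ^ (-(1 + δ)) : ℝ) : ℂ) = ((y ^ (-θ) : ℝ) : ℂ) := by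
      rw [← Complex.ofReal_mul, hP, ← Real.rpow_add hy0]; congr 2; ring
    have hεε : (ε : ℂ) * ε = 1 := by
      have : ε * ε = 1 := by rw [← abs_mul_abs_self, hε, one_mul]
      exact_mod_cast this
    have hII := Complex.I_mul_I
    simp only [smul_eq_mul] at hrect
    have hx : X = (P : ℂ) * V + (ε : ℂ) * (-I) * (H₁ - H₂) := by
      linear_combination ((ε : ℂ) * I) * hrect - (ε * ε * (P * V - X)) * hII + (P * V - X) * hεε
    rw [hx, ← hPy]; push_cast; ring
  have hyθ : y ^ (-θ) ≤ α ^ (-θ) :=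
    Real.rpow_le_rpow_of_nonpos hα (by rw [hy]; linarith [Nat.cast_nonneg (α := ℝ) m]) (by linarith)
  have hP0 : 0 < P := by positivity
  have hall : ‖X - c m * ((y ^ (-θ) : ℝ) : ℂ) * (T : ℂ)‖ ≤
      P * ((4 + A) * Real.log T) + α ^ (-θ) + (B₁ * (1 + P) * 2 + C₁ * Real.log T * (R + P) * 2) := by
    rw [hsplit]
    refine (norm_add_le _ _).trans (add_le_add ((norm_sub_le _ _).trans (add_le_add ?_ ?_)) ?_)
    · rw [norm_mul, Complex.norm_real, Real.norm_of_nonneg hP0.le]; gcongr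
    · rw [norm_mul, hL.norm_eq, one_mul, Complex.norm_real, Real.norm_of_nonneg (by positivity)]
      exact hyθ
    · rw [norm_mul, norm_mul, norm_neg, Complex.norm_I, Complex.norm_real, Real.norm_eq_abs, hε,
        one_mul, one_mul]
      exact (norm_sub_le _ _).trans (add_le_add hn1 hn2)
  refine hall.trans ?_
  have hα0 : 0 < α ^ (-θ) := by positivity
  have i1 : P * ((4 + A) * Real.log T) ≤ K * (4 + A) * Real.log T * (R + Q) := by
    calc _ ≤ K * Q * ((4 + A) * Real.log T) := by gcongr
      _ = K * (4 + A) * Real.log T * Q := by ring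
      _ ≤ _ := by gcongr; linarith
  have i2 : α ^ (-θ) ≤ α ^ (-θ) * Real.log T * (R + Q) := by
    rw [mul_assoc]
    exact le_mul_of_one_le_right hα0.le (by nlinarith)
  have i3 : B₁ * (1 + P) * 2 ≤ 2 * B₁ * (1 + K) * Real.log T * (R + Q) := by
    have : 1 + P ≤ (1 + K) * (Real.log T * (R + Q)) := by
      have t1 : R + Q ≤ Real.log T * (R + Q) := le_mul_of_one_le_left (by positivity) (by linarith)
      have t2 : K * Q ≤ K * (R + Q) := by gcongr; linarith
      have t3 : K * (R + Q) ≤ K * (Real.log T * (R + Q)) := by gcongr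
      linarith
    calc _ = 2 * B₁ * (1 + P) := by ring
      _ ≤ 2 * B₁ * ((1 + K) * (Real.log T * (R + Q))) := by gcongr
      _ = _ := by ring
  have i4 : C₁ * Real.log T * (R + P) * 2 ≤ 2 * C₁ * K * Real.log T * (R + Q) := by
    have : R + P ≤ K * (R + Q) := by nlinarith
    calc _ ≤ C₁ * Real.log T * (K * (R + Q)) * 2 := by gcongr
      _ = _ := by ring
  calc _ ≤ K * (4 + A) * Real.log T * (R + Q) + α ^ (-θ) * Real.log T * (R + Q) +
        (2 * B₁ * (1 + K) * Real.log T * (R + Q) + 2 * C₁ * K * Real.log T * (R + Q)) := by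
        gcongr
    _ = _ := by ring

/-! ### The initial partial sum -/

lemma zetaH_add_one {a : ℝ} (ha : 0 < a) (s : ℂ) :
    zetaH s a = (a : ℂ) ^ (-s) + zetaH s (a + 1) := by
  have h1 : 0 < ⌈a⌉₊ := Nat.ceil_pos.mpr ha
  have h2 : ⌈a + 1⌉₊ = ⌈a⌉₊ + 1 := by
    rw [← Nat.cast_one, Nat.ceil_add_natCast ha.le]
  obtain ⟨N, hN⟩ : ∃ N, ⌈a⌉₊ = N + 1 := ⟨⌈a⌉₊ - 1, by omega⟩
  have hc : ((a + 1 : ℝ) : UnitAddCircle) = (a : UnitAddCircle) := by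
    rw [AddCircle.coe_add, add_eq_left, AddCircle.coe_eq_zero_iff]
    exact ⟨1, by simp⟩
  rw [zetaH, zetaH, h2, hc, hN]
  simp only [Nat.add_sub_cancel]
  rw [Finset.sum_range_succ]
  have e : ∀ i : ℕ, (a + 1 - ((N + 1 : ℕ) : ℝ) + i) = a - N + i := fun i => by push_cast; ring
  simp_rw [e]
  rw [sub_add_cancel, Complex.cpow_neg, one_div ((a : ℂ) ^ s)]
  ring

/-- The partial sum `∑_{m<M} (m+a)^{-s}`. -/
noncomputable def partialSum (a : ℝ) (M : ℕ) (s : ℂ) : ℂ :=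
  ∑ m ∈ Finset.range M, ((m + a : ℝ) : ℂ) ^ (-s)

lemma zetaH_eq_partialSum_add {a : ℝ} (ha : 0 < a) (M : ℕ) (s : ℂ) :
    zetaH s a = partialSum a M s + zetaH s (a + M) := by
  induction M with
  | zero => simp [partialSum]
  | succ M ih =>
    have e1 : partialSum a (M + 1) s = partialSum a M s + ((a + M : ℝ) : ℂ) ^ (-s) := by
      rw [partialSum, partialSum, Finset.sum_range_succ, add_comm (M : ℝ) a]
    have e2 : a + ((M + 1 : ℕ) : ℝ) = a + M + 1 := by push_cast; ring
    rw [ih, zetaH_add_one (show 0 < a + M by positivity), e1, e2]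
    ring

lemma sum_succ_rpow_le_of_nonneg {κ : ℝ} (hκ : 0 ≤ κ) (M : ℕ) :
    ∑ k ∈ Finset.range M, ((k + 1 : ℕ) : ℝ) ^ κ ≤ (M : ℝ) ^ (κ + 1) := by
  rcases Nat.eq_zero_or_pos M with rfl | hM
  · simp; positivity
  · have hM0 : (0 : ℝ) < M := by exact_mod_cast hM
    calc _ ≤ ∑ k ∈ Finset.range M, (M : ℝ) ^ κ := by
          refine Finset.sum_le_sum fun k hk => ?_
          have : k + 1 ≤ M := Finset.mem_range.mp hk
          exact Real.rpow_le_rpow (by positivity) (by exact_mod_cast this) hκ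
      _ = (M : ℝ) ^ (κ + 1) := by
          rw [Finset.sum_const, Finset.card_range, nsmul_eq_mul, Real.rpow_add_one hM0.ne', mul_comm]

lemma exists_sum_rpow_le {a κ : ℝ} (ha : 0 < a) (hκ : -1 < κ) :
    ∃ C > 0, ∀ M : ℕ, ∑ m ∈ Finset.range M, (m + a : ℝ) ^ κ ≤ C * (M : ℝ) ^ (κ + 1) := by
  have hmax : (0 : ℝ) < max a 1 := by positivity
  have hmin : (0 : ℝ) < min a 1 := by positivity
  set D := max a 1 ^ κ + min a 1 ^ κ with hD
  have hD0 : 0 < D := by positivity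
  have hcomp : ∀ m : ℕ, (m + a : ℝ) ^ κ ≤ D * ((m + 1 : ℕ) : ℝ) ^ κ := by
    intro m
    have hm : (0 : ℝ) ≤ m := Nat.cast_nonneg m
    have hx : (0 : ℝ) < ((m + 1 : ℕ) : ℝ) := by positivity
    have h1 : (m + a : ℝ) = (m + a) / ((m + 1 : ℕ) : ℝ) * ((m + 1 : ℕ) : ℝ) := by field_simp
    rw [h1, Real.mul_rpow (by positivity) hx.le]
    gcongr
    have hr : (0 : ℝ) < (m + a) / ((m + 1 : ℕ) : ℝ) := by positivity
    have p1 : 0 < max a 1 ^ κ := by positivity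
    have p2 : 0 < min a 1 ^ κ := by positivity
    rcases le_total 0 κ with h | h
    · have : (m + a) / ((m + 1 : ℕ) : ℝ) ≤ max a 1 := by
        rw [div_le_iff₀ hx]; push_cast
        nlinarith [le_max_left a 1, le_max_right a 1]
      have := Real.rpow_le_rpow hr.le this h
      linarith
    · have : min a 1 ≤ (m + a) / ((m + 1 : ℕ) : ℝ) := by
        rw [le_div_iff₀ hx]; push_cast
        nlinarith [min_le_left a 1, min_le_right a 1]
      have := Real.rpow_le_rpow_of_nonpos hmin this h
      linarith
  refine ⟨D * (1 + 1 / (κ + 1)), by have : 0 < κ + 1 := by linarith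
                                    positivity, fun M => ?_⟩
  have hk1 : 0 < κ + 1 := by linarith
  calc _ ≤ ∑ m ∈ Finset.range M, D * ((m + 1 : ℕ) : ℝ) ^ κ := Finset.sum_le_sum fun m _ => hcomp m
    _ = D * ∑ m ∈ Finset.range M, ((m + 1 : ℕ) : ℝ) ^ κ := by rw [Finset.mul_sum]
    _ ≤ D * ((1 + 1 / (κ + 1)) * (M : ℝ) ^ (κ + 1)) := by
        gcongr
        have hp : 0 ≤ (M : ℝ) ^ (κ + 1) := by positivity
        have hp2 : 0 ≤ 1 / (κ + 1) * (M : ℝ) ^ (κ + 1) := by positivity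
        rcases le_total 0 κ with h | h
        · have := sum_succ_rpow_le_of_nonneg h M
          linarith
        · have := sum_succ_rpow_le hk1 (by linarith) M
          rw [add_sub_cancel_right] at this
          have e : (M : ℝ) ^ (κ + 1) / (κ + 1) = 1 / (κ + 1) * (M : ℝ) ^ (κ + 1) := by ring
          linarith
    _ = _ := by ring

lemma double_sum_eq (f : ℕ → ℕ → ℂ) (M : ℕ) :
    ∑ k ∈ Finset.range M, ∑ l ∈ Finset.range M, f k l =
      ∑ m ∈ Finset.range M, (f m m + ∑ k ∈ Finset.range m, (f m k + f k m)) := by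
  induction M with
  | zero => simp
  | succ M ih =>
    rw [Finset.sum_range_succ, Finset.sum_range_succ _ M]
    simp_rw [Finset.sum_range_succ (fun l => f _ l) M]
    rw [Finset.sum_add_distrib, ih, Finset.sum_add_distrib]
    rw [Finset.sum_range_succ (fun m => f m m + ∑ k ∈ Finset.range m, (f m k + f k m)) M,
      Finset.sum_add_distrib (f := fun k => f M k)]
    simp only [Finset.sum_add_distrib]
    ring

lemma norm_sq_sum (x : ℕ → ℂ) (M : ℕ) :
    ((‖∑ k ∈ Finset.range M, x k‖ ^ 2 : ℝ) : ℂ) =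
      ∑ m ∈ Finset.range M, (((‖x m‖ ^ 2 : ℝ) : ℂ) +
        ∑ k ∈ Finset.range m, (x m * conj (x k) + x k * conj (x m))) := by
  have e : ∀ z : ℂ, ((‖z‖ ^ 2 : ℝ) : ℂ) = z * conj z := fun z => by
    rw [Complex.mul_conj, Complex.normSq_eq_norm_sq]
  simp_rw [e]
  rw [map_sum, Finset.sum_mul_sum, double_sum_eq]

lemma integral_norm_sq_sum {x : ℕ → ℝ → ℂ} {α β : ℝ} (M : ℕ)
    (hi : ∀ m k, IntervalIntegrable (fun t => x m t * conj (x k t)) volume α β) :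
    ∫ t in α..β, ((‖∑ k ∈ Finset.range M, x k t‖ ^ 2 : ℝ) : ℂ) =
      ∑ m ∈ Finset.range M, ((∫ t in α..β, ((‖x m t‖ ^ 2 : ℝ) : ℂ)) +
        ∑ k ∈ Finset.range m, ((∫ t in α..β, x m t * conj (x k t)) +
          ∫ t in α..β, x k t * conj (x m t))) := by
  have hp : ∀ m k, IntervalIntegrable (fun t => x m t * conj (x k t) + x k t * conj (x m t))
      volume α β := fun m k => (hi m k).add (hi k m)
  have hs : ∀ m, IntervalIntegrable (fun t => ∑ k ∈ Finset.range m,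
      (x m t * conj (x k t) + x k t * conj (x m t))) volume α β := fun m => by
    simpa only [Finset.sum_fn] using IntervalIntegrable.sum (Finset.range m) fun k _ => hp m k
  have hd : ∀ m, IntervalIntegrable (fun t => ((‖x m t‖ ^ 2 : ℝ) : ℂ)) volume α β := fun m => by
    refine (hi m m).congr fun t _ => ?_
    rw [Complex.mul_conj, Complex.normSq_eq_norm_sq]
  simp_rw [norm_sq_sum]
  rw [intervalIntegral.integral_finsetSum fun m _ => (hd m).add (hs m)]
  refine Finset.sum_congr rfl fun m _ => ?_
  rw [intervalIntegral.integral_add (hd m) (hs m),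
    intervalIntegral.integral_finsetSum fun k _ => hp m k]
  congr 1
  exact Finset.sum_congr rfl fun k _ => intervalIntegral.integral_add (hi m k) (hi k m)

/-- The standard bound for off-diagonal sums. -/
lemma sum_offdiag_le {α κ : ℝ} (hα : 0 < α) (hκ1 : κ ≤ 1) (M : ℕ) (W : ℕ → ℝ) (hW : ∀ m, 0 ≤ W m) :
    ∑ m ∈ Finset.range M, ∑ k ∈ Finset.range m,
      (m + α : ℝ) ^ (-κ) * (k + α : ℝ) ^ (-κ) * (W m * ((m + α) / ((m : ℝ) - k))) ≤
    (1 / α + 2 * (1 + Real.log (M + 1))) * ∑ m ∈ Finset.range M, W m * (m + α : ℝ) ^ (1 - 2 * κ) := by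
  rw [Finset.mul_sum]
  refine Finset.sum_le_sum fun m hm => ?_
  have hm' : m < M := Finset.mem_range.mp hm
  have hmα : (0 : ℝ) < m + α := by positivity
  calc _ ≤ ∑ k ∈ Finset.range m, W m * (m + α : ℝ) ^ (1 - 2 * κ) *
        (1 / (k + α) + 1 / ((m : ℝ) - k)) := by
        refine Finset.sum_le_sum fun k hk => ?_
        have hk' : k < m := Finset.mem_range.mp hk
        have hkm : (k : ℝ) < m := by exact_mod_cast hk'
        have hd : 0 < (m : ℝ) - k := by linarith
        have hkα : (0 : ℝ) < k + α := by positivity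
        rw [← div_mul_sub_eq hα hk']
        have h1 : (k + α : ℝ) ^ (-κ) ≤ (m + α : ℝ) ^ (1 - κ) / (k + α) := by
          rw [le_div_iff₀ hkα, ← Real.rpow_add_one hkα.ne']
          rw [show -κ + 1 = 1 - κ by ring]
          exact Real.rpow_le_rpow hkα.le (by linarith) (by linarith)
        have h2 : (m + α : ℝ) ^ (1 - 2 * κ) = (m + α : ℝ) ^ (-κ) * (m + α : ℝ) ^ (1 - κ) := by
          rw [← Real.rpow_add hmα]; congr 1; ring
        have hWm := hW m
        calc _ ≤ (m + α : ℝ) ^ (-κ) * ((m + α : ℝ) ^ (1 - κ) / (k + α)) *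
              (W m * ((m + α) / ((m : ℝ) - k))) := by gcongr
          _ = _ := by rw [h2]; field_simp
    _ ≤ W m * (m + α : ℝ) ^ (1 - 2 * κ) * (1 / α + 2 * (1 + Real.log (m + 1))) := by
        rw [← Finset.mul_sum]
        have hWm := hW m
        gcongr
        exact sum_inv_le hα m
    _ ≤ _ := by
        rw [mul_comm]
        have hWm := hW m
        have : (m : ℝ) ≤ M := by exact_mod_cast hm'.le
        gcongr

lemma continuous_cpow_mul_I {x : ℝ} (hx : 0 < x) (ε : ℝ) :
    Continuous fun u : ℝ => (x : ℂ) ^ (((ε * u : ℝ) : ℂ) * I) := by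
  simp_rw [cpow_mul_I hx]; fun_prop

lemma conj_cpow_ofReal {x : ℝ} (hx : 0 < x) (s : ℂ) : conj ((x : ℂ) ^ s) = (x : ℂ) ^ (conj s) := by
  have : ((x : ℂ)).arg ≠ π := by
    rw [Complex.arg_ofReal_of_nonneg hx.le]; exact Real.pi_pos.ne
  have h := Complex.cpow_conj (x : ℂ) s this
  rw [Complex.conj_ofReal] at h
  exact h.symm

lemma cpow_neg_line {x : ℝ} (hx : 0 < x) (σ u : ℝ) :
    (x : ℂ) ^ (-((σ : ℂ) + u * I)) = ((x ^ (-σ) : ℝ) : ℂ) * (x : ℂ) ^ (-((u : ℂ) * I)) := by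
  rw [neg_add, Complex.cpow_add _ _ (by exact_mod_cast hx.ne'), Complex.ofReal_cpow hx.le]
  push_cast; ring

lemma conj_cpow_neg_line {x : ℝ} (hx : 0 < x) (σ u : ℝ) :
    conj ((x : ℂ) ^ (-((σ : ℂ) + u * I))) = ((x ^ (-σ) : ℝ) : ℂ) * (x : ℂ) ^ ((u : ℂ) * I) := by
  rw [cpow_neg_line hx, map_mul, Complex.conj_ofReal, conj_cpow_ofReal hx]
  congr 2; simp

lemma continuousOn_line {L : ℂ → ℂ} (hd : ∀ s ≠ 1, DifferentiableAt ℂ L s) (σ : ℝ) {ε : ℝ}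
    (hε : ε ≠ 0) : ContinuousOn (fun u : ℝ => L (σ + (ε * u : ℝ) * I)) (Ioi 0) := by
  intro u hu
  refine ContinuousAt.continuousWithinAt ?_
  have h1 : (σ : ℂ) + (ε * u : ℝ) * I ≠ 1 := fun h => by
    have := congrArg Complex.im h
    simp at this
    rcases this with h | h
    · exact hε h
    · exact (ne_of_gt (mem_Ioi.mp hu)) h
  exact (hd _ h1).continuousAt.comp (f := fun u : ℝ => (σ : ℂ) + (ε * u : ℝ) * I)
    (by fun_prop)

lemma continuousOn_line_one {L : ℂ → ℂ} (hd : ∀ s ≠ 1, DifferentiableAt ℂ L s) (σ : ℝ) :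
    ContinuousOn (fun u : ℝ => L (σ + u * I)) (Ioi 0) := by
  have := continuousOn_line hd σ one_ne_zero
  simpa using this

lemma ContinuousOn.intervalIntegrable_of_pos {E : Type*} [NormedAddCommGroup E] {f : ℝ → E}
    (hf : ContinuousOn f (Ioi 0)) {α β : ℝ} (hα : 0 < α) (hβ : 0 < β) :
    IntervalIntegrable f volume α β := by
  refine (hf.mono fun x hx => ?_).intervalIntegrable
  exact lt_of_lt_of_le (lt_min hα hβ) hx.1

lemma rpow_le_of_le_sqrt {T q : ℝ} {M : ℕ} (hT : 0 ≤ T) (hM : (M : ℝ) ≤ 2 * √T) (hq : 0 ≤ q) :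
    (M : ℝ) ^ q ≤ 2 ^ q * T ^ (q / 2) := by
  calc (M : ℝ) ^ q ≤ (2 * √T) ^ q := Real.rpow_le_rpow (by positivity) hM hq
    _ = 2 ^ q * T ^ (q / 2) := by
        rw [Real.mul_rpow (by norm_num) (by positivity), Real.sqrt_eq_rpow, ← Real.rpow_mul hT]
        congr 2; ring

theorem exists_integral_zetaH_mul_partialSum {a θ : ℝ} (ha : 0 < a) (hθ : 0 < θ) (hθ1 : θ < 1) :
    ∃ C > 0, ∀ (T : ℝ) (M : ℕ), 10 ≤ T → (M : ℝ) ≤ 2 * √T →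
      ‖(∫ t in (1 : ℝ)..T, zetaH (θ + t * I) a * conj (partialSum a M (θ + t * I))) -
        (∑ m ∈ Finset.range M, (m + a : ℝ) ^ (-(2 * θ)) : ℝ) * (T : ℂ)‖ ≤
        C * (T ^ (1 - θ) * Real.log T) := by
  obtain ⟨C, hC, h⟩ := (isConvexZeta_zetaH ha).exists_norm_integral_sub_le hθ hθ1
    (show 0 < 2 + a by positivity)
  obtain ⟨C₁, hC₁, h₁⟩ := exists_sum_rpow_le ha (show -1 < -θ by linarith)
  obtain ⟨C₂, hC₂, h₂⟩ := exists_sum_rpow_le ha (show -1 < 1 - 2 * θ by linarith)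
  refine ⟨C * (C₁ * 2 ^ (-θ + 1) + C₂ * 2 ^ (1 - 2 * θ + 1)), by positivity, fun T M hT hM => ?_⟩
  have hT0 : 0 < T := by linarith
  have hlog := two_le_log hT
  have hpos : ∀ m : ℕ, (0 : ℝ) < m + a := fun m => by positivity
  have hconj : ∀ t : ℝ, conj (partialSum a M (θ + t * I)) =
      ∑ m ∈ Finset.range M, (((m + a : ℝ) ^ (-θ) : ℝ) : ℂ) * ((m + a : ℝ) : ℂ) ^ ((t : ℂ) * I) := by
    intro t
    rw [partialSum, map_sum]
    exact Finset.sum_congr rfl fun m _ => conj_cpow_neg_line (hpos m) θ t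
  have hi : ∀ m : ℕ, IntervalIntegrable
      (fun t : ℝ => zetaH (θ + t * I) a * ((m + a : ℝ) : ℂ) ^ ((t : ℂ) * I)) volume 1 T := by
    intro m
    refine ContinuousOn.intervalIntegrable_of_pos ?_ one_pos hT0
    refine (continuousOn_line_one (fun s hs => differentiableAt_zetaH ha hs) θ).mul ?_
    have := continuous_cpow_mul_I (hpos m) 1
    simp only [one_mul] at this
    exact this.continuousOn
  have e1 : (∫ t in (1 : ℝ)..T, zetaH (θ + t * I) a * conj (partialSum a M (θ + t * I))) =
      ∑ m ∈ Finset.range M, (((m + a : ℝ) ^ (-θ) : ℝ) : ℂ) *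
        ∫ t in (1 : ℝ)..T, zetaH (θ + t * I) a * ((m + a : ℝ) : ℂ) ^ ((t : ℂ) * I) := by
    simp_rw [hconj, Finset.mul_sum]
    rw [intervalIntegral.integral_finsetSum fun m _ => ?_]
    · refine Finset.sum_congr rfl fun m _ => ?_
      rw [← intervalIntegral.integral_const_mul]
      congr 1; ext t; ring
    · refine ((hi m).const_mul (((m + a : ℝ) ^ (-θ) : ℝ) : ℂ)).congr ?_
      exact fun t _ => by ring
  have e2 : (((∑ m ∈ Finset.range M, (m + a : ℝ) ^ (-(2 * θ)) : ℝ)) : ℂ) * (T : ℂ) =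
      ∑ m ∈ Finset.range M, (((m + a : ℝ) ^ (-θ) : ℝ) : ℂ) *
        (1 * (((m + a : ℝ) ^ (-θ) : ℝ) : ℂ) * (T : ℂ)) := by
    rw [Complex.ofReal_sum, Finset.sum_mul]
    refine Finset.sum_congr rfl fun m _ => ?_
    rw [show -(2 * θ) = -θ + -θ by ring, Real.rpow_add (hpos m)]
    push_cast; ring
  rw [e1, e2, ← Finset.sum_sub_distrib]
  have hb : ∀ m ∈ Finset.range M, ‖(((m + a : ℝ) ^ (-θ) : ℝ) : ℂ) *
        (∫ t in (1 : ℝ)..T, zetaH (θ + t * I) a * ((m + a : ℝ) : ℂ) ^ ((t : ℂ) * I)) -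
      (((m + a : ℝ) ^ (-θ) : ℝ) : ℂ) * (1 * (((m + a : ℝ) ^ (-θ) : ℝ) : ℂ) * (T : ℂ))‖ ≤
      C * Real.log T * (T ^ ((1 - θ) / 2) * (m + a) ^ (-θ) + (m + a) ^ (1 - 2 * θ)) := by
    intro m hm
    have hmM : (m : ℝ) ≤ M := by exact_mod_cast (Finset.mem_range.mp hm).le
    have hle : (m : ℝ) + a ≤ (2 + a) * T := by
      have : √T ≤ T := by
        rw [Real.sqrt_le_left hT0.le]; nlinarith
      nlinarith
    have := h 1 m T (by simp) hT hle
    simp only [one_mul] at this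
    rw [← mul_sub, norm_mul, Complex.norm_real, Real.norm_of_nonneg (by have := hpos m; positivity)]
    simp only [one_mul]
    have hp := hpos m
    calc _ ≤ (m + a : ℝ) ^ (-θ) * (C * Real.log T * (T ^ ((1 - θ) / 2) + (m + a) ^ (1 - θ))) := by
          gcongr
      _ = _ := by
          rw [show 1 - 2 * θ = -θ + (1 - θ) by ring, Real.rpow_add hp]; ring
  refine (norm_sum_le _ _).trans ((Finset.sum_le_sum hb).trans ?_)
  rw [← Finset.mul_sum, Finset.sum_add_distrib, ← Finset.mul_sum]
  have g1 := (h₁ M).trans (mul_le_mul_of_nonneg_left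
    (rpow_le_of_le_sqrt hT0.le hM (show 0 ≤ -θ + 1 by linarith)) hC₁.le)
  have g2 := (h₂ M).trans (mul_le_mul_of_nonneg_left
    (rpow_le_of_le_sqrt hT0.le hM (show 0 ≤ 1 - 2 * θ + 1 by linarith)) hC₂.le)
  have t1 : T ^ ((1 - θ) / 2) * T ^ ((-θ + 1) / 2) = T ^ (1 - θ) := by
    rw [← Real.rpow_add hT0]; congr 1; ring
  have t2 : T ^ ((1 - 2 * θ + 1) / 2) = T ^ (1 - θ) := by congr 1; ring
  rw [t2] at g2
  calc _ ≤ C * Real.log T * (T ^ ((1 - θ) / 2) * (C₁ * (2 ^ (-θ + 1) * T ^ ((-θ + 1) / 2))) +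
        C₂ * (2 ^ (1 - 2 * θ + 1) * T ^ (1 - θ))) := by gcongr
    _ = C * Real.log T * (C₁ * 2 ^ (-θ + 1) * (T ^ ((1 - θ) / 2) * T ^ ((-θ + 1) / 2)) +
        C₂ * (2 ^ (1 - 2 * θ + 1) * T ^ (1 - θ))) := by ring
    _ = _ := by rw [t1]; ring

theorem exists_integral_sq_partialSum {a θ : ℝ} (ha : 0 < a) (hθ : 0 < θ) (hθ1 : θ < 1) :
    ∃ C > 0, ∀ (T : ℝ) (M : ℕ), 10 ≤ T → (M : ℝ) ≤ 2 * √T →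
      ‖(∫ t in (1 : ℝ)..T, ((‖partialSum a M (θ + t * I)‖ ^ 2 : ℝ) : ℂ)) -
        (∑ m ∈ Finset.range M, (m + a : ℝ) ^ (-(2 * θ)) : ℝ) * (T : ℂ)‖ ≤
        C * (T ^ (1 - θ) * Real.log T) := by
  obtain ⟨C₂, hC₂, h₂⟩ := exists_sum_rpow_le ha (show -1 < 1 - 2 * θ by linarith)
  refine ⟨(1 / a + 2 * (1 + 2)) * (4 * (C₂ * 2 ^ (1 - 2 * θ + 1))) + (1 + 1 / a) *
    (C₂ * 2 ^ (1 - 2 * θ + 1)), by positivity,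
    fun T M hT hM => ?_⟩
  have hT0 : 0 < T := by linarith
  have hlog := two_le_log hT
  have hpos : ∀ m : ℕ, (0 : ℝ) < m + a := fun m => by positivity
  set x : ℕ → ℝ → ℂ := fun m t => ((m + a : ℝ) : ℂ) ^ (-((θ : ℂ) + t * I)) with hx
  have hxn : ∀ m t, ‖x m t‖ ^ 2 = (m + a : ℝ) ^ (-(2 * θ)) := by
    intro m t
    rw [hx]; simp only
    rw [Complex.norm_cpow_eq_rpow_re_of_pos (hpos m), ← Real.rpow_mul_natCast (hpos m).le]
    congr 1; simp; ring
  have hxc : ∀ m k : ℕ, ∀ t : ℝ, x m t * conj (x k t) =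
      (((m + a : ℝ) ^ (-θ) * (k + a : ℝ) ^ (-θ) : ℝ) : ℂ) *
      (((m + a : ℝ) : ℂ) ^ (-(((1 * t : ℝ) : ℂ) * I)) * ((k + a : ℝ) : ℂ) ^ (((1 * t : ℝ) : ℂ) * I)) := by
    intro m k t
    rw [hx]; simp only
    rw [conj_cpow_neg_line (hpos k), cpow_neg_line (hpos m), one_mul]
    push_cast; ring
  have hcont : ∀ m k : ℕ, Continuous fun t => x m t * conj (x k t) := by
    intro m k
    have h1 : ∀ m : ℕ, Continuous (x m) := fun m => by
      refine continuous_iff_continuousAt.mpr fun t => ?_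
      rw [hx]; simp only
      exact ContinuousAt.const_cpow (by fun_prop) (Or.inl (by exact_mod_cast (hpos m).ne'))
    exact (h1 m).mul (Complex.continuous_conj.comp (h1 k))
  have hinteg : (∫ t in (1 : ℝ)..T, ((‖partialSum a M (θ + t * I)‖ ^ 2 : ℝ) : ℂ)) =
      ∑ m ∈ Finset.range M, ((((m + a : ℝ) ^ (-(2 * θ)) : ℝ) : ℂ) * ((T - 1 : ℝ) : ℂ) +
        ∑ k ∈ Finset.range m, ((∫ t in (1 : ℝ)..T, x m t * conj (x k t)) +
          ∫ t in (1 : ℝ)..T, x k t * conj (x m t))) := by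
    rw [← Finset.sum_congr rfl fun m _ => ?_, ← integral_norm_sq_sum M fun m k =>
      (hcont m k).intervalIntegrable _ _]
    · rfl
    · congr 1
      simp_rw [hxn]
      rw [intervalIntegral.integral_const, Complex.real_smul, mul_comm]
  rw [hinteg, Finset.sum_add_distrib, ← Finset.sum_mul, ← Complex.ofReal_sum]
  set A₀ := ∑ m ∈ Finset.range M, (m + a : ℝ) ^ (-(2 * θ)) with hA
  set O := ∑ m ∈ Finset.range M, ∑ k ∈ Finset.range m, ((∫ t in (1 : ℝ)..T, x m t * conj (x k t)) +
          ∫ t in (1 : ℝ)..T, x k t * conj (x m t)) with hO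
  have hOn : ‖O‖ ≤ (1 / a + 2 * (1 + Real.log (M + 1))) *
      ∑ m ∈ Finset.range M, 4 * (m + a : ℝ) ^ (1 - 2 * θ) := by
    refine le_trans ?_ (sum_offdiag_le ha hθ1.le M (fun _ => 4) (fun _ => by norm_num))
    refine (norm_sum_le _ _).trans (Finset.sum_le_sum fun m _ => ?_)
    refine (norm_sum_le _ _).trans (Finset.sum_le_sum fun k hk => ?_)
    have hkm : (k : ℝ) < m := by exact_mod_cast Finset.mem_range.mp hk
    have hb := norm_integral_term_le (hpos k) (show (k : ℝ) + a < m + a by linarith)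
      (show |(1 : ℝ)| = 1 by simp) 1 T
    rw [show (m : ℝ) + a - (k + a) = m - k by ring] at hb
    simp_rw [hxc]
    rw [intervalIntegral.integral_const_mul, intervalIntegral.integral_const_mul]
    have hmp := hpos m
    have hkp := hpos k
    refine (norm_add_le _ _).trans ?_
    rw [norm_mul, norm_mul, Complex.norm_real, Complex.norm_real, Real.norm_of_nonneg (by positivity),
      Real.norm_of_nonneg (by positivity)]
    have b1 := mul_le_mul_of_nonneg_left hb.2
      (show 0 ≤ (m + a : ℝ) ^ (-θ) * (k + a : ℝ) ^ (-θ) by positivity)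
    have b2 := mul_le_mul_of_nonneg_left hb.1
      (show 0 ≤ (k + a : ℝ) ^ (-θ) * (m + a : ℝ) ^ (-θ) by positivity)
    refine (add_le_add b1 b2).trans (le_of_eq ?_)
    ring
  have g2 := (h₂ M).trans (mul_le_mul_of_nonneg_left
    (rpow_le_of_le_sqrt hT0.le hM (show 0 ≤ 1 - 2 * θ + 1 by linarith)) hC₂.le)
  have t2 : T ^ ((1 - 2 * θ + 1) / 2) = T ^ (1 - θ) := by congr 1; ring
  rw [t2] at g2
  have hM1 : Real.log (M + 1) ≤ Real.log T := by
    refine Real.log_le_log (by positivity) ?_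
    have h3 : 3 ≤ √T := Real.le_sqrt_of_sq_le (by linarith)
    have := Real.mul_self_sqrt hT0.le
    nlinarith
  have hA0 : A₀ ≤ (1 + 1 / a) * ∑ m ∈ Finset.range M, (m + a : ℝ) ^ (1 - 2 * θ) := by
    rw [hA, Finset.mul_sum]
    refine Finset.sum_le_sum fun m _ => ?_
    have hp := hpos m
    rw [show -(2 * θ) = (1 - 2 * θ) - 1 by ring, Real.rpow_sub_one hp.ne', div_eq_inv_mul]
    gcongr
    rw [← one_div]
    have h4 : 1 / ((m : ℝ) + a) ≤ 1 / a :=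
      one_div_le_one_div_of_le ha (by linarith [Nat.cast_nonneg (α := ℝ) m])
    linarith
  have hAp : 0 ≤ A₀ := Finset.sum_nonneg fun m _ => by have := hpos m; positivity
  have e : (A₀ : ℂ) * ((T - 1 : ℝ) : ℂ) + O - (A₀ : ℂ) * (T : ℂ) = O - (A₀ : ℂ) := by
    push_cast; ring
  rw [e]
  refine (norm_sub_le _ _).trans ?_
  rw [Complex.norm_real, Real.norm_of_nonneg hAp]
  rw [← Finset.mul_sum] at hOn
  have i0 : 0 < T ^ (1 - θ) := by positivity
  have i1 : ‖O‖ ≤ (1 / a + 2 * (1 + 2)) * (4 * (C₂ * 2 ^ (1 - 2 * θ + 1))) *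
      (T ^ (1 - θ) * Real.log T) := by
    calc _ ≤ _ := hOn
      _ ≤ ((1 / a + 2 * (1 + 2)) * Real.log T) * (4 * (C₂ * (2 ^ (1 - 2 * θ + 1) * T ^ (1 - θ)))) := by
          gcongr
          have : 1 / a ≤ 1 / a * Real.log T := le_mul_of_one_le_right (by positivity) (by linarith)
          nlinarith
      _ = _ := by ring
  have i2 : A₀ ≤ (1 + 1 / a) * (C₂ * 2 ^ (1 - 2 * θ + 1)) * (T ^ (1 - θ) * Real.log T) := by
    calc _ ≤ _ := hA0
      _ ≤ (1 + 1 / a) * (C₂ * (2 ^ (1 - 2 * θ + 1) * T ^ (1 - θ))) := by gcongr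
      _ = (1 + 1 / a) * (C₂ * 2 ^ (1 - 2 * θ + 1)) * (T ^ (1 - θ) * 1) := by ring
      _ ≤ _ := by gcongr; linarith
  rw [add_mul]
  exact add_le_add i1 i2

/-! ### The dual Dirichlet polynomial -/

lemma norm_integral_mul_le {w w' : ℝ → ℝ} {g : ℝ → ℂ} {α β E : ℝ} (hα : 0 < α) (hαβ : α ≤ β)
    (hw : ∀ t ∈ Icc α β, HasDerivAt w (w' t) t) (hw' : ContinuousOn w' (Icc α β))
    (hs : (∀ t ∈ Icc α β, 0 ≤ w' t) ∨ ∀ t ∈ Icc α β, w' t ≤ 0) (h0 : 0 ≤ w α) (h1 : 0 ≤ w β)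
    (hg : ContinuousOn g (Ioi 0)) (hE : ∀ t ∈ Icc α β, ‖∫ u in α..t, g u‖ ≤ E) :
    ‖∫ t in α..β, (w t : ℂ) * g t‖ ≤ 2 * E * (w α + w β) := by
  have hu : uIcc α β = Icc α β := uIcc_of_le hαβ
  have hpos : ∀ t ∈ Icc α β, 0 < t := fun t ht => hα.trans_le ht.1
  have hv : ∀ t ∈ uIcc α β, HasDerivAt (fun t => ∫ u in α..t, g u) (g t) t := by
    intro t ht
    have ht0 := hpos t (hu ▸ ht)
    exact intervalIntegral.integral_hasDerivAt_right
      (ContinuousOn.intervalIntegrable_of_pos hg hα ht0)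
      (hg.stronglyMeasurableAtFilter isOpen_Ioi t ht0) (hg.continuousAt (Ioi_mem_nhds ht0))
  have hwi : IntervalIntegrable w' volume α β := (hu ▸ hw').intervalIntegrable
  have hparts := intervalIntegral.integral_mul_deriv_eq_deriv_mul (u := fun t => (w t : ℂ))
    (u' := fun t => (w' t : ℂ)) (fun t ht => (hw t (hu ▸ ht)).ofReal_comp) hv
    (Complex.continuous_ofReal.comp_continuousOn (hu ▸ hw')).intervalIntegrable
    (ContinuousOn.intervalIntegrable_of_pos hg hα (hα.trans_le hαβ))
  rw [hparts]
  have hE0 : 0 ≤ E := (norm_nonneg _).trans (hE α (left_mem_Icc.mpr hαβ))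
  have hinteg : ∫ t in α..β, w' t = w β - w α :=
    intervalIntegral.integral_eq_sub_of_hasDerivAt (fun t ht => hw t (hu ▸ ht)) hwi
  have hb : ‖∫ t in α..β, (w' t : ℂ) * ∫ u in α..t, g u‖ ≤ (w α + w β) * E := by
    have hgen : ∀ c : ℝ, (∀ t ∈ Icc α β, |w' t| = c * w' t) → ‖∫ t in α..β, (w' t : ℂ) * ∫ u in α..t, g u‖ ≤
        c * (w β - w α) * E := by
      intro c hc
      rw [← hinteg, ← intervalIntegral.integral_const_mul, ← intervalIntegral.integral_mul_const]
      refine intervalIntegral.norm_integral_le_of_norm_le hαβ (Eventually.of_forall fun t ht => ?_)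
        ((hwi.const_mul c).mul_const E)
      have ht' : t ∈ Icc α β := ⟨ht.1.le, ht.2⟩
      rw [norm_mul, Complex.norm_real, Real.norm_eq_abs, hc t ht']
      exact mul_le_mul_of_nonneg_left (hE t ht') (hc t ht' ▸ abs_nonneg _)
    rcases hs with hs | hs
    · refine (hgen 1 fun t ht => by rw [abs_of_nonneg (hs t ht), one_mul]).trans ?_
      gcongr; linarith
    · refine (hgen (-1) fun t ht => by rw [abs_of_nonpos (hs t ht)]; ring).trans ?_
      gcongr; linarith
  have hvb := hE β (right_mem_Icc.mpr hαβ)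
  refine (norm_sub_le _ _).trans ?_
  rw [intervalIntegral.integral_same, mul_zero, sub_zero, norm_mul, Complex.norm_real,
    Real.norm_of_nonneg h1]
  have := mul_le_mul_of_nonneg_left hvb h1
  have := mul_nonneg h0 hE0
  linarith

lemma norm_integral_rpow_mul_le {g : ℝ → ℂ} {α β E : ℝ} (p : ℝ) (hα : 0 < α) (hαβ : α ≤ β)
    (hg : ContinuousOn g (Ioi 0)) (hE : ∀ t ∈ Icc α β, ‖∫ u in α..t, g u‖ ≤ E) :
    ‖∫ t in α..β, (((t / (2 * π)) ^ p : ℝ) : ℂ) * g t‖ ≤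
      2 * E * ((α / (2 * π)) ^ p + (β / (2 * π)) ^ p) := by
  have hpos : ∀ t ∈ Icc α β, 0 < t / (2 * π) := fun t ht => by
    have := hα.trans_le ht.1
    positivity
  refine norm_integral_mul_le (w := fun t => (t / (2 * π)) ^ p)
    (w' := fun t => 1 / (2 * π) * p * (t / (2 * π)) ^ (p - 1)) hα hαβ
    (fun t ht => ((hasDerivAt_id t).div_const (2 * π)).rpow_const (Or.inl (hpos t ht).ne'))
    ?_ ?_ (hpos α ⟨le_rfl, hαβ⟩ |>.le |> fun h => by positivity) (by have := hpos β ⟨hαβ, le_rfl⟩; positivity)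
    hg hE
  · refine continuousOn_const.mul (ContinuousOn.rpow_const (by fun_prop) fun t ht => ?_)
    exact Or.inl (hpos t ht).ne'
  · rcases le_total 0 p with h | h
    · exact Or.inl fun t ht => by have := hpos t ht; positivity
    · refine Or.inr fun t ht => ?_
      have := hpos t ht
      exact mul_nonpos_of_nonpos_of_nonneg (mul_nonpos_of_nonneg_of_nonpos (by positivity) h)
        (by positivity)

/-- The range of the parameters in which the dual polynomial of length `N` at `b` approximates
`ζ(θ + it, b)` for `t ≤ T`. -/
structure DualRange (K T b : ℝ) (N : ℕ) : Prop where
  one_le : 1 ≤ b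
  ten_le : 10 ≤ T
  le_sq : T ≤ b ^ 2
  sq_le : b ^ 2 ≤ K * T
  le : 2 * π * b * N ≤ T
  lt : T < 2 * π * b * (N + 1)

namespace DualRange

variable {K T b : ℝ} {N : ℕ}

lemma pos (h : DualRange K T b N) : 0 < b := zero_lt_one.trans_le h.one_le

lemma T_pos (h : DualRange K T b N) : 0 < T := lt_of_lt_of_le (by norm_num) h.ten_le

lemma N_le (h : DualRange K T b N) : (N : ℝ) ≤ b := by
  have hb := h.pos
  have h1 : 2 * π * b * N ≤ b * b := h.le.trans (h.le_sq.trans (sq b).le)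
  have h2 : 1 * N ≤ 2 * π * N := by
    gcongr; linarith [Real.pi_gt_three]
  nlinarith

lemma three_le (h : DualRange K T b N) : 3 ≤ b := by
  have := h.le_sq.trans' h.ten_le
  nlinarith [h.pos]

lemma ten_le_tau (h : DualRange K T b N) (k : ℕ) : 10 ≤ 2 * π * b * (k + 1) := by
  have h2 : 2 * π * b * (k + 1) ≥ 2 * 3 * 3 * (0 + 1) := by
    have := h.three_le
    have := Real.pi_gt_three
    gcongr
    exact Nat.cast_nonneg k
  linarith

lemma tau_le (h : DualRange K T b N) {k : ℕ} (hk : k < N) : 2 * π * b * (k + 1) ≤ T := by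
  refine le_trans ?_ h.le
  have := h.pos
  have : (k : ℝ) + 1 ≤ N := by exact_mod_cast hk
  gcongr

lemma log_N_le (h : DualRange K T b N) : Real.log (N + 1) ≤ Real.log T := by
  refine Real.log_le_log (by positivity) ?_
  have h1 := h.le
  have h2 : 2 * 3 * 1 * (N : ℝ) ≤ 2 * π * b * N := by
    have := h.one_le
    have := Real.pi_gt_three
    gcongr
  have := h.ten_le
  have : (0 : ℝ) ≤ N := Nat.cast_nonneg N
  linarith

end DualRange

lemma exists_rpow_le_of_sq {K : ℝ} (hK : 0 < K) (p : ℝ) : ∃ C > 0, ∀ T b : ℝ, ∀ N : ℕ,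
    DualRange K T b N → (T / (2 * π)) ^ p ≤ C * b ^ (2 * p) := by
  refine ⟨1 + (1 / (2 * π * K)) ^ p, by positivity, fun T b N h => ?_⟩
  have hb := h.pos
  have hT := h.T_pos
  have hpi := Real.pi_gt_three
  have e : b ^ (2 * p) = (b ^ 2) ^ p := by rw [Real.rpow_mul hb.le]; norm_num
  rw [e, add_mul, one_mul]
  have q1 : 0 ≤ (b ^ 2) ^ p := by positivity
  have q2 : 0 ≤ (1 / (2 * π * K)) ^ p * (b ^ 2) ^ p := by positivity
  rcases le_total 0 p with hp | hp
  · have : (T / (2 * π)) ^ p ≤ (b ^ 2) ^ p := by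
      refine Real.rpow_le_rpow (by positivity) ?_ hp
      refine (div_le_self hT.le (by linarith)).trans h.le_sq
    linarith
  · have : (T / (2 * π)) ^ p ≤ (1 / (2 * π * K)) ^ p * (b ^ 2) ^ p := by
      rw [← Real.mul_rpow (by positivity) (by positivity)]
      refine Real.rpow_le_rpow_of_nonpos (by positivity) ?_ hp
      rw [one_div_mul_eq_div, div_le_div_iff₀ (by positivity) (by positivity)]
      have := h.sq_le
      nlinarith [Real.pi_pos]
    linarith

lemma exists_sum_weight_le {K : ℝ} (hK : 0 < K) {p q : ℝ} (hq : -1 < q) (hpq : -1 < p + q) :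
    ∃ C > 0, ∀ T b : ℝ, ∀ N : ℕ, DualRange K T b N →
      ∑ k ∈ Finset.range N, (k + 1 : ℝ) ^ q *
        ((2 * π * b * (k + 1) / (2 * π)) ^ p + (T / (2 * π)) ^ p) ≤ C * b ^ (2 * p + q + 1) := by
  obtain ⟨C₁, hC₁, h₁⟩ := exists_sum_rpow_le one_pos hpq
  obtain ⟨C₂, hC₂, h₂⟩ := exists_sum_rpow_le one_pos hq
  obtain ⟨C₃, hC₃, h₃⟩ := exists_rpow_le_of_sq hK p
  refine ⟨C₁ + C₂ * C₃, by positivity, fun T b N h => ?_⟩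
  have hb := h.pos
  have e : ∀ k : ℕ, (k + 1 : ℝ) ^ q * ((2 * π * b * (k + 1) / (2 * π)) ^ p + (T / (2 * π)) ^ p) =
      b ^ p * (k + 1 : ℝ) ^ (p + q) + (T / (2 * π)) ^ p * (k + 1 : ℝ) ^ q := by
    intro k
    have : (0 : ℝ) < k + 1 := by positivity
    rw [show 2 * π * b * (k + 1) / (2 * π) = b * (k + 1) by field_simp,
      Real.mul_rpow hb.le this.le, Real.rpow_add this]
    ring
  simp_rw [e]
  rw [Finset.sum_add_distrib, ← Finset.mul_sum, ← Finset.mul_sum]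
  have g1 := (h₁ N).trans (mul_le_mul_of_nonneg_left (Real.rpow_le_rpow (by positivity) h.N_le
    (show 0 ≤ p + q + 1 by linarith)) hC₁.le)
  have g2 := (h₂ N).trans (mul_le_mul_of_nonneg_left (Real.rpow_le_rpow (by positivity) h.N_le
    (show 0 ≤ q + 1 by linarith)) hC₂.le)
  calc _ ≤ b ^ p * (C₁ * b ^ (p + q + 1)) + C₃ * b ^ (2 * p) * (C₂ * b ^ (q + 1)) := by
        gcongr
        exact h₃ T b N h
    _ = C₁ * (b ^ p * b ^ (p + q + 1)) + C₂ * C₃ * (b ^ (2 * p) * b ^ (q + 1)) := by ring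
    _ = _ := by
        rw [← Real.rpow_add hb, ← Real.rpow_add hb, show p + (p + q + 1) = 2 * p + q + 1 by ring,
          show 2 * p + (q + 1) = 2 * p + q + 1 by ring]
        ring

/-- The `k`-th term of the dual polynomial multiplied by the leading term of the functional
equation. -/
noncomputable def dualTerm (b θ : ℝ) (k : ℕ) (t : ℝ) : ℂ :=
  wave (k + 1 : ℕ) (-b) * ((k + 1 : ℝ) : ℂ) ^ ((θ : ℂ) + t * I - 1) * dualMain θ t

lemma continuousOn_dualMain (θ : ℝ) : ContinuousOn (dualMain θ) (Ioi 0) := by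
  intro t ht
  have ht0 : (0 : ℝ) < t := ht
  refine ContinuousAt.continuousWithinAt ?_
  unfold dualMain
  have h1 : ContinuousAt (fun t : ℝ => (t / (2 * π)) ^ (1 / 2 - θ)) t :=
    ContinuousAt.rpow_const (by fun_prop) (Or.inl (by positivity))
  have h2 : ContinuousAt (fun t : ℝ => Real.log (t / (2 * π))) t :=
    ContinuousAt.log (by fun_prop) (by positivity)
  fun_prop

lemma continuousOn_dualTerm (b θ : ℝ) (k : ℕ) : ContinuousOn (dualTerm b θ k) (Ioi 0) := by
  refine ContinuousOn.mul ?_ (continuousOn_dualMain θ)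
  refine Continuous.continuousOn (continuous_const.mul ?_)
  refine continuous_iff_continuousAt.mpr fun t => ContinuousAt.const_cpow (by fun_prop) (Or.inl ?_)
  exact Complex.ofReal_ne_zero.mpr (by positivity)

open Classical in
lemma dualSum_mul_dualMain (b θ t : ℝ) (N : ℕ) : dualSum b N θ t * dualMain θ t =
    ∑ k ∈ Finset.range N, if 2 * π * b * (k + 1) ≤ t then dualTerm b θ k t else 0 := by
  rw [dualSum, Finset.sum_mul]
  refine Finset.sum_congr rfl fun k _ => ?_
  rw [ite_mul, zero_mul, dualTerm]
  push_cast
  rfl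

open Classical in
lemma intervalIntegrable_ite {f : ℝ → ℂ} (hf : ContinuousOn f (Ioi 0)) {τ T : ℝ} (hT : 0 < T) :
    IntervalIntegrable (fun t => if τ ≤ t then f t else 0) volume 1 T := by
  have := ContinuousOn.intervalIntegrable_of_pos hf one_pos hT
  rw [intervalIntegrable_iff] at this ⊢
  exact this.indicator (measurableSet_Ici (a := τ))

open Classical in
lemma integral_ite {f : ℝ → ℂ} (hf : ContinuousOn f (Ioi 0)) {τ T : ℝ} (hτ : 1 ≤ τ) (hτT : τ ≤ T) :
    ∫ t in (1 : ℝ)..T, (if τ ≤ t then f t else 0) = ∫ t in τ..T, f t := by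
  have hT : 0 < T := by linarith
  have hτ0 : 0 < τ := by linarith
  have hi := intervalIntegrable_ite (τ := τ) hf hT
  have hi' := intervalIntegrable_ite (τ := τ) hf hτ0
  rw [← intervalIntegral.integral_add_adjacent_intervals hi' (hi'.symm.trans hi)]
  have z : ∫ t in (1 : ℝ)..τ, (if τ ≤ t then f t else 0) = 0 := by
    rw [intervalIntegral.integral_of_le hτ, ← integral_Ioc_eq_integral_Ioo.symm]
    rw [setIntegral_congr_fun measurableSet_Ioo (g := fun _ => 0) fun t ht => if_neg (not_le.mpr ht.2)]
    simp
  rw [z, zero_add]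
  exact intervalIntegral.integral_congr fun t ht => if_pos (uIcc_of_le hτT ▸ ht).1

open Classical in
lemma integral_mul_conj_dual {h : ℝ → ℂ} (hh : ContinuousOn h (Ioi 0)) {K T b θ : ℝ} {N : ℕ}
    (hR : DualRange K T b N) :
    IntervalIntegrable (fun t => h t * conj (dualSum b N θ t * dualMain θ t)) volume 1 T ∧
    ∫ t in (1 : ℝ)..T, h t * conj (dualSum b N θ t * dualMain θ t) =
      ∑ k ∈ Finset.range N, ∫ t in (2 * π * b * (k + 1))..T, h t * conj (dualTerm b θ k t) := by
  have e : ∀ t, h t * conj (dualSum b N θ t * dualMain θ t) = ∑ k ∈ Finset.range N,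
      if 2 * π * b * (k + 1) ≤ t then h t * conj (dualTerm b θ k t) else 0 := by
    intro t
    rw [dualSum_mul_dualMain, map_sum, Finset.mul_sum]
    refine Finset.sum_congr rfl fun k _ => ?_
    split_ifs <;> simp
  have hc : ∀ k : ℕ, ContinuousOn (fun t => h t * conj (dualTerm b θ k t)) (Ioi 0) := fun k =>
    hh.mul (Complex.continuous_conj.comp_continuousOn (continuousOn_dualTerm b θ k))
  have hi : ∀ k : ℕ, IntervalIntegrable (fun t => if 2 * π * b * (k + 1) ≤ t then
      h t * conj (dualTerm b θ k t) else 0) volume 1 T := fun k => intervalIntegrable_ite (hc k) hR.T_pos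
  simp_rw [e]
  refine ⟨?_, ?_⟩
  · simpa only [Finset.sum_fn] using IntervalIntegrable.sum (Finset.range N) fun k _ => hi k
  · rw [intervalIntegral.integral_finsetSum fun k _ => hi k]
    refine Finset.sum_congr rfl fun k hk => ?_
    exact integral_ite (hc k) (by linarith [hR.ten_le_tau k]) (hR.tau_le (Finset.mem_range.mp hk))

lemma dualTerm_eq (b θ : ℝ) (k : ℕ) (t : ℝ) : dualTerm b θ k t =
    (((k + 1 : ℝ) ^ (θ - 1) : ℝ) : ℂ) * wave (k + 1 : ℕ) (-b) * ((k + 1 : ℝ) : ℂ) ^ ((t : ℂ) * I) *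
      dualMain θ t := by
  have hk : (0 : ℝ) < k + 1 := by positivity
  rw [dualTerm, show (θ : ℂ) + t * I - 1 = ((θ - 1 : ℝ) : ℂ) + t * I by push_cast; ring,
    Complex.cpow_add _ _ (by exact_mod_cast hk.ne'), Complex.ofReal_cpow hk.le]
  ring

lemma dualMain_mul_conj (θ : ℝ) {t : ℝ} (ht : 0 < t) :
    dualMain θ t * conj (dualMain θ t) = (((t / (2 * π)) ^ (1 - 2 * θ) : ℝ) : ℂ) := by
  rw [Complex.mul_conj, Complex.normSq_eq_norm_sq, norm_dualMain ht,
    ← Real.rpow_mul_natCast (by positivity)]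
  congr 2; push_cast; ring

lemma conj_cpow_mul_I {x : ℝ} (hx : 0 < x) (t : ℝ) :
    conj ((x : ℂ) ^ ((t : ℂ) * I)) = (x : ℂ) ^ (-((t : ℂ) * I)) := by
  rw [conj_cpow_ofReal hx]; congr 1; simp

lemma dualTerm_mul_conj (b θ : ℝ) (m k : ℕ) {t : ℝ} (ht : 0 < t) :
    dualTerm b θ m t * conj (dualTerm b θ k t) =
      ((((m + 1 : ℝ) ^ (θ - 1) * (k + 1 : ℝ) ^ (θ - 1) : ℝ) : ℂ) *
        (wave (m + 1 : ℕ) (-b) * conj (wave (k + 1 : ℕ) (-b)))) *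
      ((((t / (2 * π)) ^ (1 - 2 * θ) : ℝ) : ℂ) *
        (((k + 1 : ℝ) : ℂ) ^ (-(((1 * t : ℝ) : ℂ) * I)) *
          ((m + 1 : ℝ) : ℂ) ^ (((1 * t : ℝ) : ℂ) * I))) := by
  rw [← dualMain_mul_conj θ ht, dualTerm_eq, dualTerm_eq]
  simp only [map_mul, Complex.conj_ofReal, one_mul]
  rw [conj_cpow_mul_I (by positivity)]
  push_cast; ring

/-- The diagonal contribution of the dual polynomial to the mean square. -/
noncomputable def dualDiag (b θ T : ℝ) (N : ℕ) : ℝ :=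
  ∑ k ∈ Finset.range N, (k + 1 : ℝ) ^ (2 * θ - 2) *
    ∫ t in (2 * π * b * (k + 1))..T, (t / (2 * π)) ^ (1 - 2 * θ)

theorem exists_integral_sq_dual {K θ : ℝ} (hK : 0 < K) (hθ : 0 < θ) (hθ1 : θ < 1) :
    ∃ C > 0, ∀ T b : ℝ, ∀ N : ℕ, DualRange K T b N →
      IntervalIntegrable (fun t => ((‖dualSum b N θ t * dualMain θ t‖ ^ 2 : ℝ) : ℂ)) volume 1 T ∧
      ‖(∫ t in (1 : ℝ)..T, ((‖dualSum b N θ t * dualMain θ t‖ ^ 2 : ℝ) : ℂ)) -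
        (dualDiag b θ T N : ℂ)‖ ≤
      C * (b ^ (2 - 2 * θ) * Real.log T) := by
  classical
  obtain ⟨C, hC, h⟩ := exists_sum_weight_le hK (p := 1 - 2 * θ) (q := 2 * θ - 1)
    (by linarith) (by linarith)
  refine ⟨(1 + 2 * (1 + 2)) * (8 * C), by positivity, fun T b N hR => ?_⟩
  have hb := hR.pos
  have hT := hR.T_pos
  have hlog := two_le_log hR.ten_le
  set τ : ℕ → ℝ := fun k => 2 * π * b * (k + 1) with hτ
  have hτ0 : ∀ k, 1 ≤ τ k := fun k => by linarith [hR.ten_le_tau k]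
  have hmono : ∀ k m : ℕ, k ≤ m → max (τ m) (τ k) = τ m := fun k m hkm => by
    have : (k : ℝ) ≤ m := by exact_mod_cast hkm
    refine max_eq_left ?_
    simp only [hτ]; gcongr
  set x : ℕ → ℝ → ℂ := fun k t => if τ k ≤ t then dualTerm b θ k t else 0 with hx
  have hxx : ∀ m k t, x m t * conj (x k t) =
      if max (τ m) (τ k) ≤ t then dualTerm b θ m t * conj (dualTerm b θ k t) else 0 := by
    intro m k t
    simp only [max_le_iff]
    by_cases h1 : τ m ≤ t <;> by_cases h2 : τ k ≤ t <;> simp [hx, h1, h2]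
  have hc : ∀ m k : ℕ, ContinuousOn (fun t => dualTerm b θ m t * conj (dualTerm b θ k t)) (Ioi 0) :=
    fun m k => (continuousOn_dualTerm b θ m).mul
      (Complex.continuous_conj.comp_continuousOn (continuousOn_dualTerm b θ k))
  have hi : ∀ m k, IntervalIntegrable (fun t => x m t * conj (x k t)) volume 1 T := fun m k => by
    simp_rw [hxx]; exact intervalIntegrable_ite (hc m k) hT
  have hI : ∀ m k : ℕ, max (τ m) (τ k) ≤ T → ∫ t in (1 : ℝ)..T, x m t * conj (x k t) =
      ((((m + 1 : ℝ) ^ (θ - 1) * (k + 1 : ℝ) ^ (θ - 1) : ℝ) : ℂ) *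
        (wave (m + 1 : ℕ) (-b) * conj (wave (k + 1 : ℕ) (-b)))) *
      ∫ t in (max (τ m) (τ k))..T, ((((t / (2 * π)) ^ (1 - 2 * θ) : ℝ) : ℂ) *
        (((k + 1 : ℝ) : ℂ) ^ (-(((1 * t : ℝ) : ℂ) * I)) *
          ((m + 1 : ℝ) : ℂ) ^ (((1 * t : ℝ) : ℂ) * I))) := by
    intro m k hmk
    simp_rw [hxx]
    have h1 := (hτ0 m).trans (le_max_left _ (τ k))
    rw [integral_ite (hc m k) h1 hmk, ← intervalIntegral.integral_const_mul]
    refine intervalIntegral.integral_congr fun t ht => ?_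
    rw [uIcc_of_le hmk] at ht
    exact dualTerm_mul_conj b θ m k (by linarith [ht.1])
  have hdiag : ∀ m ∈ Finset.range N, (∫ t in (1 : ℝ)..T, ((‖x m t‖ ^ 2 : ℝ) : ℂ)) =
      ((((m + 1 : ℝ) ^ (2 * θ - 2) * ∫ t in τ m..T, (t / (2 * π)) ^ (1 - 2 * θ) : ℝ)) : ℂ) := by
    intro m hm
    have hm' := hR.tau_le (Finset.mem_range.mp hm)
    have e : ∀ t, ((‖x m t‖ ^ 2 : ℝ) : ℂ) = x m t * conj (x m t) := fun t => by
      rw [Complex.mul_conj, Complex.normSq_eq_norm_sq]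
    have hm1 : (0 : ℝ) < m + 1 := by positivity
    simp_rw [e]
    rw [hI m m (by rwa [max_self]), max_self, Complex.mul_conj, Complex.normSq_eq_norm_sq, norm_wave,
      ← Real.rpow_add hm1, Complex.ofReal_mul, ← intervalIntegral.integral_ofReal,
      one_pow, Complex.ofReal_one, mul_one, show θ - 1 + (θ - 1) = 2 * θ - 2 by ring]
    congr 1
    refine intervalIntegral.integral_congr fun t _ => ?_
    rw [← Complex.cpow_add _ _ (Complex.ofReal_ne_zero.mpr hm1.ne'), neg_add_cancel, Complex.cpow_zero,
      mul_one]
  have hD : ∀ t, dualSum b N θ t * dualMain θ t = ∑ k ∈ Finset.range N, x k t := fun t =>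
    dualSum_mul_dualMain b θ t N
  simp_rw [hD]
  refine ⟨(IntervalIntegrable.sum (Finset.range N) fun m _ =>
    IntervalIntegrable.sum (Finset.range N) fun k _ => hi m k).congr fun t _ => ?_, ?_⟩
  · simp only [Finset.sum_apply]
    rw [← Finset.sum_mul_sum, ← map_sum, Complex.mul_conj, Complex.normSq_eq_norm_sq]
  rw [integral_norm_sq_sum N hi, Finset.sum_add_distrib, Finset.sum_congr rfl hdiag, dualDiag,
    Complex.ofReal_sum, add_sub_cancel_left]
  have hoff : ∀ m ∈ Finset.range N, ∀ k ∈ Finset.range m,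
      ‖∫ t in (1 : ℝ)..T, x m t * conj (x k t)‖ + ‖∫ t in (1 : ℝ)..T, x k t * conj (x m t)‖ ≤
      (m + 1 : ℝ) ^ (-(1 - θ)) * (k + 1 : ℝ) ^ (-(1 - θ)) *
        ((8 * ((τ m / (2 * π)) ^ (1 - 2 * θ) + (T / (2 * π)) ^ (1 - 2 * θ))) *
          ((m + 1) / ((m : ℝ) - k))) := by
    intro m hm k hk
    have hkm := Finset.mem_range.mp hk
    have hkm' : (k : ℝ) + 1 < m + 1 := by
      have : (k : ℝ) < m := by exact_mod_cast hkm
      linarith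
    have hm' := hR.tau_le (Finset.mem_range.mp hm)
    have hk0 : (0 : ℝ) < k + 1 := by positivity
    have hm0 : (0 : ℝ) < m + 1 := by positivity
    have hmax := hmono k m hkm.le
    have hmax' : max (τ k) (τ m) = τ m := by rw [max_comm, hmax]
    rw [hI m k (by rwa [hmax]), hI k m (by rwa [hmax']), hmax, hmax']
    have hτm : 0 < τ m := by linarith [hτ0 m]
    have hcont : ∀ p q : ℝ, 0 < p → 0 < q → ContinuousOn (fun t : ℝ =>
        (p : ℂ) ^ (-(((1 * t : ℝ) : ℂ) * I)) * (q : ℂ) ^ (((1 * t : ℝ) : ℂ) * I)) (Ioi 0) := by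
      intro p q hp hq
      have h1 := continuous_cpow_mul_I hp (-1)
      refine (Continuous.mul ?_ (continuous_cpow_mul_I hq 1)).continuousOn
      convert! h1 using 3
      push_cast; ring
    have b1 := norm_integral_rpow_mul_le (1 - 2 * θ) hτm hm' (hcont _ _ hk0 hm0)
      fun t _ => (norm_integral_term_le hk0 hkm' abs_one (τ m) t).1
    have b2 := norm_integral_rpow_mul_le (1 - 2 * θ) hτm hm' (hcont _ _ hm0 hk0)
      fun t _ => (norm_integral_term_le hk0 hkm' abs_one (τ m) t).2
    rw [show (m : ℝ) + 1 - (k + 1) = m - k by ring] at b1 b2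
    simp only [norm_mul, norm_wave, Complex.norm_conj, Complex.norm_real, mul_one] at b1 b2 ⊢
    rw [Real.norm_of_nonneg (by positivity), Real.norm_of_nonneg (by positivity),
      mul_comm ((k + 1 : ℝ) ^ (θ - 1)), ← mul_add, show -(1 - θ) = θ - 1 by ring]
    refine mul_le_mul_of_nonneg_left ?_ (by positivity)
    refine (add_le_add b1 b2).trans (le_of_eq ?_)
    ring
  refine (norm_sum_le _ _).trans (le_trans (Finset.sum_le_sum fun m hm => (norm_sum_le _ _).trans
    (Finset.sum_le_sum fun k hk => (norm_add_le _ _).trans (hoff m hm k hk))) ?_)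
  refine (sum_offdiag_le one_pos (by linarith) N
    (fun m => 8 * ((τ m / (2 * π)) ^ (1 - 2 * θ) + (T / (2 * π)) ^ (1 - 2 * θ))) fun m => ?_).trans ?_
  · have := hτ0 m
    positivity
  have hs : ∑ m ∈ Finset.range N, 8 * ((τ m / (2 * π)) ^ (1 - 2 * θ) + (T / (2 * π)) ^ (1 - 2 * θ)) *
      (m + 1 : ℝ) ^ (1 - 2 * (1 - θ)) ≤ 8 * (C * b ^ (2 - 2 * θ)) := by
    have := h T b N hR
    rw [show 2 * (1 - 2 * θ) + (2 * θ - 1) + 1 = 2 - 2 * θ by ring] at this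
    refine le_trans (le_of_eq ?_) (mul_le_mul_of_nonneg_left this (by norm_num : (0 : ℝ) ≤ 8))
    rw [Finset.mul_sum]
    refine Finset.sum_congr rfl fun m _ => ?_
    rw [show 1 - 2 * (1 - θ) = 2 * θ - 1 by ring]; ring
  have hl := hR.log_N_le
  have hl0 : 0 ≤ Real.log ((N : ℝ) + 1) := Real.log_nonneg (by linarith [Nat.cast_nonneg (α := ℝ) N])
  calc _ ≤ ((1 + 2 * (1 + 2)) * Real.log T) * (8 * (C * b ^ (2 - 2 * θ))) := by
        gcongr
        linarith
    _ = _ := by ring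

lemma norm_integral_exp_phase_le {c α β l : ℝ} (hc : 0 < c) (hα : 0 < α) (hαβ : α ≤ β) (hl : 0 < l)
    (hlα : l ≤ Real.log (α / c)) :
    ‖∫ t in α..β, Complex.exp ((t * Real.log (t / c) - t : ℝ) * I)‖ ≤ 8 / l := by
  have hlog : ∀ t ∈ Icc α β, l ≤ Real.log (t / c) := fun t ht =>
    hlα.trans (Real.log_le_log (by positivity) (by have := ht.1; gcongr))
  have hpos : ∀ t ∈ Icc α β, 0 < t := fun t ht => hα.trans_le ht.1
  have hdl : ∀ t : ℝ, 0 < t → HasDerivAt (fun t => Real.log (t / c)) (1 / t) t := by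
    intro t ht
    convert! ((hasDerivAt_id t).div_const c).log (by simp only [id]; positivity) using 1
    simp only [id]; field_simp
  have hdf : ∀ t : ℝ, 0 < t → HasDerivAt (fun t : ℝ => Complex.exp ((t * Real.log (t / c) - t : ℝ) * I))
      (I * ((Real.log (t / c) : ℂ) * Complex.exp ((t * Real.log (t / c) - t : ℝ) * I))) t := by
    intro t ht
    have h1 := (((hasDerivAt_id t).mul (hdl t ht)).sub (hasDerivAt_id t)).ofReal_comp.mul_const I
    convert! h1.cexp using 1
    simp only [id]
    rw [show 1 * Real.log (t / c) + t * (1 / t) - 1 = Real.log (t / c) by field_simp; ring]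
    simp only [Pi.sub_apply, Pi.mul_apply, id]
    ring
  have hgc : ContinuousOn (fun t : ℝ => (Real.log (t / c) : ℂ) *
      Complex.exp ((t * Real.log (t / c) - t : ℝ) * I)) (Ioi 0) := fun t ht =>
    ((Complex.continuous_ofReal.continuousAt.comp (hdl t ht).continuousAt).mul
      (hdf t ht).continuousAt).continuousWithinAt
  have hE : ∀ t ∈ Icc α β, ‖∫ u in α..t, (Real.log (u / c) : ℂ) *
      Complex.exp ((u * Real.log (u / c) - u : ℝ) * I)‖ ≤ 2 := by
    intro t ht
    have h1 : ‖I * ∫ u in α..t, (Real.log (u / c) : ℂ) *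
        Complex.exp ((u * Real.log (u / c) - u : ℝ) * I)‖ ≤ 1 + 1 := by
      rw [← intervalIntegral.integral_const_mul, intervalIntegral.integral_eq_sub_of_hasDerivAt
        (fun u hu => hdf u ((lt_min hα (hpos t ht)).trans_le hu.1))
        ((ContinuousOn.intervalIntegrable_of_pos hgc hα (hpos t ht)).const_mul I)]
      refine (norm_sub_le _ _).trans (le_of_eq ?_)
      rw [Complex.norm_exp_ofReal_mul_I, Complex.norm_exp_ofReal_mul_I]
    rw [norm_mul, Complex.norm_I, one_mul] at h1
    linarith
  have key := norm_integral_mul_le (w := fun t => (Real.log (t / c))⁻¹)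
    (w' := fun t => -(1 / t) / Real.log (t / c) ^ 2) hα hαβ
    (fun t ht => (hdl t (hpos t ht)).inv (hl.trans_le (hlog t ht)).ne') ?_
    (Or.inr fun t ht => ?_) (inv_nonneg.mpr (hl.le.trans hlα))
    (inv_nonneg.mpr (hl.le.trans (hlog β ⟨hαβ, le_rfl⟩))) hgc hE
  · rw [intervalIntegral.integral_congr (g := fun t : ℝ =>
      Complex.exp ((t * Real.log (t / c) - t : ℝ) * I)) fun t ht => ?_] at key
    · refine key.trans ?_
      have i1 : (Real.log (α / c))⁻¹ ≤ l⁻¹ := inv_anti₀ hl hlα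
      have i2 : (Real.log (β / c))⁻¹ ≤ l⁻¹ := inv_anti₀ hl (hlog β ⟨hαβ, le_rfl⟩)
      rw [div_eq_mul_inv 8 l]
      linarith
    · rw [uIcc_of_le hαβ] at ht
      have h2 : (Real.log (t / c) : ℂ) ≠ 0 :=
        Complex.ofReal_ne_zero.mpr (hl.trans_le (hlog t ht)).ne'
      push_cast at h2 ⊢
      field_simp
  · refine ContinuousOn.div ?_ (ContinuousOn.pow (fun t ht =>
      (hdl t (hpos t ht)).continuousAt.continuousWithinAt) 2)
      fun t ht => pow_ne_zero 2 (hl.trans_le (hlog t ht)).ne'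
    exact (continuousOn_const.div continuousOn_id fun t ht => (hpos t ht).ne').neg
  · have := hpos t ht
    rw [neg_div]
    exact neg_nonpos.mpr (by positivity)

lemma cpow_mul_conj_dualTerm {x : ℝ} (hx : 0 < x) (b θ : ℝ) (k : ℕ) {t : ℝ} (ht : 0 < t) :
    (x : ℂ) ^ (-((θ : ℂ) + t * I)) * conj (dualTerm b θ k t) =
      ((((x ^ (-θ) * (k + 1 : ℝ) ^ (θ - 1) : ℝ) : ℂ) * conj (wave (k + 1 : ℕ) (-b))) *
        Complex.exp ((-(π / 4) : ℝ) * I)) * ((((t / (2 * π)) ^ (1 / 2 - θ) : ℝ) : ℂ) *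
        Complex.exp ((t * Real.log (t / (2 * π * x * (k + 1))) - t : ℝ) * I)) := by
  have hk : (0 : ℝ) < k + 1 := by positivity
  rw [cpow_neg_line hx, dualTerm_eq, dualMain]
  simp only [map_mul, Complex.conj_ofReal]
  rw [conj_cpow_mul_I hk, Complex.cpow_neg, Complex.cpow_neg, cpow_mul_I hx, cpow_mul_I hk,
    ← Complex.exp_neg, ← Complex.exp_neg, ← Complex.exp_conj]
  simp only [map_mul, Complex.conj_ofReal, Complex.conj_I]
  have e : Complex.exp (-(((Real.log x * t : ℝ) : ℂ) * I)) *
      Complex.exp (-(((Real.log (k + 1) * t : ℝ) : ℂ) * I)) *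
      Complex.exp (((π / 4 - (t * Real.log (t / (2 * π)) - t) : ℝ) : ℂ) * -I) =
      Complex.exp ((-(π / 4) : ℝ) * I) *
        Complex.exp ((t * Real.log (t / (2 * π * x * (k + 1))) - t : ℝ) * I) := by
    rw [← Complex.exp_add, ← Complex.exp_add, ← Complex.exp_add,
      show t / (2 * π * x * (k + 1)) = t / (2 * π) / x / (k + 1) by field_simp,
      Real.log_div (by positivity) hk.ne', Real.log_div (by positivity) hx.ne']
    congr 1; push_cast; ring
  push_cast at e ⊢
  linear_combination ((x ^ (-θ) : ℝ) : ℂ) * (((k + 1 : ℝ) ^ (θ - 1) : ℝ) : ℂ) *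
    conj (wave (k + 1) (-b)) * (((t / (2 * π)) ^ (1 / 2 - θ) : ℝ) : ℂ) * e

lemma continuous_cpow_line {x : ℝ} (hx : 0 < x) (θ : ℝ) :
    Continuous fun t : ℝ => (x : ℂ) ^ (-((θ : ℂ) + t * I)) :=
  continuous_iff_continuousAt.mpr fun t => ContinuousAt.const_cpow (by fun_prop)
    (Or.inl (Complex.ofReal_ne_zero.mpr hx.ne'))

theorem exists_integral_cpow_mul_dual {K θ : ℝ} (hK : 0 < K) (hθ : 0 < θ) :
    ∃ C > 0, ∀ T b x : ℝ, ∀ N : ℕ, DualRange K T b N → 0 < x → x < b →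
      ‖∫ t in (1 : ℝ)..T, (x : ℂ) ^ (-((θ : ℂ) + t * I)) *
        conj (dualSum b N θ t * dualMain θ t)‖ ≤ C * (x ^ (-θ) * (b / (b - x)) * b ^ (1 - θ)) := by
  obtain ⟨C, hC, h⟩ := exists_sum_weight_le hK (p := 1 / 2 - θ) (q := θ - 1)
    (by linarith) (by linarith)
  refine ⟨16 * C, by positivity, fun T b x N hR hx hxb => ?_⟩
  have hb := hR.pos
  have hbx : 0 < b - x := by linarith
  rw [(integral_mul_conj_dual (continuous_cpow_line hx θ).continuousOn hR).2]
  have hk : ∀ k ∈ Finset.range N, ‖∫ t in (2 * π * b * (k + 1))..T,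
      (x : ℂ) ^ (-((θ : ℂ) + t * I)) * conj (dualTerm b θ k t)‖ ≤
      (16 * (x ^ (-θ) * (b / (b - x)))) * ((k + 1 : ℝ) ^ (θ - 1) *
        ((2 * π * b * (k + 1) / (2 * π)) ^ (1 / 2 - θ) + (T / (2 * π)) ^ (1 / 2 - θ))) := by
    intro k hk
    have hτ := hR.tau_le (Finset.mem_range.mp hk)
    have hτ0 : 0 < 2 * π * b * (k + 1 : ℝ) := by positivity
    rw [intervalIntegral.integral_congr fun t ht => cpow_mul_conj_dualTerm hx b θ k
        (hτ0.trans_le (uIcc_of_le hτ ▸ ht).1), intervalIntegral.integral_const_mul]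
    have hl : (b - x) / b ≤ Real.log (2 * π * b * (k + 1) / (2 * π * x * (k + 1))) := by
      rw [show 2 * π * b * (k + 1 : ℝ) / (2 * π * x * (k + 1)) = b / x by field_simp,
        Real.log_div hb.ne' hx.ne']
      exact abs_log_sub_ge hx hxb
    have key := norm_integral_rpow_mul_le (1 / 2 - θ) hτ0 hτ (g := fun t : ℝ =>
      Complex.exp ((t * Real.log (t / (2 * π * x * (k + 1))) - t : ℝ) * I)) ?_ fun t ht =>
      norm_integral_exp_phase_le (c := 2 * π * x * (k + 1)) (by positivity) hτ0 ht.1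
        (div_pos hbx hb) hl
    · simp only [norm_mul, norm_wave, Complex.norm_conj, Complex.norm_exp_ofReal_mul_I, mul_one,
        Complex.norm_real] at key ⊢
      rw [Real.norm_of_nonneg (by positivity), Real.norm_of_nonneg (by positivity)]
      calc _ ≤ x ^ (-θ) * (k + 1 : ℝ) ^ (θ - 1) * _ := mul_le_mul_of_nonneg_left key (by positivity)
        _ = _ := by
          rw [show 8 / ((b - x) / b) = 8 * (b / (b - x)) by field_simp]; ring
    · intro t ht
      have ht0 : (0 : ℝ) < t := ht
      refine ContinuousAt.continuousWithinAt ?_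
      have h2 : ContinuousAt (fun t : ℝ => Real.log (t / (2 * π * x * (k + 1)))) t :=
        ContinuousAt.log (by fun_prop) (by positivity)
      fun_prop
  refine (norm_sum_le _ _).trans ((Finset.sum_le_sum hk).trans ?_)
  rw [← Finset.mul_sum]
  have := h T b N hR
  rw [show 2 * (1 / 2 - θ) + (θ - 1) + 1 = 1 - θ by ring] at this
  calc _ ≤ (16 * (x ^ (-θ) * (b / (b - x)))) * (C * b ^ (1 - θ)) := by
        refine mul_le_mul_of_nonneg_left this (by positivity)
    _ = _ := by ring

theorem exists_integral_partialSum_mul_dual {a K θ : ℝ} (ha : 0 < a) (hK : 0 < K) (hθ : 0 < θ)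
    (hθ1 : θ < 1) :
    ∃ C > 0, ∀ T : ℝ, ∀ M N : ℕ, DualRange K T (a + M) N →
      ‖∫ t in (1 : ℝ)..T, partialSum a M (θ + t * I) *
        conj (dualSum (a + M) N θ t * dualMain θ t)‖ ≤ C * ((a + M) ^ (2 - 2 * θ) * Real.log T) := by
  obtain ⟨C, hC, h⟩ := exists_integral_cpow_mul_dual hK hθ
  refine ⟨C * (1 / a + 2 * (1 + (1 + |Real.log K|))), by positivity, fun T M N hR => ?_⟩
  have hb := hR.pos
  have hT := hR.T_pos
  have hlog := two_le_log hR.ten_le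
  have hpos : ∀ m : ℕ, (0 : ℝ) < m + a := fun m => by positivity
  simp_rw [partialSum, Finset.sum_mul]
  rw [intervalIntegral.integral_finsetSum fun m _ =>
    (integral_mul_conj_dual (continuous_cpow_line (hpos m) θ).continuousOn hR).1]
  have hm : ∀ m ∈ Finset.range M, ‖∫ t in (1 : ℝ)..T, ((m + a : ℝ) : ℂ) ^ (-((θ : ℂ) + t * I)) *
        conj (dualSum (a + M) N θ t * dualMain θ t)‖ ≤
      C * (a + M) ^ (2 - 2 * θ) * (1 / (m + a) + 1 / ((M : ℝ) - m)) := by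
    intro m hm
    have hmM := Finset.mem_range.mp hm
    have hmM' : (m : ℝ) < M := by exact_mod_cast hmM
    have hd : 0 < (M : ℝ) - m := by linarith
    have hp := hpos m
    refine (h T (a + M) (m + a) N hR hp (by linarith)).trans ?_
    rw [← div_mul_sub_eq ha hmM, show a + M - (m + a) = (M : ℝ) - m by ring, mul_assoc C]
    refine mul_le_mul_of_nonneg_left ?_ hC.le
    have e1 : (m + a : ℝ) ^ (-θ) = (m + a : ℝ) ^ (1 - θ) / (m + a) := by
      rw [← Real.rpow_sub_one hp.ne']; congr 1; ring
    have e2 : (m + a : ℝ) ^ (1 - θ) ≤ (a + M) ^ (1 - θ) :=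
      Real.rpow_le_rpow hp.le (by linarith) (by linarith)
    have e3 : (a + M) ^ (2 - 2 * θ) = (a + M) ^ (1 - θ) * (a + M) ^ (1 - θ) := by
      rw [← Real.rpow_add hb]; congr 1; ring
    rw [e1, e3]
    calc _ ≤ (a + M) ^ (1 - θ) / (m + a) * ((a + M) / ((M : ℝ) - m)) * (a + M) ^ (1 - θ) := by gcongr
      _ = _ := by rw [add_comm (M : ℝ) a]; field_simp
  refine (norm_sum_le _ _).trans ((Finset.sum_le_sum hm).trans ?_)
  rw [← Finset.mul_sum]
  have hl : Real.log (M + 1) ≤ (1 + |Real.log K|) * Real.log T := by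
    have h1 : Real.log (M + 1) ≤ Real.log (K * T) := by
      refine Real.log_le_log (by positivity) (le_trans ?_ hR.sq_le)
      nlinarith [hR.three_le]
    rw [Real.log_mul hK.ne' hT.ne'] at h1
    nlinarith [le_abs_self (Real.log K), abs_nonneg (Real.log K)]
  have h1 : 1 / a ≤ 1 / a * Real.log T := le_mul_of_one_le_right (by positivity) (by linarith)
  calc _ ≤ C * (a + M) ^ (2 - 2 * θ) * ((1 / a + 2 * (1 + (1 + |Real.log K|))) * Real.log T) := by
        refine mul_le_mul_of_nonneg_left ((sum_inv_le ha M).trans ?_) (by positivity)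
        linarith
    _ = _ := by ring

section

open HurwitzZeta

lemma exists_norm_zetaH_sub_dualMain_le {a θ : ℝ} (ha : 0 < a) (ha1 : a ≤ 1) (hθ : 0 < θ)
    (hθ1 : θ < 1) : ∃ C > 0, ∀ t : ℝ, 10 ≤ t →
      ‖zetaH (θ + t * I) a - dualMain θ t * expZeta ((-a : ℝ) : UnitAddCircle) (1 - (θ + t * I))‖ ≤
        C * (t ^ (-1 / 2 - θ / 2) * Real.log t) := by
  obtain ⟨C₁, hC₁, h₁⟩ := exists_norm_dualFactor_sub_le
  obtain ⟨C₂, hC₂, h₂⟩ := exists_norm_factor_le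
  obtain ⟨C₃, hC₃, h₃⟩ := exists_convexity_expZeta (a : UnitAddCircle)
  obtain ⟨C₄, hC₄, h₄⟩ := exists_convexity_expZeta ((-a : ℝ) : UnitAddCircle)
  refine ⟨C₁ * (1 / (2 * π)) ^ (1 / 2 - θ) * C₄ + C₂ * C₃, by positivity, fun t ht => ?_⟩
  have ht0 : 0 < t := by linarith
  have hlog := two_le_log ht
  set s : ℂ := θ + t * I with hs
  have hsre : (1 - s).re = 1 - θ := by simp [hs]
  have hsim : (1 - s).im = -t := by simp [hs]
  have habs : |(1 - s).im| = t := by rw [hsim, abs_neg, abs_of_pos ht0]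
  have e1s : 1 - s = ((1 - θ : ℝ) : ℂ) + ((-t : ℝ) : ℂ) * I := by rw [hs]; push_cast; ring
  have hfe : zetaH s a = dualFactor s * expZeta ((-a : ℝ) : UnitAddCircle) (1 - s) +
      (2 * π : ℂ) ^ (-(1 - s)) * Complex.Gamma (1 - s) * Complex.exp (-π * I * (1 - s) / 2) *
        expZeta (a : UnitAddCircle) (1 - s) := by
    have hn : ∀ n : ℕ, 1 - s ≠ -n := fun n h => by
      have := congrArg Complex.im h
      rw [hsim] at this; simp at this; linarith
    have := hurwitzZeta_one_sub (a : UnitAddCircle) (s := 1 - s) hn (Or.inr fun h => by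
      have := congrArg Complex.im h
      rw [hsim] at this; simp at this; linarith)
    rw [sub_sub_cancel] at this
    rw [zetaH_eq_hurwitzZeta ha ha1, this, dualFactor, AddCircle.coe_neg,
      show s - 1 = -(1 - s) by ring]
    ring
  have hw := h₂ (1 - s) ((t : ℂ) * Complex.exp (-π * I * (1 - s) / 2)) (by rw [hsre]; linarith)
    (by rw [hsre]; linarith) (by rw [habs]; linarith) (by
      rw [norm_mul, Complex.norm_real, Real.norm_of_nonneg ht0.le, Complex.norm_exp, habs]
      have : (-π * I * (1 - s) / 2 : ℂ).re = -(π * t / 2) := by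
        rw [show (-π * I * (1 - s) / 2 : ℂ) = ((-(π / 2) : ℝ) : ℂ) * (I * (1 - s)) by push_cast; ring,
          Complex.re_ofReal_mul]
        simp [hs]; ring
      have e2 : Real.exp (π * t / 2) = Real.exp (π * t) * Real.exp (-(π * t / 2)) := by
        rw [← Real.exp_add]; congr 1; ring
      rw [this, e2]
      refine mul_le_mul_of_nonneg_right ?_ (Real.exp_pos _).le
      have := Real.add_one_le_exp (π * t)
      nlinarith [Real.pi_gt_three])
  rw [habs, hsre] at hw
  have g3 := h₃ (1 - θ) (-t) (by rwa [abs_neg, abs_of_pos ht0]) (by linarith) (by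
    have : 0 < 1 / Real.log |(-t)| := by rw [abs_neg, abs_of_pos ht0]; positivity
    linarith)
  have g4 := h₄ (1 - θ) (-t) (by rwa [abs_neg, abs_of_pos ht0]) (by linarith) (by
    have : 0 < 1 / Real.log |(-t)| := by rw [abs_neg, abs_of_pos ht0]; positivity
    linarith)
  rw [← e1s, abs_neg, abs_of_pos ht0, show (1 - (1 - θ)) / 2 = θ / 2 by ring] at g3 g4
  have g1 := h₁ θ t hθ.le hθ1.le (by linarith)
  rw [← hs] at g1
  rw [hfe]
  set P := (2 * π : ℂ) ^ (-(1 - s)) * Complex.Gamma (1 - s) * Complex.exp (-π * I * (1 - s) / 2)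
    with hP
  have g2 : ‖P‖ ≤ C₂ * (t ^ (1 - θ - 1 / 2) / t) := by
    have e : (2 * π : ℂ) ^ (-(1 - s)) * Complex.Gamma (1 - s) *
        (t * Complex.exp (-π * I * (1 - s) / 2)) = t * P := by rw [hP]; ring
    rw [e, norm_mul, Complex.norm_real, Real.norm_of_nonneg ht0.le] at hw
    rw [← mul_div_assoc, le_div_iff₀ ht0]; linarith
  have ep : t ^ (1 - θ - 1 / 2) / t * t ^ (θ / 2) = t ^ (-1 / 2 - θ / 2) := by
    rw [← Real.rpow_sub_one ht0.ne', ← Real.rpow_add ht0]; congr 1; ring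
  have ed : (t / (2 * π)) ^ (1 / 2 - θ) = (1 / (2 * π)) ^ (1 / 2 - θ) * t ^ (1 - θ - 1 / 2) := by
    rw [div_eq_mul_one_div, mul_comm, Real.mul_rpow (by positivity) ht0.le]
    congr 2; ring
  rw [ed] at g1
  calc _ = ‖(dualFactor s - dualMain θ t) * expZeta ((-a : ℝ) : UnitAddCircle) (1 - s) +
        P * expZeta (a : UnitAddCircle) (1 - s)‖ := by congr 1; ring
    _ ≤ _ := norm_add_le _ _
    _ ≤ C₁ / t * ((1 / (2 * π)) ^ (1 / 2 - θ) * t ^ (1 - θ - 1 / 2)) * (C₄ * t ^ (θ / 2) * Real.log t) +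
        C₂ * (t ^ (1 - θ - 1 / 2) / t) * (C₃ * t ^ (θ / 2) * Real.log t) := by
        rw [norm_mul, norm_mul]
        gcongr
    _ = (C₁ * (1 / (2 * π)) ^ (1 / 2 - θ) * C₄ + C₂ * C₃) *
        (t ^ (1 - θ - 1 / 2) / t * t ^ (θ / 2) * Real.log t) := by ring
    _ = _ := by rw [ep]

lemma exists_integral_rem_mul_dual {a K θ : ℝ} (ha : 0 < a) (ha1 : a ≤ 1) (hθ : 0 < θ)
    (hθ1 : θ < 1) : ∃ C > 0, ∀ T b : ℝ, ∀ N : ℕ, DualRange K T b N →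
      ‖∫ t in (1 : ℝ)..T, (zetaH (θ + t * I) a -
        dualMain θ t * expZeta ((-a : ℝ) : UnitAddCircle) (1 - (θ + t * I))) *
          conj (dualSum b N θ t * dualMain θ t)‖ ≤ C * (b ^ (2 - 2 * θ) * Real.log T) := by
  obtain ⟨C, hC, h⟩ := exists_norm_zetaH_sub_dualMain_le ha ha1 hθ hθ1
  refine ⟨C / θ / (1 - θ / 2), by have : 0 < 1 - θ / 2 := by linarith
                                  positivity, fun T b N hR => ?_⟩
  have hb := hR.pos
  have hT := hR.T_pos
  have hT1 : 1 ≤ T := by linarith [hR.ten_le]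
  have hlog := two_le_log hR.ten_le
  have hpi := Real.pi_gt_three
  have hbd : ∀ t ∈ Ioc 1 T, ‖(zetaH (θ + t * I) a -
        dualMain θ t * expZeta ((-a : ℝ) : UnitAddCircle) (1 - (θ + t * I))) *
          conj (dualSum b N θ t * dualMain θ t)‖ ≤
        (C / θ * Real.log T * b ^ (-θ)) * t ^ (-(θ / 2)) := by
    intro t ht
    have ht0 : 0 < t := by linarith [ht.1]
    rcases lt_or_ge t (2 * π * b) with htb | htb
    · rw [dualSum_eq_zero hb htb]
      simp only [zero_mul, map_zero, mul_zero, norm_zero]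
      positivity
    · have ht10 : 10 ≤ t := by have := hR.ten_le_tau 0; simp at this; linarith
      rw [norm_mul, Complex.norm_conj, norm_mul, norm_dualMain ht0]
      have hl : Real.log t ≤ Real.log T := Real.log_le_log ht0 ht.2
      have hd : ‖dualSum b N θ t‖ * (t / (2 * π)) ^ (1 / 2 - θ) ≤ b ^ (-θ) / θ * t ^ (1 / 2 : ℝ) := by
        calc _ ≤ (t / (2 * π * b)) ^ θ / θ * (t / (2 * π)) ^ (1 / 2 - θ) :=
              mul_le_mul_of_nonneg_right (norm_dualSum_le hb hθ hθ1 ht0 N) (by positivity)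
          _ = b ^ (-θ) / θ * (t / (2 * π)) ^ (1 / 2 : ℝ) := by
              rw [show t / (2 * π * b) = (t / (2 * π)) * b⁻¹ by field_simp,
                Real.mul_rpow (by positivity) (by positivity), Real.inv_rpow hb.le,
                ← Real.rpow_neg hb.le, show (1 / 2 : ℝ) = θ + (1 / 2 - θ) by ring,
                Real.rpow_add (by positivity)]
              ring_nf
          _ ≤ _ := by
              gcongr
              exact div_le_self ht0.le (by linarith)
      have ep : t ^ (-1 / 2 - θ / 2) * t ^ (1 / 2 : ℝ) = t ^ (-(θ / 2)) := by
        rw [← Real.rpow_add ht0]; congr 1; ring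
      calc _ ≤ C * (t ^ (-1 / 2 - θ / 2) * Real.log T) * (b ^ (-θ) / θ * t ^ (1 / 2 : ℝ)) := by
            gcongr
            exact (h t ht10).trans (by gcongr)
        _ = (C / θ * Real.log T * b ^ (-θ)) * (t ^ (-1 / 2 - θ / 2) * t ^ (1 / 2 : ℝ)) := by ring
        _ = _ := by rw [ep]
  have h0 : -1 < -(θ / 2) := by linarith
  have hθ2 : 0 < 1 - θ / 2 := by linarith
  have hinteg := intervalIntegral.norm_integral_le_of_norm_le hT1 (Eventually.of_forall hbd)
    ((intervalIntegral.intervalIntegrable_rpow' h0).const_mul _)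
  refine hinteg.trans ?_
  rw [intervalIntegral.integral_const_mul, integral_rpow (Or.inl h0), Real.one_rpow]
  have hTp : T ^ (-(θ / 2) + 1) ≤ b ^ (2 - θ) := by
    calc _ ≤ (b ^ 2) ^ (-(θ / 2) + 1) := Real.rpow_le_rpow hT.le hR.le_sq (by linarith)
      _ = _ := by rw [← Real.rpow_natCast, ← Real.rpow_mul hb.le]; congr 1; push_cast; ring
  have eb : b ^ (-θ) * b ^ (2 - θ) = b ^ (2 - 2 * θ) := by
    rw [← Real.rpow_add hb]; congr 1; ring
  calc _ ≤ C / θ * Real.log T * b ^ (-θ) * (b ^ (2 - θ) / (1 - θ / 2)) := by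
        rw [show -(θ / 2) + 1 = 1 - θ / 2 by ring] at hTp ⊢
        gcongr
        linarith
    _ = C / θ / (1 - θ / 2) * (b ^ (-θ) * b ^ (2 - θ) * Real.log T) := by ring
    _ = _ := by rw [eb]

lemma conj_wave_mul (a : ℝ) (M k : ℕ) : conj (wave (k + 1 : ℕ) (-(a + M))) *
    Complex.exp (2 * π * I * (-a : ℝ) * (k + 1 : ℕ)) = 1 := by
  rw [wave, ← Complex.exp_conj, ← Complex.exp_add, Complex.exp_eq_one_iff]
  refine ⟨((k + 1) * M : ℕ), ?_⟩
  simp only [map_mul, Complex.conj_ofReal, Complex.conj_I]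
  push_cast; ring

theorem exists_integral_zetaH_mul_dual {a K θ : ℝ} (ha : 0 < a) (ha1 : a ≤ 1) (hK : 0 < K)
    (hθ : 0 < θ) (hθ1 : θ < 1) : ∃ C > 0, ∀ T : ℝ, ∀ M N : ℕ, DualRange K T (a + M) N →
      ‖(∫ t in (1 : ℝ)..T, zetaH (θ + t * I) a *
          conj (dualSum (a + M) N θ t * dualMain θ t)) - (dualDiag (a + M) θ T N : ℂ)‖ ≤
        C * ((a + M) ^ (2 - 2 * θ) * Real.log T) := by
  obtain ⟨C₁, hC₁, h₁⟩ := exists_integral_rem_mul_dual (K := K) ha ha1 hθ hθ1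
  have hL := isConvexZeta_expZeta (-a)
  obtain ⟨C₂, hC₂, h₂⟩ := hL.exists_norm_integral_sub_le (θ := 1 - θ) (by linarith) (by linarith)
    one_pos
  obtain ⟨C₃, hC₃, h₃⟩ := exists_sum_weight_le hK (p := 1 - 2 * θ) (q := θ - 1)
    (by linarith) (by linarith)
  refine ⟨C₁ + 8 * C₂ * C₃, by positivity, fun T M N hR => ?_⟩
  have hT := hR.T_pos
  have hlog := two_le_log hR.ten_le
  have hb := hR.pos
  set b : ℝ := a + M with hbdef
  set F : ℂ → ℂ := expZeta ((-a : ℝ) : UnitAddCircle) with hF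
  have hFc : ContinuousOn (fun t : ℝ => F (1 - (θ + t * I))) (Ioi 0) := by
    refine (continuousOn_line hL.differentiableAt (1 - θ) (ε := -1) (by norm_num)).congr fun t _ => ?_
    simp only
    congr 1; push_cast; ring
  have hζc := continuousOn_line_one (fun s hs => differentiableAt_zetaH ha hs) θ
  have hmc : ContinuousOn (fun t : ℝ => dualMain θ t * F (1 - (θ + t * I))) (Ioi 0) :=
    (continuousOn_dualMain θ).mul hFc
  obtain ⟨i1, e1⟩ := integral_mul_conj_dual (θ := θ) hmc hR
  have i2 := (integral_mul_conj_dual (θ := θ) hζc hR).1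
  have hsplit : (∫ t in (1 : ℝ)..T, zetaH (θ + t * I) a * conj (dualSum b N θ t * dualMain θ t)) =
      (∫ t in (1 : ℝ)..T, (zetaH (θ + t * I) a - dualMain θ t * F (1 - (θ + t * I))) *
        conj (dualSum b N θ t * dualMain θ t)) +
      ∫ t in (1 : ℝ)..T, dualMain θ t * F (1 - (θ + t * I)) * conj (dualSum b N θ t * dualMain θ t) := by
    simp_rw [sub_mul]
    rw [intervalIntegral.integral_sub i2 i1, sub_add_cancel]
  rw [hsplit, e1, dualDiag, Complex.ofReal_sum, add_sub_assoc, ← Finset.sum_sub_distrib]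
  have hk : ∀ k ∈ Finset.range N, ‖(∫ t in (2 * π * b * (k + 1))..T,
      dualMain θ t * F (1 - (θ + t * I)) * conj (dualTerm b θ k t)) -
      (((k + 1 : ℝ) ^ (2 * θ - 2) * ∫ t in (2 * π * b * (k + 1))..T,
        (t / (2 * π)) ^ (1 - 2 * θ) : ℝ) : ℂ)‖ ≤
      8 * C₂ * Real.log T * b ^ θ * ((k + 1 : ℝ) ^ (θ - 1) *
        ((2 * π * b * (k + 1) / (2 * π)) ^ (1 - 2 * θ) + (T / (2 * π)) ^ (1 - 2 * θ))) := by
    intro k hk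
    have hτ := hR.tau_le (Finset.mem_range.mp hk)
    have hτ10 := hR.ten_le_tau k
    set τ : ℝ := 2 * π * b * (k + 1) with hτdef
    have hτ0 : 0 < τ := by linarith
    have hk0 : (0 : ℝ) < k + 1 := by positivity
    have hkτ : (k : ℝ) + 1 ≤ τ := by
      rw [hτdef]
      refine le_mul_of_one_le_left hk0.le ?_
      nlinarith [Real.pi_gt_three, hR.one_le]
    set c : ℂ := Complex.exp (2 * π * I * (-a : ℝ) * (k + 1 : ℕ)) *
      (((k + 1 : ℝ) ^ (-(1 - θ)) : ℝ) : ℂ) with hc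
    set g : ℝ → ℂ := fun u => F ((1 - θ : ℝ) + (-1 * u : ℝ) * I) *
      ((k + 1 : ℝ) : ℂ) ^ (((-1 * u : ℝ) : ℂ) * I) with hg
    have hgc : ContinuousOn g (Ioi 0) :=
      (continuousOn_line hL.differentiableAt (1 - θ) (ε := -1) (by norm_num)).mul
        (continuous_cpow_mul_I hk0 (-1)).continuousOn
    have hgi : ∀ {x y : ℝ}, 0 < x → 0 < y → IntervalIntegrable g volume x y := fun hx hy =>
      ContinuousOn.intervalIntegrable_of_pos hgc hx hy
    have hB : ∀ t : ℝ, τ ≤ t → t ≤ T → ‖(∫ u in (1 : ℝ)..t, g u) - c * t‖ ≤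
        C₂ * Real.log T * (2 * b ^ θ) := by
      intro t ht htT
      have ht0 : 0 < t := by linarith
      refine (h₂ (-1) k t (by simp) (by linarith) (by linarith)).trans ?_
      rw [show (1 - (1 - θ)) / 2 = θ / 2 by ring, sub_sub_cancel]
      have q1 : t ^ (θ / 2) ≤ b ^ θ := by
        calc _ ≤ (b ^ 2) ^ (θ / 2) :=
              Real.rpow_le_rpow ht0.le (htT.trans hR.le_sq) (by linarith)
          _ = _ := by rw [← Real.rpow_natCast, ← Real.rpow_mul hb.le]; congr 1; push_cast; ring
      have q2 : (k + 1 : ℝ) ^ θ ≤ b ^ θ := by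
        refine Real.rpow_le_rpow hk0.le (le_trans ?_ hR.N_le) hθ.le
        exact_mod_cast Finset.mem_range.mp hk
      have q3 : Real.log t ≤ Real.log T := Real.log_le_log ht0 htT
      have q4 : 0 ≤ Real.log t := Real.log_nonneg (by linarith)
      gcongr
      linarith
    have hE : ∀ t ∈ Icc τ T, ‖∫ u in τ..t, (g u - c)‖ ≤ C₂ * Real.log T * (4 * b ^ θ) := by
      intro t ht
      have ht0 : 0 < t := hτ0.trans_le ht.1
      rw [intervalIntegral.integral_sub (hgi hτ0 ht0) (by simp), intervalIntegral.integral_const,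
        ← intervalIntegral.integral_interval_sub_left (hgi one_pos ht0) (hgi one_pos hτ0),
        Complex.real_smul]
      calc _ = ‖((∫ u in (1 : ℝ)..t, g u) - c * t) - ((∫ u in (1 : ℝ)..τ, g u) - c * τ)‖ := by
            congr 1; push_cast; ring
        _ ≤ _ := (norm_sub_le _ _).trans (add_le_add (hB t ht.1 ht.2) (hB τ le_rfl hτ))
        _ = _ := by ring
    have key := norm_integral_rpow_mul_le (1 - 2 * θ) hτ0 hτ (hgc.sub continuousOn_const) hE
    have hφc : ContinuousOn (fun t : ℝ => (((t / (2 * π)) ^ (1 - 2 * θ) : ℝ) : ℂ)) (Ioi 0) := by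
      refine Complex.continuous_ofReal.comp_continuousOn (ContinuousOn.rpow_const (by fun_prop) ?_)
      intro t ht
      have : (0 : ℝ) < t := ht
      exact Or.inl (by positivity)
    have e2 : ∫ t in τ..T, (((t / (2 * π)) ^ (1 - 2 * θ) : ℝ) : ℂ) * (g t - c) =
        (∫ t in τ..T, (((t / (2 * π)) ^ (1 - 2 * θ) : ℝ) : ℂ) * g t) -
          c * ((∫ t in τ..T, (t / (2 * π)) ^ (1 - 2 * θ) : ℝ) : ℂ) := by
      have i3 : IntervalIntegrable (fun t => (((t / (2 * π)) ^ (1 - 2 * θ) : ℝ) : ℂ) * g t) volume τ T :=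
        ContinuousOn.intervalIntegrable_of_pos (hφc.mul hgc) hτ0 hT
      simp_rw [mul_sub]
      rw [intervalIntegral.integral_sub i3 ((ContinuousOn.intervalIntegrable_of_pos hφc hτ0 hT).mul_const c),
        intervalIntegral.integral_mul_const, intervalIntegral.integral_ofReal, mul_comm c]
    have e3 : (∫ t in τ..T, dualMain θ t * F (1 - (θ + t * I)) * conj (dualTerm b θ k t)) =
        ((((k + 1 : ℝ) ^ (θ - 1) : ℝ) : ℂ) * conj (wave (k + 1 : ℕ) (-b))) *
          ∫ t in τ..T, (((t / (2 * π)) ^ (1 - 2 * θ) : ℝ) : ℂ) * g t := by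
      rw [← intervalIntegral.integral_const_mul]
      refine intervalIntegral.integral_congr fun t ht => ?_
      have ht0 : 0 < t := hτ0.trans_le (uIcc_of_le hτ ▸ ht).1
      simp only [hg]
      rw [← dualMain_mul_conj θ ht0, dualTerm_eq,
        show ((1 - θ : ℝ) : ℂ) + ((-1 * t : ℝ) : ℂ) * I = 1 - (θ + t * I) by push_cast; ring,
        show ((-1 * t : ℝ) : ℂ) * I = -((t : ℂ) * I) by push_cast; ring]
      simp only [map_mul, Complex.conj_ofReal]
      rw [conj_cpow_mul_I hk0]
      ring
    have e4 : (((k + 1 : ℝ) ^ (2 * θ - 2) * ∫ t in τ..T, (t / (2 * π)) ^ (1 - 2 * θ) : ℝ) : ℂ) =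
        ((((k + 1 : ℝ) ^ (θ - 1) : ℝ) : ℂ) * conj (wave (k + 1 : ℕ) (-b))) *
          (c * ((∫ t in τ..T, (t / (2 * π)) ^ (1 - 2 * θ) : ℝ) : ℂ)) := by
      have hw := conj_wave_mul a M k
      rw [show 2 * θ - 2 = (θ - 1) + (θ - 1) by ring, Real.rpow_add hk0, hc,
        show -(1 - θ) = θ - 1 by ring]
      push_cast at hw ⊢
      linear_combination (-(((k + 1 : ℝ) ^ (θ - 1) : ℝ) : ℂ) * (((k + 1 : ℝ) ^ (θ - 1) : ℝ) : ℂ) *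
        ((∫ t in τ..T, (t / (2 * π)) ^ (1 - 2 * θ) : ℝ) : ℂ)) * hw
    rw [e3, e4, ← mul_sub, ← e2, norm_mul, norm_mul, Complex.norm_conj, norm_wave, mul_one,
      Complex.norm_real, Real.norm_of_nonneg (by positivity)]
    calc _ ≤ (k + 1 : ℝ) ^ (θ - 1) * _ := mul_le_mul_of_nonneg_left key (by positivity)
      _ = _ := by ring
  refine (norm_add_le _ _).trans ?_
  have hsum := (norm_sum_le _ _).trans (Finset.sum_le_sum hk)
  rw [← Finset.mul_sum] at hsum
  have h3 := h₃ T b N hR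
  rw [show 2 * (1 - 2 * θ) + (θ - 1) + 1 = (2 - 2 * θ) - θ by ring] at h3
  have eb : b ^ θ * b ^ ((2 - 2 * θ) - θ) = b ^ (2 - 2 * θ) := by
    rw [← Real.rpow_add hb]; congr 1; ring
  have h4 : 8 * C₂ * Real.log T * b ^ θ * (C₃ * b ^ ((2 - 2 * θ) - θ)) =
      8 * C₂ * C₃ * (b ^ (2 - 2 * θ) * Real.log T) := by rw [← eb]; ring
  have h5 := mul_le_mul_of_nonneg_left h3 (show 0 ≤ 8 * C₂ * Real.log T * b ^ θ by positivity)
  linarith [h₁ T b N hR]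

end

/-! ### The mean square of the Hurwitz zeta function -/

lemma norm_sub_sq_ofReal (z w : ℂ) : ((‖z - w‖ ^ 2 : ℝ) : ℂ) =
    ((‖z‖ ^ 2 : ℝ) : ℂ) - (z * conj w + conj (z * conj w)) + ((‖w‖ ^ 2 : ℝ) : ℂ) := by
  have e : ∀ z : ℂ, ((‖z‖ ^ 2 : ℝ) : ℂ) = z * conj z := fun z => by
    rw [Complex.mul_conj, Complex.normSq_eq_norm_sq]
  simp only [e, map_sub, map_mul, Complex.conj_conj]
  ring

/-- If `∫ f ḡ` and `∫ |g|²` are close to `A`, then `∫ |f|²` is close to `A + ∫ |f - g|²`. -/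
lemma norm_integral_sq_sub_le {f g : ℝ → ℂ} {α β A E : ℝ}
    (hf : IntervalIntegrable (fun t => ((‖f t‖ ^ 2 : ℝ) : ℂ)) volume α β)
    (hfg : IntervalIntegrable (fun t => f t * conj (g t)) volume α β)
    (hg : IntervalIntegrable (fun t => ((‖g t‖ ^ 2 : ℝ) : ℂ)) volume α β)
    (h1 : ‖(∫ t in α..β, f t * conj (g t)) - A‖ ≤ E)
    (h2 : ‖(∫ t in α..β, ((‖g t‖ ^ 2 : ℝ) : ℂ)) - A‖ ≤ E) :
    |(∫ t in α..β, ‖f t‖ ^ 2) - (A + ∫ t in α..β, ‖f t - g t‖ ^ 2)| ≤ 3 * E := by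
  have hc : IntervalIntegrable (fun t => conj (f t * conj (g t))) volume α β :=
    ⟨Complex.conjCLE.toContinuousLinearMap.integrable_comp hfg.1,
      Complex.conjCLE.toContinuousLinearMap.integrable_comp hfg.2⟩
  have hci : ∫ t in α..β, conj (f t * conj (g t)) = conj (∫ t in α..β, f t * conj (g t)) := by
    simp only [intervalIntegral, integral_conj, map_sub]
  have e : (∫ t in α..β, ((‖f t - g t‖ ^ 2 : ℝ) : ℂ)) = (∫ t in α..β, ((‖f t‖ ^ 2 : ℝ) : ℂ)) -
      ((∫ t in α..β, f t * conj (g t)) + conj (∫ t in α..β, f t * conj (g t))) +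
      ∫ t in α..β, ((‖g t‖ ^ 2 : ℝ) : ℂ) := by
    simp_rw [norm_sub_sq_ofReal]
    rw [intervalIntegral.integral_add (hf.sub (hfg.add hc)) hg,
      intervalIntegral.integral_sub hf (hfg.add hc), intervalIntegral.integral_add hfg hc, hci]
  rw [← Real.norm_eq_abs, ← Complex.norm_real]
  push_cast
  rw [← intervalIntegral.integral_ofReal, ← intervalIntegral.integral_ofReal, e]
  set P := ∫ t in α..β, f t * conj (g t)
  set Q := ∫ t in α..β, ((‖g t‖ ^ 2 : ℝ) : ℂ)
  have h3 : ‖conj P - A‖ ≤ E := by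
    rw [show conj P - (A : ℂ) = conj (P - A) by simp, Complex.norm_conj]; exact h1
  set R := ∫ t in α..β, ((‖f t‖ ^ 2 : ℝ) : ℂ)
  calc _ = ‖(P - A) + (conj P - A) - (Q - A)‖ := by congr 1; ring
    _ ≤ ‖P - A‖ + ‖conj P - A‖ + ‖Q - A‖ := (norm_sub_le _ _).trans (by gcongr; exact norm_add_le _ _)
    _ ≤ _ := by linarith

lemma continuousOn_partialSum {a : ℝ} (ha : 0 < a) (M : ℕ) (θ : ℝ) :
    Continuous fun t : ℝ => partialSum a M (θ + t * I) :=
  continuous_finsetSum _ fun m _ => continuous_cpow_line (by positivity) θ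

lemma intervalIntegrable_sq {f : ℝ → ℂ} (hf : ContinuousOn f (Ioi 0)) {T : ℝ} (hT : 0 < T) :
    IntervalIntegrable (fun t => ((‖f t‖ ^ 2 : ℝ) : ℂ)) volume 1 T :=
  ContinuousOn.intervalIntegrable_of_pos
    (Complex.continuous_ofReal.comp_continuousOn (hf.norm.pow 2)) one_pos hT

lemma continuousOn_zetaH_line {a : ℝ} (ha : 0 < a) (θ : ℝ) :
    ContinuousOn (fun t : ℝ => zetaH (θ + t * I) a) (Ioi 0) :=
  continuousOn_line_one (fun _ hs => differentiableAt_zetaH ha hs) θ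

theorem exists_integral_sq_zetaH_shift {a K θ : ℝ} (ha : 0 < a) (ha1 : a ≤ 1) (hK : 0 < K)
    (hθ : 0 < θ) (hθ1 : θ < 1) : ∃ C > 0, ∀ T : ℝ, ∀ M N : ℕ, DualRange K T (a + M) N →
      |(∫ t in (1 : ℝ)..T, ‖zetaH (θ + t * I) (a + M)‖ ^ 2) - dualDiag (a + M) θ T N| ≤
        C * ((a + M) ^ (2 - 2 * θ) * Real.log T) := by
  obtain ⟨C₁, hC₁, h₁⟩ := exists_integral_sq_dual hK hθ hθ1
  obtain ⟨C₂, hC₂, h₂⟩ := exists_integral_partialSum_mul_dual ha hK hθ hθ1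
  obtain ⟨C₃, hC₃, h₃⟩ := exists_integral_zetaH_mul_dual ha ha1 hK hθ hθ1
  obtain ⟨C₄, hC₄, h₄⟩ := exists_integral_sq_rem_le hθ hθ1
  refine ⟨3 * (C₁ + C₂ + C₃) + C₄, by positivity, fun T M N hR => ?_⟩
  have hT := hR.T_pos
  have hlog := two_le_log hR.ten_le
  have hb := hR.pos
  have hc := continuousOn_zetaH_line (show 0 < a + M from hb) θ
  set E := (a + M) ^ (2 - 2 * θ) * Real.log T with hE
  have hE0 : 0 ≤ E := by positivity
  have hZ : ‖(∫ t in (1 : ℝ)..T, zetaH (θ + t * I) (a + M) *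
      conj (dualSum (a + M) N θ t * dualMain θ t)) - (dualDiag (a + M) θ T N : ℂ)‖ ≤
      (C₁ + C₂ + C₃) * E := by
    have e : ∀ t : ℝ, zetaH (θ + t * I) (a + M) * conj (dualSum (a + M) N θ t * dualMain θ t) =
        zetaH (θ + t * I) a * conj (dualSum (a + M) N θ t * dualMain θ t) -
        partialSum a M (θ + t * I) * conj (dualSum (a + M) N θ t * dualMain θ t) := fun t => by
      rw [zetaH_eq_partialSum_add ha M]; ring
    simp_rw [e]
    rw [intervalIntegral.integral_sub (integral_mul_conj_dual (continuousOn_zetaH_line ha θ) hR).1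
      (integral_mul_conj_dual (continuousOn_partialSum ha M θ).continuousOn hR).1, sub_right_comm]
    refine (norm_sub_le _ _).trans ((add_le_add (h₃ T M N hR) (h₂ T M N hR)).trans ?_)
    have := mul_nonneg hC₁.le hE0
    linarith
  obtain ⟨i1, b1⟩ := h₁ T _ N hR
  have key := norm_integral_sq_sub_le (intervalIntegrable_sq hc hT) (integral_mul_conj_dual hc hR).1
    i1 hZ (b1.trans (by gcongr; linarith))
  have hrem := h₄ (a + M) T N hR.one_le (by linarith [hR.ten_le]) hR.le_sq hR.lt hR.N_le
  have hrem0 : 0 ≤ ∫ t in (1 : ℝ)..T, ‖zetaH (θ + t * I) (a + M) -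
      dualSum (a + M) N θ t * dualMain θ t‖ ^ 2 :=
    intervalIntegral.integral_nonneg (by linarith [hR.ten_le]) fun _ _ => by positivity
  have hE1 : C₄ * (a + M) ^ (2 - 2 * θ) ≤ C₄ * E := by
    rw [hE]; gcongr; exact le_mul_of_one_le_right (by positivity) (by linarith)
  rw [abs_le] at key ⊢
  constructor <;> linarith [key.1, key.2]

lemma exists_dualRange {a : ℝ} (ha : 0 < a) {T : ℝ} (hT : 10 ≤ T) :
    ∃ M N : ℕ, (M : ℝ) ≤ 2 * √T ∧ DualRange ((2 + a) ^ 2) T (a + M) N := by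
  have h3 : 3 ≤ √T := Real.le_sqrt_of_sq_le (by linarith)
  have hs := Real.sq_sqrt (show 0 ≤ T by linarith)
  have hM := Nat.le_ceil √T
  have hM' := Nat.ceil_lt_add_one (show 0 ≤ √T by positivity)
  refine ⟨⌈√T⌉₊, ⌊T / (2 * π * (a + ⌈√T⌉₊))⌋₊, by linarith, ?_⟩
  have hb : 0 < a + (⌈√T⌉₊ : ℝ) := by positivity
  have hτ : 0 < 2 * π * (a + ⌈√T⌉₊) := by positivity
  refine ⟨by linarith, hT, ?_, ?_, ?_, ?_⟩
  · nlinarith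
  · have h5 : a + (⌈√T⌉₊ : ℝ) ≤ (2 + a) * √T := by nlinarith
    calc _ ≤ ((2 + a) * √T) ^ 2 := by gcongr
      _ = _ := by rw [mul_pow, hs]
  · have := Nat.floor_le (show 0 ≤ T / (2 * π * (a + ⌈√T⌉₊)) by positivity)
    rwa [le_div_iff₀ hτ, mul_comm] at this
  · have := Nat.lt_floor_add_one (T / (2 * π * (a + ⌈√T⌉₊)))
    rwa [div_lt_iff₀ hτ, mul_comm] at this

lemma DualRange.rpow_le {K T b θ : ℝ} {N : ℕ} (hR : DualRange K T b N) (hK : 0 ≤ K) (hθ1 : θ ≤ 1) :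
    b ^ (2 - 2 * θ) ≤ K ^ (1 - θ) * T ^ (1 - θ) := by
  rw [← Real.mul_rpow hK hR.T_pos.le, show 2 - 2 * θ = (2 : ℕ) * (1 - θ) by push_cast; ring,
    Real.rpow_mul hR.pos.le, Real.rpow_natCast]
  exact Real.rpow_le_rpow (by positivity) hR.sq_le (by linarith)

theorem exists_integral_sq_zetaH {a θ : ℝ} (ha : 0 < a) (hθ : 0 < θ) (hθ1 : θ < 1) :
    ∃ C > 0, ∀ T : ℝ, 10 ≤ T → ∃ M N : ℕ, DualRange ((2 + a) ^ 2) T (a + M) N ∧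
      |(∫ t in (1 : ℝ)..T, ‖zetaH (θ + t * I) a‖ ^ 2) -
        ((∑ m ∈ Finset.range M, (m + a : ℝ) ^ (-(2 * θ))) * T + dualDiag (a + M) θ T N)| ≤
        C * (T ^ (1 - θ) * Real.log T) := by
  obtain ⟨n, hn⟩ : ∃ n : ℕ, ⌈a⌉₊ = n + 1 := ⟨⌈a⌉₊ - 1, by have := Nat.ceil_pos.mpr ha; omega⟩
  have hn1 : a ≤ n + 1 := by have := Nat.le_ceil a; rw [hn] at this; exact_mod_cast this
  have hn2 : (n : ℝ) < a := by
    have := Nat.ceil_lt_add_one ha.le; rw [hn] at this; push_cast at this; linarith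
  obtain ⟨C₁, hC₁, h₁⟩ := exists_integral_sq_zetaH_shift (a := a - n) (K := (2 + a) ^ 2) (by linarith)
    (by linarith) (by positivity) hθ hθ1
  obtain ⟨C₂, hC₂, h₂⟩ := exists_integral_zetaH_mul_partialSum ha hθ hθ1
  obtain ⟨C₃, hC₃, h₃⟩ := exists_integral_sq_partialSum ha hθ hθ1
  refine ⟨3 * (C₂ + C₃) + C₁ * ((2 + a) ^ 2) ^ (1 - θ), by positivity, fun T hT => ?_⟩
  obtain ⟨M, N, hM, hR⟩ := exists_dualRange ha hT
  refine ⟨M, N, hR, ?_⟩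
  have hT0 := hR.T_pos
  have hb := hR.pos
  have hlog := two_le_log hT
  set E := T ^ (1 - θ) * Real.log T with hE
  have hE0 : 0 ≤ E := by positivity
  have hζ := continuousOn_zetaH_line ha θ
  have hS := (continuousOn_partialSum ha M θ).continuousOn (s := Ioi 0)
  have g2 := h₂ T M hT hM
  have g3 := h₃ T M hT hM
  rw [← Complex.ofReal_mul] at g2 g3
  have key := norm_integral_sq_sub_le (intervalIntegrable_sq hζ hT0)
    (ContinuousOn.intervalIntegrable_of_pos (hζ.mul
      (Complex.continuous_conj.comp_continuousOn hS)) one_pos hT0) (intervalIntegrable_sq hS hT0)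
    (g2.trans (show _ ≤ (C₂ + C₃) * E by gcongr; linarith))
    (g3.trans (show _ ≤ (C₂ + C₃) * E by gcongr; linarith))
  have eb : a - n + ((n + M : ℕ) : ℝ) = a + M := by push_cast; ring
  have g1 := h₁ T (n + M) N (by rwa [eb])
  rw [eb] at g1
  have ed : ∀ t : ℝ, zetaH (θ + t * I) a - partialSum a M (θ + t * I) = zetaH (θ + t * I) (a + M) :=
    fun t => by rw [zetaH_eq_partialSum_add ha M]; ring
  simp_rw [ed] at key
  have hbT := hR.rpow_le (by positivity) hθ1.le
  have g4 : C₁ * ((a + M) ^ (2 - 2 * θ) * Real.log T) ≤ C₁ * ((2 + a) ^ 2) ^ (1 - θ) * E := by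
    rw [hE]
    calc _ ≤ C₁ * (((2 + a) ^ 2) ^ (1 - θ) * T ^ (1 - θ) * Real.log T) := by gcongr
      _ = _ := by ring
  rw [abs_le] at key g1 ⊢
  constructor <;> linarith [key.1, key.2, g1.1, g1.2]

lemma exists_sum_rpow_sub_le {a σ : ℝ} (ha : 0 < a) (hσ : 0 < σ) (hσ1 : σ ≠ 1) :
    ∃ C > 0, ∀ M : ℕ, 1 ≤ a + M →
      ‖((∑ m ∈ Finset.range M, (m + a : ℝ) ^ (-σ) : ℝ) : ℂ) -
        (zetaH (σ : ℂ) a - (((a + M) ^ (1 - σ) / (σ - 1) : ℝ) : ℂ))‖ ≤ C * (a + M) ^ (-σ) := by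
  refine ⟨1 / 2 + (‖(σ : ℂ)‖ / 12 + ‖(σ : ℂ)‖ * ‖(σ : ℂ) + 1‖ / (12 * (σ + 1))), by positivity,
    fun M hM => ?_⟩
  have hb : 0 < a + M := by linarith
  have hs1 : (σ : ℂ) ≠ 1 := by exact_mod_cast hσ1
  have e1 : ((∑ m ∈ Finset.range M, (m + a : ℝ) ^ (-σ) : ℝ) : ℂ) = partialSum a M σ := by
    rw [partialSum, Complex.ofReal_sum]
    refine Finset.sum_congr rfl fun m _ => ?_
    rw [Complex.ofReal_cpow (by positivity)]; push_cast; rfl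
  have e2 : (((a + M) ^ (1 - σ) / (σ - 1) : ℝ) : ℂ) = ((a + M : ℝ) : ℂ) ^ (1 - (σ : ℂ)) / (σ - 1) := by
    rw [Complex.ofReal_div, Complex.ofReal_cpow hb.le]; push_cast; rfl
  have h := norm_emSum_sub_le hb (s := (σ : ℂ)) (by simp; linarith)
  rw [← zetaH_eq_emSum hb (by simp; linarith) hs1, Complex.ofReal_re, ← e2] at h
  rw [e1, zetaH_eq_partialSum_add ha M]
  rw [← norm_neg]
  calc _ = ‖zetaH (σ : ℂ) (a + M) - (((a + M) ^ (1 - σ) / (σ - 1) : ℝ) : ℂ)‖ := by congr 1; ring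
    _ ≤ _ := h
    _ ≤ (a + M) ^ (-σ) / 2 + (a + M) ^ (-σ) *
        (‖(σ : ℂ)‖ / 12 + ‖(σ : ℂ)‖ * ‖(σ : ℂ) + 1‖ / (12 * (σ + 1))) := by
        gcongr
        linarith
    _ = _ := by ring

lemma zetaH_one (s : ℂ) : zetaH s 1 = riemannZeta s := by
  rw [zetaH_eq_hurwitzZeta one_pos le_rfl, AddCircle.coe_period, HurwitzZeta.hurwitzZeta_zero]

lemma dualDiag_eq {b θ T : ℝ} (hb : 0 < b) (hθ1 : θ < 1) (N : ℕ) :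
    dualDiag b θ T N = 2 * π / (2 - 2 * θ) * ((T / (2 * π)) ^ (2 - 2 * θ) *
      ∑ k ∈ Finset.range N, (k + 1 : ℝ) ^ (-(2 - 2 * θ)) - N * b ^ (2 - 2 * θ)) := by
  have hp : 0 < 2 - 2 * θ := by linarith
  rw [dualDiag, Finset.mul_sum, show (N : ℝ) * b ^ (2 - 2 * θ) =
    ∑ k ∈ Finset.range N, b ^ (2 - 2 * θ) by simp, ← Finset.sum_sub_distrib, Finset.mul_sum]
  refine Finset.sum_congr rfl fun k _ => ?_
  have hk : (0 : ℝ) < k + 1 := by positivity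
  rw [intervalIntegral.integral_comp_div (f := fun x => x ^ (1 - 2 * θ)) (by positivity : 2 * π ≠ 0),
    integral_rpow (Or.inl (by linarith)), show 2 * π * b * (k + 1) / (2 * π) = b * (k + 1) by field_simp,
    show 1 - 2 * θ + 1 = 2 - 2 * θ by ring, Real.mul_rpow hb.le hk.le,
    show 2 * θ - 2 = -(2 - 2 * θ) by ring, Real.rpow_neg hk.le, smul_eq_mul]
  field_simp

/-- The quantity `X / b` of the dual range, compared with its integral part. -/
lemma DualRange.quot {K T b : ℝ} {N : ℕ} (h : DualRange K T b N) :
    0 < T / (2 * π) / b ∧ (N : ℝ) ≤ T / (2 * π) / b ∧ T / (2 * π) / b < N + 1 := by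
  have hb := h.pos
  have hT := h.T_pos
  refine ⟨by positivity, ?_, ?_⟩
  · rw [div_div, le_div_iff₀ (by positivity)]; linarith [h.le]
  · rw [div_div, div_lt_iff₀ (by positivity)]; linarith [h.lt]

lemma abs_rpow_sub_le {ρ p : ℝ} (hρ : 0 < ρ) (hρ1 : ρ ≤ 1) (hp : 0 < p) (hp2 : p ≤ 2) :
    |ρ ^ p - ρ| ≤ 1 - ρ := by
  have h1 : ρ ^ p ≤ 1 := Real.rpow_le_one hρ.le hρ1 hp.le
  have h2 : ρ ^ (2 : ℝ) ≤ ρ ^ p := Real.rpow_le_rpow_of_exponent_ge hρ hρ1 hp2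
  rw [Real.rpow_two] at h2
  rw [abs_le]
  constructor <;> nlinarith

theorem exists_main_terms {a K θ : ℝ} (ha : 0 < a) (hθ : 0 < θ) (hθ1 : θ < 1)
    (hθ2 : θ ≠ 1 / 2) : ∃ C > 0, ∀ T : ℝ, ∀ M N : ℕ, DualRange K T (a + M) N →
      ‖(((∑ m ∈ Finset.range M, (m + a : ℝ) ^ (-(2 * θ))) * T + dualDiag (a + M) θ T N : ℝ) : ℂ) -
        (zetaH ((2 * θ : ℝ) : ℂ) a * T + (((2 * π) ^ (2 * θ - 1) / (2 - 2 * θ) : ℝ) : ℂ) *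
          riemannZeta ((2 - 2 * θ : ℝ) : ℂ) * ((T ^ (2 - 2 * θ) : ℝ) : ℂ))‖ ≤
        C * (a + M) ^ (2 - 2 * θ) := by
  have hp : 0 < 2 - 2 * θ := by linarith
  have hq : 2 * θ - 1 ≠ 0 := fun h => hθ2 (by linarith)
  obtain ⟨C₁, hC₁, h₁⟩ := exists_sum_rpow_sub_le ha (show 0 < 2 * θ by linarith)
    (fun h => hθ2 (by linarith))
  obtain ⟨C₂, hC₂, h₂⟩ := exists_sum_rpow_sub_le one_pos hp (fun h => hθ2 (by linarith))
  refine ⟨C₁ + 2 * π / (2 - 2 * θ) * C₂ + 2 * π / (2 - 2 * θ) * (1 / |2 * θ - 1| + 1), by positivity,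
    fun T M N hR => ?_⟩
  have hb := hR.pos
  have hT := hR.T_pos
  obtain ⟨hy0, hyN, hyN1⟩ := hR.quot
  have g1 := h₁ M hR.one_le
  have g2 := h₂ N (by have := Nat.cast_nonneg (α := ℝ) N; linarith)
  rw [zetaH_one, add_comm (1 : ℝ)] at g2
  rw [dualDiag_eq hb hθ1]
  set b := a + (M : ℝ) with hbdef
  set y := T / (2 * π) / b with hy
  set p := 2 - 2 * θ with hpdef
  have hX : T / (2 * π) = b * y := by rw [hy]; field_simp
  have hTy : T = 2 * π * (b * y) := by rw [← hX]; field_simp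
  have hN1 : (0 : ℝ) < N + 1 := by positivity
  set A := ∑ m ∈ Finset.range M, (m + a : ℝ) ^ (-(2 * θ))
  set H := ∑ k ∈ Finset.range N, (k + 1 : ℝ) ^ (-p)
  set ε := y ^ p * (N + 1 : ℝ) ^ (1 - p) - y with hε
  have hε1 : |ε| ≤ 1 := by
    have hρ : y / (N + 1) ≤ 1 := (div_le_one hN1).mpr hyN1.le
    have e : ε = (N + 1) * ((y / (N + 1)) ^ p - y / (N + 1)) := by
      rw [hε, Real.div_rpow hy0.le hN1.le, Real.rpow_sub hN1, Real.rpow_one]; field_simp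
    rw [e, abs_mul, abs_of_pos hN1]
    calc _ ≤ (N + 1 : ℝ) * (1 - y / (N + 1)) :=
          mul_le_mul_of_nonneg_left (abs_rpow_sub_le (by positivity) hρ hp (by linarith)) hN1.le
      _ = N + 1 - y := by field_simp
      _ ≤ 1 := by linarith
  have ebp : b ^ p = b * b ^ (1 - 2 * θ) := by
    rw [hpdef, show 2 - 2 * θ = 1 + (1 - 2 * θ) by ring, Real.rpow_add hb, Real.rpow_one]
  have eXp : (T / (2 * π)) ^ p = b ^ p * y ^ p := by rw [hX, Real.mul_rpow hb.le hy0.le]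
  have eTp : (2 * π) ^ (2 * θ - 1) / p * T ^ p = 2 * π / p * (b ^ p * y ^ p) := by
    rw [← eXp, Real.div_rpow hT.le (by positivity),
      show 2 * θ - 1 = 1 - p by rw [hpdef]; ring, Real.rpow_sub (by positivity), Real.rpow_one]
    ring
  have hreal : -(T * (b ^ (1 - 2 * θ) / (2 * θ - 1))) +
      2 * π / p * (b ^ p * y ^ p * (-((N + 1 : ℝ) ^ (1 - p) / (p - 1))) - N * b ^ p) =
      2 * π / p * b ^ p * (ε / (2 * θ - 1) + (y - N)) := by
    have e1 : y ^ p * (N + 1 : ℝ) ^ (1 - p) = y + ε := by rw [hε]; ring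
    have e2 : p - 1 = -(2 * θ - 1) := by rw [hpdef]; ring
    calc _ = -(2 * π * y * (b * b ^ (1 - 2 * θ)) / (2 * θ - 1)) +
        2 * π / p * b ^ p * ((y ^ p * (N + 1 : ℝ) ^ (1 - p)) / (2 * θ - 1) - N) := by
          rw [e2, hTy]; field_simp
      _ = _ := by
          rw [e1, ← ebp]; field_simp
          rw [hpdef]; ring
  have hTb : T * b ^ (-(2 * θ)) ≤ b ^ p := by
    calc _ ≤ b ^ 2 * b ^ (-(2 * θ)) := by gcongr; exact hR.le_sq
      _ = _ := by rw [← Real.rpow_natCast, ← Real.rpow_add hb]; congr 1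
  have hyN' : y ^ p * (N + 1 : ℝ) ^ (-p) ≤ 1 := by
    rw [Real.rpow_neg hN1.le, ← div_eq_mul_inv, ← Real.div_rpow hy0.le hN1.le]
    exact Real.rpow_le_one (by positivity) ((div_le_one hN1).mpr hyN1.le) hp.le
  set u := ((A : ℝ) : ℂ) - (zetaH ((2 * θ : ℝ) : ℂ) a - ((b ^ (1 - 2 * θ) / (2 * θ - 1) : ℝ) : ℂ))
    with hu
  set v := ((H : ℝ) : ℂ) - (riemannZeta (p : ℂ) - (((N + 1 : ℝ) ^ (1 - p) / (p - 1) : ℝ) : ℂ))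
    with hv
  have hsplit : ((A * T + 2 * π / p * ((T / (2 * π)) ^ p * H - N * b ^ p) : ℝ) : ℂ) -
        (zetaH ((2 * θ : ℝ) : ℂ) a * T + (((2 * π) ^ (2 * θ - 1) / p : ℝ) : ℂ) *
          riemannZeta (p : ℂ) * ((T ^ p : ℝ) : ℂ)) =
      (T : ℂ) * u + ((2 * π / p * (b ^ p * y ^ p) : ℝ) : ℂ) * v +
        ((2 * π / p * b ^ p * (ε / (2 * θ - 1) + (y - N)) : ℝ) : ℂ) := by
    rw [← hreal, eXp, mul_right_comm _ (riemannZeta (p : ℂ)), ← Complex.ofReal_mul, eTp, hu, hv]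
    push_cast; ring
  rw [hsplit]
  have n1 : ‖(T : ℂ) * u‖ ≤ C₁ * b ^ p := by
    rw [norm_mul, Complex.norm_real, Real.norm_of_nonneg hT.le]
    calc _ ≤ T * (C₁ * b ^ (-(2 * θ))) := by gcongr
      _ = C₁ * (T * b ^ (-(2 * θ))) := by ring
      _ ≤ _ := by gcongr
  have n2 : ‖((2 * π / p * (b ^ p * y ^ p) : ℝ) : ℂ) * v‖ ≤ 2 * π / p * C₂ * b ^ p := by
    rw [norm_mul, Complex.norm_real, Real.norm_of_nonneg (by positivity)]
    calc _ ≤ 2 * π / p * (b ^ p * y ^ p) * (C₂ * (N + 1 : ℝ) ^ (-p)) := by gcongr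
      _ = 2 * π / p * C₂ * b ^ p * (y ^ p * (N + 1 : ℝ) ^ (-p)) := by ring
      _ ≤ _ := mul_le_of_le_one_right (by positivity) hyN'
  have n3 : ‖((2 * π / p * b ^ p * (ε / (2 * θ - 1) + (y - N)) : ℝ) : ℂ)‖ ≤
      2 * π / p * (1 / |2 * θ - 1| + 1) * b ^ p := by
    rw [Complex.norm_real, norm_mul, Real.norm_of_nonneg (by positivity), mul_right_comm]
    gcongr
    rw [Real.norm_eq_abs]
    refine (abs_add_le _ _).trans (add_le_add ?_ ?_)
    · rw [abs_div]; gcongr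
    · rw [abs_le]; constructor <;> linarith
  refine (norm_add_le _ _).trans ((add_le_add ((norm_add_le _ _).trans (add_le_add n1 n2)) n3).trans
    (le_of_eq ?_))
  ring

/-! ### Generalized Euler constants -/

lemma abs_sum_inv_sub_le {a : ℝ} (ha : 0 < a) (M : ℕ) :
    |∑ m ∈ Finset.range M, 1 / (m + a : ℝ) - Real.log (M + a) - eulerGamma a| ≤ 1 / (M + a) ∧
    Tendsto (fun M : ℕ => ∑ m ∈ Finset.range (M + 1), 1 / ((m : ℝ) + a) - Real.log (M + a)) atTop
      (𝓝 (eulerGamma a)) := by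
  set v : ℕ → ℝ := fun M => ∑ m ∈ Finset.range M, 1 / (m + a : ℝ) - Real.log (M + a) with hv
  set w : ℕ → ℝ := fun M => ∑ m ∈ Finset.range (M + 1), 1 / ((m : ℝ) + a) - Real.log (M + a) with hw
  have hpos : ∀ m : ℕ, (0 : ℝ) < m + a := fun m => by positivity
  have hvw : ∀ M, w M = v M + 1 / (M + a) := fun M => by
    simp only [hv, hw, Finset.sum_range_succ]; ring
  have hlog : ∀ M : ℕ, 1 / ((M : ℝ) + 1 + a) ≤ Real.log ((M : ℝ) + 1 + a) - Real.log (M + a) ∧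
      Real.log ((M : ℝ) + 1 + a) - Real.log (M + a) ≤ 1 / (M + a) := by
    intro M
    have h1 := hpos M
    have h2 : (0 : ℝ) < M + 1 + a := by linarith
    constructor
    · have := abs_log_sub_ge h1 (show (M : ℝ) + a < M + 1 + a by linarith)
      rwa [show (M : ℝ) + 1 + a - (M + a) = 1 by ring] at this
    · rw [← Real.log_div h2.ne' h1.ne']
      refine (Real.log_le_sub_one_of_pos (by positivity)).trans (le_of_eq ?_)
      field_simp; ring
  have hvm : Monotone v := monotone_nat_of_le_succ fun M => by
    have := (hlog M).2
    simp only [hv, Finset.sum_range_succ]; push_cast; linarith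
  have hwa : Antitone w := antitone_nat_of_succ_le fun M => by
    have := (hlog M).1
    simp only [hw, Finset.sum_range_succ _ (M + 1)]; push_cast; linarith
  have hle : ∀ m n, v m ≤ w n := fun m n => by
    have h1 := hvm (le_max_left m n)
    have h2 := hwa (le_max_right m n)
    have h3 := hvw (max m n)
    have : 0 < 1 / (((max m n : ℕ) : ℝ) + a) := one_div_pos.mpr (hpos _)
    linarith
  have htend : Tendsto w atTop (𝓝 (⨅ i, w i)) := tendsto_atTop_ciInf hwa ⟨v 0, by
    rintro _ ⟨n, rfl⟩; exact hle 0 n⟩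
  have heq : eulerGamma a = ⨅ i, w i := htend.limUnder_eq
  have h1 : eulerGamma a ≤ w M := heq ▸ ciInf_le ⟨v 0, by rintro _ ⟨n, rfl⟩; exact hle 0 n⟩ M
  have h2 : v M ≤ eulerGamma a := heq ▸ le_ciInf fun n => hle M n
  refine ⟨?_, heq ▸ htend⟩
  have := hvw M
  rw [abs_le]
  constructor <;> simp only [hv] at h2 this <;> linarith

lemma eulerGamma_one : eulerGamma 1 = Real.eulerMascheroniConstant := by
  refine tendsto_nhds_unique (abs_sum_inv_sub_le one_pos 0).2 ?_
  have := Real.tendsto_harmonic_sub_log.comp (tendsto_add_atTop_nat 1)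
  refine this.congr fun M => ?_
  simp only [Function.comp, harmonic]
  push_cast
  simp

theorem exists_main_terms_half {a K : ℝ} (ha : 0 < a) : ∃ C > 0, ∀ T : ℝ, ∀ M N : ℕ,
    DualRange K T (a + M) N →
      |(∑ m ∈ Finset.range M, (m + a : ℝ) ^ (-(2 * (1 / 2 : ℝ)))) * T + dualDiag (a + M) (1 / 2) T N -
        (T * Real.log T + (eulerGamma a + Real.eulerMascheroniConstant - 1 - Real.log (2 * π)) * T)| ≤
        C * (a + M) ^ (2 - 2 * (1 / 2 : ℝ)) := by
  refine ⟨1 + 6 * π, by positivity, fun T M N hR => ?_⟩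
  have hb := hR.pos
  have hT := hR.T_pos
  obtain ⟨hy0, hyN, hyN1⟩ := hR.quot
  have g1 := (abs_sum_inv_sub_le ha M).1
  have g2 := (abs_sum_inv_sub_le one_pos N).1
  rw [eulerGamma_one] at g2
  rw [dualDiag_eq hb (by norm_num)]
  rw [add_comm (M : ℝ) a] at g1
  norm_num only [Real.rpow_one, Real.rpow_neg_one, one_div] at g1 g2 ⊢
  simp only [div_one] at g1 g2 ⊢
  set b := a + (M : ℝ) with hbdef
  set y := T / (2 * π) / b with hy
  have hN1 : (0 : ℝ) < N + 1 := by positivity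
  have hTy : T = 2 * π * b * y := by rw [hy]; field_simp
  set A := ∑ m ∈ Finset.range M, (m + a : ℝ)⁻¹
  set H := ∑ k ∈ Finset.range N, (k + 1 : ℝ)⁻¹
  have hX : T / (2 * π) * (2 * π) = T := by field_simp
  have hlog : Real.log T = Real.log (2 * π) + Real.log b + Real.log y := by
    rw [hTy, Real.log_mul (by positivity) hy0.ne', Real.log_mul (by positivity) hb.ne']
  have hl1 : 0 ≤ Real.log (N + 1) - Real.log y := by
    have := Real.log_le_log hy0 hyN1.le; linarith
  have hl2 : y * (Real.log (N + 1) - Real.log y) ≤ 1 := by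
    have : Real.log (N + 1) - Real.log y ≤ (N + 1) / y - 1 := by
      rw [← Real.log_div hN1.ne' hy0.ne']; exact Real.log_le_sub_one_of_pos (by positivity)
    calc _ ≤ y * ((N + 1) / y - 1) := by gcongr
      _ = N + 1 - y := by field_simp
      _ ≤ 1 := by linarith
  set u := A - Real.log b - eulerGamma a with hu
  set v := H - Real.log (N + 1) - Real.eulerMascheroniConstant with hv
  set l := Real.log (N + 1) - Real.log y with hl
  have hsplit : A * T + 2 * π * (T / (2 * π) * H - N * b) -
      (T * Real.log T + (eulerGamma a + Real.eulerMascheroniConstant - 1 - Real.log (2 * π)) * T) =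
      T * u + T * v + 2 * π * b * (y * l) + 2 * π * b * (y - N) := by
    rw [show 2 * π * (T / (2 * π) * H - N * b) = T / (2 * π) * (2 * π) * H - 2 * π * N * b by ring, hX,
      hlog, hu, hv, show 2 * π * b * (y * l) = (2 * π * b * y) * l by ring, ← hTy, hl,
      show 2 * π * b * (y - N) = 2 * π * b * y - 2 * π * N * b by ring, ← hTy]
    ring
  rw [hsplit]
  have n1 : |T * u| ≤ b := by
    rw [abs_mul, abs_of_pos hT]
    calc _ ≤ b ^ 2 * b⁻¹ := by gcongr; exact hR.le_sq
      _ = b := by field_simp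
  have hpb : 0 < 2 * π * b := by positivity
  have n2 : |T * v| ≤ 2 * π * b := by
    rw [abs_mul, abs_of_pos hT]
    calc _ ≤ T * (N + 1 : ℝ)⁻¹ := by gcongr
      _ ≤ _ := by
        rw [← div_eq_mul_inv, div_le_iff₀ hN1, hTy]; gcongr
  have n3 : |2 * π * b * (y * l)| ≤ 2 * π * b := by
    rw [abs_of_nonneg (by positivity)]
    exact mul_le_of_le_one_right hpb.le hl2
  have n4 : |2 * π * b * (y - N)| ≤ 2 * π * b := by
    rw [abs_of_nonneg (mul_nonneg hpb.le (by linarith))]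
    exact mul_le_of_le_one_right hpb.le (by linarith)
  refine (abs_add_le _ _).trans ((add_le_add ((abs_add_le _ _).trans (add_le_add
    ((abs_add_le _ _).trans (add_le_add n1 n2)) n3)) n4).trans (le_of_eq ?_))
  ring

/-! ### Products of Hurwitz zeta functions on different lines -/

lemma norm_zetaH_line_le {b σ : ℝ} (hb : 0 < b) (hσ : 1 < σ) (t : ℝ) :
    ‖zetaH (σ + t * I) b‖ ≤ ‖zetaH (σ : ℂ) b‖ := by
  have hsum : Summable fun k : ℕ => (k + b : ℝ) ^ (-σ) := by
    have := summable_rpow_neg hb (show 0 < σ - 1 by linarith)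
    rwa [show 1 + (σ - 1) = σ by ring] at this
  have hn : ∀ (s : ℂ) (k : ℕ), s.re = σ → ‖1 / ((k + b : ℝ) : ℂ) ^ s‖ = (k + b : ℝ) ^ (-σ) := by
    intro s k hs
    rw [norm_div, norm_one, Complex.norm_cpow_eq_rpow_re_of_pos (by positivity), hs,
      Real.rpow_neg (by positivity), one_div]
  have h1 := (hasSum_zetaH hb (s := σ + t * I) (by simpa using hσ)).norm_le_of_bounded hsum.hasSum
    fun k => (hn _ k (by simp)).le
  have h2 : zetaH (σ : ℂ) b = ((∑' k : ℕ, (k + b : ℝ) ^ (-σ) : ℝ) : ℂ) := by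
    refine (hasSum_zetaH hb (s := σ) (by simpa using hσ)).unique ?_
    refine (Complex.hasSum_ofReal.mpr hsum.hasSum).congr_fun fun k => ?_
    rw [Real.rpow_neg (by positivity), Complex.ofReal_inv, Complex.ofReal_cpow (by positivity), one_div]
  rw [h2, Complex.norm_real]
  exact h1.trans (le_abs_self _)

lemma exists_norm_zetaH_real_le {σ : ℝ} (hσ : 1 < σ) :
    ∃ C > 0, ∀ b t : ℝ, 1 ≤ b → ‖zetaH (σ + t * I) b‖ ≤ C * b ^ (1 - σ) := by
  refine ⟨1 / (σ - 1) + (1 / 2 + (‖(σ : ℂ)‖ / 12 + ‖(σ : ℂ)‖ * ‖(σ : ℂ) + 1‖ / (12 * (σ + 1)))), ?_,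
    fun b t hb => ?_⟩
  · have : 0 < 1 / (σ - 1) := div_pos one_pos (by linarith)
    positivity
  have hb0 : 0 < b := by linarith
  refine (norm_zetaH_line_le hb0 hσ t).trans ?_
  have h := norm_emSum_sub_le hb0 (s := (σ : ℂ)) (by simp; linarith)
  rw [← zetaH_eq_emSum hb0 (by simp; linarith) (by exact_mod_cast hσ.ne'), Complex.ofReal_re] at h
  have h1 : ‖(b : ℂ) ^ (1 - (σ : ℂ)) / (σ - 1)‖ = b ^ (1 - σ) / (σ - 1) := by
    rw [norm_div, Complex.norm_cpow_eq_rpow_re_of_pos hb0, ← Complex.ofReal_one, ← Complex.ofReal_sub,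
      ← Complex.ofReal_sub, Complex.ofReal_re, Complex.norm_real, Real.norm_of_nonneg (by linarith)]
  have h2 : b ^ (-σ) ≤ b ^ (1 - σ) := Real.rpow_le_rpow_of_exponent_le hb (by linarith)
  have h3 : b ^ (-σ - 1) ≤ b ^ (1 - σ) := Real.rpow_le_rpow_of_exponent_le hb (by linarith)
  have h4 := norm_le_norm_add_norm_sub' (zetaH (σ : ℂ) b) ((b : ℂ) ^ (1 - (σ : ℂ)) / (σ - 1))
  rw [h1] at h4
  calc _ ≤ b ^ (1 - σ) / (σ - 1) + (b ^ (1 - σ) / 2 + b ^ (1 - σ) *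
        (‖(σ : ℂ)‖ / 12 + ‖(σ : ℂ)‖ * ‖(σ : ℂ) + 1‖ / (12 * (σ + 1)))) := by
        refine h4.trans (add_le_add le_rfl (h.trans ?_))
        gcongr
    _ = _ := by ring

lemma exists_norm_zetaH_strip_le {θ : ℝ} (hθ : 0 < θ) (hθ1 : θ < 1) :
    ∃ C > 0, ∀ b t : ℝ, 1 ≤ t → t ≤ b → ‖zetaH (θ + t * I) b‖ ≤ C * b ^ (1 - θ) / t := by
  obtain ⟨C, hC, h⟩ := exists_norm_zetaH_sub_dualSum_le hθ hθ1
  refine ⟨2 * C, by positivity, fun b t ht htb => ?_⟩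
  have hb : 0 < b := by linarith
  have ht0 : 0 < t := by linarith
  have hpi := Real.pi_gt_three
  have h0 : 0 < t / (2 * π * b) := by positivity
  have h1 : t / (2 * π * b) ≤ 1 / 2 := by
    rw [div_le_iff₀ (by positivity)]; nlinarith
  have := h b t 0 0 (by linarith) ht (by nlinarith) (by push_cast; nlinarith) (fun n hn => by
      rw [hn] at h0 h1
      have h2 : 0 < n := by exact_mod_cast h0
      have h3 : (1 : ℝ) ≤ n := by exact_mod_cast h2
      linarith) (by rw [Nat.cast_zero, sub_zero, abs_of_pos h0]; exact h1)
  simp only [dualSum, Finset.range_zero, Finset.sum_empty, zero_mul, sub_zero, if_true, add_zero] at this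
  refine this.trans ?_
  have h2 : b ^ (-θ) ≤ b ^ (1 - θ) / t := by
    rw [le_div_iff₀ ht0, show 1 - θ = -θ + 1 by ring, Real.rpow_add_one hb.ne']
    gcongr
  calc _ ≤ C * (b ^ (1 - θ) / t + b ^ (1 - θ) / t) := by gcongr
    _ = _ := by ring

lemma exists_integral_norm_zetaH_le {a θ α : ℝ} (ha : 0 < a) (hθ : 0 < θ) (hθ1 : θ < 1)
    (hα : α = θ ∨ 1 + θ ≤ α) : ∃ C > 0, ∀ T : ℝ, ∀ N : ℕ, 10 ≤ T → T ≤ N → (N : ℝ) ≤ T + 1 →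
      ∫ t in (1 : ℝ)..T, ‖zetaH (α + t * I) (a + N)‖ ≤ C * (T ^ (1 - θ) * Real.log T) := by
  have hgen : ∃ C > 0, ∀ b t T : ℝ, 1 ≤ t → t ≤ T → T ≤ b → ‖zetaH (α + t * I) b‖ ≤ C * b ^ (1 - θ) / t := by
    rcases hα with rfl | hα
    · obtain ⟨C, hC, h⟩ := exists_norm_zetaH_strip_le hθ hθ1
      exact ⟨C, hC, fun b t T h1 h2 h3 => h b t h1 (h2.trans h3)⟩
    · obtain ⟨C, hC, h⟩ := exists_norm_zetaH_real_le (show 1 < α by linarith)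
      refine ⟨C, hC, fun b t T h1 h2 h3 => (h b t (by linarith)).trans ?_⟩
      have hb : 0 < b := by linarith
      rw [mul_div_assoc]
      gcongr
      rw [le_div_iff₀ (by linarith)]
      calc _ ≤ b ^ (1 - α) * b := by gcongr; linarith
        _ = b ^ (2 - α) := by rw [← Real.rpow_add_one hb.ne']; congr 1; ring
        _ ≤ _ := Real.rpow_le_rpow_of_exponent_le (by linarith) (by linarith)
  obtain ⟨C, hC, h⟩ := hgen
  refine ⟨C * (2 + a) ^ (1 - θ), by positivity, fun T N hT hN hN1 => ?_⟩
  have hT0 : 0 < T := by linarith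
  have hbT : (a + N) ^ (1 - θ) ≤ (2 + a) ^ (1 - θ) * T ^ (1 - θ) := by
    rw [← Real.mul_rpow (by positivity) hT0.le]
    exact Real.rpow_le_rpow (by positivity) (by nlinarith) (by linarith)
  have hlog := two_le_log hT
  have hi : IntervalIntegrable (fun t : ℝ => C * (a + N) ^ (1 - θ) * t⁻¹) volume 1 T :=
    (intervalIntegral.intervalIntegrable_inv (fun t ht => ne_of_gt (lt_of_lt_of_le
      (lt_min one_pos hT0) ht.1)) continuousOn_id).const_mul _
  calc _ ≤ ∫ t in (1 : ℝ)..T, C * (a + N) ^ (1 - θ) * t⁻¹ := by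
        refine intervalIntegral.integral_mono_on (by linarith) (ContinuousOn.intervalIntegrable_of_pos
          (continuousOn_zetaH_line (by positivity) α).norm one_pos hT0) hi fun t ht => ?_
        exact (h (a + N) t T ht.1 ht.2 (by linarith)).trans (le_of_eq (div_eq_mul_inv _ _))
    _ = C * (a + N) ^ (1 - θ) * Real.log T := by
        rw [intervalIntegral.integral_const_mul, integral_inv_of_pos one_pos hT0, div_one]
    _ ≤ C * ((2 + a) ^ (1 - θ) * T ^ (1 - θ)) * Real.log T := by gcongr
    _ = _ := by ring

lemma exists_integral_mul_conj_partialSum {a θ α β : ℝ} (ha : 0 < a) (hθ1 : θ < 1)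
    (hα : θ ≤ α) (hβ : 1 < β) : ∃ C > 0, ∀ T : ℝ, ∀ N : ℕ, 10 ≤ T → (N : ℝ) ≤ T + 1 →
      ‖(∫ t in (1 : ℝ)..T, zetaH (β + t * I) a * conj (partialSum a N (α + t * I))) -
        ((∑ m ∈ Finset.range N, (m + a : ℝ) ^ (-(α + β)) : ℝ) * T : ℝ)‖ ≤
        C * (T ^ (1 - θ) * Real.log T) := by
  obtain ⟨C₁, hC₁, h₁⟩ := exists_sum_rpow_le ha (show -1 < -θ by linarith)
  set D := 2 * (2 + 1 / (β - 1)) + 2 * a ^ (-(β - 1)) * (1 / a + 2 * (1 + 2)) + a ^ (-β) with hD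
  have hβ1 : 0 < β - 1 := by linarith
  have hD0 : 0 < D := by positivity
  refine ⟨D * (a ^ (θ - α) * (C₁ * 2 ^ (-θ + 1))), by positivity, fun T N hT hN => ?_⟩
  have hT0 : 0 < T := by linarith
  have hlog := two_le_log hT
  have hpos : ∀ m : ℕ, (0 : ℝ) < m + a := fun m => by positivity
  have hi : ∀ m : ℕ, IntervalIntegrable
      (fun t : ℝ => zetaH (β + t * I) a * ((m + a : ℝ) : ℂ) ^ ((t : ℂ) * I)) volume 1 T := by
    intro m
    refine ContinuousOn.intervalIntegrable_of_pos ((continuousOn_zetaH_line ha β).mul ?_) one_pos hT0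
    have := continuous_cpow_mul_I (hpos m) 1
    simp only [one_mul] at this
    exact this.continuousOn
  have e1 : (∫ t in (1 : ℝ)..T, zetaH (β + t * I) a * conj (partialSum a N (α + t * I))) =
      ∑ m ∈ Finset.range N, (((m + a : ℝ) ^ (-α) : ℝ) : ℂ) *
        ∫ t in (1 : ℝ)..T, zetaH (β + t * I) a * ((m + a : ℝ) : ℂ) ^ ((t : ℂ) * I) := by
    simp_rw [partialSum, map_sum, Finset.mul_sum, conj_cpow_neg_line (hpos _),
      mul_left_comm (zetaH _ a)]
    rw [intervalIntegral.integral_finsetSum fun m _ => (hi m).const_mul _]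
    simp_rw [intervalIntegral.integral_const_mul]
  have e2 : (((∑ m ∈ Finset.range N, (m + a : ℝ) ^ (-(α + β)) : ℝ) * T : ℝ) : ℂ) =
      ∑ m ∈ Finset.range N, (((m + a : ℝ) ^ (-α) : ℝ) : ℂ) *
        ((((m + a : ℝ) ^ (-β) : ℝ) : ℂ) * (T : ℂ)) := by
    rw [Finset.sum_mul, Complex.ofReal_sum]
    refine Finset.sum_congr rfl fun m _ => ?_
    rw [neg_add, Real.rpow_add (hpos m)]
    push_cast; ring
  rw [e1, e2, ← Finset.sum_sub_distrib]
  have hb : ∀ m ∈ Finset.range N, ‖(((m + a : ℝ) ^ (-α) : ℝ) : ℂ) *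
        (∫ t in (1 : ℝ)..T, zetaH (β + t * I) a * ((m + a : ℝ) : ℂ) ^ ((t : ℂ) * I)) -
      (((m + a : ℝ) ^ (-α) : ℝ) : ℂ) * ((((m + a : ℝ) ^ (-β) : ℝ) : ℂ) * (T : ℂ))‖ ≤
      D * Real.log T * a ^ (θ - α) * (m + a : ℝ) ^ (-θ) := by
    intro m hm
    have hp := hpos m
    have ham : a ≤ m + a := by linarith [Nat.cast_nonneg (α := ℝ) m]
    have hmN : (m : ℝ) + 1 ≤ N := by exact_mod_cast Finset.mem_range.mp hm
    have hm0 : (0 : ℝ) ≤ m := Nat.cast_nonneg m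
    have hlm : Real.log (m + 1) ≤ 2 * Real.log T := by
      rw [← Real.log_rpow hT0 2]
      refine Real.log_le_log (by positivity) ?_
      rw [Real.rpow_two]; nlinarith
    have hr := (isConvexZeta_zetaH ha).norm_integral_right_sub_le hβ1 le_rfl (abs_one (α := ℝ)) m T
    simp only [one_mul, add_sub_cancel] at hr
    have hV : ‖(∫ t in (1 : ℝ)..T, zetaH (β + t * I) a * ((m + a : ℝ) : ℂ) ^ ((t : ℂ) * I)) -
        (((m + a : ℝ) ^ (-β) : ℝ) : ℂ) * (T : ℂ)‖ ≤ D * Real.log T := by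
      have e3 : (((m + a : ℝ) ^ (-β) : ℝ) : ℂ) * (T : ℂ) = (((m + a : ℝ) ^ (-β) : ℝ) : ℂ) *
          ((T - 1 : ℝ) : ℂ) + (((m + a : ℝ) ^ (-β) : ℝ) : ℂ) := by push_cast; ring
      rw [e3, ← sub_sub]
      refine (norm_sub_le _ _).trans ((add_le_add hr le_rfl).trans ?_)
      rw [Complex.norm_real, Real.norm_of_nonneg (by positivity)]
      have q1 : (m + a : ℝ) ^ (-β) ≤ a ^ (-β) :=
        Real.rpow_le_rpow_of_nonpos ha ham (by linarith)
      have q2 : 1 / a + 2 * (1 + Real.log (m + 1)) ≤ (1 / a + 2 * (1 + 2)) * Real.log T := by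
        have : 1 / a ≤ 1 / a * Real.log T := le_mul_of_one_le_right (by positivity) (by linarith)
        linarith
      have q3 : 2 * (2 + 1 / (β - 1)) ≤ 2 * (2 + 1 / (β - 1)) * Real.log T :=
        le_mul_of_one_le_right (by positivity) (by linarith)
      have q4 : a ^ (-β) ≤ a ^ (-β) * Real.log T :=
        le_mul_of_one_le_right (by positivity) (by linarith)
      have q5 := mul_le_mul_of_nonneg_left q2 (show 0 ≤ 2 * a ^ (-(β - 1)) by positivity)
      rw [hD]; linarith
    have hlam : (m + a : ℝ) ^ (-α) ≤ a ^ (θ - α) * (m + a : ℝ) ^ (-θ) := by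
      rw [show -α = (θ - α) + -θ by ring, Real.rpow_add hp]
      exact mul_le_mul_of_nonneg_right (Real.rpow_le_rpow_of_nonpos ha ham (by linarith))
        (by positivity)
    rw [← mul_sub, norm_mul, Complex.norm_real, Real.norm_of_nonneg (by positivity)]
    calc _ ≤ a ^ (θ - α) * (m + a : ℝ) ^ (-θ) * (D * Real.log T) := by gcongr
      _ = _ := by ring
  refine (norm_sum_le _ _).trans ((Finset.sum_le_sum hb).trans ?_)
  rw [← Finset.mul_sum]
  have hN2 : (N : ℝ) ^ (-θ + 1) ≤ 2 ^ (-θ + 1) * T ^ (1 - θ) := by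
    rw [show 1 - θ = -θ + 1 by ring, ← Real.mul_rpow (by norm_num) hT0.le]
    exact Real.rpow_le_rpow (by positivity) (by linarith) (by linarith)
  calc _ ≤ D * Real.log T * a ^ (θ - α) * (C₁ * (2 ^ (-θ + 1) * T ^ (1 - θ))) := by
        gcongr
        exact (h₁ N).trans (by gcongr)
    _ = _ := by ring

theorem exists_integral_mul_conj_zetaH {a θ α β : ℝ} (ha : 0 < a) (hθ : 0 < θ) (hθ1 : θ < 1)
    (hα : α = θ ∨ 1 + θ ≤ α) (hβ : 1 + θ ≤ β) : ∃ C > 0, ∀ T : ℝ, 10 ≤ T →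
      ‖(∫ t in (1 : ℝ)..T, zetaH (β + t * I) a * conj (zetaH (α + t * I) a)) -
        zetaH ((α + β : ℝ) : ℂ) a * T‖ ≤ C * (T ^ (1 - θ) * Real.log T) ∧
      ‖(∫ t in (1 : ℝ)..T, zetaH (α + t * I) a * conj (zetaH (β + t * I) a)) -
        zetaH ((α + β : ℝ) : ℂ) a * T‖ ≤ C * (T ^ (1 - θ) * Real.log T) := by
  have hαθ : θ ≤ α := by rcases hα with h | h <;> linarith
  obtain ⟨C₁, hC₁, h₁⟩ := exists_integral_norm_zetaH_le ha hθ hθ1 hα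
  obtain ⟨C₂, hC₂, h₂⟩ := exists_integral_mul_conj_partialSum ha hθ1 hαθ (show 1 < β by linarith)
  obtain ⟨C₃, hC₃, h₃⟩ := exists_sum_rpow_sub_le ha (show 0 < α + β by linarith)
    (show α + β ≠ 1 by linarith)
  set Z := ‖zetaH (β : ℂ) a‖
  have hZ0 : 0 ≤ Z := norm_nonneg _
  refine ⟨Z * C₁ + C₂ + (C₃ + 1 / (α + β - 1)), by
    have : 0 < 1 / (α + β - 1) := div_pos one_pos (by linarith)
    positivity, fun T hT => ?_⟩
  have hT0 : 0 < T := by linarith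
  have hlog := two_le_log hT
  set N := ⌈T⌉₊
  have hN : T ≤ N := Nat.le_ceil T
  have hN1 : (N : ℝ) ≤ T + 1 := (Nat.ceil_lt_add_one hT0.le).le
  set E := T ^ (1 - θ) * Real.log T with hE
  set S : ℝ := (∑ m ∈ Finset.range N, (m + a : ℝ) ^ (-(α + β)) : ℝ) with hS
  have hb : 0 < a + N := by positivity
  have hcβ := continuousOn_zetaH_line ha β
  have hcα := continuousOn_zetaH_line hb α
  have hmain : ‖(∫ t in (1 : ℝ)..T, zetaH (β + t * I) a * conj (zetaH (α + t * I) a)) -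
      ((S * T : ℝ) : ℂ)‖ ≤ (Z * C₁ + C₂) * E := by
    have e : ∀ t : ℝ, zetaH (β + t * I) a * conj (zetaH (α + t * I) a) =
        zetaH (β + t * I) a * conj (partialSum a N (α + t * I)) +
        zetaH (β + t * I) a * conj (zetaH (α + t * I) (a + N)) := fun t => by
      rw [zetaH_eq_partialSum_add ha N (α + t * I), map_add, mul_add]
    have hi : ∀ {f : ℝ → ℂ}, ContinuousOn f (Ioi 0) →
        IntervalIntegrable (fun t => zetaH (β + t * I) a * conj (f t)) volume 1 T := fun hf =>
      ContinuousOn.intervalIntegrable_of_pos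
        (hcβ.mul (Complex.continuous_conj.comp_continuousOn hf)) one_pos hT0
    simp_rw [e]
    rw [intervalIntegral.integral_add (hi (continuousOn_partialSum ha N α).continuousOn) (hi hcα),
      add_sub_right_comm]
    have ht : ‖∫ t in (1 : ℝ)..T, zetaH (β + t * I) a * conj (zetaH (α + t * I) (a + N))‖ ≤
        Z * (C₁ * E) := by
      refine (intervalIntegral.norm_integral_le_of_norm_le (by linarith)
        (g := fun t : ℝ => Z * ‖zetaH (α + t * I) (a + N)‖) (Eventually.of_forall fun t _ => ?_)
        ((ContinuousOn.intervalIntegrable_of_pos hcα.norm one_pos hT0).const_mul Z)).trans ?_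
      · rw [norm_mul, Complex.norm_conj]
        gcongr
        exact norm_zetaH_line_le ha (by linarith) t
      · rw [intervalIntegral.integral_const_mul]
        gcongr
        exact h₁ T N hT hN hN1
    refine (norm_add_le _ _).trans ((add_le_add (h₂ T N hT hN1) ht).trans (le_of_eq ?_))
    ring
  have hrest : ‖((S * T : ℝ) : ℂ) - zetaH ((α + β : ℝ) : ℂ) a * T‖ ≤ (C₃ + 1 / (α + β - 1)) * E := by
    have h4 := h₃ N (by linarith)
    have h5 : ‖((S : ℝ) : ℂ) - zetaH ((α + β : ℝ) : ℂ) a‖ ≤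
        (C₃ + 1 / (α + β - 1)) * (a + N) ^ (1 - (α + β)) := by
      have e : ((S : ℝ) : ℂ) - zetaH ((α + β : ℝ) : ℂ) a =
          (((S : ℝ) : ℂ) - (zetaH ((α + β : ℝ) : ℂ) a -
            (((a + N) ^ (1 - (α + β)) / (α + β - 1) : ℝ) : ℂ))) -
            (((a + N) ^ (1 - (α + β)) / (α + β - 1) : ℝ) : ℂ) := by ring
      have h6 : 0 < α + β - 1 := by linarith
      rw [e]
      refine (norm_sub_le _ _).trans ((add_le_add h4 le_rfl).trans ?_)
      rw [Complex.norm_real, Real.norm_of_nonneg (by positivity), add_mul, one_div_mul_eq_div]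
      gcongr
      · linarith
      · linarith
    rw [Complex.ofReal_mul, ← sub_mul, norm_mul, Complex.norm_real, Real.norm_of_nonneg hT0.le]
    have h6 : 0 < 1 / (α + β - 1) := div_pos one_pos (by linarith)
    have h7 : (a + N) ^ (1 - (α + β)) * T ≤ E := by
      calc _ ≤ T ^ (1 - (α + β)) * T := mul_le_mul_of_nonneg_right
            (Real.rpow_le_rpow_of_nonpos hT0 (by linarith) (by linarith)) hT0.le
        _ = T ^ (1 - (α + β) + 1) := by rw [Real.rpow_add_one hT0.ne']
        _ ≤ T ^ (1 - θ) := Real.rpow_le_rpow_of_exponent_le (by linarith) (by linarith)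
        _ ≤ _ := le_mul_of_one_le_right (by positivity) (by linarith)
    calc _ ≤ (C₃ + 1 / (α + β - 1)) * (a + N) ^ (1 - (α + β)) * T := by gcongr
      _ = (C₃ + 1 / (α + β - 1)) * ((a + N) ^ (1 - (α + β)) * T) := by ring
      _ ≤ _ := by gcongr
  have hfin : ∀ P : ℂ, ‖P - ((S * T : ℝ) : ℂ)‖ ≤ (Z * C₁ + C₂) * E →
      ‖P - zetaH ((α + β : ℝ) : ℂ) a * T‖ ≤ (Z * C₁ + C₂ + (C₃ + 1 / (α + β - 1))) * E := by
    intro P hP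
    rw [add_mul]
    exact (norm_sub_le_norm_sub_add_norm_sub _ _ _).trans (add_le_add hP hrest)
  refine ⟨hfin _ hmain, hfin _ ?_⟩
  have e : (∫ t in (1 : ℝ)..T, zetaH (α + t * I) a * conj (zetaH (β + t * I) a)) =
      conj (∫ t in (1 : ℝ)..T, zetaH (β + t * I) a * conj (zetaH (α + t * I) a)) := by
    simp only [intervalIntegral, map_sub, ← integral_conj, map_mul, Complex.conj_conj, mul_comm]
  rw [e, ← Complex.conj_ofReal (S * T), ← map_sub, Complex.norm_conj]
  exact hmain

/-! ### The decomposition of the Hurwitz multiple zeta function -/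

lemma length_antidiagonalTuple (k n : ℕ) :
    (List.Nat.antidiagonalTuple (k + 1) n).length = (n + k).choose k := by
  have hrec : ∀ k n, (List.Nat.antidiagonalTuple (k + 1) (n + 1)).length =
      (List.Nat.antidiagonalTuple k (n + 1)).length + (List.Nat.antidiagonalTuple (k + 1) n).length := by
    intro k n
    simp only [List.Nat.antidiagonalTuple, List.Nat.antidiagonal_succ, List.flatMap_cons,
      List.length_append, List.length_map, List.length_flatMap, List.map_map]
    rfl
  induction k generalizing n with
  | zero => simp
  | succ k ih =>
    induction n with
    | zero => simp [List.Nat.antidiagonalTuple_zero_right]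
    | succ n ihn =>
      rw [hrec, ih, ihn, show n + 1 + (k + 1) = (n + k + 1) + 1 by ring, Nat.choose_succ_succ]
      congr 2; ring

lemma sum_stirlingFirst_mul_pow (q : ℕ) (x : ℝ) :
    ∑ l ∈ Finset.range (q + 1), (Nat.stirlingFirst (q + 1) (l + 1) : ℝ) * x ^ l =
      ∏ i ∈ Finset.range q, (x + i + 1) := by
  induction q with
  | zero => simp [Nat.stirlingFirst]
  | succ q ih =>
    have e : ∀ l, (Nat.stirlingFirst (q + 1 + 1) (l + 1) : ℝ) * x ^ l =
        (q + 1) * ((Nat.stirlingFirst (q + 1) (l + 1) : ℝ) * x ^ l) +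
          (Nat.stirlingFirst (q + 1) l : ℝ) * x ^ l := by
      intro l
      rw [Nat.stirlingFirst_succ_succ (q + 1) l]; push_cast; ring
    simp_rw [e]
    rw [Finset.sum_add_distrib, ← Finset.mul_sum, Finset.sum_range_succ _ (q + 1),
      Nat.stirlingFirst_eq_zero_of_lt (Nat.lt_succ_self (q + 1)), ih, Finset.sum_range_succ' _ (q + 1),
      Nat.stirlingFirst_succ_zero, Finset.prod_range_succ]
    have e2 : ∑ k ∈ Finset.range (q + 1), (Nat.stirlingFirst (q + 1) (k + 1) : ℝ) * x ^ (k + 1) =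
        x * ∏ i ∈ Finset.range q, (x + i + 1) := by
      rw [← ih, Finset.mul_sum]
      exact Finset.sum_congr rfl fun k _ => by ring
    rw [e2]; push_cast; ring

lemma sum_hurwitzCoeff_mul_pow (q : ℕ) (a : ℝ) (n : ℕ) :
    ∑ j ∈ Finset.range (q + 1), hurwitzCoeff (q + 1) j a * (n + a) ^ j = ((n + q).choose q : ℝ) := by
  have hc : ∀ j ∈ Finset.range (q + 1), hurwitzCoeff (q + 1) j a * (n + a) ^ j =
      1 / (q.factorial : ℝ) * ∑ l ∈ Finset.range (q + 1), (Nat.stirlingFirst (q + 1) (l + 1) : ℝ) *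
        ((n + a) ^ j * (-a) ^ (l - j) * (l.choose j : ℝ)) := by
    intro j hj
    have hj' := Finset.mem_range.mp hj
    rw [hurwitzCoeff, Nat.add_sub_cancel, mul_assoc, Finset.sum_mul]
    congr 1
    rw [← Finset.sum_subset (s₁ := Finset.Ico j (q + 1))
      (fun l hl => Finset.mem_range.mpr (Finset.mem_Ico.mp hl).2) fun l hl hl' => ?_]
    · refine Finset.sum_congr rfl fun l hl => ?_
      have hl' := (Finset.mem_Ico.mp hl).1
      obtain ⟨d, rfl⟩ := Nat.exists_eq_add_of_le hl'
      obtain ⟨e, he⟩ := Nat.exists_eq_add_of_le hj'.le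
      rw [signedStirlingFirst, Nat.add_sub_cancel_left, neg_pow a,
        show q + 1 + 1 - j = e + 1 by omega, show q + 1 + (j + d + 1) = 2 * j + (e + 1) + d by omega]
      push_cast
      have h1 : (-1 : ℝ) ^ (e + 1) * (-1) ^ (2 * j + (e + 1) + d) = (-1) ^ d := by
        rw [← pow_add, show e + 1 + (2 * j + (e + 1) + d) = 2 * (j + e + 1) + d by ring, pow_add, pow_mul]
        simp
      rw [← h1]; ring
    · rw [Finset.mem_Ico, not_and_or, not_le, not_lt] at hl'
      have : l < j := by have := Finset.mem_range.mp hl; omega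
      rw [Nat.choose_eq_zero_of_lt this]; simp
  rw [Finset.sum_congr rfl hc, ← Finset.mul_sum, Finset.sum_comm]
  have hl : ∀ l ∈ Finset.range (q + 1), ∑ j ∈ Finset.range (q + 1),
      (Nat.stirlingFirst (q + 1) (l + 1) : ℝ) * ((n + a) ^ j * (-a) ^ (l - j) * (l.choose j : ℝ)) =
      (Nat.stirlingFirst (q + 1) (l + 1) : ℝ) * (n : ℝ) ^ l := by
    intro l hl
    rw [← Finset.mul_sum]
    congr 1
    have h2 := add_pow ((n : ℝ) + a) (-a) l
    rw [add_neg_cancel_right] at h2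
    rw [h2]
    refine (Finset.sum_subset (Finset.range_mono (Finset.mem_range.mp hl)) fun j _ hj => ?_).symm
    rw [Nat.choose_eq_zero_of_lt (by simpa using hj)]; simp
  rw [Finset.sum_congr rfl hl, sum_stirlingFirst_mul_pow]
  have h3 := Nat.ascFactorial_eq_factorial_mul_choose n q
  rw [Nat.ascFactorial_eq_prod_range] at h3
  have h4 : ∏ i ∈ Finset.range q, ((n : ℝ) + i + 1) = q.factorial * (n + q).choose q := by
    rw [← Nat.cast_mul, ← h3]
    push_cast
    exact Finset.prod_congr rfl fun i _ => by ring
  rw [h4]; field_simp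

lemma barnesSeries_eq {q : ℕ} {a : ℝ} (ha : 0 < a) {s : ℂ} (hs : ((q + 1 : ℕ) : ℝ) < s.re) :
    barnesSeries (q + 1) a (fun _ => 1) s =
      ∑ j ∈ Finset.range (q + 1), (hurwitzCoeff (q + 1) j a : ℂ) * zetaH (s - j) a := by
  set g : ℕ → ℂ := fun n => 1 / ((n + a : ℝ) : ℂ) ^ s with hg
  have hsum : HasSum (fun n : ℕ => (((n + q).choose q : ℝ) : ℂ) * g n)
      (∑ j ∈ Finset.range (q + 1), (hurwitzCoeff (q + 1) j a : ℂ) * zetaH (s - j) a) := by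
    have h1 := hasSum_sum (s := Finset.range (q + 1)) fun j hj => (hasSum_zetaH ha (s := s - j) (by
      have : ((j + 1 : ℕ) : ℝ) ≤ ((q + 1 : ℕ) : ℝ) := by exact_mod_cast Finset.mem_range.mp hj
      simp; push_cast at this hs; linarith)).mul_left (hurwitzCoeff (q + 1) j a : ℂ)
    refine h1.congr_fun fun n => ?_
    have hn : ((n + a : ℝ) : ℂ) ≠ 0 := by
      have : (0 : ℝ) < n + a := by positivity
      exact_mod_cast this.ne'
    rw [← sum_hurwitzCoeff_mul_pow q a n, Complex.ofReal_sum, Finset.sum_mul]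
    refine Finset.sum_congr rfl fun j _ => ?_
    rw [Complex.cpow_sub _ _ hn, Complex.cpow_natCast, hg]
    push_cast
    field_simp
  rw [barnesSeries]
  refine HasSum.tsum_eq ?_
  rw [← (Finset.Nat.sigmaAntidiagonalTupleEquivTuple (q + 1)).hasSum_iff]
  have hterm : ∀ p : (Σ n, Finset.Nat.antidiagonalTuple (q + 1) n),
      ((fun m : Fin (q + 1) → ℕ => 1 / ((a + ∑ i, (m i : ℝ) * 1 : ℝ) : ℂ) ^ s) ∘
        Finset.Nat.sigmaAntidiagonalTupleEquivTuple (q + 1)) p = g p.1 := by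
    rintro ⟨n, x, hx⟩
    have : ∑ i, x i = n := Finset.Nat.mem_antidiagonalTuple.mp hx
    simp only [Function.comp, Finset.Nat.sigmaAntidiagonalTupleEquivTuple_apply, mul_one, hg, ← this]
    push_cast
    rw [add_comm]
  have hcard : ∀ n, (Finset.Nat.antidiagonalTuple (q + 1) n).card = (n + q).choose q :=
    length_antidiagonalTuple q
  refine HasSum.congr_fun ?_ hterm
  refine hsum.sigma_of_hasSum (fun n => ?_) ?_
  · convert! hasSum_fintype (fun _ : Finset.Nat.antidiagonalTuple (q + 1) n => g n) using 1
    simp [hcard]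
  · refine Summable.of_norm ((summable_sigma_of_nonneg fun _ => norm_nonneg _).mpr
      ⟨fun n => (hasSum_fintype _).summable, ?_⟩)
    refine hsum.summable.norm.congr fun n => ?_
    rw [tsum_fintype]
    simp [hcard]

theorem hurwitzMultipleZeta_eq {r : ℕ} (hr : 1 ≤ r) {a : ℝ} (ha : 0 < a) {s : ℂ}
    (hs : s ∉ barnesPoles r) : hurwitzMultipleZeta r s a =
      ∑ j ∈ Finset.range r, (hurwitzCoeff r j a : ℂ) * zetaH (s - j) a := by
  obtain ⟨q, rfl⟩ : ∃ q, r = q + 1 := ⟨r - 1, by omega⟩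
  set W : ℂ → ℂ := fun s => ∑ j ∈ Finset.range (q + 1), (hurwitzCoeff (q + 1) j a : ℂ) * zetaH (s - j) a
    with hW
  have hWd : DifferentiableOn ℂ W (barnesPoles (q + 1))ᶜ := by
    intro z hz
    refine DifferentiableAt.differentiableWithinAt ?_
    refine DifferentiableAt.fun_sum fun j hj => DifferentiableAt.const_mul ?_ _
    refine (differentiableAt_zetaH ha fun h => hz ⟨j + 1, by omega, Finset.mem_range.mp hj, ?_⟩).comp z
      (differentiableAt_id.sub_const (j : ℂ))
    rw [← sub_add_cancel z (j : ℂ)]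
    rw [h]; push_cast; ring
  have hex : ∃ Z : ℂ → ℂ, IsBarnesZeta (q + 1) a (fun _ => 1) Z :=
    ⟨W, hWd, fun z hz => (barnesSeries_eq ha hz).symm⟩
  have hfin : (barnesPoles (q + 1)).Finite :=
    ((Finset.range (q + 2)).image fun j : ℕ => (j : ℂ)).finite_toSet.subset fun z ⟨j, _, hj, hz⟩ => by
      simp only [Finset.coe_image, mem_image, Finset.mem_coe, Finset.mem_range]
      exact ⟨j, by omega, hz.symm⟩
  have hopen : IsOpen (barnesPoles (q + 1))ᶜ := hfin.isClosed.isOpen_compl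
  obtain ⟨hZd, hZs⟩ := hex.choose_spec
  rw [hurwitzMultipleZeta, barnesZeta, dif_pos hex]
  have hre : ∀ z : ℂ, ((q + 1 : ℕ) : ℝ) < z.re → z ∈ (barnesPoles (q + 1))ᶜ := by
    rintro z hz ⟨j, _, hj, rfl⟩
    rw [Complex.natCast_re] at hz
    have : q + 1 < j := by exact_mod_cast hz
    omega
  have h0 : ((q + 1 : ℕ) : ℝ) < ((q + 2 : ℕ) : ℂ).re := by
    rw [Complex.natCast_re]; exact_mod_cast Nat.lt_succ_self _
  refine (hZd.analyticOnNhd hopen).eqOn_of_preconnected_of_eventuallyEq (hWd.analyticOnNhd hopen)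
    (hfin.countable.isConnected_compl_of_one_lt_rank (by simp)).isPreconnected (hre _ h0) ?_ hs
  filter_upwards [(isOpen_lt continuous_const Complex.continuous_re).mem_nhds h0] with z hz
  rw [hZs z hz, barnesSeries_eq ha hz]

lemma hurwitzCoeff_self {r : ℕ} (hr : 1 ≤ r) (a : ℝ) :
    hurwitzCoeff r (r - 1) a = 1 / ((r - 1).factorial : ℝ) := by
  obtain ⟨q, rfl⟩ : ∃ q, r = q + 1 := ⟨r - 1, by omega⟩
  rw [hurwitzCoeff, Nat.add_sub_cancel, Nat.Ico_succ_singleton, Finset.sum_singleton,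
    signedStirlingFirst, Nat.stirlingFirst_self, show q + 1 + 1 - q = 2 by omega]
  simp [← two_mul]

theorem exists_integral_sq_zetaH_sub_le {a θ : ℝ} (ha : 0 < a) (hθ : 0 < θ) (hθ1 : θ < 1)
    (hθ2 : θ ≠ 1 / 2) : ∃ C > 0, ∀ T : ℝ, 10 ≤ T →
      ‖((∫ t in (1 : ℝ)..T, ‖zetaH (θ + t * I) a‖ ^ 2 : ℝ) : ℂ) -
        (zetaH ((2 * θ : ℝ) : ℂ) a * T + (((2 * π) ^ (2 * θ - 1) / (2 - 2 * θ) : ℝ) : ℂ) *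
          riemannZeta ((2 - 2 * θ : ℝ) : ℂ) * ((T ^ (2 - 2 * θ) : ℝ) : ℂ))‖ ≤
        C * (T ^ (1 - θ) * Real.log T) := by
  obtain ⟨C₁, hC₁, h₁⟩ := exists_integral_sq_zetaH ha hθ hθ1
  obtain ⟨C₂, hC₂, h₂⟩ := exists_main_terms (K := (2 + a) ^ 2) ha hθ hθ1 hθ2
  refine ⟨C₁ + C₂ * ((2 + a) ^ 2) ^ (1 - θ), by positivity, fun T hT => ?_⟩
  obtain ⟨M, N, hR, hb⟩ := h₁ T hT
  have hT0 := hR.T_pos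
  have hlog := two_le_log hT
  have hm : C₂ * (a + M) ^ (2 - 2 * θ) ≤ C₂ * ((2 + a) ^ 2) ^ (1 - θ) * (T ^ (1 - θ) * Real.log T) := by
    rw [mul_assoc, ← mul_assoc (_ ^ (1 - θ))]
    gcongr
    exact (hR.rpow_le (by positivity) hθ1.le).trans (le_mul_of_one_le_right (by positivity) (by linarith))
  rw [← Real.norm_eq_abs, ← Complex.norm_real, Complex.ofReal_sub] at hb
  rw [add_mul]
  exact (norm_sub_le_norm_sub_add_norm_sub _ _ _).trans (add_le_add hb ((h₂ T M N hR).trans hm))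

theorem exists_integral_sq_zetaH_half {a : ℝ} (ha : 0 < a) : ∃ C > 0, ∀ T : ℝ, 10 ≤ T →
      |(∫ t in (1 : ℝ)..T, ‖zetaH ((1 / 2 : ℝ) + t * I) a‖ ^ 2) -
        (T * Real.log T + (eulerGamma a + Real.eulerMascheroniConstant - 1 - Real.log (2 * π)) * T)| ≤
        C * (T ^ (1 - 1 / 2 : ℝ) * Real.log T) := by
  obtain ⟨C₁, hC₁, h₁⟩ := exists_integral_sq_zetaH ha (show (0 : ℝ) < 1 / 2 by norm_num) (by norm_num)
  obtain ⟨C₂, hC₂, h₂⟩ := exists_main_terms_half (K := (2 + a) ^ 2) ha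
  refine ⟨C₁ + C₂ * ((2 + a) ^ 2) ^ (1 - 1 / 2 : ℝ), by positivity, fun T hT => ?_⟩
  obtain ⟨M, N, hR, hb⟩ := h₁ T hT
  have hT0 := hR.T_pos
  have hlog := two_le_log hT
  have hm : C₂ * (a + M) ^ (2 - 2 * (1 / 2 : ℝ)) ≤
      C₂ * ((2 + a) ^ 2) ^ (1 - 1 / 2 : ℝ) * (T ^ (1 - 1 / 2 : ℝ) * Real.log T) := by
    rw [mul_assoc, ← mul_assoc (_ ^ (1 - 1 / 2 : ℝ))]
    refine mul_le_mul_of_nonneg_left ((hR.rpow_le (by positivity) (by norm_num)).trans ?_) hC₂.le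
    exact le_mul_of_one_le_right (by positivity) (by linarith)
  rw [add_mul]
  exact (abs_sub_le _ _ _).trans (add_le_add hb ((h₂ T M N hR).trans hm))

theorem exists_meanSquare_sub_le {r : ℕ} (hr : 1 ≤ r) {a θ σ : ℝ} (ha : 0 < a) (hθ : 0 < θ)
    (hθ1 : θ < 1) (hσ : σ = r - 1 + θ) : ∃ C > 0, ∀ T : ℝ, 10 ≤ T →
      ‖(meanSquare r σ a T : ℂ) -
        ((∑ kl ∈ (Finset.range r ×ˢ Finset.range r).erase (r - 1, r - 1),
            (hurwitzCoeff r kl.1 a : ℂ) * (hurwitzCoeff r kl.2 a : ℂ) *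
              zetaH ((2 * σ - kl.1 - kl.2 : ℝ) : ℂ) a) * (T : ℂ) +
          ((1 / ((r - 1).factorial : ℝ) ^ 2 : ℝ) : ℂ) *
            ((∫ t in (1 : ℝ)..T, ‖zetaH (θ + t * I) a‖ ^ 2 : ℝ) : ℂ))‖ ≤
        C * (T ^ (1 - θ) * Real.log T) := by
  set p : ℕ → ℂ := fun k => (hurwitzCoeff r k a : ℂ) with hp
  set A := Finset.range r ×ˢ Finset.range r with hA
  set J : ℕ × ℕ → ℝ → ℂ := fun kl T => ∫ t in (1 : ℝ)..T,
    zetaH ((σ - kl.1 : ℝ) + t * I) a * conj (zetaH ((σ - kl.2 : ℝ) + t * I) a) with hJ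
  have hr1 : ((r - 1 : ℕ) : ℝ) = r - 1 := by rw [Nat.cast_sub hr, Nat.cast_one]
  have hmem : (r - 1, r - 1) ∈ A := by simp [hA]; omega
  have hcross : ∀ kl ∈ A.erase (r - 1, r - 1), ∃ C > 0, ∀ T : ℝ, 10 ≤ T →
      ‖J kl T - zetaH ((2 * σ - kl.1 - kl.2 : ℝ) : ℂ) a * T‖ ≤ C * (T ^ (1 - θ) * Real.log T) := by
    rintro ⟨k, l⟩ hkl
    simp only [hA, Finset.mem_erase, Finset.mem_product, Finset.mem_range, ne_eq, Prod.mk.injEq] at hkl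
    obtain ⟨hne, hk, hl⟩ := hkl
    have hline : ∀ k : ℕ, k < r → σ - k = θ ∨ 1 + θ ≤ σ - k := by
      intro k hk
      rcases Nat.lt_or_ge k (r - 1) with h | h
      · have : ((k + 1 : ℕ) : ℝ) ≤ ((r - 1 : ℕ) : ℝ) := by exact_mod_cast h
        rw [hr1] at this; push_cast at this
        right; linarith
      · have : k = r - 1 := by omega
        left; rw [this, hr1, hσ]; ring
    have hbig : ∀ k : ℕ, k < r → k ≠ r - 1 → 1 + θ ≤ σ - k := by
      intro k hk hne
      refine (hline k hk).resolve_left fun h => hne ?_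
      have : (k : ℝ) = ((r - 1 : ℕ) : ℝ) := by rw [hr1]; linarith
      exact_mod_cast this
    rcases eq_or_ne l (r - 1) with h | h
    · obtain ⟨C, hC, hb⟩ := exists_integral_mul_conj_zetaH ha hθ hθ1 (hline l hl)
        (hbig k hk fun hk' => hne ⟨hk', h⟩)
      refine ⟨C, hC, fun T hT => ?_⟩
      have := (hb T hT).1
      rwa [show σ - l + (σ - k) = 2 * σ - k - l by ring] at this
    · obtain ⟨C, hC, hb⟩ := exists_integral_mul_conj_zetaH ha hθ hθ1 (hline k hk) (hbig l hl h)
      refine ⟨C, hC, fun T hT => ?_⟩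
      have := (hb T hT).2
      rwa [show σ - k + (σ - l) = 2 * σ - k - l by ring] at this
  choose! C hC hb using hcross
  refine ⟨1 + ∑ kl ∈ A.erase (r - 1, r - 1), ‖p kl.1 * p kl.2‖ * C kl, by
    have : 0 ≤ ∑ kl ∈ A.erase (r - 1, r - 1), ‖p kl.1 * p kl.2‖ * C kl :=
      Finset.sum_nonneg fun kl hkl => mul_nonneg (norm_nonneg _) (hC kl hkl).le
    linarith, fun T hT => ?_⟩
  have hT0 : 0 < T := by linarith
  have hlog := two_le_log hT
  have hE0 : 0 ≤ T ^ (1 - θ) * Real.log T := by positivity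
  have hms : (meanSquare r σ a T : ℂ) = ∑ kl ∈ A, p kl.1 * p kl.2 * J kl T := by
    rw [meanSquare, ← intervalIntegral.integral_ofReal]
    simp_rw [hJ, ← intervalIntegral.integral_const_mul]
    rw [← intervalIntegral.integral_finsetSum fun kl _ => ?_]
    · refine intervalIntegral.integral_congr fun t ht => ?_
      rw [uIcc_of_le (by linarith)] at ht
      have hpole : (σ : ℂ) + t * I ∉ barnesPoles r := by
        rintro ⟨j, _, _, hj⟩
        have := congrArg Complex.im hj
        simp at this
        linarith [ht.1]
      rw [hurwitzMultipleZeta_eq hr ha hpole, ← Complex.normSq_eq_norm_sq, ← Complex.mul_conj, map_sum,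
        Finset.sum_mul_sum, ← Finset.sum_product']
      refine Finset.sum_congr rfl fun kl _ => ?_
      have e : ∀ k : ℕ, (σ : ℂ) + t * I - k = ((σ - k : ℝ) : ℂ) + t * I := fun k => by push_cast; ring
      rw [e, e, map_mul, Complex.conj_ofReal]
      ring
    · exact (ContinuousOn.intervalIntegrable_of_pos ((continuousOn_zetaH_line ha _).mul
        (Complex.continuous_conj.comp_continuousOn (continuousOn_zetaH_line ha _))) one_pos hT0).const_mul _
  have hdiag : p (r - 1) * p (r - 1) * J (r - 1, r - 1) T =
      ((1 / ((r - 1).factorial : ℝ) ^ 2 : ℝ) : ℂ) *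
        ((∫ t in (1 : ℝ)..T, ‖zetaH (θ + t * I) a‖ ^ 2 : ℝ) : ℂ) := by
    have e1 : σ - ((r - 1 : ℕ) : ℝ) = θ := by rw [hr1, hσ]; ring
    simp only [hJ, hp, hurwitzCoeff_self hr, e1, Complex.mul_conj, Complex.normSq_eq_norm_sq]
    rw [intervalIntegral.integral_ofReal]
    push_cast; ring
  rw [hms, ← Finset.add_sum_erase A _ hmem, hdiag, Finset.sum_mul]
  have e : ∀ x y z : ℂ, x + y - (z + x) = y - z := fun x y z => by ring
  rw [e, ← Finset.sum_sub_distrib]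
  refine (norm_sum_le _ _).trans ?_
  rw [add_mul, one_mul, Finset.sum_mul]
  refine le_add_of_nonneg_of_le hE0 (Finset.sum_le_sum fun kl hkl => ?_)
  rw [mul_assoc (p kl.1 * p kl.2), ← mul_sub, norm_mul, mul_assoc]
  exact mul_le_mul_of_nonneg_left (hb kl hkl T hT) (norm_nonneg _)

theorem meanSquare_isBigO {r : ℕ} (hr : 1 ≤ r) {a σ : ℝ} (ha : 0 < a) (h0 : (r : ℝ) - 1 < σ)
    (h1 : σ < r) (h2 : σ ≠ r - 1 / 2) :
    (fun T : ℝ => (meanSquare r σ a T : ℂ) -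
        ((∑ k ∈ Finset.range r, ∑ l ∈ Finset.range r,
            (hurwitzCoeff r k a : ℂ) * (hurwitzCoeff r l a : ℂ) *
              zetaH ((2 * σ - k - l : ℝ) : ℂ) a) * (T : ℂ) +
          ((1 / ((r - 1).factorial : ℝ) ^ 2 *
              ((2 * Real.pi) ^ (2 * σ - 2 * r + 1) / (2 * r - 2 * σ)) : ℝ) : ℂ) *
            riemannZeta ((2 * r - 2 * σ : ℝ) : ℂ) * ((T ^ (2 * r - 2 * σ) : ℝ) : ℂ)))
        =O[atTop] fun T : ℝ => T ^ (r - σ) * Real.log T := by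
  obtain ⟨θ, hσ⟩ : ∃ θ, σ = r - 1 + θ := ⟨σ - (r - 1), by ring⟩
  have hθ : 0 < θ := by linarith
  have hθ1 : θ < 1 := by linarith
  obtain ⟨C₁, hC₁, g₁⟩ := exists_meanSquare_sub_le hr ha hθ hθ1 hσ
  obtain ⟨C₂, hC₂, g₂⟩ := exists_integral_sq_zetaH_sub_le ha hθ hθ1 fun h => h2 (by rw [hσ, h]; ring)
  set F : ℝ := 1 / ((r - 1).factorial : ℝ) ^ 2 with hF
  have hF0 : 0 ≤ F := by positivity
  refine IsBigO.of_bound (C₁ + F * C₂) ?_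
  filter_upwards [eventually_ge_atTop 10] with T hT
  have hT0 : 0 < T := by linarith
  have hlog := two_le_log hT
  have hr1 : ((r - 1 : ℕ) : ℝ) = r - 1 := by rw [Nat.cast_sub hr, Nat.cast_one]
  have hmem : (r - 1, r - 1) ∈ Finset.range r ×ˢ Finset.range r := by simp; omega
  rw [show (r : ℝ) - σ = 1 - θ by rw [hσ]; ring, Real.norm_of_nonneg (by positivity),
    show 2 * σ - 2 * r + 1 = 2 * θ - 1 by rw [hσ]; ring,
    show 2 * r - 2 * σ = 2 - 2 * θ by rw [hσ]; ring, ← Finset.sum_product', ← Finset.add_sum_erase _ _ hmem]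
  simp only [hurwitzCoeff_self hr, hr1]
  rw [show 2 * σ - (r - 1) - (r - 1) = 2 * θ by rw [hσ]; ring]
  have k1 := g₁ T hT
  have k2 := mul_le_mul_of_nonneg_left (g₂ T hT) hF0
  rw [← Real.norm_of_nonneg hF0, ← Complex.norm_real, ← norm_mul, Complex.norm_real,
    Real.norm_of_nonneg hF0] at k2
  rw [show (C₁ + F * C₂) * (T ^ (1 - θ) * Real.log T) = C₁ * (T ^ (1 - θ) * Real.log T) +
    F * (C₂ * (T ^ (1 - θ) * Real.log T)) by ring]
  refine le_trans (le_of_eq ?_) ((norm_add_le _ _).trans (add_le_add k1 k2))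
  congr 1
  rw [hF]
  push_cast
  ring

theorem meanSquare_isBigO_half {r : ℕ} (hr : 1 ≤ r) {a σ : ℝ} (ha : 0 < a) (hσ : σ = r - 1 / 2) :
    (fun T : ℝ => (meanSquare r σ a T : ℂ) -
        (((1 / ((r - 1).factorial : ℝ) ^ 2 * (T * Real.log T) : ℝ) : ℂ) +
          ((∑ kl ∈ (Finset.range r ×ˢ Finset.range r).erase (r - 1, r - 1),
              (hurwitzCoeff r kl.1 a : ℂ) * (hurwitzCoeff r kl.2 a : ℂ) *
                zetaH ((2 * σ - kl.1 - kl.2 : ℝ) : ℂ) a) +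
            (((eulerGamma a + Real.eulerMascheroniConstant - 1 - Real.log (2 * Real.pi)) /
              ((r - 1).factorial : ℝ) ^ 2 : ℝ) : ℂ)) * (T : ℂ)))
        =O[atTop] fun T : ℝ => T ^ (1 / 2 : ℝ) * Real.log T := by
  obtain ⟨C₁, hC₁, g₁⟩ := exists_meanSquare_sub_le hr ha (θ := 1 / 2) (by norm_num) (by norm_num)
    (hσ.trans (by ring))
  obtain ⟨C₂, hC₂, g₂⟩ := exists_integral_sq_zetaH_half ha
  set F : ℝ := 1 / ((r - 1).factorial : ℝ) ^ 2 with hF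
  have hF0 : 0 ≤ F := by positivity
  refine IsBigO.of_bound (C₁ + F * C₂) ?_
  filter_upwards [eventually_ge_atTop 10] with T hT
  have hT0 : 0 < T := by linarith
  have hlog := two_le_log hT
  have k1 := g₁ T hT
  have k2 := mul_le_mul_of_nonneg_left (g₂ T hT) hF0
  rw [show (1 - 1 / 2 : ℝ) = 1 / 2 by norm_num] at k1 k2
  nth_rewrite 1 [← abs_of_nonneg hF0] at k2
  rw [← abs_mul, ← Real.norm_eq_abs, ← Complex.norm_real] at k2
  rw [Real.norm_of_nonneg (by positivity),
    show (C₁ + F * C₂) * (T ^ (1 / 2 : ℝ) * Real.log T) = C₁ * (T ^ (1 / 2 : ℝ) * Real.log T) +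
    F * (C₂ * (T ^ (1 / 2 : ℝ) * Real.log T)) by ring]
  refine le_trans (le_of_eq ?_) ((norm_add_le _ _).trans (add_le_add k1 k2))
  congr 1
  rw [hF]
  push_cast
  ring

end HurwitzMean

theorem theorem1p1 (r : ℕ) (hr : 1 ≤ r) (a : ℝ) (ha : 0 < a) :
    -- the decomposition into Hurwitz zeta functions, away from the possible poles `1, …, r`
    (∀ s : ℂ, s ∉ barnesPoles r →
      hurwitzMultipleZeta r s a =
        ∑ j ∈ Finset.range r, (hurwitzCoeff r j a : ℂ) * zetaH (s - j) a) ∧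
    -- case (i)
    (∀ σ : ℝ, (r : ℝ) - 1 / 2 < σ → σ < r →
      (fun T : ℝ => (meanSquare r σ a T : ℂ) -
        ((∑ k ∈ Finset.range r, ∑ l ∈ Finset.range r,
            (hurwitzCoeff r k a : ℂ) * (hurwitzCoeff r l a : ℂ) *
              zetaH ((2 * σ - k - l : ℝ) : ℂ) a) * (T : ℂ) +
          ((1 / ((r - 1).factorial : ℝ) ^ 2 *
              ((2 * Real.pi) ^ (2 * σ - 2 * r + 1) / (2 * r - 2 * σ)) : ℝ) : ℂ) *
            riemannZeta ((2 * r - 2 * σ : ℝ) : ℂ) * ((T ^ (2 * r - 2 * σ) : ℝ) : ℂ)))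
        =O[atTop] fun T : ℝ => T ^ (r - σ) * Real.log T) ∧
    -- case (ii), where `σ = r - 1/2`
    (∀ σ : ℝ, σ = (r : ℝ) - 1 / 2 →
      (fun T : ℝ => (meanSquare r σ a T : ℂ) -
        (((1 / ((r - 1).factorial : ℝ) ^ 2 * (T * Real.log T) : ℝ) : ℂ) +
          ((∑ kl ∈ (Finset.range r ×ˢ Finset.range r).erase (r - 1, r - 1),
              (hurwitzCoeff r kl.1 a : ℂ) * (hurwitzCoeff r kl.2 a : ℂ) *
                zetaH ((2 * σ - kl.1 - kl.2 : ℝ) : ℂ) a) +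
            (((eulerGamma a + Real.eulerMascheroniConstant - 1 - Real.log (2 * Real.pi)) /
              ((r - 1).factorial : ℝ) ^ 2 : ℝ) : ℂ)) * (T : ℂ)))
        =O[atTop] fun T : ℝ => T ^ (1 / 2 : ℝ) * Real.log T) ∧
    -- case (iii)
    (∀ σ : ℝ, (r : ℝ) - 1 < σ → σ < (r : ℝ) - 1 / 2 →
      (fun T : ℝ => (meanSquare r σ a T : ℂ) -
        (((1 / ((r - 1).factorial : ℝ) ^ 2 *
              ((2 * Real.pi) ^ (2 * σ - 2 * r + 1) / (2 * r - 2 * σ)) : ℝ) : ℂ) *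
            riemannZeta ((2 * r - 2 * σ : ℝ) : ℂ) * ((T ^ (2 * r - 2 * σ) : ℝ) : ℂ) +
          (∑ k ∈ Finset.range r, ∑ l ∈ Finset.range r,
            (hurwitzCoeff r k a : ℂ) * (hurwitzCoeff r l a : ℂ) *
              zetaH ((2 * σ - k - l : ℝ) : ℂ) a) * (T : ℂ)))
        =O[atTop] fun T : ℝ => T ^ (r - σ) * Real.log T) := by
  refine ⟨fun s hs => HurwitzMean.hurwitzMultipleZeta_eq hr ha hs, fun σ h1 h2 => ?_,
    fun σ hσ => HurwitzMean.meanSquare_isBigO_half hr ha hσ, fun σ h1 h2 => ?_⟩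
  · exact HurwitzMean.meanSquare_isBigO hr ha (by linarith) h2 h1.ne'
  · have := HurwitzMean.meanSquare_isBigO hr ha h1 (by linarith) h2.ne
    refine this.congr_left fun T => ?_
    rw [add_comm (_ * (T : ℂ))]
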